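/- **Conventions.** A set $C\subset\mathbb P(\mathbb R^d)$ is *convex* (*properly convex*) if it is a convex (bounded convex) subset of some affine chart; a *properly convex domain* is a non-empty open properly convex set $\Omega$, $\mathrm{Aut}(\Omega)=\{g\in \mathrm{PGL}_d(\mathbb R): g\Omega=\Omega\}$, and $H_\Omega$ is the Hilbert metric, $H_\Omega(x,y)=\frac12\log\frac{|x-b||y-a|}{|x-a||y-b|}$, where $a,b$ are the points of $\partial\Omega$ on the line through $x\ne y$, in the order $a,x,y,b$. For $A\subset\Omega$ let $\mathcal N_\Omega(A;r)$ be its open $r$-neighbourhood and $\mathrm{diam}_\Omega(A)$ its diameter for $H_\Omega$. For $x\in\overline\Omega$ the *open face* $F_\Omega(x)$ consists of $x$ and of all $y\in\overline\Omega$ such that some open line segment in $\overline\Omega$ contains $x$ and $y$. A *naive convex co-compact triple* $(\Omega,\mathcal C,\Lambda)$ consists of a properly convex domain $\Omega\subset\mathbb P(\mathbb R^d)$, an infinite discrete subgroup $\Lambda\le\mathrm{Aut}(\Omega)$ and a non-empty convex subset $\mathcal C\subset\Omega$, closed in $\Omega$, that is $\Lambda$-invariant and on which $\Lambda$ acts co-compactly.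 A *simplex of dimension $k\ge 2$* is a set of the form $\{[\sum_{i=1}^{k+1} x_i v_i]: x_1,\dots,x_{k+1}>0\}$ with $v_1,\dots,v_{k+1}\in\mathbb R^d$ linearly independent; its *vertices* are $[v_1],\dots,[v_{k+1}]$. A simplex $S\subset\mathcal C$ is *properly embedded* in $\mathcal C$ if the inclusion $S\hookrightarrow\mathcal C$ is a proper map, and *maximal* if it is not contained in a larger properly embedded simplex in $\mathcal C$. A family $\mathcal S$ of maximal properly embedded simplices in $\mathcal C$ is * *isolated* if it is closed and discrete in the local Hausdorff topology on the non-empty closed subsets of $(\Omega,H_\Omega)$, that is, the topology generated by the sets $U(C_0,x_0,r_0,\varepsilon_0)$ ($C_0$ non-empty and closed in $\Omega$, $x_0\in\Omega$, $r_0,\varepsilon_0>0$) of all non-empty closed $C$ such that each point of $C$ in the closed ball of radius $r_0$ at $x_0$ is at distance less than $\varepsilon_0$ from some point of $C_0$, and each point of $C_0$ in this ball is at distance less than $\varepsilon_0$ from some point of $C$; * *coarsely complete* if there is $D>0$ such that each properly embedded simplex $S$ in $\mathcal C$ satisfies $S\subset\mathcal N_\Omega(S';D)$ for some $S'\in\mathcal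 S$; * *$\Lambda$-invariant* if $gS\in\mathcal S$ for all $g\in\Lambda$, $S\in\mathcal S$; * *strongly isolated* if for every $r>0$ there is $D(r)>0$ such that $\mathrm{diam}_\Omega(\mathcal N_\Omega(S_1;r)\cap\mathcal N_\Omega(S_2;r))\le D(r)$ for all distinct $S_1,S_2\in\mathcal S$. The triple has *coarsely isolated simplices* if there is an isolated, coarsely complete, $\Lambda$-invariant family of maximal properly embedded simplices in $\mathcal C$. A *center of mass* assigns to each properly convex set $F\subset\mathbb P(\mathbb R^d)$ that is open in its span, and each non-empty compact $K\subset F$, a point $\mathrm{CoM}_F(K)\in\mathrm{ConvHull}_F(K)$ such that $\mathrm{CoM}_F(K)=\mathrm{CoM}_F(\mathrm{ConvHull}_F(K))$ and $g\,\mathrm{CoM}_F(K)=\mathrm{CoM}_{gF}(gK)$ for all $g\in\mathrm{PGL}_d(\mathbb R)$. Here $\mathrm{ConvHull}_F(K)$ is the smallest convex subset of $\overline F$ containing $K$. Let $\widehat{\mathcal S}_{\max}$ be the set of all maximal properly embedded simplices $S$ in $\mathcal C$ for which there is no maximal properly embedded simplex $S'$ in $\mathcal C$ with $\dim S<\dim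 S'$ and $\sup_{p\in S}H_\Omega(p,S')<\infty$. For $S\in\widehat{\mathcal S}_{\max}$ with vertices $v_1,\dots,v_p$ put $w_j=\mathrm{CoM}_{F_\Omega(v_j)}(\overline{\mathcal C}\cap F_\Omega(v_j))$ and $\Phi(S)=\Omega\cap[\mathrm{Span}\{w_1,\dots,w_p\}]$, and let $\mathcal S_{\mathrm{core}}=\{\Phi(S):S\in\widehat{\mathcal S}_{\max}\}$. **Theorem.** Suppose that $(\Omega,\mathcal C,\Lambda)$ is a naive convex co-compact triple with coarsely isolated simplices. Then there exists a strongly isolated, coarsely complete, $\Lambda$-invariant family of maximal properly embedded simplices in $\mathcal C$. Moreover, centers of mass exist, and for every center of mass $\mathrm{CoM}$ the family $\mathcal S_{\mathrm{core}}$ is well defined (that is, $\overline{\mathcal C}\cap F_\Omega(v)$ is compact for each vertex $v$ of each $S\in\widehat{\mathcal S}_{\max}$) and is a strongly isolated, coarsely complete, $\Lambda$-invariant family of maximal properly embedded simplices in $\mathcal C$. -/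

import Mathlib

open Set
open scoped LinearAlgebra.Projectivization MatrixGroups Pointwise

noncomputable section

namespace ConvexProj

/-- Real projective space, the set of lines of the `d`-dimensional real vector space. -/
abbrev RP (d : ℕ) : Type := ℙ ℝ (Fin d → ℝ)

/-- The quotient topology on projective space. -/
instance instTopRP (d : ℕ) : TopologicalSpace (RP d) :=
  TopologicalSpace.coinduced (Projectivization.mk' ℝ) inferInstance

/-- The quotient topology on the projective general linear group. -/
instance instTopPGL (d : ℕ) : TopologicalSpace PGL(d, ℝ) :=
  TopologicalSpace.coinduced (Matrix.ProjGenLinGroup.mk (n := Fin d) (R := ℝ)) inferInstance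

variable {d : ℕ}

/-! ### Affine charts, spans and convexity -/

/-- A nonzero linear functional `f` defines the affine chart of all lines `p` on which `f` does
not vanish; the chart map sends `p` to the unique vector of `p` at which `f` equals `1`. -/
def chart (f : Module.Dual ℝ (Fin d → ℝ)) (p : RP d) : Fin d → ℝ :=
  (f p.rep)⁻¹ • p.rep

/-- `C` lies in the affine chart of `f`. -/
def InChart (f : Module.Dual ℝ (Fin d → ℝ)) (C : Set (RP d)) : Prop :=
  f ≠ 0 ∧ ∀ p ∈ C, f p.rep ≠ 0

/-- `C` is a convex subset of some affine chart. -/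
def IsConvex (C : Set (RP d)) : Prop :=
  ∃ f, InChart f C ∧ Convex ℝ (chart f '' C)

/-- `C` is a bounded convex subset of the affine chart of `f`. -/
def IsProperChart (f : Module.Dual ℝ (Fin d → ℝ)) (C : Set (RP d)) : Prop :=
  InChart f C ∧ Convex ℝ (chart f '' C) ∧ Bornology.IsBounded (chart f '' C)

/-- `C` is a bounded convex subset of some affine chart. -/
def IsProperlyConvex (C : Set (RP d)) : Prop :=
  ∃ f, IsProperChart f C

/-- A properly convex domain: non-empty, open and properly convex. -/
def IsProperlyConvexDomain (Ω : Set (RP d)) : Prop :=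
  Ω.Nonempty ∧ IsOpen Ω ∧ IsProperlyConvex Ω

/-- The linear span of a set of lines. -/
def linSpan (X : Set (RP d)) : Submodule ℝ (Fin d → ℝ) :=
  ⨆ p ∈ X, p.submodule

/-- The projective subspace `[V]`, the set of lines contained in `V`. -/
def projSubspace (V : Submodule ℝ (Fin d → ℝ)) : Set (RP d) :=
  {p | p.submodule ≤ V}

/-- `C` is open in the projective subspace that it spans. -/
def IsOpenInSpan (C : Set (RP d)) : Prop :=
  ∃ U : Set (RP d), IsOpen U ∧ C = U ∩ projSubspace (linSpan C)

/-- The smallest convex subset of the closure of `C` that contains `X`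
(for `C` properly convex and `X` a subset of the closure of `C`). -/
def convHull (C X : Set (RP d)) : Set (RP d) :=
  ⋂₀ {Y | X ⊆ Y ∧ Y ⊆ closure C ∧ IsConvex Y}

/-- The automorphism group of a subset of projective space. -/
def Aut (X : Set (RP d)) : Subgroup PGL(d, ℝ) :=
  MulAction.stabilizer PGL(d, ℝ) X

/-! ### The Hilbert metric -/

/-- The cross ratio `|x-b| |y-a| / (|x-a| |y-b|)` computed in an affine chart. It is only used for
collinear points, for which it depends neither on the norm nor on the chart. -/
def crossRatio (f : Module.Dual ℝ (Fin d → ℝ)) (a x y b : RP d) : ℝ :=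
  (‖chart f x - chart f b‖ * ‖chart f y - chart f a‖) /
    (‖chart f x - chart f a‖ * ‖chart f y - chart f b‖)

/-- The Hilbert distance of a properly convex set `C` that is open in its span. For distinct points
`x`, `y` of `C` the points `a`, `b` are the two points of the line through `x` and `y` on the
boundary of `C`, in the order `a, x, y, b`, and the set below has exactly one element. For `x = y`
the set is empty and the value is `0`. -/
def hilbertDist (C : Set (RP d)) (x y : RP d) : ℝ :=
  sSup {t | ∃ (f : Module.Dual ℝ (Fin d → ℝ)) (a b : RP d), IsProperChart f C ∧
    a ∈ closure C \ C ∧ b ∈ closure C \ C ∧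
    Sbtw ℝ (chart f a) (chart f x) (chart f y) ∧ Sbtw ℝ (chart f x) (chart f y) (chart f b) ∧
    t = 1 / 2 * Real.log (crossRatio f a x y b)}

/-- The open `r`-neighbourhood of `A` in the Hilbert metric of `Ω`. -/
def nbhd (Ω A : Set (RP d)) (r : ℝ) : Set (RP d) :=
  {y ∈ Ω | ∃ x ∈ A, hilbertDist Ω x y < r}

/-- The diameter of `A` in the Hilbert metric of `Ω`, possibly infinite. -/
def hilbertDiam (Ω A : Set (RP d)) : ENNReal :=
  ⨆ x ∈ A, ⨆ y ∈ A, ENNReal.ofReal (hilbertDist Ω x y)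

/-! ### Faces -/

/-- The open face of a point `x` of the closure of `Ω`: the point `x` and all points `y` of the
closure such that some open line segment in the closure of `Ω` contains `x` and `y`. -/
def face (Ω : Set (RP d)) (x : RP d) : Set (RP d) :=
  {x} ∪ {y ∈ closure Ω | ∃ (f : Module.Dual ℝ (Fin d → ℝ)) (a b : RP d), IsProperChart f Ω ∧
    a ∈ closure Ω ∧ b ∈ closure Ω ∧ a ≠ b ∧
    chart f x ∈ openSegment ℝ (chart f a) (chart f b) ∧
    chart f y ∈ openSegment ℝ (chart f a) (chart f b)}

/-! ### Simplices -/

/-- The projective classes of all positive combinations of `v 0, ..., v k`. -/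
def openSimplex {k : ℕ} (v : Fin (k + 1) → Fin d → ℝ) : Set (RP d) :=
  {p | ∃ x : Fin (k + 1) → ℝ, (∀ i, 0 < x i) ∧
    p.submodule = Submodule.span ℝ {∑ i, x i • v i}}

/-- `S` is a simplex of dimension `k`, where `k ≥ 2`: up to a projective transformation it is the
set of all `[x_1 : ... : x_{k+1} : 0 : ... : 0]` with `x_1, ..., x_{k+1}` positive. -/
def IsSimplexOfDim (k : ℕ) (S : Set (RP d)) : Prop :=
  2 ≤ k ∧ ∃ v : Fin (k + 1) → Fin d → ℝ, LinearIndependent ℝ v ∧ S = openSimplex v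

/-- `S` is a simplex. -/
def IsSimplex (S : Set (RP d)) : Prop :=
  ∃ k, IsSimplexOfDim k S

/-- The set of vertices of a simplex `S`. -/
def vertices (S : Set (RP d)) : Set (RP d) :=
  {p | ∃ (k : ℕ) (v : Fin (k + 1) → Fin d → ℝ), LinearIndependent ℝ v ∧ S = openSimplex v ∧
    ∃ i, p.submodule = Submodule.span ℝ {v i}}

/-- `A` is a subset of `B` and the inclusion of `A` in `B` is a proper map. -/
def IsProperlyEmbedded (A B : Set (RP d)) : Prop :=
  ∃ h : A ⊆ B, IsProperMap (Set.inclusion h)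

/-- `S` is a properly embedded simplex in `C`. -/
def IsPES (C S : Set (RP d)) : Prop :=
  IsSimplex S ∧ IsProperlyEmbedded S C

/-- `S` is a maximal properly embedded simplex in `C`. -/
def IsMaximalPES (C S : Set (RP d)) : Prop :=
  IsPES C S ∧ ∀ T, IsPES C T → S ⊆ T → T = S

/-! ### The local Hausdorff topology -/

/-- Non-empty subsets of `Ω` that are closed in `Ω`. -/
structure ClosedSubset (Ω : Set (RP d)) where
  carrier : Set (RP d)
  nonempty : carrier.Nonempty
  subset : carrier ⊆ Ω
  closed : closure carrier ∩ Ω ⊆ carrier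

/-- The closed sets `C` that are `ε`-close to `C₀` on the closed ball of radius `r` at `x₀`: every
point of one of the sets in this ball is at distance less than `ε` from the other set. -/
def localHausdorffNhd (Ω : Set (RP d)) (C₀ : ClosedSubset Ω) (x₀ : RP d) (r ε : ℝ) :
    Set (ClosedSubset Ω) :=
  {C | (∀ p ∈ C.carrier, hilbertDist Ω x₀ p ≤ r → ∃ q ∈ C₀.carrier, hilbertDist Ω p q < ε) ∧
    (∀ p ∈ C₀.carrier, hilbertDist Ω x₀ p ≤ r → ∃ q ∈ C.carrier, hilbertDist Ω p q < ε)}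

/-- The local Hausdorff topology induced by the Hilbert metric of `Ω`. -/
instance instLocalHausdorff (Ω : Set (RP d)) : TopologicalSpace (ClosedSubset Ω) :=
  TopologicalSpace.generateFrom
    {U | ∃ (C₀ : ClosedSubset Ω) (x₀ : RP d) (r ε : ℝ), x₀ ∈ Ω ∧ 0 < r ∧ 0 < ε ∧
      U = localHausdorffNhd Ω C₀ x₀ r ε}

/-- The family, viewed in the space of closed subsets of `Ω`, is closed and discrete. -/
def IsIsolated (Ω : Set (RP d)) (𝒮 : Set (Set (RP d))) : Prop :=
  IsClosed {A : ClosedSubset Ω | A.carrier ∈ 𝒮} ∧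
    DiscreteTopology {A : ClosedSubset Ω | A.carrier ∈ 𝒮}

/-! ### Naive convex co-compact triples and families of simplices -/

/-- `(Ω, C, Λ)` is a naive convex co-compact triple. -/
structure IsNaiveConvexCocompact (Ω C : Set (RP d)) (Λ : Subgroup PGL(d, ℝ)) : Prop where
  domain : IsProperlyConvexDomain Ω
  le_aut : Λ ≤ Aut Ω
  infinite : Infinite Λ
  discrete : DiscreteTopology Λ
  nonempty : C.Nonempty
  subset : C ⊆ Ω
  closed : closure C ∩ Ω ⊆ C
  convex : IsConvex C
  invariant : ∀ g ∈ Λ, g • C = C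
  cocompact : ∃ K ⊆ C, IsCompact K ∧ C ⊆ ⋃ g ∈ Λ, g • K

/-- A family of maximal properly embedded simplices in `C`. -/
def IsMaximalFamily (C : Set (RP d)) (𝒮 : Set (Set (RP d))) : Prop :=
  ∀ S ∈ 𝒮, IsMaximalPES C S

/-- Every properly embedded simplex in `C` lies in a uniformly bounded neighbourhood of a member of
the family. -/
def IsCoarselyComplete (Ω C : Set (RP d)) (𝒮 : Set (Set (RP d))) : Prop :=
  ∃ D > 0, ∀ S, IsPES C S → ∃ T ∈ 𝒮, S ⊆ nbhd Ω T D

/-- The family is invariant under the group `Λ`. -/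
def IsInvariantFamily (Λ : Subgroup PGL(d, ℝ)) (𝒮 : Set (Set (RP d))) : Prop :=
  ∀ g ∈ Λ, ∀ S ∈ 𝒮, g • S ∈ 𝒮

/-- For every `r > 0` the `r`-neighbourhoods of two distinct members of the family have an
intersection of diameter at most `D`, where `D` depends on `r` only. -/
def IsStronglyIsolated (Ω : Set (RP d)) (𝒮 : Set (Set (RP d))) : Prop :=
  ∀ r > 0, ∃ D > 0, ∀ S₁ ∈ 𝒮, ∀ S₂ ∈ 𝒮, S₁ ≠ S₂ →
    hilbertDiam Ω (nbhd Ω S₁ r ∩ nbhd Ω S₂ r) ≤ ENNReal.ofReal D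

/-- The triple has coarsely isolated simplices. -/
def HasCoarselyIsolatedSimplices (Ω C : Set (RP d)) (Λ : Subgroup PGL(d, ℝ)) : Prop :=
  ∃ 𝒮 : Set (Set (RP d)), IsMaximalFamily C 𝒮 ∧ IsIsolated Ω 𝒮 ∧ IsCoarselyComplete Ω C 𝒮 ∧
    IsInvariantFamily Λ 𝒮

/-! ### Centers of mass and the core family -/

/-- A center of mass: it assigns to every properly convex set `F` that is open in its span, and
every non-empty compact subset `K` of `F`, a point of the convex hull of `K`, which depends only on
`F` and this hull, in a projectively equivariant way. -/
structure IsCenterOfMass (CoM : Set (RP d) → Set (RP d) → RP d) : Prop where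
  mem_hull : ∀ F K, IsProperlyConvex F → IsOpenInSpan F → K ⊆ F → K.Nonempty → IsCompact K →
    CoM F K ∈ convHull F K
  hull : ∀ F K, IsProperlyConvex F → IsOpenInSpan F → K ⊆ F → K.Nonempty → IsCompact K →
    CoM F K = CoM F (convHull F K)
  equivariant : ∀ F K, IsProperlyConvex F → IsOpenInSpan F → K ⊆ F → K.Nonempty → IsCompact K →
    ∀ g : PGL(d, ℝ), g • CoM F K = CoM (g • F) (g • K)

/-- The maximal properly embedded simplices in `C` that are not contained in a tubular neighbourhood
of a maximal properly embedded simplex of strictly larger dimension. -/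
def topSimplices (Ω C : Set (RP d)) : Set (Set (RP d)) :=
  {S | IsMaximalPES C S ∧ ¬ ∃ (T : Set (RP d)) (k l : ℕ), IsMaximalPES C T ∧
    IsSimplexOfDim k S ∧ IsSimplexOfDim l T ∧ k < l ∧
    (⨆ p ∈ S, ⨅ q ∈ T, ENNReal.ofReal (hilbertDist Ω p q)) < ⊤}

/-- The simplex obtained from `S` by replacing every vertex `v` by the center of mass, in the open
face `F` of `v`, of the intersection of `F` with the closure of `C`. -/
def coreSimplex (CoM : Set (RP d) → Set (RP d) → RP d) (Ω C S : Set (RP d)) : Set (RP d) :=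
  Ω ∩ projSubspace (linSpan ((fun v => CoM (face Ω v) (closure C ∩ face Ω v)) '' vertices S))

/-- The core family. -/
def coreFamily (CoM : Set (RP d) → Set (RP d) → RP d) (Ω C : Set (RP d)) : Set (Set (RP d)) :=
  coreSimplex CoM Ω C '' topSimplices Ω C

end ConvexProj

end

open Set
open scoped LinearAlgebra.Projectivization MatrixGroups Pointwise

noncomputable section

set_option linter.unusedSectionVars false

namespace ConvexProj

/-! ### The preorder of a closed cone -/

section Cone

open Filter Topology

variable {V : Type*} [NormedAddCommGroup V] [NormedSpace ℝ V]

/-! Fix an affine chart `f` in which Ω is bounded and pass to cones: `D` is the open cone over Ω,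
`P` its closure, `Q` the closed cone over the convex set 𝒞. The order of `P` carries all the
geometry. Two nonzero vectors of `P` dominate each other exactly when they represent points of the
same open face. The Hilbert distance is half the logarithm of αβ for the least constants with x ≤ αy
and y ≤ βx. A properly embedded simplex is a frame: vectors of `Q` whose sum is in `D` while no
proper partial sum is. Containment in a bounded neighbourhood is `Coarse`. If one simplex is
coarsely contained in another, letting a point tend to a vertex shows that each vertex lies in an
open face spanned by some vertices of the other (`exists_domEquiv_of_coarse`); when the dimensions
agree, the vertices are matched face by face and the simplices are parallel.

The main arguments renormalise: move a sequence of points into a fixed compact set by the group,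
take limits along a nonprincipal ultrafilter, and use that an isolated family is locally finite
(`finite_of_isIsolated`), so that translated members of the family are eventually constant.

First, a vertex of a top-dimensional simplex spans a minimal face relative to 𝒞 (`isMin_of_isTop`).
Otherwise, pushing the vertex towards a smaller face and renormalising gives a limit simplex in
which the vertex splits in two. The limit simplex sits inside a larger one, and coarse completeness
transports this larger simplex back to a neighbourhood of the original, contradicting maximality of
the dimension. Hence the closure of 𝒞 meets the open face of the vertex in a compact set and the
center of mass is defined there.

Second, a minimal vector in a proper closed face spanned by vertices of a family member is
equivalent to one of those vertices (`exists_domEquiv_of_dom_sum`). The induction is on the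
dimension of the face. The case where the vector and a proper set of vertices span an interior point
is handled by renormalising towards the face spanned by that set (`exists_domEquiv_of_proper`).

Third, if two members stayed close along arbitrarily long segments, moving midpoints into a compact
set would produce two members sharing two boundary points that span an interior point. By the second
fact they are parallel (`parallel_of_shared`), and a family with one member per parallelism class
contains no two such (`exists_bound_of_close`).

The core family is such a family. Its simplex depends only on the open faces of the vertices, hence
only on the parallelism class, and equivariance of the center of mass makes it invariant
(`isTopFamily_coreFamily`). Centers of mass exist because the automorphisms of a properly convex set
that preserve a compact convex subset fix a point of it (`exists_common_ray`), so that points can be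
chosen equivariantly on orbits (`exists_equivariant`). -/

/-- A closed convex cone on which the norm is bounded by a multiple of the functional `f`. -/
structure IsSharpCone (f : V →ₗ[ℝ] ℝ) (P : Set V) : Prop where
  isClosed : IsClosed P
  zero_mem : (0 : V) ∈ P
  add_mem : ∀ {x y}, x ∈ P → y ∈ P → x + y ∈ P
  smul_mem : ∀ {c : ℝ} {x}, 0 ≤ c → x ∈ P → c • x ∈ P
  bound : ∃ M > 0, ∀ x ∈ P, ‖x‖ ≤ M * f x

/-- An open convex cone `D` inside a closed sharp cone `P` with `D + P ⊆ D`. -/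
structure IsConePair (f : V →ₗ[ℝ] ℝ) (D P : Set V) : Prop extends IsSharpCone f P where
  isOpen : IsOpen D
  subset : D ⊆ P
  interior_add_mem : ∀ {x y}, x ∈ D → y ∈ P → x + y ∈ D
  interior_smul_mem : ∀ {c : ℝ} {x}, 0 < c → x ∈ D → c • x ∈ D
  zero_notMem : (0 : V) ∉ D

/-- `x` is dominated by a positive multiple of `y` in the order defined by the cone `P`. -/
def Dom (P : Set V) (x y : V) : Prop := ∃ c : ℝ, 0 < c ∧ c • y - x ∈ P

/-- `x` and `y` dominate each other. -/
def DomEquiv (P : Set V) (x y : V) : Prop := Dom P x y ∧ Dom P y x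

theorem DomEquiv.symm {P : Set V} {x y : V} (h : DomEquiv P x y) : DomEquiv P y x := ⟨h.2, h.1⟩

namespace IsSharpCone

variable {f : V →ₗ[ℝ] ℝ} {P : Set V} (h : IsSharpCone f P)
include h

theorem apply_nonneg {x : V} (hx : x ∈ P) : 0 ≤ f x := by
  obtain ⟨M, hM, hb⟩ := h.bound
  have := (norm_nonneg x).trans (hb x hx)
  exact nonneg_of_mul_nonneg_right this hM

theorem eq_zero_of_apply_eq_zero {x : V} (hx : x ∈ P) (h0 : f x = 0) : x = 0 := by
  obtain ⟨M, hM, hb⟩ := h.bound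
  have := hb x hx
  rw [h0, mul_zero] at this
  exact norm_le_zero_iff.1 this

theorem apply_pos {x : V} (hx : x ∈ P) (h0 : x ≠ 0) : 0 < f x :=
  lt_of_le_of_ne (h.apply_nonneg hx) fun e => h0 (h.eq_zero_of_apply_eq_zero hx e.symm)

theorem eq_zero_of_neg_mem {x : V} (hx : x ∈ P) (hx' : -x ∈ P) : x = 0 := by
  apply h.eq_zero_of_apply_eq_zero hx
  have h1 := h.apply_nonneg hx
  have h2 := h.apply_nonneg hx'
  rw [map_neg] at h2
  linarith

theorem sum_mem {ι : Type*} {A : Finset ι} {u : ι → V} (hu : ∀ i ∈ A, u i ∈ P) :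
    ∑ i ∈ A, u i ∈ P := by
  classical
  induction A using Finset.induction_on with
  | empty => simpa using h.zero_mem
  | insert a s ha ih =>
    rw [Finset.sum_insert ha]
    exact h.add_mem (hu a (by simp)) (ih fun i hi => hu i (by simp [hi]))

theorem smul_sub_mem_of_le {c c' : ℝ} {x y : V} (hc : c ≤ c') (hy : y ∈ P) (hxy : c • y - x ∈ P) :
    c' • y - x ∈ P := by
  have := h.add_mem hxy (h.smul_mem (sub_nonneg.2 hc) hy)
  convert this using 1
  module

theorem dom_refl (x : V) : Dom P x x := ⟨1, one_pos, by simpa using h.zero_mem⟩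

theorem domEquiv_refl (x : V) : DomEquiv P x x := ⟨h.dom_refl x, h.dom_refl x⟩

theorem dom_trans {x y z : V} (h1 : Dom P x y) (h2 : Dom P y z) : Dom P x z := by
  obtain ⟨c, hc, h1⟩ := h1
  obtain ⟨c', hc', h2⟩ := h2
  refine ⟨c * c', by positivity, ?_⟩
  convert h.add_mem h1 (h.smul_mem hc.le h2) using 1
  module

theorem domEquiv_trans {x y z : V} (h1 : DomEquiv P x y) (h2 : DomEquiv P y z) :
    DomEquiv P x z := ⟨h.dom_trans h1.1 h2.1, h.dom_trans h2.2 h1.2⟩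

theorem dom_add {x y z : V} (h1 : Dom P x z) (h2 : Dom P y z) : Dom P (x + y) z := by
  obtain ⟨c, hc, h1⟩ := h1
  obtain ⟨c', hc', h2⟩ := h2
  refine ⟨c + c', by positivity, ?_⟩
  convert h.add_mem h1 h2 using 1
  module

theorem zero_dom {z : V} (hz : z ∈ P) : Dom P 0 z := ⟨1, one_pos, by simpa using hz⟩

theorem dom_of_mem {x y : V} (hxy : y - x ∈ P) : Dom P x y :=
  ⟨1, one_pos, by simpa using hxy⟩

theorem dom_sum {ι : Type*} {A : Finset ι} {u : ι → V} {z : V} (hz : z ∈ P)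
    (hu : ∀ i ∈ A, Dom P (u i) z) : Dom P (∑ i ∈ A, u i) z := by
  classical
  induction A using Finset.induction_on with
  | empty => simpa using h.zero_dom hz
  | insert a s ha ih =>
    rw [Finset.sum_insert ha]
    exact h.dom_add (hu a (by simp)) (ih fun i hi => hu i (by simp [hi]))

theorem dom_sum_of_mem {ι : Type*} {A : Finset ι} {u : ι → V} (hu : ∀ i ∈ A, u i ∈ P) {i : ι}
    (hi : i ∈ A) : Dom P (u i) (∑ j ∈ A, u j) := by
  classical
  refine h.dom_of_mem ?_
  rw [← Finset.sum_erase_eq_sub hi]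
  exact h.sum_mem fun j hj => hu j (Finset.mem_of_mem_erase hj)

theorem dom_sum_of_subset {ι : Type*} {A B : Finset ι} {u : ι → V} (hu : ∀ i, u i ∈ P)
    (hAB : A ⊆ B) : Dom P (∑ j ∈ A, u j) (∑ j ∈ B, u j) :=
  h.dom_sum (h.sum_mem fun i _ => hu i) fun _ hi => h.dom_sum_of_mem (fun i _ => hu i) (hAB hi)

theorem dom_add_right {x y z : V} (hxy : Dom P x y) (hz : z ∈ P) : Dom P x (y + z) := by
  obtain ⟨c, hc, h1⟩ := hxy
  refine ⟨c, hc, ?_⟩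
  convert h.add_mem h1 (h.smul_mem hc.le hz) using 1
  module

theorem dom_add_left {x y z : V} (hxy : Dom P x y) (hz : z ∈ P) : Dom P x (z + y) := by
  rw [add_comm]; exact h.dom_add_right hxy hz

theorem dom_add_add {x y x' y' : V} (hx : Dom P x x') (hy : Dom P y y') (hx' : x' ∈ P)
    (hy' : y' ∈ P) : Dom P (x + y) (x' + y') :=
  h.dom_add (h.dom_add_right hx hy') (h.dom_add_left hy hx')

theorem smul_dom {c : ℝ} (hc : 0 < c) {x y : V} (hxy : Dom P x y) : Dom P (c • x) y := by
  obtain ⟨k, hk, h1⟩ := hxy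
  refine ⟨c * k, by positivity, ?_⟩
  convert h.smul_mem hc.le h1 using 1
  module

theorem dom_smul {c : ℝ} (hc : 0 < c) {x y : V} (hxy : Dom P x y) : Dom P x (c • y) := by
  obtain ⟨k, hk, h1⟩ := hxy
  refine ⟨k * c⁻¹, by positivity, ?_⟩
  convert h1 using 2
  rw [smul_smul]; congr 1; field_simp

theorem domEquiv_smul {c : ℝ} (hc : 0 < c) (x : V) : DomEquiv P x (c • x) :=
  ⟨h.dom_smul hc (h.dom_refl x), h.smul_dom hc (h.dom_refl x)⟩

theorem ne_zero_of_dom {x y : V} (hx : x ∈ P) (hx0 : x ≠ 0) (hxy : Dom P x y) : y ≠ 0 := by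
  rintro rfl
  obtain ⟨c, hc, h1⟩ := hxy
  rw [smul_zero, zero_sub] at h1
  exact hx0 (h.eq_zero_of_neg_mem hx h1)

/-- A uniform constant for finitely many domination relations. -/
theorem exists_uniform_dom {ι : Type*} [Finite ι] {x y : ι → V} (hy : ∀ i, y i ∈ P)
    (hxy : ∀ i, Dom P (x i) (y i)) : ∃ c : ℝ, 0 < c ∧ ∀ i, c • y i - x i ∈ P := by
  cases nonempty_fintype ι
  choose c hc hxy using hxy
  refine ⟨1 + ∑ i, c i, by have := Finset.sum_nonneg fun i (_ : i ∈ Finset.univ) => (hc i).le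
                           positivity, fun i => h.smul_sub_mem_of_le ?_ (hy i) (hxy i)⟩
  have := Finset.single_le_sum (f := c) (fun i _ => (hc i).le) (Finset.mem_univ i)
  linarith

/-- The subspace of all vectors bounded in the order by multiples of `y`. -/
def domSpan (y : V) : Submodule ℝ V where
  -- The clause `y ∈ P` and the adjoined zero make this a subspace for every `y`; for `y` outside
  -- `P` it is the zero subspace.
  carrier := {z | Dom P z y ∧ Dom P (-z) y ∧ y ∈ P} ∪ {0}
  zero_mem' := by simp
  add_mem' := by
    rintro a b (ha | rfl) (hb | rfl)
    · refine Or.inl ⟨h.dom_add ha.1 hb.1, ?_, ha.2.2⟩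
      rw [neg_add]
      exact h.dom_add ha.2.1 hb.2.1
    · rw [add_zero]; exact Or.inl ha
    · rw [zero_add]; exact Or.inl hb
    · simp
  smul_mem' := by
    rintro c a (ha | rfl)
    · rcases lt_trichotomy c 0 with hc | rfl | hc
      · left
        refine ⟨?_, ?_, ha.2.2⟩
        · rw [← neg_smul_neg]; exact h.smul_dom (neg_pos.2 hc) ha.2.1
        · rw [← neg_smul]; exact h.smul_dom (neg_pos.2 hc) ha.1
      · simp
      · left
        refine ⟨h.smul_dom hc ha.1, ?_, ha.2.2⟩
        rw [← smul_neg]; exact h.smul_dom hc ha.2.1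
    · simp

theorem mem_domSpan_iff {z y : V} (hy : y ∈ P) :
    z ∈ h.domSpan y ↔ Dom P z y ∧ Dom P (-z) y := by
  constructor
  · rintro (hz | rfl)
    · exact ⟨hz.1, hz.2.1⟩
    · simpa using h.zero_dom hy
  · rintro ⟨h1, h2⟩
    exact Or.inl ⟨h1, h2, hy⟩

theorem neg_dom {z y : V} (hz : z ∈ P) (hy : y ∈ P) : Dom P (-z) y :=
  ⟨1, one_pos, by simpa using h.add_mem hy hz⟩

theorem mem_domSpan_of_mem {z y : V} (hz : z ∈ P) (hy : y ∈ P) :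
    z ∈ h.domSpan y ↔ Dom P z y := by
  rw [h.mem_domSpan_iff hy]
  exact ⟨And.left, fun h1 => ⟨h1, h.neg_dom hz hy⟩⟩

theorem domSpan_mono {s y : V} (hs : s ∈ P) (hy : y ∈ P) (hsy : Dom P s y) :
    h.domSpan s ≤ h.domSpan y := by
  intro z hz
  rw [h.mem_domSpan_iff hs] at hz
  rw [h.mem_domSpan_iff hy]
  exact ⟨h.dom_trans hz.1 hsy, h.dom_trans hz.2 hsy⟩

theorem domSpan_lt {s y : V} (hs : s ∈ P) (hy : y ∈ P) (hsy : Dom P s y) (hys : ¬ Dom P y s) :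
    h.domSpan s < h.domSpan y := by
  refine lt_of_le_of_ne (h.domSpan_mono hs hy hsy) fun e => hys ?_
  rw [← h.mem_domSpan_of_mem hy hs, e, h.mem_domSpan_of_mem hy hy]
  exact h.dom_refl y

/-- The constant of domination may blow up along a sequence, yet the closed face of `y` is the trace
on `P` of a linear subspace, and subspaces are closed in finite dimension. -/
theorem isClosed_dom [FiniteDimensional ℝ V] {y : V} (hy : y ∈ P) :
    IsClosed {z | z ∈ P ∧ Dom P z y} := by
  have : {z | z ∈ P ∧ Dom P z y} = P ∩ (h.domSpan y : Set V) := by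
    ext z
    constructor
    · rintro ⟨h1, h2⟩
      exact ⟨h1, (h.mem_domSpan_of_mem h1 hy).2 h2⟩
    · rintro ⟨h1, h2⟩
      exact ⟨h1, (h.mem_domSpan_of_mem h1 hy).1 h2⟩
  rw [this]
  exact h.isClosed.inter (Submodule.closed_of_finiteDimensional _)

/-- Inside its order span, `y` is an interior point of the cone. -/
theorem eventually_smul_sub_mem [FiniteDimensional ℝ V] {y : V} (hy : y ∈ P) {ε : ℝ}
    (hε : 0 < ε) : ∀ᶠ w in 𝓝 (0 : V), w ∈ h.domSpan y → ε • y - w ∈ P := by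
  obtain ⟨ι, b⟩ : Σ ι : Type, Module.Basis (Fin (Module.finrank ℝ (h.domSpan y))) ℝ (h.domSpan y) :=
    ⟨Unit, Module.finBasis ℝ _⟩
  set n := Module.finrank ℝ (h.domSpan y)
  have hb : ∀ i, Dom P (b i : V) y ∧ Dom P (-(b i : V)) y := fun i =>
    (h.mem_domSpan_iff hy).1 (b i).2
  obtain ⟨c, hc, hc1⟩ := h.exists_uniform_dom (fun _ => hy) (fun i => (hb i).1)
  obtain ⟨c', hc', hc2⟩ := h.exists_uniform_dom (fun _ => hy) (fun i => (hb i).2)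
  set K := max c c'
  have hK : 0 < K := lt_max_of_lt_left hc
  -- Every basis vector of the order span lies between `-K • y` and `K • y`, so a vector with small
  -- coordinates is bounded above by a small multiple of `y`.
  have key : ∀ (i) (t : ℝ), (|t| * K) • y - t • (b i : V) ∈ P := by
    intro i t
    rcases le_total 0 t with ht | ht
    · rw [abs_of_nonneg ht]
      convert h.smul_mem ht (h.smul_sub_mem_of_le (le_max_left c c') hy (hc1 i)) using 1
      module
    · rw [abs_of_nonpos ht]
      convert h.smul_mem (neg_nonneg.2 ht)
        (h.smul_sub_mem_of_le (le_max_right c c') hy (hc2 i)) using 1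
      module
  have hcont : Continuous fun w : h.domSpan y => ∑ i, |b.repr w i| * K := by
    refine continuous_finsetSum _ fun i _ => ?_
    have : Continuous fun w : h.domSpan y => b.coord i w :=
      LinearMap.continuous_of_finiteDimensional _
    exact (this.abs).mul_const K
  have hev : ∀ᶠ w in 𝓝 (0 : h.domSpan y), ∑ i, |b.repr w i| * K < ε := by
    have := hcont.tendsto 0
    simp only [map_zero, Finsupp.coe_zero, Pi.zero_apply, abs_zero, zero_mul,
      Finset.sum_const_zero] at this
    exact this.eventually (gt_mem_nhds hε)
  rw [nhds_subtype_eq_comap, eventually_comap] at hev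
  filter_upwards [hev] with w hw hwm
  have hw := hw ⟨w, hwm⟩ rfl
  have e : w = ∑ i, b.repr ⟨w, hwm⟩ i • (b i : V) := by
    conv_lhs => rw [show w = ((⟨w, hwm⟩ : h.domSpan y) : V) from rfl, ← b.sum_repr ⟨w, hwm⟩]
    push_cast
    rfl
  refine h.smul_sub_mem_of_le hw.le hy ?_
  have : (∑ i, |b.repr ⟨w, hwm⟩ i| * K) • y - w
      = ∑ i, ((|b.repr ⟨w, hwm⟩ i| * K) • y - b.repr ⟨w, hwm⟩ i • (b i : V)) := by
    rw [Finset.sum_sub_distrib, ← Finset.sum_smul, ← e]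
  rw [this]
  exact h.sum_mem fun i _ => key i _

/-- A limit along an ultrafilter of vectors of a closed cone that are bounded in the order by a
convergent family. -/
theorem exists_tendsto [FiniteDimensional ℝ V] {α : Type*} {U : Ultrafilter α} {x y : α → V} {b : V}
    (hx : ∀ᶠ n in U, x n ∈ P) (hxy : ∀ᶠ n in U, y n - x n ∈ P) (hy : Tendsto y U (𝓝 b)) :
    ∃ a, Tendsto x U (𝓝 a) := by
  obtain ⟨M, hM, hb⟩ := h.bound
  have hf : Continuous f := LinearMap.continuous_of_finiteDimensional _
  have h1 : ∀ᶠ n in U, f (y n) < f b + 1 :=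
    ((hf.tendsto b).comp hy).eventually (gt_mem_nhds (lt_add_one _))
  have h2 : ∀ᶠ n in U, x n ∈ Metric.closedBall (0 : V) (M * (f b + 1)) := by
    filter_upwards [hx, hxy, h1] with n n1 n2 n3
    rw [mem_closedBall_zero_iff]
    refine (hb _ n1).trans (mul_le_mul_of_nonneg_left ?_ hM.le)
    have := h.apply_nonneg n2
    rw [map_sub] at this
    linarith
  have : ProperSpace V := FiniteDimensional.proper ℝ V
  obtain ⟨a, -, ha⟩ := (isCompact_closedBall (0 : V) (M * (f b + 1))).ultrafilter_le_nhds
    (U.map x) (by rw [le_principal_iff]; exact h2)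
  exact ⟨a, ha⟩

end IsSharpCone

namespace IsConePair

variable {f : V →ₗ[ℝ] ℝ} {D P : Set V} (h : IsConePair f D P)
include h

theorem mem_of_smul_mem {c : ℝ} (hc : 0 < c) {x : V} (hx : c • x ∈ D) : x ∈ D := by
  have := h.interior_smul_mem (inv_pos.2 hc) hx
  rwa [smul_smul, inv_mul_cancel₀ hc.ne', one_smul] at this

theorem mem_of_dom {x y : V} (hx : x ∈ D) (hxy : Dom P x y) : y ∈ D := by
  obtain ⟨c, hc, h1⟩ := hxy
  apply h.mem_of_smul_mem hc
  simpa using h.interior_add_mem hx h1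

/-- Interior vectors are order units: `y - ε • x` stays in the open cone for small `ε`. -/
theorem dom_of_mem_interior {y : V} (hy : y ∈ D) (x : V) : Dom P x y := by
  have : Tendsto (fun ε : ℝ => y - ε • x) (𝓝 0) (𝓝 y) := by
    have : Continuous fun ε : ℝ => y - ε • x := by fun_prop
    simpa using this.tendsto 0
  have h1 := (this.mono_left (nhdsWithin_le_nhds (s := Ioi 0))).eventually (h.isOpen.mem_nhds hy)
  obtain ⟨ε, h1, hε⟩ := (h1.and self_mem_nhdsWithin).exists
  have hε : 0 < ε := hε
  refine ⟨ε⁻¹, inv_pos.2 hε, ?_⟩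
  convert h.smul_mem (inv_pos.2 hε).le (h.subset h1) using 1
  rw [smul_sub, smul_smul, inv_mul_cancel₀ hε.ne', one_smul]

/-- Domination of a limit in the open cone passes to the approximating vectors. -/
theorem eventually_smul_sub_mem_of_tendsto {α : Type*} {l : Filter α} {x y : α → V} {a b : V}
    (hx : Tendsto x l (𝓝 a)) (hy : Tendsto y l (𝓝 b)) (hb : b ∈ D) {c c' : ℝ} (hc : c < c')
    (hab : c • b - a ∈ P) : ∀ᶠ n in l, c' • y n - x n ∈ P := by
  have h1 : Tendsto (fun n => c' • y n - x n) l (𝓝 (c' • b - a)) := (hy.const_smul c').sub hx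
  have h2 : c' • b - a ∈ D := by
    convert h.interior_add_mem (h.interior_smul_mem (sub_pos.2 hc) hb) hab using 1
    module
  exact (h1.eventually (h.isOpen.mem_nhds h2)).mono fun n hn => h.subset hn

end IsConePair

end Cone

/-! ### Frames: linear models of properly embedded simplices -/

section Frame

open Filter Topology

variable {V : Type*} [NormedAddCommGroup V] [NormedSpace ℝ V]
variable {ι κ : Type*} [Fintype ι] [Fintype κ]

/-- All positive combinations of a finite family of vectors. -/
def openCone (u : ι → V) : Set V := {p | ∃ t : ι → ℝ, (∀ i, 0 < t i) ∧ p = ∑ i, t i • u i}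

/-- A family of vectors of `Q` whose sum lies in the open cone `D` while no sum of a proper
subfamily does. -/
structure IsFrame (D Q : Set V) (u : ι → V) : Prop where
  mem : ∀ i, u i ∈ Q
  sum_mem : ∑ i, u i ∈ D
  facet : ∀ A : Finset ι, A ≠ Finset.univ → ∑ i ∈ A, u i ∉ D

/-- Every point of `σ` is `C`-close in the order to a point of `τ`. -/
def Coarse (P : Set V) (C : ℝ) (σ τ : Set V) : Prop :=
  ∀ p ∈ σ, ∃ q ∈ τ, q - p ∈ P ∧ C • p - q ∈ P

/-- Two families are parallel if a bijection matches equivalent vectors. -/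
def Parallel (P : Set V) (u : ι → V) (v : κ → V) : Prop :=
  ∃ e : ι ≃ κ, ∀ i, DomEquiv P (u i) (v (e i))

namespace IsConePair

variable {f : V →ₗ[ℝ] ℝ} {D P Q : Set V} (h : IsConePair f D P) (hQ : IsSharpCone f Q)
  (hQP : Q ⊆ P)
include h

/-- Removing one vector at a time is enough: the sum over a smaller subfamily is dominated by the
sum over a larger one, and `D` is closed upwards under domination. -/
theorem isFrame_of_sub {u : ι → V} (hu : ∀ i, u i ∈ Q) (hQP : Q ⊆ P) (hs : ∑ i, u i ∈ D)
    (hf : ∀ i, ∑ j, u j - u i ∉ D) : IsFrame D Q u := by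
  classical
  refine ⟨hu, hs, fun A hA hAD => ?_⟩
  obtain ⟨i, hi⟩ : ∃ i, i ∉ A := by
    by_contra hc
    push Not at hc
    exact hA (Finset.eq_univ_iff_forall.2 hc)
  apply hf i
  rw [← Finset.sum_erase_eq_sub (Finset.mem_univ i)]
  refine h.mem_of_dom hAD (h.dom_sum_of_subset (fun i => hQP (hu i)) fun j hj => ?_)
  simp only [Finset.mem_erase, Finset.mem_univ, and_true]
  rintro rfl
  exact hi hj

variable {u : ι → V} (hu : IsFrame D P u)
include hu

/-- If `i` were not in `B`, then `u i`, and with it the whole sum, would be dominated by the sum of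
the other vectors. That would place this facet sum in `D`. -/
theorem mem_of_dom_sum {i : ι} {B : Finset ι} (hi : Dom P (u i) (∑ j ∈ B, u j)) : i ∈ B := by
  classical
  by_contra hiB
  have h1 : Dom P (∑ j ∈ B, u j) (∑ j ∈ Finset.univ.erase i, u j) := by
    refine h.dom_sum_of_subset hu.mem fun j hj => ?_
    simp only [Finset.mem_erase, Finset.mem_univ, and_true]
    rintro rfl
    exact hiB hj
  have h2 : Dom P (∑ j, u j) (∑ j ∈ Finset.univ.erase i, u j) := by
    rw [← Finset.add_sum_erase _ _ (Finset.mem_univ i)]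
    exact h.dom_add (h.dom_trans hi h1) (h.dom_refl _)
  exact hu.facet (Finset.univ.erase i) (fun e => by simpa using Finset.ext_iff.1 e i)
    (h.mem_of_dom hu.sum_mem h2)

theorem frame_ne_zero (i : ι) : u i ≠ 0 := fun e => by
  have := h.mem_of_dom_sum hu (i := i) (B := ∅) (by simpa [e] using h.dom_refl 0)
  simp at this

theorem dom_sum_support {t : ι → ℝ} (ht : ∀ i, 0 ≤ t i) {B : Finset ι}
    (hB : ∀ i, t i ≠ 0 → i ∈ B) : Dom P (∑ i, t i • u i) (∑ j ∈ B, u j) := by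
  refine h.dom_sum (h.sum_mem fun i _ => hu.mem i) fun i _ => ?_
  rcases (ht i).eq_or_lt with e | e
  · rw [← e, zero_smul]
    exact h.zero_dom (h.sum_mem fun i _ => hu.mem i)
  · exact h.smul_dom e (h.dom_sum_of_mem (fun j _ => hu.mem j) (hB i e.ne'))

theorem sum_support_dom {t : ι → ℝ} (ht : ∀ i, 0 ≤ t i) {B : Finset ι}
    (hB : ∀ i ∈ B, t i ≠ 0) : Dom P (∑ j ∈ B, u j) (∑ i, t i • u i) := by
  have hm : ∀ i ∈ Finset.univ, t i • u i ∈ P := fun i _ => h.smul_mem (ht i) (hu.mem i)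
  refine h.dom_sum (h.sum_mem hm) fun i hi => ?_
  have := h.dom_sum_of_mem hm (Finset.mem_univ i)
  have hti : 0 < t i := lt_of_le_of_ne (ht i) (hB i hi).symm
  exact h.dom_trans (h.domEquiv_smul hti (u i)).1 this

theorem exists_domEquiv_sum {t : ι → ℝ} (ht : ∀ i, 0 ≤ t i) :
    ∃ B : Finset ι, DomEquiv P (∑ i, t i • u i) (∑ j ∈ B, u j) := by
  classical
  exact ⟨Finset.univ.filter fun i => t i ≠ 0, h.dom_sum_support hu ht (by simp),
    h.sum_support_dom hu ht (by simp)⟩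

theorem coeff_pos {t : ι → ℝ} (ht : ∀ i, 0 ≤ t i) (hD : ∑ i, t i • u i ∈ D) (i : ι) : 0 < t i := by
  classical
  refine lt_of_le_of_ne (ht i) fun e => ?_
  have := h.mem_of_dom hD (h.dom_sum_support hu ht (B := Finset.univ.erase i) fun j hj => by
    simp only [Finset.mem_erase, Finset.mem_univ, and_true]
    rintro rfl
    exact hj e.symm)
  exact hu.facet (Finset.univ.erase i) (fun e => by simpa using Finset.ext_iff.1 e i) this

/-- If the smallest coefficient is not positive, subtracting it from all coefficients adds a
nonnegative multiple of the full sum. The vector stays in `D` but has acquired a vanishing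
coefficient, so it lies over a facet. -/
theorem coeff_pos_of_mem {c : ι → ℝ} (hD : ∑ i, c i • u i ∈ D) (i : ι) : 0 < c i := by
  classical
  have : Nonempty ι := ⟨i⟩
  obtain ⟨m, -, hm⟩ := Finset.exists_min_image Finset.univ c Finset.univ_nonempty
  by_contra hi
  push Not at hi
  have hcm : c m ≤ 0 := (hm i (Finset.mem_univ i)).trans hi
  have hsum : ∑ j, (c j - c m) • u j ∈ D := by
    have := h.interior_add_mem hD (h.smul_mem (neg_nonneg.2 hcm) (h.subset hu.sum_mem))
    convert this using 1
    simp only [sub_smul, Finset.sum_sub_distrib, ← Finset.smul_sum]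
    module
  have := h.coeff_pos hu (fun j => sub_nonneg.2 (hm j (Finset.mem_univ j))) hsum m
  simp at this

/-- A linear relation with a negative coefficient, rescaled to make that coefficient -1 and added to
the full sum, would write the sum with a zero coefficient. Applied to a relation and its negative,
this kills all coefficients. -/
theorem linearIndependent_frame : LinearIndependent ℝ u := by
  rw [Fintype.linearIndependent_iff]
  have key : ∀ c : ι → ℝ, ∑ i, c i • u i = 0 → ∀ i, 0 ≤ c i := by
    intro c hc i
    by_contra hi
    push Not at hi
    have : ∑ j, (1 + (-c i)⁻¹ * c j) • u j ∈ D := by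
      have e : ∑ j, (1 + (-c i)⁻¹ * c j) • u j = ∑ j, u j + (-c i)⁻¹ • ∑ j, c j • u j := by
        simp only [add_smul, one_smul, Finset.sum_add_distrib, Finset.smul_sum, mul_smul]
      rw [e, hc, smul_zero, add_zero]
      exact hu.sum_mem
    have := h.coeff_pos_of_mem hu this i
    have hne : -c i ≠ 0 := (neg_pos.2 hi).ne'
    have e : (-c i)⁻¹ * c i = -1 := by rw [inv_neg, neg_mul, inv_mul_cancel₀ hi.ne]
    rw [e] at this
    norm_num at this
  intro c hc i
  refine le_antisymm ?_ (key c hc i)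
  have := key (-c) (by simp [hc]) i
  simpa using this

theorem openCone_subset_interior : openCone u ⊆ D := by
  rintro p ⟨t, ht, rfl⟩
  exact h.mem_of_dom hu.sum_mem
    (h.sum_support_dom hu (fun i => (ht i).le) (B := Finset.univ) fun i _ => (ht i).ne')

/-- Needed to identify `coreSimplex`, which is cut out by a linear span, with an open simplex, and
to keep limits of points of a simplex inside it. -/
theorem mem_openCone_of_mem_span {p : V} (hp : p ∈ D) (hs : p ∈ Submodule.span ℝ (range u)) :
    p ∈ openCone u := by
  obtain ⟨c, rfl⟩ := (Submodule.mem_span_range_iff_exists_fun ℝ).1 hs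
  exact ⟨c, fun i => h.coeff_pos_of_mem hu hp i, rfl⟩

end IsConePair

theorem openCone_subset_span (u : ι → V) : openCone u ⊆ Submodule.span ℝ (range u) := by
  rintro p ⟨t, -, rfl⟩
  exact Submodule.sum_mem _ fun i _ => Submodule.smul_mem _ _ (Submodule.subset_span ⟨i, rfl⟩)

theorem span_openCone (u : ι → V) :
    Submodule.span ℝ (openCone u) = Submodule.span ℝ (range u) := by
  classical
  refine le_antisymm (Submodule.span_le.2 (openCone_subset_span u)) (Submodule.span_le.2 ?_)
  rintro _ ⟨i, rfl⟩
  have h1 : ∑ j, u j ∈ openCone u := ⟨fun _ => 1, fun _ => one_pos, by simp⟩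
  have h2 : ∑ j, u j + u i ∈ openCone u := by
    refine ⟨fun j => 1 + if j = i then 1 else 0, fun j => by dsimp only; split_ifs <;> norm_num, ?_⟩
    simp [add_smul, Finset.sum_add_distrib]
  have := Submodule.sub_mem _ (Submodule.subset_span (R := ℝ) h2)
    (Submodule.subset_span (R := ℝ) h1)
  simpa using this

theorem sum_mem_openCone (u : ι → V) : ∑ i, u i ∈ openCone u :=
  ⟨fun _ => 1, fun _ => one_pos, by simp⟩

theorem smul_mem_openCone {u : ι → V} {c : ℝ} (hc : 0 < c) {p : V} (hp : p ∈ openCone u) :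
    c • p ∈ openCone u := by
  obtain ⟨t, ht, rfl⟩ := hp
  exact ⟨fun i => c * t i, fun i => mul_pos hc (ht i), by simp [Finset.smul_sum, mul_smul]⟩

theorem openCone_comp_equiv (u : ι → V) (e : κ ≃ ι) : openCone (u ∘ e) = openCone u := by
  ext p
  constructor
  · rintro ⟨t, ht, rfl⟩
    refine ⟨t ∘ e.symm, fun i => ht _, ?_⟩
    rw [← e.sum_comp]
    simp
  · rintro ⟨t, ht, rfl⟩
    refine ⟨t ∘ e, fun i => ht _, ?_⟩
    rw [← e.sum_comp]
    simp

theorem openCone_smul (u : ι → V) {c : ι → ℝ} (hc : ∀ i, 0 < c i) :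
    openCone (fun i => c i • u i) = openCone u := by
  ext p
  constructor
  · rintro ⟨t, ht, rfl⟩
    exact ⟨fun i => t i * c i, fun i => mul_pos (ht i) (hc i), by simp [mul_smul]⟩
  · rintro ⟨t, ht, rfl⟩
    refine ⟨fun i => t i / c i, fun i => div_pos (ht i) (hc i), ?_⟩
    refine Finset.sum_congr rfl fun i _ => ?_
    rw [smul_smul, div_mul_cancel₀ _ (hc i).ne']

theorem image_openCone (u : ι → V) (g : V ≃ₗ[ℝ] V) : g '' openCone u = openCone (g ∘ u) := by
  ext p
  constructor
  · rintro ⟨_, ⟨t, ht, rfl⟩, rfl⟩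
    exact ⟨t, ht, by simp⟩
  · rintro ⟨t, ht, rfl⟩
    exact ⟨_, ⟨t, ht, rfl⟩, by simp⟩

theorem IsFrame.comp_equiv {D Q : Set V} {u : ι → V} (hu : IsFrame D Q u) (e : κ ≃ ι) :
    IsFrame D Q (u ∘ e) := by
  refine ⟨fun i => hu.mem _, ?_, fun A hA => ?_⟩
  · have := hu.sum_mem
    rw [← e.sum_comp] at this
    exact this
  · have := hu.facet (A.map e.toEmbedding) fun e' => hA ?_
    · simpa using this
    · rw [Finset.eq_univ_iff_forall] at e' ⊢
      intro i
      have := e' (e i)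
      simpa using this

theorem IsFrame.mono {D Q Q' : Set V} {u : ι → V} (hu : IsFrame D Q u) (hQ : Q ⊆ Q') :
    IsFrame D Q' u := ⟨fun i => hQ (hu.mem i), hu.sum_mem, hu.facet⟩

namespace IsConePair

variable {f : V →ₗ[ℝ] ℝ} {D P Q : Set V} (h : IsConePair f D P)
include h

/-- Rescaling the vectors of a frame. -/
theorem isFrame_smul {u : ι → V} (hQ : IsSharpCone f Q) (hQP : Q ⊆ P) (hu : IsFrame D Q u)
    {c : ι → ℝ} (hc : ∀ i, 0 < c i) : IsFrame D Q fun i => c i • u i := by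
  have hm : ∀ i, c i • u i ∈ P := fun i => hQP (hQ.smul_mem (hc i).le (hu.mem i))
  have hm' : ∀ i, u i ∈ P := fun i => hQP (hu.mem i)
  refine ⟨fun i => hQ.smul_mem (hc i).le (hu.mem i), h.mem_of_dom hu.sum_mem ?_,
    fun A hA hD => hu.facet A hA (h.mem_of_dom hD ?_)⟩
  · refine h.dom_sum (h.sum_mem fun i _ => hm i) fun i hi => ?_
    exact h.dom_trans (h.domEquiv_smul (hc i) _).1 (h.dom_sum_of_mem (fun i _ => hm i) hi)
  · refine h.dom_sum (h.sum_mem fun i _ => hm' i) fun i hi => ?_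
    exact h.dom_trans (h.domEquiv_smul (hc i) _).2 (h.dom_sum_of_mem (fun i _ => hm' i) hi)

/-- Replacing the vectors of a frame by equivalent ones. -/
theorem isFrame_of_domEquiv {u v : ι → V} (hu : IsFrame D P u) (hv : ∀ i, v i ∈ Q) (hQP : Q ⊆ P)
    (huv : ∀ i, DomEquiv P (u i) (v i)) : IsFrame D Q v := by
  have hv' : ∀ i, v i ∈ P := fun i => hQP (hv i)
  refine ⟨hv, h.mem_of_dom hu.sum_mem ?_, fun A hA hD => hu.facet A hA (h.mem_of_dom hD ?_)⟩
  · refine h.dom_sum (h.sum_mem fun i _ => hv' i) fun i hi => ?_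
    exact h.dom_trans (huv i).1 (h.dom_sum_of_mem (fun i _ => hv' i) hi)
  · refine h.dom_sum (h.sum_mem fun i _ => hu.mem i) fun i hi => ?_
    exact h.dom_trans (huv i).2 (h.dom_sum_of_mem (fun i _ => hu.mem i) hi)

/-- Limits of frames are frames, as long as the sum stays in the open cone. -/
theorem isFrame_of_tendsto {α : Type*} {l : Filter α} [l.NeBot] {u : α → ι → V} {v : ι → V}
    (hQ : IsSharpCone f Q) (hu : ∀ᶠ n in l, IsFrame D Q (u n))
    (huv : ∀ i, Tendsto (fun n => u n i) l (𝓝 (v i))) (hs : ∑ i, v i ∈ D) : IsFrame D Q v := by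
  refine ⟨fun i => hQ.isClosed.mem_of_tendsto (huv i) (hu.mono fun n hn => hn.mem i), hs,
    fun A hA hD => ?_⟩
  have h1 : Tendsto (fun n => ∑ i ∈ A, u n i) l (𝓝 (∑ i ∈ A, v i)) :=
    tendsto_finsetSum _ fun i _ => huv i
  obtain ⟨n, h2, h3⟩ := ((h1.eventually (h.isOpen.mem_nhds hD)).and hu).exists
  exact h3.facet A hA h2

/-- Coefficients of convergent points of convergent frames converge. -/
theorem exists_tendsto_coeff [FiniteDimensional ℝ V] {α : Type*} {U : Ultrafilter α}
    {u : α → ι → V} {v : ι → V} {t : α → ι → ℝ} {p : V} (hu : ∀ᶠ n in U, ∀ i, u n i ∈ P)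
    (hv : ∀ i, v i ≠ 0) (huv : ∀ i, Tendsto (fun n => u n i) U (𝓝 (v i)))
    (ht : ∀ᶠ n in U, ∀ i, 0 ≤ t n i) (hp : Tendsto (fun n => ∑ i, t n i • u n i) U (𝓝 p)) :
    ∃ s : ι → ℝ, (∀ i, Tendsto (fun n => t n i) U (𝓝 (s i))) ∧ (∀ i, 0 ≤ s i) ∧
      p = ∑ i, s i • v i := by
  have hf : Continuous f := LinearMap.continuous_of_finiteDimensional _
  have hvP : ∀ i, v i ∈ P := fun i =>
    h.isClosed.mem_of_tendsto (huv i) (hu.mono fun n hn => hn i)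
  have key : ∀ i, ∃ s, Tendsto (fun n => t n i) U (𝓝 s) := by
    intro i
    -- Since `f (u n i)` stays away from zero, the coefficient `t n i` is bounded by a multiple of
    -- `f` of the whole combination, and the ultrafilter converges on a compact interval.
    have hfv : 0 < f (v i) := h.apply_pos (hvP i) (hv i)
    have h1 : ∀ᶠ n in U, f (v i) / 2 < f (u n i) :=
      ((hf.tendsto _).comp (huv i)).eventually (lt_mem_nhds (half_lt_self hfv))
    have h2 : ∀ᶠ n in U, f (∑ i, t n i • u n i) < f p + 1 :=
      ((hf.tendsto _).comp hp).eventually (gt_mem_nhds (lt_add_one _))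
    have h3 : ∀ᶠ n in U, t n i ∈ Icc 0 ((f p + 1) / (f (v i) / 2)) := by
      filter_upwards [h1, h2, hu, ht] with n n1 n2 n3 n4
      refine ⟨n4 i, ?_⟩
      rw [le_div_iff₀ (by positivity)]
      have : f (t n i • u n i) ≤ f (∑ i, t n i • u n i) := by
        rw [map_sum]
        exact Finset.single_le_sum (f := fun i => f (t n i • u n i))
          (fun j _ => h.apply_nonneg (h.smul_mem (n4 j) (n3 j))) (Finset.mem_univ i)
      rw [map_smul, smul_eq_mul] at this
      nlinarith [mul_le_mul_of_nonneg_left n1.le (n4 i)]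
    obtain ⟨s, -, hs⟩ := isCompact_Icc.ultrafilter_le_nhds (U.map fun n => t n i)
      (by rw [le_principal_iff]; exact h3)
    exact ⟨s, hs⟩
  choose s hs using key
  refine ⟨s, hs, fun i => ge_of_tendsto (hs i) (ht.mono fun n hn => hn i), ?_⟩
  exact tendsto_nhds_unique hp (tendsto_finsetSum _ fun i _ => (hs i).smul (huv i))

/-- A point of the open cone that is a limit of points of `openCone u` belongs to it. -/
theorem mem_openCone_of_tendsto [FiniteDimensional ℝ V] {α : Type*} {U : Ultrafilter α}
    {u : ι → V} (hu : IsFrame D P u) {x : α → V} {p : V} (hx : ∀ᶠ n in U, x n ∈ openCone u)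
    (hp : Tendsto x U (𝓝 p)) (hD : p ∈ D) : p ∈ openCone u := by
  refine h.mem_openCone_of_mem_span hu hD ?_
  exact (Submodule.closed_of_finiteDimensional _).mem_of_tendsto hp
    (hx.mono fun n hn => openCone_subset_span u hn)

end IsConePair

end Frame

/-! ### Coarse containment of simplices -/

section Coarse

open Filter Topology

variable {V : Type*} [NormedAddCommGroup V] [NormedSpace ℝ V]
variable {ι κ : Type*} [Fintype ι] [Fintype κ]

theorem DomEquiv.image {P : Set V} {g : V ≃ₗ[ℝ] V} (hg : ∀ x, x ∈ P → g x ∈ P) {x y : V}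
    (hxy : DomEquiv P x y) : DomEquiv P (g x) (g y) := by
  obtain ⟨⟨c, hc, h1⟩, c', hc', h2⟩ := hxy
  exact ⟨⟨c, hc, by simpa using hg _ h1⟩, c', hc', by simpa using hg _ h2⟩

theorem Dom.image {P : Set V} {g : V ≃ₗ[ℝ] V} (hg : ∀ x, x ∈ P → g x ∈ P) {x y : V}
    (hxy : Dom P x y) : Dom P (g x) (g y) := by
  obtain ⟨c, hc, h1⟩ := hxy
  exact ⟨c, hc, by simpa using hg _ h1⟩

theorem Coarse.image {P : Set V} {C : ℝ} {σ τ : Set V} (hc : Coarse P C σ τ) {g : V ≃ₗ[ℝ] V}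
    (hg : ∀ x, x ∈ P → g x ∈ P) : Coarse P C (g '' σ) (g '' τ) := by
  rintro _ ⟨p, hp, rfl⟩
  obtain ⟨q, hq, h1, h2⟩ := hc p hp
  exact ⟨g q, ⟨q, hq, rfl⟩, by simpa using hg _ h1, by simpa using hg _ h2⟩

theorem Coarse.mono_right {P : Set V} {C : ℝ} {σ τ τ' : Set V} (hc : Coarse P C σ τ)
    (h : τ ⊆ τ') : Coarse P C σ τ' := fun p hp => by
  obtain ⟨q, hq, h1⟩ := hc p hp
  exact ⟨q, h hq, h1⟩

/-- Limits are taken along a nonprincipal ultrafilter on ℕ: no subsequences have to be extracted,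
and a choice among finitely many alternatives is eventually constant. -/
theorem eventually_hyperfilter_of_forall_ge {p : ℕ → Prop} (N : ℕ) (h : ∀ n, N ≤ n → p n) :
    ∀ᶠ n in (hyperfilter ℕ : Filter ℕ), p n :=
  Nat.hyperfilter_le_atTop (eventually_atTop.2 ⟨N, h⟩)

theorem tendsto_inv_hyperfilter :
    Tendsto (fun n : ℕ => ((n : ℝ) + 1)⁻¹) (hyperfilter ℕ) (𝓝 0) := by
  have := tendsto_one_div_add_atTop_nhds_zero_nat (𝕜 := ℝ)
  simp only [one_div] at this
  exact this.mono_left Nat.hyperfilter_le_atTop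

theorem tendsto_add_inv_smul (x y : V) :
    Tendsto (fun n : ℕ => x + ((n : ℝ) + 1)⁻¹ • y) (hyperfilter ℕ) (𝓝 x) := by
  simpa using tendsto_const_nhds.add (tendsto_inv_hyperfilter.smul_const y)

/-- These interior points of the simplex approach the vertex `u i`. -/
theorem add_inv_smul_mem_openCone (u : ι → V) (i : ι) (n : ℕ) :
    u i + ((n : ℝ) + 1)⁻¹ • ∑ j, u j ∈ openCone u := by
  classical
  refine ⟨fun j => ((n : ℝ) + 1)⁻¹ + if j = i then 1 else 0, fun j => ?_, ?_⟩
  · dsimp only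
    split_ifs <;> positivity
  · simp [add_smul, Finset.sum_add_distrib, Finset.smul_sum, add_comm]

theorem Parallel.symm {P : Set V} {u : ι → V} {v : κ → V} (h : Parallel P u v) :
    Parallel P v u := by
  obtain ⟨e, he⟩ := h
  exact ⟨e.symm, fun i => by simpa using (he (e.symm i)).symm⟩

theorem Parallel.card_eq {P : Set V} {u : ι → V} {v : κ → V} (h : Parallel P u v) :
    Fintype.card ι = Fintype.card κ := Fintype.card_congr h.choose

namespace IsSharpCone

variable {f : V →ₗ[ℝ] ℝ} {P : Set V} (h : IsSharpCone f P)
include h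

theorem parallel_trans {μ : Type*} [Fintype μ] {u : ι → V} {v : κ → V} {w : μ → V}
    (h1 : Parallel P u v) (h2 : Parallel P v w) : Parallel P u w := by
  obtain ⟨e, he⟩ := h1
  obtain ⟨e', he'⟩ := h2
  exact ⟨e.trans e', fun i => h.domEquiv_trans (he i) (he' (e i))⟩

theorem coarse_trans {C C' : ℝ} (hC : 0 ≤ C') {σ τ ρ : Set V} (h1 : Coarse P C σ τ)
    (h2 : Coarse P C' τ ρ) : Coarse P (C' * C) σ ρ := by
  intro p hp
  obtain ⟨q, hq, a1, a2⟩ := h1 p hp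
  obtain ⟨r, hr, b1, b2⟩ := h2 q hq
  refine ⟨r, hr, ?_, ?_⟩
  · convert h.add_mem a1 b1 using 1; abel
  · convert h.add_mem (h.smul_mem hC a2) b2 using 1; module

theorem coarse_mono {C C' : ℝ} (hC : C ≤ C') {σ τ : Set V} (hσ : σ ⊆ P) (h1 : Coarse P C σ τ) :
    Coarse P C' σ τ := by
  intro p hp
  obtain ⟨q, hq, a1, a2⟩ := h1 p hp
  exact ⟨q, hq, a1, h.smul_sub_mem_of_le hC (hσ hp) a2⟩

end IsSharpCone

namespace IsConePair

variable {f : V →ₗ[ℝ] ℝ} {D P : Set V} (h : IsConePair f D P)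
include h

variable {u : ι → V} {v : κ → V}

theorem openCone_subset_closed (hu : IsFrame D P u) : openCone u ⊆ P :=
  (h.openCone_subset_interior hu).trans h.subset

/-- Points of the first simplex tending to `u i` have companions `q` in the second one, which are
bounded in the order and so converge to a nonnegative combination of the `v k`. The two-sided bounds
survive in the limit, and the limit combination is equivalent to the sum over its support. -/
theorem exists_domEquiv_of_coarse [FiniteDimensional ℝ V] (hu : IsFrame D P u)
    (hv : IsFrame D P v) {C : ℝ} (hc : Coarse P C (openCone u) (openCone v)) (i : ι) :
    ∃ B : Finset κ, DomEquiv P (u i) (∑ k ∈ B, v k) := by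
  choose q hq h1 h2 using fun n : ℕ => hc _ (add_inv_smul_mem_openCone u i n)
  have hp := tendsto_add_inv_smul (u i) (∑ j, u j)
  obtain ⟨a, ha⟩ := h.exists_tendsto (U := hyperfilter ℕ) (x := q)
    (Eventually.of_forall fun n => h.openCone_subset_closed hv (hq n))
    (Eventually.of_forall h2) (hp.const_smul C)
  choose t ht hqt using hq
  obtain ⟨s, -, hs, has⟩ := h.exists_tendsto_coeff (U := hyperfilter ℕ) (u := fun _ => v) (v := v)
    (t := t) (Eventually.of_forall fun _ => hv.mem) (h.frame_ne_zero hv)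
    (fun _ => tendsto_const_nhds) (Eventually.of_forall fun n i => (ht n i).le)
    (by simpa only [← hqt] using ha)
  obtain ⟨B, hB⟩ := h.exists_domEquiv_sum hv hs
  rw [← has] at hB
  refine ⟨B, h.domEquiv_trans ⟨?_, ?_⟩ hB⟩
  · exact h.dom_of_mem (h.isClosed.mem_of_tendsto (ha.sub hp) (Eventually.of_forall h1))
  · refine ⟨max C 1, by positivity, h.smul_sub_mem_of_le (le_max_left _ _) (hu.mem i) ?_⟩
    exact h.isClosed.mem_of_tendsto ((hp.const_smul C).sub ha) (Eventually.of_forall h2)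

/-- If the vectors of a frame are equivalent to sums of subfamilies of `v`, each of these
subfamilies has a private member. -/
theorem exists_injective_of_domEquiv (hu : IsFrame D P u) (hv : ∀ k, v k ∈ P) {θ : ι → Finset κ}
    (hθ : ∀ i, DomEquiv P (u i) (∑ k ∈ θ i, v k)) :
    ∃ e : ι → κ, Function.Injective e ∧ ∀ i, e i ∈ θ i ∧ ∀ l, l ≠ i → e i ∉ θ l := by
  classical
  -- If every member of `θ i` also occurred in some other `θ l`, then `u i` would be dominated by
  -- the sum of the other vectors of the frame.
  have key : ∀ i, ∃ k, k ∈ θ i ∧ ∀ l, l ≠ i → k ∉ θ l := by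
    intro i
    by_contra hc
    push Not at hc
    have : Dom P (u i) (∑ l ∈ Finset.univ.erase i, u l) := by
      refine h.dom_trans (hθ i).1 (h.dom_sum (h.sum_mem fun l _ => hu.mem l) fun k hk => ?_)
      obtain ⟨l, hl, hkl⟩ := hc k hk
      refine h.dom_trans (h.dom_sum_of_mem (fun k _ => hv k) hkl) (h.dom_trans (hθ l).2 ?_)
      exact h.dom_sum_of_mem (fun l _ => hu.mem l) (by simp [hl])
    simpa using h.mem_of_dom_sum hu this
  choose e he1 he2 using key
  refine ⟨e, fun i l hil => ?_, fun i => ⟨he1 i, he2 i⟩⟩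
  by_contra hne
  exact he2 i l (Ne.symm hne) (hil ▸ he1 l)

theorem card_le_of_domEquiv (hu : IsFrame D P u) (hv : ∀ k, v k ∈ P) {θ : ι → Finset κ}
    (hθ : ∀ i, DomEquiv P (u i) (∑ k ∈ θ i, v k)) : Fintype.card ι ≤ Fintype.card κ := by
  obtain ⟨e, he, -⟩ := h.exists_injective_of_domEquiv hu hv hθ
  exact Fintype.card_le_of_injective e he

/-- With enough indices the private members exhaust `κ`, so `θ i` has no room for a second element.
-/
theorem exists_equiv_of_domEquiv (hu : IsFrame D P u) (hv : ∀ k, v k ∈ P) {θ : ι → Finset κ}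
    (hθ : ∀ i, DomEquiv P (u i) (∑ k ∈ θ i, v k)) (hcard : Fintype.card κ ≤ Fintype.card ι) :
    ∃ e : ι ≃ κ, ∀ i, θ i = {e i} := by
  obtain ⟨e, he, h1⟩ := h.exists_injective_of_domEquiv hu hv hθ
  have hb : Function.Bijective e := by
    rw [Fintype.bijective_iff_injective_and_card]
    exact ⟨he, le_antisymm (Fintype.card_le_of_injective e he) hcard⟩
  refine ⟨Equiv.ofBijective e hb, fun i => Finset.eq_singleton_iff_unique_mem.2
    ⟨(h1 i).1, fun k hk => ?_⟩⟩
  obtain ⟨l, rfl⟩ := hb.2 k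
  by_contra hne
  exact (h1 l).2 i (fun e' => hne (by subst e'; rfl)) hk

theorem card_le_of_coarse [FiniteDimensional ℝ V] (hu : IsFrame D P u) (hv : IsFrame D P v) {C : ℝ}
    (hc : Coarse P C (openCone u) (openCone v)) : Fintype.card ι ≤ Fintype.card κ := by
  choose θ hθ using h.exists_domEquiv_of_coarse hu hv hc
  exact h.card_le_of_domEquiv hu hv.mem hθ

theorem parallel_of_coarse [FiniteDimensional ℝ V] (hu : IsFrame D P u) (hv : IsFrame D P v) {C : ℝ}
    (hc : Coarse P C (openCone u) (openCone v)) (hcard : Fintype.card κ ≤ Fintype.card ι) :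
    Parallel P u v := by
  choose θ hθ using h.exists_domEquiv_of_coarse hu hv hc
  obtain ⟨e, he⟩ := h.exists_equiv_of_domEquiv hu hv.mem hθ hcard
  exact ⟨e, fun i => by simpa [he] using hθ i⟩

/-- Keep the coefficients of a point and replace each `u i` by a multiple of the sum over `θ i`. The
result lies in the span of `v` and dominates a point of `D`, which already forces all its
coefficients to be positive. -/
theorem coarse_of_domEquiv (hu : IsFrame D P u) (hv : IsFrame D P v) {θ : ι → Finset κ}
    (hθ : ∀ i, DomEquiv P (u i) (∑ k ∈ θ i, v k)) :
    ∃ C > 0, Coarse P C (openCone u) (openCone v) := by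
  classical
  have hm : ∀ i, ∑ k ∈ θ i, v k ∈ P := fun i => h.sum_mem fun k _ => hv.mem k
  obtain ⟨c, hc, h1⟩ := h.exists_uniform_dom hm (fun i => (hθ i).1)
  obtain ⟨c', hc', h2⟩ := h.exists_uniform_dom hu.mem (fun i => (hθ i).2)
  refine ⟨c * c', by positivity, ?_⟩
  rintro p ⟨t, ht, rfl⟩
  have e : ∑ i, t i • c • ∑ k ∈ θ i, v k
      = ∑ k, (∑ i, if k ∈ θ i then t i * c else 0) • v k := by
    simp only [Finset.sum_smul, ite_smul, zero_smul]
    rw [Finset.sum_comm]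
    refine Finset.sum_congr rfl fun i _ => ?_
    rw [smul_smul, Finset.smul_sum, ← Finset.sum_filter]
    simp
  have hqp : ∑ i, t i • c • ∑ k ∈ θ i, v k - ∑ i, t i • u i ∈ P := by
    rw [← Finset.sum_sub_distrib]
    refine h.sum_mem fun i _ => ?_
    rw [← smul_sub]
    exact h.smul_mem (ht i).le (h1 i)
  refine ⟨∑ i, t i • c • ∑ k ∈ θ i, v k, ?_, hqp, ?_⟩
  · have hqD : ∑ i, t i • c • ∑ k ∈ θ i, v k ∈ D :=
      h.mem_of_dom (h.openCone_subset_interior hu ⟨t, ht, rfl⟩) (h.dom_of_mem hqp)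
    refine h.mem_openCone_of_mem_span hv hqD ?_
    rw [e]
    exact Submodule.sum_mem _ fun i _ => Submodule.smul_mem _ _ (Submodule.subset_span ⟨i, rfl⟩)
  · rw [Finset.smul_sum, ← Finset.sum_sub_distrib]
    refine h.sum_mem fun i _ => ?_
    convert h.smul_mem (mul_nonneg (ht i).le hc.le) (h2 i) using 1
    module

theorem coarse_of_parallel (hu : IsFrame D P u) (hv : IsFrame D P v) (huv : Parallel P u v) :
    ∃ C > 0, Coarse P C (openCone u) (openCone v) := by
  obtain ⟨e, he⟩ := huv
  exact h.coarse_of_domEquiv hu hv (θ := fun i => {e i}) (by simpa using he)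

/-- The rays spanned by the vectors of a frame are determined by the open cone. -/
theorem exists_equiv_of_openCone_eq [FiniteDimensional ℝ V] (hu : IsFrame D P u)
    (hv : IsFrame D P v) (huv : openCone u = openCone v) :
    ∃ (e : ι ≃ κ) (c : ι → ℝ), (∀ i, 0 < c i) ∧ ∀ i, u i = c i • v (e i) := by
  classical
  have key : ∀ i, ∃ s : κ → ℝ, (∀ k, 0 ≤ s k) ∧ u i = ∑ k, s k • v k := by
    intro i
    have hp := tendsto_add_inv_smul (u i) (∑ j, u j)
    have hq : ∀ n : ℕ, u i + ((n : ℝ) + 1)⁻¹ • ∑ j, u j ∈ openCone v := fun n =>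
      huv ▸ add_inv_smul_mem_openCone u i n
    choose t ht hqt using hq
    obtain ⟨s, -, hs, has⟩ := h.exists_tendsto_coeff (U := hyperfilter ℕ) (u := fun _ => v)
      (v := v) (t := t) (Eventually.of_forall fun _ => hv.mem) (h.frame_ne_zero hv)
      (fun _ => tendsto_const_nhds) (Eventually.of_forall fun n i => (ht n i).le)
      (by simpa only [← hqt] using hp)
    exact ⟨s, hs, has⟩
  choose s hs hus using key
  -- Equal cones contain each other coarsely with constant 1; this bounds the number of vectors of
  -- `v`. Then the supports of the `u i` in terms of `v` must be singletons.
  have hc : Coarse P 1 (openCone v) (openCone u) := fun p hp =>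
    ⟨p, huv ▸ hp, by simpa using h.zero_mem, by simpa using h.zero_mem⟩
  obtain ⟨e, he⟩ := h.exists_equiv_of_domEquiv hu hv.mem
    (θ := fun i => Finset.univ.filter fun k => s i k ≠ 0) (fun i => by
      rw [hus i]
      exact ⟨h.dom_sum_support hv (hs i) (by simp), h.sum_support_dom hv (hs i) (by simp)⟩)
    (h.card_le_of_coarse hv hu hc)
  refine ⟨e, fun i => s i (e i), fun i => ?_, fun i => ?_⟩
  · refine lt_of_le_of_ne (hs i _) (Ne.symm ?_)
    have : e i ∈ Finset.univ.filter fun k => s i k ≠ 0 := by rw [he]; simp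
    simpa using this
  · rw [hus i]
    refine Finset.sum_eq_single (e i) (fun k _ hk => ?_) (by simp)
    by_contra hne
    have : k ∈ Finset.univ.filter fun k => s i k ≠ 0 := by
      simp only [Finset.mem_filter, Finset.mem_univ, true_and]
      intro h0
      simp [h0] at hne
    rw [he] at this
    exact hk (by simpa using this)

theorem card_le_finrank [FiniteDimensional ℝ V] (hu : IsFrame D P u) :
    Fintype.card ι ≤ Module.finrank ℝ V :=
  (h.linearIndependent_frame hu).fintype_card_le_finrank

end IsConePair

end Coarse

/-! ### Cocompact actions on cones -/

section Action

open Filter Topology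

variable {V : Type*} [NormedAddCommGroup V] [NormedSpace ℝ V]

theorem exists_tendsto_of_isCompact {X : Type*} [TopologicalSpace X] {K : Set X} (hK : IsCompact K)
    {x : ℕ → X} (hx : ∀ n, x n ∈ K) : ∃ a ∈ K, Tendsto x (hyperfilter ℕ) (𝓝 a) :=
  hK.ultrafilter_le_nhds ((hyperfilter ℕ).map x)
    (le_principal_iff.2 (mem_map.2 (Eventually.of_forall hx)))

/-- A group of linear maps preserving the cones `D ⊆ P` and `Q ⊆ P` such that every point of
`Q ∩ D` can be moved into a fixed compact subset of `D`. -/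
structure IsCocompactCone (f : V →ₗ[ℝ] ℝ) (D P Q : Set V) (G : Subgroup (V ≃ₗ[ℝ] V)) : Prop where
  pair : IsConePair f D P
  sharp : IsSharpCone f Q
  subset : Q ⊆ P
  map_interior : ∀ g ∈ G, ∀ x ∈ D, g x ∈ D
  map_closed : ∀ g ∈ G, ∀ x ∈ P, g x ∈ P
  map_mem : ∀ g ∈ G, ∀ x ∈ Q, g x ∈ Q
  cocompact : ∃ K, IsCompact K ∧ K ⊆ D ∧ ∀ x ∈ Q, x ∈ D → ∃ g ∈ G, g x ∈ K

/-- A `G`-invariant locally finite family of open simplicial cones of dimension at least `3`. -/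
structure IsSimplexFamily (D Q : Set V) (G : Subgroup (V ≃ₗ[ℝ] V)) (𝒮 : Set (Set V)) : Prop where
  frame : ∀ σ ∈ 𝒮, ∃ (ι : Type) (_ : Fintype ι) (u : ι → V), 3 ≤ Fintype.card ι ∧
    IsFrame D Q u ∧ σ = openCone u
  invariant : ∀ g ∈ G, ∀ σ ∈ 𝒮, g '' σ ∈ 𝒮
  finite : ∀ K ⊆ D, IsCompact K → {σ ∈ 𝒮 | (σ ∩ K).Nonempty}.Finite

/-- No frame of larger cardinality coarsely contains the simplex of `u`. -/
def IsTop (D P Q : Set V) {ι : Type} [Fintype ι] (u : ι → V) : Prop :=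
  ∀ (κ : Type) [Fintype κ] (w : κ → V), IsFrame D Q w → ∀ C,
    Coarse P C (openCone u) (openCone w) → Fintype.card κ ≤ Fintype.card ι

/-- The vector `b` spans a minimal face of `P` relative to the vectors of `Q`. -/
def IsMin (P Q : Set V) (b : V) : Prop :=
  b ∈ Q ∧ b ≠ 0 ∧ ∀ z ∈ Q, z ≠ 0 → Dom P z b → Dom P b z

/-- Every simplex of dimension at least `2` is `C`-coarsely contained in a member of `𝒮`. -/
def IsConeComplete (D P Q : Set V) (C : ℝ) (𝒮 : Set (Set V)) : Prop :=
  ∀ (ι : Type) [Fintype ι] (u : ι → V), 3 ≤ Fintype.card ι → IsFrame D Q u →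
    ∃ σ ∈ 𝒮, Coarse P C (openCone u) σ

namespace IsCocompactCone

variable {f : V →ₗ[ℝ] ℝ} {D P Q : Set V} {G : Subgroup (V ≃ₗ[ℝ] V)}
  (h : IsCocompactCone f D P Q G)
include h

theorem symm_apply_mem {g : V ≃ₗ[ℝ] V} (hg : g ∈ G) : g.symm ∈ G := G.inv_mem hg

theorem isFrame_image {ι : Type*} [Fintype ι] {u : ι → V} (hu : IsFrame D Q u) {g : V ≃ₗ[ℝ] V}
    (hg : g ∈ G) : IsFrame D Q (g ∘ u) := by
  refine ⟨fun i => h.map_mem g hg _ (hu.mem i), ?_, fun A hA hD => hu.facet A hA ?_⟩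
  · simpa using h.map_interior g hg _ hu.sum_mem
  · have := h.map_interior _ (h.symm_apply_mem hg) _ hD
    simpa using this

theorem dom_of_image {g : V ≃ₗ[ℝ] V} (hg : g ∈ G) {x y : V} (hxy : Dom P (g x) (g y)) :
    Dom P x y := by
  simpa using Dom.image (h.map_closed _ (h.symm_apply_mem hg)) hxy

theorem isTop_image {ι : Type} [Fintype ι] {u : ι → V} (hu : IsTop D P Q u) {g : V ≃ₗ[ℝ] V}
    (hg : g ∈ G) : IsTop D P Q (g ∘ u) := by
  intro κ _ w hw C hc
  refine hu κ (g.symm ∘ w) (h.isFrame_image hw (h.symm_apply_mem hg)) C ?_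
  rw [← image_openCone] at hc ⊢
  simpa [image_image] using hc.image (h.map_closed _ (h.symm_apply_mem hg))

theorem image_symm_image (g : V ≃ₗ[ℝ] V) (σ : Set V) : g.symm '' (g '' σ) = σ := by
  simp [image_image]

variable [FiniteDimensional ℝ V] {𝒮 : Set (Set V)} (h𝒮 : IsSimplexFamily D Q G 𝒮)
include h𝒮

/-- Only finitely many members of the family meet a compact ball around the limit, and the
ultrafilter selects one of them. -/
theorem eventually_eq_of_tendsto {α : Type*} {U : Ultrafilter α} {σ : α → Set V} {s : α → V}
    {a : V} (hσ : ∀ᶠ n in U, σ n ∈ 𝒮) (hs : ∀ᶠ n in U, s n ∈ σ n) (hsa : Tendsto s U (𝓝 a))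
    (ha : a ∈ D) : ∃ τ ∈ 𝒮, ∀ᶠ n in U, σ n = τ := by
  have : ProperSpace V := FiniteDimensional.proper ℝ V
  obtain ⟨r, hr, hrD⟩ := Metric.isOpen_iff.1 h.pair.isOpen a ha
  have hK : Metric.closedBall a (r / 2) ⊆ D :=
    (Metric.closedBall_subset_ball (half_lt_self hr)).trans hrD
  have h1 : ∀ᶠ n in U, ∃ τ ∈ {σ ∈ 𝒮 | (σ ∩ Metric.closedBall a (r / 2)).Nonempty}, σ n = τ := by
    filter_upwards [hσ, hs, hsa.eventually (Metric.closedBall_mem_nhds a (half_pos hr))]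
      with n n1 n2 n3
    exact ⟨σ n, ⟨n1, s n, n2, n3⟩, rfl⟩
  obtain ⟨τ, hτ, h2⟩ := (Ultrafilter.eventually_exists_mem_iff
    (h𝒮.finite _ hK (isCompact_closedBall _ _))).1 h1
  exact ⟨τ, hτ.1, h2⟩

/-- Moving points of a simplex of the family along a sequence of group elements into a compact set
leads to a fixed member of the family, with control of the vertices. -/
theorem exists_translates {ι : Type} [Fintype ι] {u : ι → V} (hu : IsFrame D Q u)
    (hu𝒮 : openCone u ∈ 𝒮) {c : ℕ → ι → ℝ} (hc : ∀ n i, 0 < c n i) :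
    ∃ (g : ℕ → V ≃ₗ[ℝ] V) (x : ι → V) (μ : ℕ → ι → ℝ), (∀ n, g n ∈ G) ∧ IsFrame D Q x ∧
      openCone x ∈ 𝒮 ∧ (∀ i, Tendsto (fun n => μ n i) (hyperfilter ℕ) (𝓝 1)) ∧
      ∀ᶠ n in (hyperfilter ℕ : Filter ℕ), ∀ i, 0 < μ n i ∧ c n i • g n (u i) = μ n i • x i := by
  classical
  have hP := h.pair
  have hf : Continuous f := LinearMap.continuous_of_finiteDimensional _
  obtain ⟨K, hK, hKD, hcc⟩ := h.cocompact
  have hcu : ∀ n, IsFrame D Q fun i => c n i • u i := fun n =>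
    hP.isFrame_smul h.sharp h.subset hu (hc n)
  choose g hg hgK using fun n => hcc _ (h.sharp.sum_mem fun i _ => (hcu n).mem i) (hcu n).sum_mem
  obtain ⟨a, haK, ha⟩ := exists_tendsto_of_isCompact hK hgK
  -- The coefficients `c n` select a point of the simplex and `g n` moves it into `K`. The moved,
  -- rescaled vertices are bounded by their convergent sum, so they converge to a frame `x`.
  set y : ℕ → ι → V := fun n i => c n i • g n (u i) with hy
  have hyf : ∀ n, IsFrame D Q (y n) := fun n => by
    have := h.isFrame_image (hcu n) (hg n)
    convert this using 1
    ext1 i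
    simp [hy]
  have hys : ∀ n, ∑ i, y n i = g n (∑ i, c n i • u i) := fun n => by simp [hy]
  have hyx : ∀ i, ∃ x, Tendsto (fun n => y n i) (hyperfilter ℕ) (𝓝 x) := fun i => by
    refine h.sharp.exists_tendsto (Eventually.of_forall fun n => (hyf n).mem i)
      (Eventually.of_forall fun n => ?_) ha
    rw [← hys, ← Finset.sum_erase_eq_sub (Finset.mem_univ i)]
    exact h.sharp.sum_mem fun j _ => (hyf n).mem j
  choose x hx using hyx
  have hxs : ∑ i, x i = a := tendsto_nhds_unique (tendsto_finsetSum _ fun i _ => hx i)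
    (by simpa only [hys] using ha)
  have hxf : IsFrame D Q x := hP.isFrame_of_tendsto h.sharp (Eventually.of_forall hyf) hx
    (hxs ▸ hKD haK)
  have hyc : ∀ n, openCone (y n) = g n '' openCone u := fun n => by
    rw [image_openCone]
    exact openCone_smul _ (hc n)
  obtain ⟨τ, hτ, hyτ⟩ := h.eventually_eq_of_tendsto h𝒮 (σ := fun n => openCone (y n))
    (s := fun n => ∑ i, y n i)
    (Eventually.of_forall fun n => (hyc n).symm ▸ h𝒮.invariant _ (hg n) _ hu𝒮)
    (Eventually.of_forall fun n => sum_mem_openCone _) (by simpa only [hys] using ha) (hKD haK)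
  obtain ⟨n₀, hn₀⟩ := hyτ.exists
  -- The translated simplices are eventually one fixed simplex, whose rays are determined up to a
  -- permutation; finitely many permutations mean that a single one works.
  have h1 : ∀ᶠ n in (hyperfilter ℕ : Filter ℕ), ∃ e : ι ≃ ι, ∀ i, ∃ s : ℝ, 0 < s ∧
      y n i = s • y n₀ (e i) := by
    filter_upwards [hyτ] with n hn
    obtain ⟨e, s, hs, hes⟩ := hP.exists_equiv_of_openCone_eq ((hyf n).mono h.subset)
      ((hyf n₀).mono h.subset) (hn.trans hn₀.symm)
    exact ⟨e, fun i => ⟨s i, hs i, hes i⟩⟩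
  obtain ⟨e, he⟩ := Ultrafilter.eventually_exists_iff.1 h1
  have hfx : ∀ i, 0 < f (x i) := fun i =>
    h.sharp.apply_pos (hxf.mem i) (hP.frame_ne_zero (hxf.mono h.subset) i)
  have hfy : ∀ i, 0 < f (y n₀ i) := fun i =>
    h.sharp.apply_pos ((hyf n₀).mem i) (hP.frame_ne_zero ((hyf n₀).mono h.subset) i)
  have hray : ∀ᶠ n in (hyperfilter ℕ : Filter ℕ), ∀ i,
      y n i = (f (y n i) / f (y n₀ (e i))) • y n₀ (e i) := by
    filter_upwards [he] with n hn i
    obtain ⟨s, -, hs⟩ := hn i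
    rw [hs, map_smul, smul_eq_mul, mul_div_cancel_right₀ _ (hfy _).ne']
  -- All `y n i` lie on one ray, hence so does their limit; the ratio of the values of `f` is the
  -- factor `μ`, which tends to 1.
  have hxray : ∀ i, x i = (f (x i) / f (y n₀ (e i))) • y n₀ (e i) := by
    intro i
    have hlim : Tendsto (fun n => (f (y n i) / f (y n₀ (e i))) • y n₀ (e i)) (hyperfilter ℕ)
        (𝓝 ((f (x i) / f (y n₀ (e i))) • y n₀ (e i))) :=
      ((((hf.tendsto _).comp (hx i)).div_const _).smul_const _)
    exact tendsto_nhds_unique ((hx i).congr' (hray.mono fun n hn => hn i)) hlim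
  refine ⟨g, x, fun n i => f (y n i) / f (x i), hg, hxf, ?_, fun i => ?_, ?_⟩
  · have : openCone x = openCone (y n₀) := by
      rw [← openCone_comp_equiv (y n₀) e, ← openCone_smul (y n₀ ∘ e)
        (c := fun i => f (x i) / f (y n₀ (e i))) fun i => div_pos (hfx i) (hfy _)]
      congr 1
      ext1 i
      exact hxray i
    rw [this, hn₀]
    exact hτ
  · have := ((hf.tendsto _).comp (hx i)).div_const (f (x i))
    rwa [div_self (hfx i).ne'] at this
  · filter_upwards [hray] with n hn i
    have hfyn : 0 < f (y n i) := h.sharp.apply_pos ((hyf n).mem i)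
      (hP.frame_ne_zero ((hyf n).mono h.subset) i)
    refine ⟨div_pos hfyn (hfx i), ?_⟩
    calc c n i • g n (u i) = (f (y n i) / f (y n₀ (e i))) • y n₀ (e i) := hn i
      _ = (f (y n i) / f (x i)) • (f (x i) / f (y n₀ (e i))) • y n₀ (e i) := by
        rw [← div_mul_div_cancel₀ (a := f (y n i)) (c := f (y n₀ (e i))) (hfx i).ne', mul_smul]
      _ = (f (y n i) / f (x i)) • x i := by rw [← hxray i]

/-- A limit of simplices that are uniformly coarsely contained in `τ` is coarsely contained
in `τ`. -/
theorem coarse_of_tendsto {ι κ : Type*} [Fintype ι] [Fintype κ] {α : Type*} {U : Ultrafilter α}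
    {u : α → ι → V} {x : ι → V} {v : κ → V} (hx : IsFrame D P x) (hv : IsFrame D P v)
    (hux : ∀ i, Tendsto (fun n => u n i) U (𝓝 (x i))) {C : ℝ}
    (hc : ∀ᶠ n in U, Coarse P C (openCone (u n)) (openCone v)) :
    Coarse P C (openCone x) (openCone v) := by
  rintro p ⟨t, ht, rfl⟩
  have hp : Tendsto (fun n => ∑ i, t i • u n i) U (𝓝 (∑ i, t i • x i)) :=
    tendsto_finsetSum _ fun i _ => (hux i).const_smul (t i)
  have h1 : ∀ n, ∃ q, Coarse P C (openCone (u n)) (openCone v) → q ∈ openCone v ∧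
      q - ∑ i, t i • u n i ∈ P ∧ C • ∑ i, t i • u n i - q ∈ P := by
    intro n
    by_cases hn : Coarse P C (openCone (u n)) (openCone v)
    · obtain ⟨q, hq⟩ := hn _ ⟨t, ht, rfl⟩
      exact ⟨q, fun _ => hq⟩
    · exact ⟨0, fun h => absurd h hn⟩
  choose q hq using h1
  obtain ⟨a, ha⟩ := h.pair.exists_tendsto (U := U) (x := q)
    (hc.mono fun n hn => h.pair.openCone_subset_closed hv (hq n hn).1)
    (hc.mono fun n hn => (hq n hn).2.2) (hp.const_smul C)
  have h2 : a - ∑ i, t i • x i ∈ P := h.pair.isClosed.mem_of_tendsto (ha.sub hp)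
    (hc.mono fun n hn => (hq n hn).2.1)
  refine ⟨a, h.pair.mem_openCone_of_tendsto hv (hc.mono fun n hn => (hq n hn).1) ha ?_, h2,
    h.pair.isClosed.mem_of_tendsto ((hp.const_smul C).sub ha)
      (hc.mono fun n hn => (hq n hn).2.2)⟩
  exact h.pair.mem_of_dom (h.pair.openCone_subset_interior hx ⟨t, ht, rfl⟩) (h.pair.dom_of_mem h2)

end IsCocompactCone

end Action

/-! ### Vertices of top-dimensional simplices span minimal faces -/

section MinimalFaces

open Filter Topology

variable {V : Type*} [NormedAddCommGroup V] [NormedSpace ℝ V]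

theorem sum_update_eq {ι : Type*} [Fintype ι] [DecidableEq ι] (w : ι → V) (i : ι) (a : V) :
    ∑ j, Function.update w i a j = a + ∑ j ∈ Finset.univ.erase i, w j := by
  rw [← Finset.add_sum_erase _ _ (Finset.mem_univ i), Function.update_self]
  congr 1
  refine Finset.sum_congr rfl fun j hj => ?_
  rw [Function.update_of_ne (Finset.ne_of_mem_erase hj)]

theorem IsConePair.eventually_uniform {f : V →ₗ[ℝ] ℝ} {D P : Set V} (h : IsConePair f D P)
    {α : Type*} {l : Filter α} {x y : α → V} {a b : V} (hx : Tendsto x l (𝓝 a))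
    (hy : Tendsto y l (𝓝 b)) (hb : b ∈ D) : ∃ c : ℝ, 0 < c ∧ ∀ᶠ n in l, c • y n - x n ∈ P := by
  obtain ⟨c, hc, h1⟩ := h.dom_of_mem_interior hb a
  exact ⟨c + 1, by positivity, h.eventually_smul_sub_mem_of_tendsto hx hy hb (lt_add_one c) h1⟩

namespace IsCocompactCone

variable {f : V →ₗ[ℝ] ℝ} {D P Q : Set V} {G : Subgroup (V ≃ₗ[ℝ] V)}
  (h : IsCocompactCone f D P Q G) [FiniteDimensional ℝ V] {𝒮 : Set (Set V)}
  (h𝒮 : IsSimplexFamily D Q G 𝒮)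
include h h𝒮

/-- Suppose `z` spans a strictly smaller face than the vertex `v`. Replace `v` by `v + (n + 1) • z`,
shrink the other vertices by a factor `ε n`, and renormalise. The contributions of `v` and of `(n +
1) • z` converge to separate vectors `a` and `b`, neither of which can be omitted. Thus the limit
simplex `x` lies in a simplex `Y` with one vertex more. By completeness a translate of the original
simplex is coarsely contained in `Y`, against `htop`. -/
theorem isMin_of_isTop {C₀ : ℝ} (hC₀ : 0 ≤ C₀) (hc : IsConeComplete D P Q C₀ 𝒮) {ι : Type}
    [Fintype ι] {u : ι → V} (h3 : 3 ≤ Fintype.card ι) (hu : IsFrame D Q u)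
    (htop : IsTop D P Q u) (i₀ : ι) : IsMin P Q (u i₀) := by
  classical
  have hP := h.pair
  have huP := hu.mono h.subset
  have hf : Continuous f := LinearMap.continuous_of_finiteDimensional _
  refine ⟨hu.mem i₀, hP.frame_ne_zero huP i₀, fun z hzQ hz0 hzv => ?_⟩
  by_contra hvz
  have hz := h.subset hzQ
  set v := u i₀ with hv
  set r := ∑ j ∈ Finset.univ.erase i₀, u j with hr
  have hrQ : r ∈ Q := h.sharp.sum_mem fun i _ => hu.mem i
  -- If no such `ε` existed, letting it tend to zero would give a domination of `v` by `z`.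
  have heps : ∀ n : ℕ, ∃ ε : ℝ, 0 < ε ∧ ε ≤ 1 ∧ ((n : ℝ) + 1) • (((n : ℝ) + 1) • z + ε • r) -
      (v + ((n : ℝ) + 1) • z + ε • r) ∉ P := by
    intro n
    by_contra hcon
    push Not at hcon
    have hlim : Tendsto (fun k : ℕ => ((n : ℝ) + 1) • (((n : ℝ) + 1) • z + ((k : ℝ) + 1)⁻¹ • r) -
        (v + ((n : ℝ) + 1) • z + ((k : ℝ) + 1)⁻¹ • r)) (hyperfilter ℕ)
        (𝓝 (((n : ℝ) + 1) • (((n : ℝ) + 1) • z) - (v + ((n : ℝ) + 1) • z))) :=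
      ((tendsto_add_inv_smul _ _).const_smul _).sub (tendsto_add_inv_smul _ _)
    have hmem := hP.isClosed.mem_of_tendsto hlim (Eventually.of_forall fun k =>
      hcon _ (by positivity) (inv_le_one_of_one_le₀ (by linarith [k.cast_nonneg (α := ℝ)])))
    refine hvz ⟨((n : ℝ) + 1) * ((n : ℝ) + 1), by positivity, ?_⟩
    convert hP.add_mem hmem (hP.smul_mem (c := (n : ℝ) + 1) (by positivity) hz) using 1
    module
  choose ε hε hε1 hεP using heps
  -- The vectors of `w n` lie in the same open faces as those of `u`, so `w n` is a frame parallel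
  -- to `u`.
  set w : ℕ → ι → V := fun n => Function.update (fun i => ε n • u i) i₀ (v + ((n : ℝ) + 1) • z)
    with hw
  have hw0 : ∀ n, w n i₀ = v + ((n : ℝ) + 1) • z := fun n => by simp [hw]
  have hwi : ∀ n i, i ≠ i₀ → w n i = ε n • u i := fun n i hi => by simp [hw, hi]
  have hn0 : ∀ n : ℕ, (0 : ℝ) < (n : ℝ) + 1 := fun n => by positivity
  have hwQ : ∀ n i, w n i ∈ Q := by
    intro n i
    by_cases hi : i = i₀
    · rw [hi, hw0]
      exact h.sharp.add_mem (hu.mem i₀) (h.sharp.smul_mem (hn0 n).le hzQ)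
    · rw [hwi n i hi]
      exact h.sharp.smul_mem (hε n).le (hu.mem i)
  have hwu : ∀ n i, DomEquiv P (u i) (w n i) := by
    intro n i
    by_cases hi : i = i₀
    · rw [hi, hw0]
      exact ⟨hP.dom_add_right (hP.dom_refl _) (hP.smul_mem (hn0 n).le hz),
        hP.dom_add (hP.dom_refl _) (hP.smul_dom (hn0 n) hzv)⟩
    · rw [hwi n i hi]
      exact hP.domEquiv_smul (hε n) _
  have hwf : ∀ n, IsFrame D Q (w n) := fun n =>
    hP.isFrame_of_domEquiv huP (hwQ n) h.subset (hwu n)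
  have hws : ∀ n, ∑ i, w n i = v + ((n : ℝ) + 1) • z + ε n • r := fun n => by
    rw [hw, sum_update_eq, hr, Finset.smul_sum]
  obtain ⟨K, hK, hKD, hcc⟩ := h.cocompact
  choose g hg hgK using fun n =>
    hcc _ (h.sharp.sum_mem fun i _ => (hwf n).mem i) (hwf n).sum_mem
  obtain ⟨q, hqK, hq⟩ := exists_tendsto_of_isCompact hK hgK
  have hqD := hKD hqK
  have hgQ : ∀ n x, x ∈ Q → g n x ∈ Q := fun n => h.map_mem _ (hg n)
  have hgP : ∀ n x, x ∈ P → g n x ∈ P := fun n => h.map_closed _ (hg n)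
  have hgP' : ∀ n x, g n x ∈ P → x ∈ P := fun n x hx => by
    simpa using h.map_closed _ (h.symm_apply_mem (hg n)) _ hx
  have hlim : ∀ y : ℕ → V, (∀ n, y n ∈ Q) → (∀ n, ∑ i, w n i - y n ∈ Q) →
      ∃ b ∈ Q, Tendsto (fun n => g n (y n)) (hyperfilter ℕ) (𝓝 b) := by
    intro y hy hqy
    obtain ⟨b, hb⟩ := h.sharp.exists_tendsto (Eventually.of_forall fun n => hgQ n _ (hy n))
      (Eventually.of_forall fun n => by simpa using hgQ n _ (hqy n)) hq
    exact ⟨b, h.sharp.isClosed.mem_of_tendsto hb (Eventually.of_forall fun n => hgQ n _ (hy n)), hb⟩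
  have htz : ∀ n : ℕ, ((n : ℝ) + 1) • z ∈ Q := fun n => h.sharp.smul_mem (hn0 n).le hzQ
  have her : ∀ n : ℕ, ε n • r ∈ Q := fun n => h.sharp.smul_mem (hε n).le hrQ
  obtain ⟨a, haQ, ha⟩ := hlim (fun _ => v) (fun _ => hu.mem i₀) fun n => by
    rw [hws]; convert h.sharp.add_mem (htz n) (her n) using 1; abel
  obtain ⟨b, hbQ, hb⟩ := hlim (fun n => ((n : ℝ) + 1) • z) htz fun n => by
    rw [hws]; convert h.sharp.add_mem (hu.mem i₀) (her n) using 1; abel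
  choose x hxQ hx using fun i => hlim (fun n => w n i) (fun n => hwQ n i) fun n => by
    rw [← Finset.sum_erase_eq_sub (Finset.mem_univ i)]
    exact h.sharp.sum_mem fun j _ => hwQ n j
  have hxs : ∑ i, x i = q := tendsto_nhds_unique (tendsto_finsetSum _ fun i _ => hx i)
    (by simpa only [map_sum] using hq)
  have hgwf : ∀ n, IsFrame D Q (g n ∘ w n) := fun n => h.isFrame_image (hwf n) (hg n)
  have hxf : IsFrame D Q x := hP.isFrame_of_tendsto h.sharp (Eventually.of_forall hgwf) hx
    (hxs ▸ hqD)
  have hx0 : x i₀ = a + b := tendsto_nhds_unique (hx i₀) (by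
    simpa only [hw0, map_add] using ha.add hb)
  -- Otherwise the sum of `w n` would be bounded by a constant times what remains after removing
  -- `v`, which the choice of `ε n` excludes for large `n`.
  have hqa : q - a ∉ D := by
    intro hD
    obtain ⟨c, hc0, hev⟩ := hP.eventually_uniform hq (hq.sub ha) hD
    obtain ⟨N, hN⟩ := exists_nat_gt c
    obtain ⟨n, h1, hn⟩ := (hev.and (eventually_hyperfilter_of_forall_ge (p := fun n => N ≤ n) N
      fun n hn => hn)).exists
    have hcn : c ≤ (n : ℝ) + 1 := by
      have : (N : ℝ) ≤ n := by exact_mod_cast hn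
      linarith
    have h2 : c • (((n : ℝ) + 1) • z + ε n • r) - (v + ((n : ℝ) + 1) • z + ε n • r) ∈ P := by
      apply hgP' n
      rw [hws] at h1
      convert h1 using 1
      simp only [map_sub, map_smul, map_add]
      module
    exact hεP n (hP.smul_sub_mem_of_le hcn
      (h.subset (h.sharp.add_mem (htz n) (her n))) h2)
  -- Otherwise `(n + 1) • z` would be bounded by a constant times `v + ε n • r`; the values of `f`
  -- rule this out since `ε n ≤ 1`.
  have hqb : q - b ∉ D := by
    intro hD
    obtain ⟨c, hc0, hev⟩ := hP.eventually_uniform hq (hq.sub hb) hD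
    have hfz : 0 < f z := h.sharp.apply_pos hzQ hz0
    obtain ⟨N, hN⟩ := exists_nat_gt (c * (f v + f r) / f z)
    obtain ⟨n, h1, hn⟩ := (hev.and (eventually_hyperfilter_of_forall_ge (p := fun n => N ≤ n) N
      fun n hn => hn)).exists
    have h2 : c • (v + ε n • r) - (v + ((n : ℝ) + 1) • z + ε n • r) ∈ P := by
      apply hgP' n
      rw [hws] at h1
      convert h1 using 1
      simp only [map_sub, map_smul, map_add]
      module
    have h3 := hP.apply_nonneg h2
    simp only [map_sub, map_smul, map_add, smul_eq_mul] at h3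
    have hfv := h.sharp.apply_nonneg (hu.mem i₀)
    have hfr := h.sharp.apply_nonneg hrQ
    rw [div_lt_iff₀ hfz] at hN
    have hNn : (N : ℝ) ≤ n := by exact_mod_cast hn
    have h4 : ε n * f r ≤ f r := mul_le_of_le_one_left hfr (hε1 n)
    have h5 : 0 ≤ ε n * f r := mul_nonneg (hε n).le hfr
    have h6 : c * (f v + ε n * f r) ≤ c * (f v + f r) := by gcongr
    have h7 : (N : ℝ) * f z ≤ ((n : ℝ) + 1) * f z := by gcongr; linarith
    have hfv' : 0 ≤ f v := hfv
    linarith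
  -- Split the vertex `x i₀ = a + b` into the two vertices `a` and `b`.
  set Y : Option ι → V := fun o => o.elim b (Function.update x i₀ a) with hY
  have hYs : ∑ o, Y o = q := by
    rw [Fintype.sum_option]
    simp only [hY, Option.elim]
    rw [sum_update_eq, ← hxs, ← Finset.add_sum_erase _ _ (Finset.mem_univ i₀), hx0]
    abel
  have hYf : IsFrame D Q Y := by
    refine hP.isFrame_of_sub ?_ h.subset (hYs ▸ hqD) ?_
    · rintro (_ | i)
      · exact hbQ
      · by_cases hi : i = i₀
        · simpa [hY, hi] using haQ
        · simpa [hY, hi] using hxQ i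
    · rw [hYs]
      rintro (_ | i)
      · exact hqb
      · by_cases hi : i = i₀
        · simpa [hY, hi] using hqa
        · have := hxf.facet (Finset.univ.erase i) (fun e => by simpa using Finset.ext_iff.1 e i)
          rw [Finset.sum_erase_eq_sub (Finset.mem_univ i), hxs] at this
          simpa [hY, hi] using this
  have hxY : openCone x ⊆ openCone Y := by
    rintro p ⟨t, ht, rfl⟩
    refine ⟨fun o => o.elim (t i₀) t, fun o => by cases o <;> exact ht _, ?_⟩
    rw [Fintype.sum_option]
    simp only [hY, Option.elim]
    rw [← Finset.add_sum_erase _ _ (Finset.mem_univ i₀),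
      ← Finset.add_sum_erase (a := i₀) _ (fun i => t i • Function.update x i₀ a i)
        (Finset.mem_univ i₀), hx0, Function.update_self, smul_add, ← add_assoc,
      add_comm (t i₀ • a)]
    congr 1
    refine Finset.sum_congr rfl fun j hj => ?_
    rw [Function.update_of_ne (Finset.ne_of_mem_erase hj)]
  -- The constant of completeness is uniform in `n`, so the members close to `w n` pass through a
  -- bounded region after translation and are eventually one fixed simplex.
  choose σ hσ hwσ using fun n => hc ι (w n) h3 (hwf n)
  choose s hs hs1 hs2 using fun n => hwσ n _ (sum_mem_openCone (w n))
  have hσP : ∀ n, σ n ⊆ P := fun n => by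
    obtain ⟨κ, _, e, -, he, hσe⟩ := h𝒮.frame _ (hσ n)
    rw [hσe]
    exact hP.openCone_subset_closed (he.mono h.subset)
  obtain ⟨s', hs'⟩ := hP.exists_tendsto (U := hyperfilter ℕ) (x := fun n => g n (s n))
    (Eventually.of_forall fun n => hgP n _ (hσP n (hs n)))
    (Eventually.of_forall fun n => by
      have := hgP n _ (hs2 n)
      rwa [map_sub, map_smul] at this) (hq.const_smul C₀)
  have hs'D : s' ∈ D := by
    refine hP.mem_of_dom hqD (hP.dom_of_mem (hP.isClosed.mem_of_tendsto (hs'.sub hq)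
      (Eventually.of_forall fun n => ?_)))
    rw [← map_sub]
    exact hgP n _ (hs1 n)
  obtain ⟨τ, hτ, hστ⟩ := h.eventually_eq_of_tendsto h𝒮 (σ := fun n => g n '' σ n)
    (s := fun n => g n (s n)) (Eventually.of_forall fun n => h𝒮.invariant _ (hg n) _ (hσ n))
    (Eventually.of_forall fun n => ⟨_, hs n, rfl⟩) hs' hs'D
  obtain ⟨κ, _, e, -, he, rfl⟩ := h𝒮.frame _ hτ
  have heP := he.mono h.subset
  have hxP := hxf.mono h.subset
  have hxe : Coarse P C₀ (openCone x) (openCone e) := by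
    refine h.coarse_of_tendsto h𝒮 (u := fun n => g n ∘ w n) hxP heP hx ?_
    filter_upwards [hστ] with n hn
    rw [← hn, ← image_openCone]
    exact (hwσ n).image (hgP n)
  obtain ⟨n, hn⟩ := hστ.exists
  obtain ⟨C₁, hC₁, huw⟩ := hP.coarse_of_parallel huP ((hwf n).mono h.subset)
    ⟨Equiv.refl ι, hwu n⟩
  have huσ : Coarse P (C₀ * C₁) (openCone u) (σ n) := hP.coarse_trans hC₀ huw (hwσ n)
  have hgu : Coarse P (C₀ * C₁) (openCone (g n ∘ u)) (openCone e) := by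
    rw [← hn, ← image_openCone]
    exact huσ.image (hgP n)
  have htop' := h.isTop_image htop (hg n)
  -- Since `u` is top-dimensional, the fixed simplex `e` has no more vertices than `x`; it is
  -- therefore parallel to `x`, and `u`, up to translation, is coarsely contained in `x` and so in
  -- `Y`.
  have hcard := htop' κ e he _ hgu
  obtain ⟨C₂, hC₂, hex⟩ := hP.coarse_of_parallel heP hxP (hP.parallel_of_coarse hxP heP hxe
    hcard).symm
  have hfin := htop' (Option ι) Y hYf _
    ((hP.coarse_trans hC₂.le hgu hex).mono_right hxY)
  simp at hfin

end IsCocompactCone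

end MinimalFaces

/-! ### Simplices with minimal vertices -/

section Isolation

open Filter Topology

variable {V : Type*} [NormedAddCommGroup V] [NormedSpace ℝ V]

/-- A locally finite invariant family of simplices whose vertices span minimal faces and which
coarsely contains every simplex. -/
structure IsMinimalFamily (f : V →ₗ[ℝ] ℝ) (D P Q : Set V) (G : Subgroup (V ≃ₗ[ℝ] V))
    (𝒯 : Set (Set V)) : Prop where
  cone : IsCocompactCone f D P Q G
  family : IsSimplexFamily D Q G 𝒯
  isMin : ∀ {ι : Type} [Fintype ι] {u : ι → V}, IsFrame D Q u → openCone u ∈ 𝒯 →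
    ∀ i, IsMin P Q (u i)
  complete : ∀ {ι : Type} [Fintype ι] {u : ι → V}, 3 ≤ Fintype.card ι → IsFrame D Q u →
    ∃ σ ∈ 𝒯, ∃ C, Coarse P C (openCone u) σ

namespace IsConePair

variable {f : V →ₗ[ℝ] ℝ} {D P Q : Set V} (h : IsConePair f D P)
include h

/-- Each summand is a nonzero vector of `Q` below `b`, hence equivalent to `b` by minimality; there
is a summand because `b` is not zero. -/
theorem exists_domEquiv_of_isMin {κ : Type*} {b : V} {e : κ → V} {θ : Finset κ}
    (hQP : Q ⊆ P) (hb : IsMin P Q b) (he : ∀ k, e k ∈ Q) (he0 : ∀ k, e k ≠ 0)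
    (hbe : DomEquiv P b (∑ k ∈ θ, e k)) : ∃ k ∈ θ, DomEquiv P b (e k) := by
  have hne : θ.Nonempty := by
    rw [Finset.nonempty_iff_ne_empty]
    rintro rfl
    rw [Finset.sum_empty] at hbe
    exact h.ne_zero_of_dom (hQP hb.1) hb.2.1 hbe.1 rfl
  obtain ⟨k, hk⟩ := hne
  have hkb : Dom P (e k) b := h.dom_trans (h.dom_sum_of_mem (fun k _ => hQP (he k)) hk) hbe.2
  exact ⟨k, hk, hb.2.2 _ (he k) (he0 k) hkb, hkb⟩

/-- The smallest multiple of `y` that dominates `x`. -/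
theorem exists_exact [FiniteDimensional ℝ V] {x y : V} (hx : x ∈ D) (hy : y ∈ D) :
    ∃ α : ℝ, 0 < α ∧ α • y - x ∈ P ∧ α • y - x ∉ D := by
  have hx0 : x ≠ 0 := fun e => h.zero_notMem (e ▸ hx)
  have hy0 : y ≠ 0 := fun e => h.zero_notMem (e ▸ hy)
  have hfx := h.apply_pos (h.subset hx) hx0
  have hfy := h.apply_pos (h.subset hy) hy0
  set A : Set ℝ := {α | α • y - x ∈ P} with hA
  have hcont : Continuous fun α : ℝ => α • y - x := by fun_prop
  have hAc : IsClosed A := h.isClosed.preimage hcont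
  have hlow : ∀ α ∈ A, f x / f y ≤ α := fun α hα => by
    have := h.apply_nonneg hα
    rw [map_sub, map_smul, smul_eq_mul] at this
    rw [div_le_iff₀ hfy]
    linarith
  have hAb : BddBelow A := ⟨_, hlow⟩
  have hAn : A.Nonempty := by
    obtain ⟨c, -, hc⟩ := h.dom_of_mem_interior hy x
    exact ⟨c, hc⟩
  have hmem := hAc.csInf_mem hAn hAb
  refine ⟨sInf A, (div_pos hfx hfy).trans_le (hlow _ hmem), hmem, fun hD => ?_⟩
  have hev : ∀ᶠ α in 𝓝[<] (sInf A), α • y - x ∈ D :=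
    (hcont.continuousWithinAt.tendsto).eventually (h.isOpen.mem_nhds hD)
  obtain ⟨α, hα, hlt⟩ := (hev.and self_mem_nhdsWithin).exists
  exact absurd (csInf_le hAb (h.subset hα)) (not_le.2 hlt)

theorem le_of_exact {x y : V} {α c : ℝ} (hy : y ∈ D) (hα : α • y - x ∉ D) (hc : c • y - x ∈ P) :
    α ≤ c := by
  by_contra hlt
  push Not at hlt
  refine hα ?_
  convert h.interior_add_mem (h.interior_smul_mem (sub_pos.2 hlt) hy) hc using 1
  module

end IsConePair

namespace IsMinimalFamily

variable {f : V →ₗ[ℝ] ℝ} {D P Q : Set V} {G : Subgroup (V ≃ₗ[ℝ] V)} {𝒯 : Set (Set V)}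
  [FiniteDimensional ℝ V] (h : IsMinimalFamily f D P Q G 𝒯)
include h

/-- A minimal vector `b` for which a proper face of a simplex together with `b` spans an interior
point is equivalent to a vertex. -/
theorem exists_domEquiv_of_proper {ι : Type} [Fintype ι] {v : ι → V} (hv : IsFrame D Q v)
    (hv𝒯 : openCone v ∈ 𝒯) {J : Finset ι} (hJ : J ≠ Finset.univ) {b : V} (hb : IsMin P Q b)
    (hbJ : Dom P b (∑ i ∈ J, v i)) {A : Finset ι} (hA : A ≠ Finset.univ)
    (hAD : ∑ i ∈ A, v i + b ∈ D) (hAmin : ∀ i ∈ A, ∑ j ∈ A, v j - v i + b ∉ D) :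
    ∃ i ∈ J, DomEquiv P b (v i) := by
  classical
  have hC := h.cone
  have hP := hC.pair
  have hvP := hv.mono hC.subset
  have hbP := hC.subset hb.1
  -- Renormalise along points tending to the face of `A`: the translates of `v i` converge for `i ∈
  -- A`, while for the other `i` they converge only after division by `n + 1`.
  obtain ⟨g, x, μ, hg, hxf, hx𝒯, hμ, hgx⟩ := hC.exists_translates h.family hv hv𝒯
    (c := fun n i => if i ∈ A then 1 else ((n : ℝ) + 1)⁻¹)
    (fun n i => by split_ifs <;> positivity)
  have hxP := hxf.mono hC.subset
  have hgP : ∀ n x, x ∈ P → g n x ∈ P := fun n => hC.map_closed _ (hg n)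
  have hn0 : ∀ n : ℕ, (0 : ℝ) < ((n : ℝ) + 1)⁻¹ := fun n => by positivity
  have hgA : ∀ i ∈ A, Tendsto (fun n => g n (v i)) (hyperfilter ℕ) (𝓝 (x i)) := by
    intro i hi
    have : Tendsto (fun n => μ n i • x i) (hyperfilter ℕ) (𝓝 ((1 : ℝ) • x i)) :=
      (hμ i).smul_const _
    rw [one_smul] at this
    refine this.congr' ?_
    filter_upwards [hgx] with n hn
    rw [← (hn i).2, if_pos hi, one_smul]
  have hgA' : ∀ i ∈ A, Tendsto (fun n : ℕ => ((n : ℝ) + 1)⁻¹ • g n (v i)) (hyperfilter ℕ)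
      (𝓝 0) := by
    intro i hi
    simpa using tendsto_inv_hyperfilter.smul (hgA i hi)
  have hgE : ∀ i, i ∉ A → Tendsto (fun n : ℕ => ((n : ℝ) + 1)⁻¹ • g n (v i)) (hyperfilter ℕ)
      (𝓝 (x i)) := by
    intro i hi
    have : Tendsto (fun n => μ n i • x i) (hyperfilter ℕ) (𝓝 ((1 : ℝ) • x i)) :=
      (hμ i).smul_const _
    rw [one_smul] at this
    refine this.congr' ?_
    filter_upwards [hgx] with n hn
    rw [← (hn i).2, if_neg hi]
  have hgxe : ∀ᶠ n in (hyperfilter ℕ : Filter ℕ), ∀ i, DomEquiv P (g n (v i)) (x i) := by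
    filter_upwards [hgx] with n hn i
    have hc : 0 < (if i ∈ A then 1 else ((n : ℝ) + 1)⁻¹) := by
      have := hn0 n
      split_ifs <;> positivity
    have h1 := hP.domEquiv_smul hc (g n (v i))
    have h2 := hP.domEquiv_smul (hn i).1 (x i)
    rw [← (hn i).2] at h2
    exact hP.domEquiv_trans h1 h2.symm
  set y : ℕ → V := fun n => ∑ i, ((n : ℝ) + 1)⁻¹ • g n (v i) with hy
  have hyE : Tendsto y (hyperfilter ℕ) (𝓝 (∑ i ∈ Aᶜ, x i)) := by
    have : Tendsto y (hyperfilter ℕ) (𝓝 (∑ i, if i ∈ A then 0 else x i)) := by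
      refine tendsto_finsetSum _ fun i _ => ?_
      split_ifs with hi
      · exact hgA' i hi
      · exact hgE i hi
    convert this using 2
    rw [Finset.sum_ite, Finset.sum_const_zero, zero_add]
    congr 1
    ext i
    simp
  set bn : ℕ → V := fun n => ((n : ℝ) + 1)⁻¹ • g n b with hbn
  have hbnQ : ∀ n, bn n ∈ Q := fun n => hC.sharp.smul_mem (hn0 n).le (hC.map_mem _ (hg n) _ hb.1)
  obtain ⟨c₀, hc₀, hc₀b⟩ := hP.dom_of_mem_interior hv.sum_mem b
  obtain ⟨B, hB⟩ := hP.exists_tendsto (U := hyperfilter ℕ) (x := bn) (y := fun n => c₀ • y n)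
    (Eventually.of_forall fun n => hC.subset (hbnQ n)) (Eventually.of_forall fun n => by
      have := hP.smul_mem (hn0 n).le (hgP n _ hc₀b)
      convert this using 1
      simp only [hy, hbn, map_sub, map_smul, map_sum, smul_sub, ← Finset.smul_sum]
      module) (hyE.const_smul c₀)
  have hBQ : B ∈ Q := hC.sharp.isClosed.mem_of_tendsto hB (Eventually.of_forall hbnQ)
  have hBP := hC.subset hBQ
  obtain ⟨k, hk, hkD⟩ := hP.dom_of_mem_interior hAD (∑ i, v i)
  -- The sum of all `v i` is bounded by a multiple of the sum over `A` plus `b`. After division by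
  -- `n + 1` the part over `A` disappears in the limit, so `B` dominates the limits of all vertices
  -- outside `A`.
  have hkB : k • B - ∑ i ∈ Aᶜ, x i ∈ P := by
    have hl : Tendsto (fun n : ℕ => k • (∑ i ∈ A, ((n : ℝ) + 1)⁻¹ • g n (v i) + bn n) - y n)
        (hyperfilter ℕ) (𝓝 (k • (∑ i ∈ A, (0 : V) + B) - ∑ i ∈ Aᶜ, x i)) :=
      (((tendsto_finsetSum _ hgA').add hB).const_smul k).sub hyE
    rw [Finset.sum_const_zero, zero_add] at hl
    refine hP.isClosed.mem_of_tendsto hl (Eventually.of_forall fun n => ?_)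
    convert hP.smul_mem (hn0 n).le (hgP n _ hkD) using 1
    simp only [hy, hbn, map_sub, map_smul, map_add, map_sum, smul_sub, smul_add,
      ← Finset.smul_sum]
    module
  have hEB : ∀ i, i ∉ A → Dom P (x i) B := fun i hi =>
    hP.dom_trans (hP.dom_sum_of_mem (fun i _ => hxP.mem i) (by simpa using hi)) ⟨k, hk, hkB⟩
  -- Otherwise `A ∪ J` would miss `i` although its sum dominates a vector of `D`.
  have hJA : ∀ i, i ∉ J → i ∈ A := by
    intro i hi
    by_contra hiA
    refine hvP.facet (A ∪ J) (fun e => ?_) (hP.mem_of_dom hAD ?_)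
    · have := Finset.ext_iff.1 e i
      simp [hi, hiA] at this
    · exact hP.dom_add (hP.dom_sum_of_subset hvP.mem Finset.subset_union_left)
        (hP.dom_trans hbJ (hP.dom_sum_of_subset hvP.mem Finset.subset_union_right))
  have hbnb : ∀ n, DomEquiv P (g n b) (bn n) := fun n => hP.domEquiv_smul (hn0 n) _
  -- It remains to dominate `B` by some `g n b`. Then a vertex outside `A` is dominated by `b`,
  -- minimality of `b` makes them equivalent, and the vertex belongs to `J` because it is dominated
  -- by the sum over `J`.
  suffices hmain : ∃ᶠ n in (hyperfilter ℕ : Filter ℕ), Dom P B (g n b) by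
    obtain ⟨n, hn, hxn⟩ := (hmain.and_eventually hgxe).exists
    obtain ⟨i, hi⟩ : ∃ i, i ∉ A := by
      by_contra hc
      push Not at hc
      exact hA (Finset.eq_univ_iff_forall.2 hc)
    have hvb : Dom P (v i) b := hC.dom_of_image (hg n)
      (hP.dom_trans (hxn i).1 (hP.dom_trans (hEB i hi) hn))
    exact ⟨i, hP.mem_of_dom_sum hvP (hP.dom_trans hvb hbJ),
      hb.2.2 _ (hv.mem i) (hP.frame_ne_zero hvP i) hvb, hvb⟩
  -- Completeness concerns only simplices with at least three vertices, so the simplex spanned by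
  -- `A` and `b` can be used only when `A` has two elements.
  by_cases hcard : 2 ≤ A.card
  · set T : Option {i // i ∈ A} → V := fun o => o.elim b fun i => v i with hT
    have hTs : ∑ o, T o = ∑ i ∈ A, v i + b := by
      rw [Fintype.sum_option, add_comm]
      simp only [hT, Option.elim]
      rw [Finset.sum_coe_sort A v]
    have hTf : IsFrame D Q T := by
      refine hP.isFrame_of_sub ?_ hC.subset (hTs ▸ hAD) ?_
      · rintro (_ | i)
        exacts [hb.1, hv.mem _]
      · rw [hTs]
        rintro (_ | i)
        · simpa [hT] using hv.facet A hA
        · have := hAmin i i.2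
          simp only [hT, Option.elim]
          rwa [add_sub_right_comm]
    obtain ⟨σ, hσ, C, hcoarse⟩ := h.complete (by simpa using hcard) hTf
    obtain ⟨κ, _, e, -, he, rfl⟩ := h.family.frame _ hσ
    have heP := he.mono hC.subset
    obtain ⟨θ, hθ⟩ := hP.exists_domEquiv_of_coarse (hTf.mono hC.subset) heP hcoarse none
    obtain ⟨j, -, hj⟩ := hP.exists_domEquiv_of_isMin hC.subset hb he.mem
      (hP.frame_ne_zero heP) hθ
    -- The weight of `b` is chosen so that the `g n`-translates of these points converge into `D`.
    -- Hence the translates of the simplex `e`, which has a vertex equivalent to `b`, are eventually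
    -- constant.
    have htT : ∀ n : ℕ, ∑ i ∈ A, v i + ((n : ℝ) + 1)⁻¹ • b ∈ openCone T := by
      intro n
      refine ⟨fun o => o.elim ((n : ℝ) + 1)⁻¹ fun _ => 1, ?_, ?_⟩
      · rintro (_ | i)
        exacts [hn0 n, one_pos]
      · rw [Fintype.sum_option, add_comm]
        simp only [hT, Option.elim, one_smul]
        rw [Finset.sum_coe_sort A v]
    choose s hs hs1 hs2 using fun n => hcoarse _ (htT n)
    have hgt : Tendsto (fun n : ℕ => g n (∑ i ∈ A, v i + ((n : ℝ) + 1)⁻¹ • b)) (hyperfilter ℕ)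
        (𝓝 (∑ i ∈ A, x i + B)) := by
      simp only [map_add, map_sum, map_smul]
      exact (tendsto_finsetSum _ hgA).add hB
    have htD : ∑ i ∈ A, x i + B ∈ D := by
      have hAP : ∑ i ∈ A, x i ∈ P := hP.sum_mem fun i _ => hxP.mem i
      refine hP.mem_of_dom hxf.sum_mem (hP.dom_sum (hP.add_mem hAP hBP) fun i _ => ?_)
      by_cases hi : i ∈ A
      · exact hP.dom_add_right (hP.dom_sum_of_mem (fun i _ => hxP.mem i) hi) hBP
      · exact hP.dom_add_left (hEB i hi) hAP
    obtain ⟨s', hs'⟩ := hP.exists_tendsto (U := hyperfilter ℕ) (x := fun n => g n (s n))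
      (Eventually.of_forall fun n => hgP n _ (hP.openCone_subset_closed heP (hs n)))
      (Eventually.of_forall fun n => by
        have := hgP n _ (hs2 n)
        rwa [map_sub, map_smul] at this) (hgt.const_smul C)
    have hs'D : s' ∈ D := by
      refine hP.mem_of_dom htD (hP.dom_of_mem (hP.isClosed.mem_of_tendsto (hs'.sub hgt)
        (Eventually.of_forall fun n => ?_)))
      rw [← map_sub]
      exact hgP n _ (hs1 n)
    obtain ⟨τ, hτ, hστ⟩ := hC.eventually_eq_of_tendsto h.family
      (σ := fun n => g n '' openCone e) (s := fun n => g n (s n))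
      (Eventually.of_forall fun n => h.family.invariant _ (hg n) _ hσ)
      (Eventually.of_forall fun n => ⟨_, hs n, rfl⟩) hs' hs'D
    obtain ⟨n₀, hn₀⟩ := hστ.exists
    have h1 : ∀ᶠ n in (hyperfilter ℕ : Filter ℕ), ∃ j', DomEquiv P (g n b) (g n₀ (e j')) := by
      filter_upwards [hστ] with n hn
      have hee : openCone (g n ∘ e) = openCone (g n₀ ∘ e) := by
        rw [← image_openCone, ← image_openCone, hn, hn₀]
      obtain ⟨π, c, hc, hπ⟩ := hP.exists_equiv_of_openCone_eq
        ((hC.isFrame_image he (hg n)).mono hC.subset)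
        ((hC.isFrame_image he (hg n₀)).mono hC.subset) hee
      refine ⟨π j, hP.domEquiv_trans (DomEquiv.image (hgP n) hj) ?_⟩
      have := hπ j
      simp only [Function.comp_apply] at this
      rw [this]
      exact (hP.domEquiv_smul (hc j) _).symm
    obtain ⟨j', hj'⟩ := Ultrafilter.eventually_exists_iff.1 h1
    have hj'P : g n₀ (e j') ∈ P := hgP _ _ (heP.mem _)
    -- The translates of `b` all lie in one open face, whose closed face contains their rescaled
    -- limit `B`.
    have hBj : Dom P B (g n₀ (e j')) :=
      ((hP.isClosed_dom hj'P).mem_of_tendsto hB (hj'.mono fun n hn =>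
        ⟨hC.subset (hbnQ n), hP.dom_trans (hbnb n).2 hn.1⟩)).2
    exact (hj'.mono fun n hn => hP.dom_trans hBj hn.2).frequently
  · have hAJ : Aᶜ = J := by
      obtain ⟨i, hi⟩ : ∃ i, i ∉ J := by
        by_contra hc
        push Not at hc
        exact hJ (Finset.eq_univ_iff_forall.2 hc)
      ext l
      rw [Finset.mem_compl]
      refine ⟨fun hl => by by_contra hlJ; exact hl (hJA l hlJ), fun hl hlA => hcard ?_⟩
      exact Finset.one_lt_card.2 ⟨l, hlA, i, hJA i hi, fun e => hi (e ▸ hl)⟩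
    rw [hAJ] at hkB
    set Y := ∑ i ∈ J, x i with hY
    have hYP : Y ∈ P := hP.sum_mem fun i _ => hxP.mem i
    have hbnY : ∀ᶠ n in (hyperfilter ℕ : Filter ℕ), Dom P (bn n) Y := by
      filter_upwards [hgxe] with n hn
      refine hP.dom_trans (hbnb n).2 (hP.dom_trans (Dom.image (hgP n) hbJ) ?_)
      rw [map_sum]
      exact hP.dom_sum hYP fun i hi => hP.dom_trans (hn i).1
        (hP.dom_sum_of_mem (fun i _ => hxP.mem i) hi)
    have hBY : Dom P B Y := ((hP.isClosed_dom hYP).mem_of_tendsto hB (hbnY.mono fun n hn =>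
      ⟨hC.subset (hbnQ n), hn⟩)).2
    have hsub : Tendsto (fun n => B - bn n) (hyperfilter ℕ) (𝓝 0) := by
      simpa using (tendsto_const_nhds (x := B)).sub hB
    -- Here `bn n` tends to `B` inside the order span of `Y`, in which `Y` is an interior point of
    -- the cone. The bound `Y ≤ k • B` therefore passes to `bn n` with half the constant.
    have hev := hsub.eventually (hP.eventually_smul_sub_mem hYP (ε := k⁻¹ / 2) (by positivity))
    refine (Eventually.frequently ?_)
    filter_upwards [hev, hbnY] with n hn hnY
    have hmem : B - bn n ∈ hP.domSpan Y := Submodule.sub_mem _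
      ((hP.mem_domSpan_of_mem hBP hYP).2 hBY)
      ((hP.mem_domSpan_of_mem (hC.subset (hbnQ n)) hYP).2 hnY)
    have h1 := hn hmem
    have h2 : bn n - (k⁻¹ / 2) • Y ∈ P := by
      convert hP.add_mem h1 (hP.smul_mem (inv_pos.2 hk).le hkB) using 1
      rw [smul_sub, smul_smul, inv_mul_cancel₀ hk.ne']
      module
    have h3 : Dom P Y (bn n) := by
      refine ⟨(k⁻¹ / 2)⁻¹, by positivity, ?_⟩
      have hk2 : k⁻¹ / 2 ≠ 0 := by positivity
      convert hP.smul_mem (c := (k⁻¹ / 2)⁻¹) (by positivity) h2 using 1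
      rw [smul_sub, smul_smul _ (k⁻¹ / 2), inv_mul_cancel₀ hk2, one_smul]
    exact hP.dom_trans hBY (hP.dom_trans h3 (hbnb n).2)

end IsMinimalFamily

end Isolation

/-! ### Minimal vectors in boundary faces, and strong isolation -/

section Isolation

open Filter Topology

variable {V : Type*} [NormedAddCommGroup V] [NormedSpace ℝ V]

namespace IsMinimalFamily

variable {f : V →ₗ[ℝ] ℝ} {D P Q : Set V} {G : Subgroup (V ≃ₗ[ℝ] V)} {𝒯 : Set (Set V)}
  [FiniteDimensional ℝ V] (h : IsMinimalFamily f D P Q G 𝒯)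
include h

/-- If some proper set of vertices and `b` span an interior point, a smallest such set allows the
renormalisation argument. Otherwise, replacing the vertices of `J` by one of them, `v i`, and by the
sum `s` of `b` with the rest gives another frame. A family member `e` close to it has a face
equivalent to that of `s`, of smaller dimension than the face of `J`. The induction applied to `e`
finds `b` and all `v l` among the vertices of `e`, and a count of vertices identifies `b` with some
`v l`. -/
theorem exists_domEquiv_of_dom_sum_aux (N : ℕ) : ∀ {ι : Type} [Fintype ι] {v : ι → V},
    IsFrame D Q v → openCone v ∈ 𝒯 → ∀ {J : Finset ι}, J ≠ Finset.univ → ∀ {b : V}, IsMin P Q b →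
    Dom P b (∑ i ∈ J, v i) →
    Module.finrank ℝ (h.cone.pair.domSpan (∑ i ∈ J, v i)) ≤ N →
    ∃ i ∈ J, DomEquiv P b (v i) := by
  classical
  induction N using Nat.strong_induction_on with
  | _ N ih =>
  intro ι _ v hv hv𝒯 J hJ b hb hbJ hN
  have hC := h.cone
  have hP := hC.pair
  have hvP := hv.mono hC.subset
  have hbP := hC.subset hb.1
  have hmin := h.isMin hv hv𝒯
  have hsum : ∀ A : Finset ι, ∑ i ∈ A, v i ∈ P := fun A => hP.sum_mem fun i _ => hvP.mem i
  by_cases hA : ∃ A : Finset ι, A ≠ Finset.univ ∧ ∑ i ∈ A, v i + b ∈ D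
  · obtain ⟨A, hAm, hAmin⟩ := Finset.exists_min_image
      (Finset.univ.filter fun A : Finset ι => A ≠ Finset.univ ∧ ∑ i ∈ A, v i + b ∈ D)
      Finset.card (by obtain ⟨A, hA⟩ := hA; exact ⟨A, by simpa using hA⟩)
    simp only [Finset.mem_filter, Finset.mem_univ, true_and] at hAm hAmin
    refine h.exists_domEquiv_of_proper hv hv𝒯 hJ hb hbJ hAm.1 hAm.2 fun i hi hD => ?_
    rw [← Finset.sum_erase_eq_sub hi] at hD
    have := hAmin (A.erase i) ⟨fun e => by simpa using Finset.ext_iff.1 e i, hD⟩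
    exact absurd (Finset.card_erase_lt_of_mem hi) (not_lt.2 this)
  push Not at hA
  have hJne : J.Nonempty := by
    rw [Finset.nonempty_iff_ne_empty]
    rintro rfl
    rw [Finset.sum_empty] at hbJ
    exact hP.ne_zero_of_dom hbP hb.2.1 hbJ rfl
  obtain ⟨i, hi⟩ := hJne
  by_cases hJi : J.erase i = ∅
  · have hJ1 : J = {i} := Finset.eq_singleton_iff_unique_mem.2 ⟨hi, fun j hj => by
      by_contra hne
      simpa [hJi] using Finset.mem_erase.2 ⟨hne, hj⟩⟩
    rw [hJ1, Finset.sum_singleton] at hbJ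
    exact ⟨i, hi, hbJ, (hmin i).2.2 b hb.1 hb.2.1 hbJ⟩
  obtain ⟨i', hi'⟩ := Finset.nonempty_iff_ne_empty.2 hJi
  set s := b + ∑ l ∈ J.erase i, v l with hs
  have hsP : s ∈ P := hP.add_mem hbP (hsum _)
  have hsJ : Dom P s (∑ l ∈ J, v l) :=
    hP.dom_add hbJ (hP.dom_sum_of_subset hvP.mem (Finset.erase_subset _ _))
  have hcompl : ∑ l ∈ J.erase i, v l + ∑ l ∈ Jᶜ, v l = ∑ l ∈ Finset.univ.erase i, v l := by
    rw [Finset.sum_erase_eq_sub hi, Finset.sum_erase_eq_sub (Finset.mem_univ i),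
      ← Finset.sum_add_sum_compl J v]
    abel
  -- If `s` dominated the sum over `J`, then all vertices except `i`, together with `b`, would span
  -- an interior point, which the present case excludes.
  have hnotdom : ¬ Dom P (∑ l ∈ J, v l) s := by
    intro hd
    refine hA (Finset.univ.erase i) (fun e => by simpa using Finset.ext_iff.1 e i)
      (hP.mem_of_dom (x := ∑ l, v l) hv.sum_mem ?_)
    rw [← Finset.sum_add_sum_compl J v, ← hcompl]
    have := hP.dom_add_add hd (hP.dom_refl (∑ l ∈ Jᶜ, v l)) hsP (hsum _)
    convert this using 1
    rw [hs]
    abel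
  set T : Option (Option {l // l ∉ J}) → V := fun o => o.elim s fun o => o.elim (v i) fun l => v l
    with hT
  have hcoe : ∑ l : {l // l ∉ J}, v l = ∑ l ∈ Jᶜ, v l := by
    rw [← Finset.sum_coe_sort Jᶜ v]
    exact Fintype.sum_equiv (Equiv.subtypeEquivRight fun l => by simp) _ _ fun l => rfl
  have hTs : ∑ o, T o = ∑ l, v l + b := by
    rw [Fintype.sum_option, Fintype.sum_option]
    simp only [hT, Option.elim]
    rw [hcoe, ← Finset.sum_add_sum_compl J v, ← Finset.add_sum_erase _ _ hi, hs]
    abel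
  have hTf : IsFrame D Q T := by
    refine hP.isFrame_of_sub ?_ hC.subset ?_ ?_
    · rintro (_ | _ | l)
      · exact hC.sharp.add_mem hb.1 (hC.sharp.sum_mem fun l _ => hv.mem l)
      · exact hv.mem i
      · exact hv.mem _
    · rw [hTs]
      exact hP.interior_add_mem hv.sum_mem hbP
    · rw [hTs]
      rintro (_ | _ | l)
      · simp only [hT, Option.elim]
        have e : ∑ l, v l + b - s = ∑ l ∈ insert i Jᶜ, v l := by
          rw [Finset.sum_insert (by simpa using hi), ← Finset.sum_add_sum_compl J v,
            ← Finset.add_sum_erase _ _ hi, hs]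
          abel
        rw [e]
        refine hv.facet _ fun e => ?_
        have := Finset.ext_iff.1 e i'
        simp [Finset.ne_of_mem_erase hi', Finset.mem_of_mem_erase hi'] at this
      · simp only [hT, Option.elim]
        rw [add_sub_right_comm, ← Finset.sum_erase_eq_sub (Finset.mem_univ i)]
        exact hA _ fun e => by simpa using Finset.ext_iff.1 e i
      · simp only [hT, Option.elim]
        rw [add_sub_right_comm, ← Finset.sum_erase_eq_sub (Finset.mem_univ l.1)]
        exact hA _ fun e => by simpa using Finset.ext_iff.1 e l.1
  obtain ⟨j₀, hj₀⟩ : ∃ j, j ∉ J := by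
    by_contra hc
    push Not at hc
    exact hJ (Finset.eq_univ_iff_forall.2 hc)
  have hcard : 3 ≤ Fintype.card (Option (Option {l // l ∉ J})) := by
    have : 0 < Fintype.card {l // l ∉ J} := Fintype.card_pos_iff.2 ⟨⟨j₀, hj₀⟩⟩
    simp only [Fintype.card_option]
    omega
  obtain ⟨σ, hσ, C, hcoarse⟩ := h.complete hcard hTf
  obtain ⟨κ, _, e, -, he, rfl⟩ := h.family.frame _ hσ
  have heP := he.mono hC.subset
  have hfaces := hP.exists_domEquiv_of_coarse (hTf.mono hC.subset) heP hcoarse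
  obtain ⟨E, hE⟩ := hfaces none
  have hE : DomEquiv P s (∑ k ∈ E, e k) := hE
  have hEP : ∑ k ∈ E, e k ∈ P := hP.sum_mem fun k _ => heP.mem k
  have hEJ := hP.dom_trans hE.2 hsJ
  have hEuniv : E ≠ Finset.univ := by
    rintro rfl
    exact hv.facet J hJ (hP.mem_of_dom he.sum_mem hEJ)
  have hlt := Submodule.finrank_lt_finrank_of_lt (hP.domSpan_lt hEP (hsum J) hEJ
    fun hd => hnotdom (hP.dom_trans hd hE.2))
  have hIH : ∀ {b' : V}, IsMin P Q b' → Dom P b' s → ∃ k, DomEquiv P b' (e k) := by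
    intro b' hb' hbs
    obtain ⟨k, -, hk⟩ := ih _ (hlt.trans_le hN) he hσ hEuniv hb' (hP.dom_trans hbs hE.1) le_rfl
    exact ⟨k, hk⟩
  -- Vertices in `J` other than `v i` lie below `s` and are found by induction; `v i` and the
  -- vertices outside `J` are vertices of the auxiliary frame and are matched by minimality.
  have hvtx : ∀ l, ∃ k, DomEquiv P (v l) (e k) := by
    have hmatch : ∀ {b' : V} {θ : Finset κ}, IsMin P Q b' → DomEquiv P b' (∑ k ∈ θ, e k) →
        ∃ k, DomEquiv P b' (e k) := by
      intro b' θ hb' hθ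
      obtain ⟨k, -, hk⟩ := hP.exists_domEquiv_of_isMin hC.subset hb' he.mem
        (hP.frame_ne_zero heP) hθ
      exact ⟨k, hk⟩
    intro l
    by_cases hl : l ∈ J
    · by_cases hli : l = i
      · obtain ⟨θ, hθ⟩ := hfaces (some none)
        rw [hli]
        exact hmatch (hmin i) hθ
      · refine hIH (hmin l) (hP.dom_add_left ?_ hbP)
        exact hP.dom_sum_of_mem (fun l _ => hvP.mem l) (Finset.mem_erase.2 ⟨hli, hl⟩)
    · obtain ⟨θ, hθ⟩ := hfaces (some (some ⟨l, hl⟩))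
      exact hmatch (hmin l) hθ
  choose φ hφ using hvtx
  obtain ⟨k, hk⟩ := hIH hb (hP.dom_add_right (hP.dom_refl b) (hsum _))
  -- An unmatched vertex of `e` would put the whole sum of the `v l` into a proper face of `e`.
  obtain ⟨l, rfl⟩ : ∃ l, φ l = k := by
    by_contra hc
    push Not at hc
    refine heP.facet (Finset.univ.erase k) (fun e => by simpa using Finset.ext_iff.1 e k)
      (hP.mem_of_dom hv.sum_mem (hP.dom_sum (hP.sum_mem fun k _ => heP.mem k) fun l _ => ?_))
    exact hP.dom_trans (hφ l).1
      (hP.dom_sum_of_mem (fun k _ => heP.mem k) (by simpa using hc l))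
  have hbl := hP.domEquiv_trans hk (hφ l).symm
  exact ⟨l, hP.mem_of_dom_sum hvP (hP.dom_trans hbl.2 hbJ), hbl⟩

/-- A minimal vector in the boundary face spanned by some vertices of a simplex of the family is
equivalent to one of these vertices. -/
theorem exists_domEquiv_of_dom_sum {ι : Type} [Fintype ι] {v : ι → V} (hv : IsFrame D Q v)
    (hv𝒯 : openCone v ∈ 𝒯) {J : Finset ι} (hJ : J ≠ Finset.univ) {b : V} (hb : IsMin P Q b)
    (hbJ : Dom P b (∑ i ∈ J, v i)) : ∃ i ∈ J, DomEquiv P b (v i) :=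
  h.exists_domEquiv_of_dom_sum_aux _ hv hv𝒯 hJ hb hbJ le_rfl

/-- Two simplices of the family that share two boundary faces spanning an interior point are
parallel. -/
theorem parallel_of_shared {ι κ : Type} [Fintype ι] [Fintype κ] {v : ι → V} {w : κ → V}
    (hv : IsFrame D Q v) (hv𝒯 : openCone v ∈ 𝒯) (hw : IsFrame D Q w) (hw𝒯 : openCone w ∈ 𝒯)
    {s t : ι → ℝ} {s' t' : κ → ℝ} (hs : ∀ i, 0 ≤ s i) (ht : ∀ i, 0 ≤ t i) (hs' : ∀ i, 0 ≤ s' i)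
    (ht' : ∀ i, 0 ≤ t' i) (hsD : ∑ i, s i • v i ∉ D) (htD : ∑ i, t i • v i ∉ D)
    (hss' : Dom P (∑ i, s' i • w i) (∑ i, s i • v i))
    (htt' : Dom P (∑ i, t' i • w i) (∑ i, t i • v i))
    (hD : ∑ i, s' i • w i + ∑ i, t' i • w i ∈ D) : Parallel P w v := by
  classical
  have hC := h.cone
  have hP := hC.pair
  have hvP := hv.mono hC.subset
  have hwP := hw.mono hC.subset
  have hpos : ∀ k, 0 < s' k + t' k := by
    simp only [← Finset.sum_add_distrib, ← add_smul] at hD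
    exact hP.coeff_pos hwP (fun i => add_nonneg (hs' i) (ht' i)) hD
  -- A vertex of `w` that occurs in `r'` lies in a boundary face of `v` and is minimal, so it is
  -- equivalent to a vertex of `v`. Every vertex occurs in `s'` or `t'`, because their sum is
  -- interior.
  have key : ∀ {r : ι → ℝ} {r' : κ → ℝ}, (∀ i, 0 ≤ r i) → (∀ i, 0 ≤ r' i) →
      ∑ i, r i • v i ∉ D → Dom P (∑ i, r' i • w i) (∑ i, r i • v i) → ∀ k, 0 < r' k →
      ∃ i, DomEquiv P (w k) (v i) := by
    intro r r' hr hr' hrD hrr' k hk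
    obtain ⟨B, hB⟩ := hP.exists_domEquiv_sum hvP hr
    have hBu : B ≠ Finset.univ := by
      rintro rfl
      exact hrD (hP.mem_of_dom hv.sum_mem hB.2)
    have hwk : Dom P (w k) (∑ i, r' i • w i) := by
      have := hP.sum_support_dom hwP hr' (B := {k}) (by simpa using hk.ne')
      simpa using this
    obtain ⟨i, -, hi⟩ := h.exists_domEquiv_of_dom_sum hv hv𝒯 hBu (h.isMin hw hw𝒯 k)
      (hP.dom_trans hwk (hP.dom_trans hrr' hB.1))
    exact ⟨i, hi⟩
  have hall : ∀ k, ∃ i, DomEquiv P (w k) (v i) := by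
    intro k
    rcases (hs' k).eq_or_lt with h0 | h0
    · exact key ht ht' htD htt' k (by have := hpos k; linarith)
    · exact key hs hs' hsD hss' k h0
  choose φ hφ using hall
  -- A vertex of `v` that is not hit would confine the interior point `∑ w` to a facet of `v`.
  have hsurj : ∀ i, ∃ k, φ k = i := by
    intro i
    by_contra hc
    push Not at hc
    refine hvP.facet (Finset.univ.erase i) (fun e => by simpa using Finset.ext_iff.1 e i)
      (hP.mem_of_dom hw.sum_mem (hP.dom_sum (hP.sum_mem fun k _ => hvP.mem k) fun k _ => ?_))
    exact hP.dom_trans (hφ k).1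
      (hP.dom_sum_of_mem (fun k _ => hvP.mem k) (by simpa using hc k))
  obtain ⟨e, he⟩ := hP.exists_equiv_of_domEquiv hwP hvP.mem (θ := fun k => {φ k})
    (fun k => by simpa using hφ k) (Fintype.card_le_of_surjective φ hsurj)
  exact ⟨e, fun k => by
    have : φ k = e k := by simpa using he k
    exact this ▸ hφ k⟩

/-- Distinct simplices of the family stay close to each other only along sets of uniformly bounded
diameter. -/
theorem exists_bound_of_close
    (hpar : ∀ {ι κ : Type} [Fintype ι] [Fintype κ] {v : ι → V} {w : κ → V}, IsFrame D Q v →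
      IsFrame D Q w → openCone v ∈ 𝒯 → openCone w ∈ 𝒯 → Parallel P v w → openCone v = openCone w)
    (C : ℝ) : ∃ M : ℝ, ∀ σ ∈ 𝒯, ∀ τ ∈ 𝒯, σ ≠ τ → ∀ x ∈ σ, ∀ y ∈ σ, ∀ x' ∈ τ, ∀ y' ∈ τ,
      x' - x ∈ P → C • x - x' ∈ P → y' - y ∈ P → C • y - y' ∈ P →
      ∃ α β : ℝ, 0 < α ∧ 0 < β ∧ α • y - x ∈ P ∧ β • x - y ∈ P ∧ α * β ≤ M := by
  have hC := h.cone
  have hP := hC.pair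
  by_contra hcon
  push Not at hcon
  choose σ hσ τ hτ hστ x hx y hy x' hx' y' hy' h1 h2 h3 h4 h5 using
    fun n : ℕ => hcon (((n : ℝ) + 1) ^ 2)
  have hsub : ∀ ρ ∈ 𝒯, ρ ⊆ D := by
    intro ρ hρ
    obtain ⟨κ, _, e, -, he, rfl⟩ := h.family.frame _ hρ
    exact hP.openCone_subset_interior (he.mono hC.subset)
  have hadd : ∀ ρ ∈ 𝒯, ∀ a ∈ ρ, ∀ b ∈ ρ, a + b ∈ ρ := by
    intro ρ hρ
    obtain ⟨κ, _, e, -, he, rfl⟩ := h.family.frame _ hρ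
    rintro _ ⟨s, hs, rfl⟩ _ ⟨t, ht, rfl⟩
    exact ⟨fun i => s i + t i, fun i => add_pos (hs i) (ht i), by
      simp [add_smul, Finset.sum_add_distrib]⟩
  have hsmul : ∀ ρ ∈ 𝒯, ∀ a ∈ ρ, ∀ c : ℝ, 0 < c → c • a ∈ ρ := by
    intro ρ hρ
    obtain ⟨κ, _, e, -, he, rfl⟩ := h.family.frame _ hρ
    exact fun a ha c hc => smul_mem_openCone hc ha
  have hQ : ∀ ρ ∈ 𝒯, ρ ⊆ Q := by
    intro ρ hρ
    obtain ⟨κ, _, e, -, he, rfl⟩ := h.family.frame _ hρ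
    rintro _ ⟨s, hs, rfl⟩
    exact hC.sharp.sum_mem fun i _ => hC.sharp.smul_mem (hs i).le (he.mem i)
  have hxD := fun n => hsub _ (hσ n) (hx n)
  have hyD := fun n => hsub _ (hσ n) (hy n)
  choose α hα hα1 hα2 using fun n => hP.exists_exact (hxD n) (hyD n)
  choose β hβ hβ1 hβ2 using fun n => hP.exists_exact (hyD n) (hxD n)
  have hM : ∀ n : ℕ, ((n : ℝ) + 1) ^ 2 < α n * β n := fun n =>
    h5 n _ _ (hα n) (hβ n) (hα1 n) (hβ1 n)
  -- The square root balances the two exact constants: after rescaling `y` by `γ n = α n / a n`,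
  -- both constants between `x` and `Y` equal `a n`, so `x + Y` represents a midpoint, far from both
  -- ends.
  set a : ℕ → ℝ := fun n => √(α n * β n) with ha
  have han : ∀ n : ℕ, (n : ℝ) + 1 < a n := fun n => Real.lt_sqrt_of_sq_lt (hM n)
  have ha0 : ∀ n, 0 < a n := fun n => (by positivity : (0 : ℝ) < (n : ℝ) + 1).trans (han n)
  have haa : ∀ n, a n * a n = α n * β n := fun n =>
    Real.mul_self_sqrt (mul_pos (hα n) (hβ n)).le
  set γ : ℕ → ℝ := fun n => α n / a n with hγ
  have hγ0 : ∀ n, 0 < γ n := fun n => div_pos (hα n) (ha0 n)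
  have haγ : ∀ n, a n * γ n = α n := fun n => mul_div_cancel₀ _ (ha0 n).ne'
  have hγβ : ∀ n, γ n * β n = a n := fun n => by
    rw [hγ]
    have := (ha0 n).ne'
    field_simp
    rw [pow_two, haa]
  set X := x
  set Y : ℕ → V := fun n => γ n • y n with hY
  have hYσ : ∀ n, Y n ∈ σ n := fun n => hsmul _ (hσ n) _ (hy n) _ (hγ0 n)
  have hYD := fun n => hsub _ (hσ n) (hYσ n)
  have e1 : ∀ n, a n • Y n - X n ∉ D := fun n => by
    rw [hY, smul_smul, haγ]; exact hα2 n
  have e2 : ∀ n, a n • X n - Y n ∉ D := fun n hD => by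
    refine hβ2 n (hP.mem_of_smul_mem (hγ0 n) ?_)
    rwa [smul_sub, smul_smul, hγβ]
  set Y' : ℕ → V := fun n => γ n • y' n with hY'
  have hY'τ : ∀ n, Y' n ∈ τ n := fun n => hsmul _ (hτ n) _ (hy' n) _ (hγ0 n)
  have h3' : ∀ n, Y' n - Y n ∈ P := fun n => by
    rw [hY, hY', ← smul_sub]; exact hP.smul_mem (hγ0 n).le (h3 n)
  have h4' : ∀ n, C • Y n - Y' n ∈ P := fun n => by
    rw [hY, hY', smul_comm, ← smul_sub]; exact hP.smul_mem (hγ0 n).le (h4 n)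
  obtain ⟨K, hK, hKD, hcc⟩ := hC.cocompact
  choose g hg hgK using fun n => hcc _ (hQ _ (hσ n) (hadd _ (hσ n) _ (hx n) _ (hYσ n)))
    (hsub _ (hσ n) (hadd _ (hσ n) _ (hx n) _ (hYσ n)))
  obtain ⟨m, hmK, hm⟩ := exists_tendsto_of_isCompact hK hgK
  have hmD := hKD hmK
  have hgP : ∀ n x, x ∈ P → g n x ∈ P := fun n => hC.map_closed _ (hg n)
  have hgP' : ∀ n x, g n x ∈ P → x ∈ P := fun n x hx => by
    simpa using hC.map_closed _ (hC.symm_apply_mem (hg n)) _ hx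
  have hgD : ∀ n x, x ∈ D → g n x ∈ D := fun n => hC.map_interior _ (hg n)
  obtain ⟨Xl, hXl⟩ := hP.exists_tendsto (U := hyperfilter ℕ) (x := fun n => g n (X n))
    (Eventually.of_forall fun n => hP.subset (hgD n _ (hxD n)))
    (Eventually.of_forall fun n => by
      rw [← map_sub, add_sub_cancel_left]; exact hP.subset (hgD n _ (hYD n))) hm
  obtain ⟨Yl, hYl⟩ := hP.exists_tendsto (U := hyperfilter ℕ) (x := fun n => g n (Y n))
    (Eventually.of_forall fun n => hP.subset (hgD n _ (hYD n)))
    (Eventually.of_forall fun n => by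
      rw [← map_sub, add_sub_cancel_right]; exact hP.subset (hgD n _ (hxD n))) hm
  obtain ⟨Xl', hXl'⟩ := hP.exists_tendsto (U := hyperfilter ℕ) (x := fun n => g n (x' n))
    (Eventually.of_forall fun n => hP.subset (hgD n _ (hsub _ (hτ n) (hx' n))))
    (Eventually.of_forall fun n => by
      have := hgP n _ (h2 n)
      rwa [map_sub, map_smul] at this) (hXl.const_smul C)
  obtain ⟨Yl', hYl'⟩ := hP.exists_tendsto (U := hyperfilter ℕ) (x := fun n => g n (Y' n))
    (Eventually.of_forall fun n => hP.subset (hgD n _ (hsub _ (hτ n) (hY'τ n))))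
    (Eventually.of_forall fun n => by
      have := hgP n _ (h4' n)
      rwa [map_sub, map_smul] at this) (hYl.const_smul C)
  have hmXY : m = Xl + Yl := tendsto_nhds_unique hm (by simpa using hXl.add hYl)
  -- If the limit of one end were interior, it would dominate the midpoint with a fixed constant,
  -- whereas the exact constants `a n` exceed `n`.
  have hnot : ∀ {A B : ℕ → V} {A' : V}, (∀ n, A n ∈ D) → (∀ n, a n • A n - B n ∉ D) →
      Tendsto (fun n => g n (A n)) (hyperfilter ℕ) (𝓝 A') →
      Tendsto (fun n => g n (A n + B n)) (hyperfilter ℕ) (𝓝 m) → A' ∉ D := by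
    intro A B A' hA hAB hA' hAB' hD
    obtain ⟨c, hc, hev⟩ := hP.eventually_uniform hAB' hA' hD
    obtain ⟨N, hN⟩ := exists_nat_gt c
    obtain ⟨n, hn1, hn2⟩ := (hev.and (eventually_hyperfilter_of_forall_ge (p := fun n => N ≤ n) N
      fun n hn => hn)).exists
    have h6 : (c - 1) • A n - B n ∈ P := by
      apply hgP' n
      convert hn1 using 1
      simp only [map_sub, map_add, map_smul]
      module
    have h7 := hP.le_of_exact (hA n) (hAB n) h6
    have h8 : (N : ℝ) ≤ n := by exact_mod_cast hn2
    have := han n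
    linarith
  have hXlD : Xl ∉ D := hnot hxD e2 hXl hm
  have hYlD : Yl ∉ D := hnot (A := Y) (B := X) hYD e1 hYl (by simpa only [add_comm] using hm)
  have hXX : Xl' - Xl ∈ P := hP.isClosed.mem_of_tendsto (hXl'.sub hXl)
    (Eventually.of_forall fun n => by rw [← map_sub]; exact hgP n _ (h1 n))
  have hYY : Yl' - Yl ∈ P := hP.isClosed.mem_of_tendsto (hYl'.sub hYl)
    (Eventually.of_forall fun n => by rw [← map_sub]; exact hgP n _ (h3' n))
  have hD' : Xl' + Yl' ∈ D := by
    convert hP.interior_add_mem hmD (hP.add_mem hXX hYY) using 1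
    rw [hmXY]
    abel
  have hCX : C • Xl - Xl' ∈ P := hP.isClosed.mem_of_tendsto ((hXl.const_smul C).sub hXl')
    (Eventually.of_forall fun n => by rw [← map_smul, ← map_sub]; exact hgP n _ (h2 n))
  have hCY : C • Yl - Yl' ∈ P := hP.isClosed.mem_of_tendsto ((hYl.const_smul C).sub hYl')
    (Eventually.of_forall fun n => by rw [← map_smul, ← map_sub]; exact hgP n _ (h4' n))
  obtain ⟨σ', hσ', hσσ'⟩ := hC.eventually_eq_of_tendsto h.family (σ := fun n => g n '' σ n)
    (s := fun n => g n (X n + Y n))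
    (Eventually.of_forall fun n => h.family.invariant _ (hg n) _ (hσ n))
    (Eventually.of_forall fun n => ⟨_, hadd _ (hσ n) _ (hx n) _ (hYσ n), rfl⟩) hm hmD
  obtain ⟨τ', hτ', hττ'⟩ := hC.eventually_eq_of_tendsto h.family (σ := fun n => g n '' τ n)
    (s := fun n => g n (x' n + Y' n))
    (Eventually.of_forall fun n => h.family.invariant _ (hg n) _ (hτ n))
    (Eventually.of_forall fun n => ⟨_, hadd _ (hτ n) _ (hx' n) _ (hY'τ n), rfl⟩)
    (by simpa using hXl'.add hYl') hD'
  obtain ⟨ι, _, v, -, hv, rfl⟩ := h.family.frame _ hσ'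
  obtain ⟨κ, _, w, -, hw, rfl⟩ := h.family.frame _ hτ'
  have hcoef : ∀ {ν : Type} [Fintype ν] {u : ν → V}, IsFrame D Q u → ∀ {z : ℕ → V} {zl : V},
      (∀ᶠ n in (hyperfilter ℕ : Filter ℕ), z n ∈ openCone u) → Tendsto z (hyperfilter ℕ) (𝓝 zl) →
      ∃ s : ν → ℝ, (∀ i, 0 ≤ s i) ∧ zl = ∑ i, s i • u i := by
    intro ν _ u hu z zl hz hzl
    have huP := hu.mono hC.subset
    have h6 : ∀ n, ∃ t : ν → ℝ, z n ∈ openCone u → (∀ i, 0 < t i) ∧ z n = ∑ i, t i • u i := by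
      intro n
      by_cases hn : z n ∈ openCone u
      · obtain ⟨t, ht⟩ := hn
        exact ⟨t, fun _ => ht⟩
      · exact ⟨0, fun h => absurd h hn⟩
    choose t ht using h6
    obtain ⟨s, -, hs, hzs⟩ := hP.exists_tendsto_coeff (U := hyperfilter ℕ) (u := fun _ => u)
      (v := u) (t := t) (Eventually.of_forall fun _ => huP.mem) (hP.frame_ne_zero huP)
      (fun _ => tendsto_const_nhds) (hz.mono fun n hn i => ((ht n hn).1 i).le)
      (hzl.congr' (hz.mono fun n hn => (ht n hn).2))
    exact ⟨s, hs, hzs⟩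
  obtain ⟨s, hs, hXs⟩ := hcoef hv (hσσ'.mono fun n hn => hn ▸ ⟨_, hx n, rfl⟩) hXl
  obtain ⟨t, ht, hYt⟩ := hcoef hv (hσσ'.mono fun n hn => hn ▸ ⟨_, hYσ n, rfl⟩) hYl
  obtain ⟨s', hs', hXs'⟩ := hcoef hw (hττ'.mono fun n hn => hn ▸ ⟨_, hx' n, rfl⟩) hXl'
  obtain ⟨t', ht', hYt'⟩ := hcoef hw (hττ'.mono fun n hn => hn ▸ ⟨_, hY'τ n, rfl⟩) hYl'
  have hdom : ∀ {A B : V}, A ∈ P → C • A - B ∈ P → Dom P B A := fun hA hAB =>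
    ⟨max C 1, by positivity, hP.smul_sub_mem_of_le (le_max_left _ _) hA hAB⟩
  have hXlP : Xl ∈ P := hP.isClosed.mem_of_tendsto hXl
    (Eventually.of_forall fun n => hP.subset (hgD n _ (hxD n)))
  have hYlP : Yl ∈ P := hP.isClosed.mem_of_tendsto hYl
    (Eventually.of_forall fun n => hP.subset (hgD n _ (hYD n)))
  have hXd := hdom hXlP hCX
  have hYd := hdom hYlP hCY
  rw [hXs] at hXlD hXd
  rw [hYt] at hYlD hYd
  rw [hXs'] at hXd hD'
  rw [hYt'] at hYd hD'
  -- The limits of both ends are boundary points of the eventual simplex `v`, and their companions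
  -- in `w` span an interior point.
  have hparallel := h.parallel_of_shared hv hσ' hw hτ' hs ht hs' ht' hXlD hYlD hXd hYd hD'
  have heq := hpar hw hv hτ' hσ' hparallel
  obtain ⟨n, hn1, hn2⟩ := (hσσ'.and hττ').exists
  have hn1 : g n '' σ n = openCone v := hn1
  have hn2 : g n '' τ n = openCone w := hn2
  refine hστ n ?_
  rw [← hC.image_symm_image (g n) (σ n), ← hC.image_symm_image (g n) (τ n), hn1, hn2, heq]

end IsMinimalFamily

end Isolation

/-! ### Families of top-dimensional simplices -/

section CoreFamily

open Filter Topology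

variable {V : Type*} [NormedAddCommGroup V] [NormedSpace ℝ V]

/-- A `G`-invariant family of simplices that contains exactly one member of each parallelism class
of top-dimensional simplices. -/
structure IsTopFamily (D P Q : Set V) (G : Subgroup (V ≃ₗ[ℝ] V)) (𝒯 : Set (Set V)) : Prop where
  frame : ∀ σ ∈ 𝒯, ∃ (ι : Type) (_ : Fintype ι) (u : ι → V), 3 ≤ Fintype.card ι ∧
    IsFrame D Q u ∧ IsTop D P Q u ∧ σ = openCone u
  invariant : ∀ g ∈ G, ∀ σ ∈ 𝒯, g '' σ ∈ 𝒯
  eq_of_parallel : ∀ {ι κ : Type} [Fintype ι] [Fintype κ] {v : ι → V} {w : κ → V},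
    IsFrame D Q v → IsFrame D Q w → openCone v ∈ 𝒯 → openCone w ∈ 𝒯 → Parallel P v w →
    openCone v = openCone w
  exists_parallel : ∀ {ι : Type} [Fintype ι] {u : ι → V}, 3 ≤ Fintype.card ι → IsFrame D Q u →
    IsTop D P Q u → ∃ (κ : Type) (_ : Fintype κ) (v : κ → V), IsFrame D Q v ∧
      openCone v ∈ 𝒯 ∧ Parallel P u v

theorem isTop_of_openCone_eq {D P Q : Set V} {ι κ : Type} [Fintype ι] [Fintype κ] {u : ι → V}
    {v : κ → V} (hu : IsTop D P Q u) (huv : openCone u = openCone v)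
    (hcard : Fintype.card ι = Fintype.card κ) : IsTop D P Q v := by
  intro μ _ w hw C hc
  rw [← hcard]
  exact hu μ w hw C (huv ▸ hc)

namespace IsCocompactCone

variable [FiniteDimensional ℝ V] {f : V →ₗ[ℝ] ℝ} {D P Q : Set V} {G : Subgroup (V ≃ₗ[ℝ] V)}
  (h : IsCocompactCone f D P Q G)
include h

/-- Pass to a larger simplex as long as one exists; frames are linearly independent, so their size
is bounded by the dimension. -/
theorem exists_coarse_isTop (N : ℕ) : ∀ {ι : Type} [Fintype ι] {u : ι → V},
    Module.finrank ℝ V - Fintype.card ι ≤ N → IsFrame D Q u →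
    ∃ (κ : Type) (_ : Fintype κ) (w : κ → V), Fintype.card ι ≤ Fintype.card κ ∧ IsFrame D Q w ∧
      IsTop D P Q w ∧ ∃ C > 0, Coarse P C (openCone u) (openCone w) := by
  induction N with
  | zero =>
    intro ι _ u hN hu
    refine ⟨ι, inferInstance, u, le_rfl, hu, fun κ _ w hw C hc => ?_, 1, one_pos,
      fun p hp => ⟨p, hp, by simpa using h.pair.zero_mem, by simpa using h.pair.zero_mem⟩⟩
    have := h.pair.card_le_finrank (hw.mono h.subset)
    omega
  | succ N ih =>
    intro ι _ u hN hu
    by_cases hT : IsTop D P Q u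
    · exact ⟨ι, inferInstance, u, le_rfl, hu, hT, 1, one_pos,
        fun p hp => ⟨p, hp, by simpa using h.pair.zero_mem, by simpa using h.pair.zero_mem⟩⟩
    · simp only [IsTop, not_forall, not_le] at hT
      obtain ⟨κ, _, w, hw, C, hc, hcard⟩ := hT
      obtain ⟨μ, _, z, h1, h2, h3, C', hC', h4⟩ := ih (u := w) (by
        have := h.pair.card_le_finrank (hw.mono h.subset)
        omega) hw
      have hc1 := h.pair.coarse_mono (le_max_left C 1)
        (h.pair.openCone_subset_closed (hu.mono h.subset)) hc
      exact ⟨μ, inferInstance, z, hcard.le.trans h1, h2, h3, C' * max C 1,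
        mul_pos hC' (lt_max_of_lt_right one_pos), h.pair.coarse_trans hC'.le hc1 h4⟩

variable {𝒮 𝒯 : Set (Set V)} (h𝒮 : IsSimplexFamily D Q G 𝒮)

theorem exists_coarse_mem (h𝒯 : IsTopFamily D P Q G 𝒯) {ι : Type}
    [Fintype ι] {u : ι → V} (h3 : 3 ≤ Fintype.card ι) (hu : IsFrame D Q u) :
    ∃ τ ∈ 𝒯, ∃ C > 0, Coarse P C (openCone u) τ := by
  obtain ⟨κ, _, w, hcard, hw, hT, C, hC, hc⟩ := h.exists_coarse_isTop _ le_rfl hu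
  obtain ⟨μ, _, v, hv, hvT, hpar⟩ := h𝒯.exists_parallel (h3.trans hcard) hw hT
  obtain ⟨C', hC', hc'⟩ := h.pair.coarse_of_parallel (hw.mono h.subset) (hv.mono h.subset) hpar
  exact ⟨_, hvT, C' * C, mul_pos hC' hC, h.pair.coarse_trans hC'.le hc hc'⟩

/-- Used to transfer local finiteness to a family of nearby simplices. Boundedness comes from `‖C •
p - q‖ ≤ M * f (C • p - q)`. -/
theorem isCompact_thickening {K : Set V} (hK : IsCompact K) (C : ℝ) :
    IsCompact {q | ∃ p ∈ K, q - p ∈ P ∧ C • p - q ∈ P} := by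
  have : ProperSpace V := FiniteDimensional.proper ℝ V
  have hf : Continuous f := LinearMap.continuous_of_finiteDimensional _
  obtain ⟨M, hM, hb⟩ := h.pair.bound
  obtain ⟨R, hR⟩ := (hK.image (f := fun p => ‖C • p‖ + M * (C * f p - f p)) (by fun_prop)).bddAbove
  have h1 : IsCompact ((K ×ˢ Metric.closedBall (0 : V) R) ∩
      {x : V × V | x.2 - x.1 ∈ P ∧ C • x.1 - x.2 ∈ P}) :=
    (hK.prod (isCompact_closedBall _ _)).inter_right
      ((h.pair.isClosed.preimage (by fun_prop)).inter (h.pair.isClosed.preimage (by fun_prop)))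
  convert h1.image continuous_snd using 1
  ext q
  constructor
  · rintro ⟨p, hp, h2, h3⟩
    refine ⟨(p, q), ⟨⟨hp, ?_⟩, h2, h3⟩, rfl⟩
    have h4 := hR (mem_image_of_mem _ hp)
    have h5 := hb _ h3
    have h6 := h.pair.apply_nonneg h2
    rw [map_sub, sub_nonneg] at h6
    have h7 : f (C • p - q) ≤ C * f p - f p := by
      rw [map_sub, map_smul, smul_eq_mul]
      linarith
    have h8 : ‖q‖ ≤ ‖C • p‖ + ‖C • p - q‖ := by
      have := norm_sub_le (C • p) (C • p - q)
      simpa using this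
    have h9 := mul_le_mul_of_nonneg_left h7 hM.le
    simpa using by linarith
  · rintro ⟨x, ⟨⟨h1, -⟩, h2, h3⟩, rfl⟩
    exact ⟨x.1, h1, h2, h3⟩

theorem thickening_subset {K : Set V} (hK : K ⊆ D) (C : ℝ) :
    {q | ∃ p ∈ K, q - p ∈ P ∧ C • p - q ∈ P} ⊆ D := by
  rintro q ⟨p, hp, h1, -⟩
  simpa using h.pair.interior_add_mem (hK hp) h1

include h𝒮

/-- Attach to each `τ` a member of `𝒮` that coarsely contains it. As `τ` is top-dimensional, it is
parallel to this member, so the member determines `τ`. Members attached to simplices meeting `K`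
meet a compact thickening of `K`, and there are finitely many of them. -/
theorem isSimplexFamily_of_isTopFamily {C₀ : ℝ} (hc : IsConeComplete D P Q C₀ 𝒮)
    (h𝒯 : IsTopFamily D P Q G 𝒯) : IsSimplexFamily D Q G 𝒯 := by
  refine ⟨fun σ hσ => ?_, h𝒯.invariant, fun K hKD hK => ?_⟩
  · obtain ⟨ι, i1, u, h1, h2, -, h3⟩ := h𝒯.frame σ hσ
    exact ⟨ι, i1, u, h1, h2, h3⟩
  have h1 : ∀ τ, ∃ σ, τ ∈ 𝒯 → σ ∈ 𝒮 ∧ Coarse P C₀ τ σ := fun τ => by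
    by_cases hτ : τ ∈ 𝒯
    · obtain ⟨ι, _, u, h3, hu, -, rfl⟩ := h𝒯.frame τ hτ
      obtain ⟨σ, hσ, hcσ⟩ := hc ι u h3 hu
      exact ⟨σ, fun _ => ⟨hσ, hcσ⟩⟩
    · exact ⟨∅, fun h => absurd h hτ⟩
  choose F hF using h1
  refine Set.Finite.of_injOn (f := F) (fun τ hτ => ?_) (fun τ hτ τ' hτ' hττ' => ?_)
    (h𝒮.finite _ (h.thickening_subset hKD C₀) (h.isCompact_thickening hK C₀))
  · obtain ⟨hτ, p, hpτ, hpK⟩ := hτ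
    obtain ⟨q, hq, h1, h2⟩ := (hF τ hτ).2 p hpτ
    exact ⟨(hF τ hτ).1, q, hq, p, hpK, h1, h2⟩
  · have h2 : ∀ {ι κ : Type} [Fintype ι] [Fintype κ] {v : ι → V} {w : κ → V}, IsFrame D Q v →
        IsTop D P Q v → IsFrame D Q w → Coarse P C₀ (openCone v) (openCone w) →
        Parallel P v w := fun {ι κ} _ _ {v w} hv hT hw hvw =>
      h.pair.parallel_of_coarse (hv.mono h.subset) (hw.mono h.subset) hvw (hT κ w hw C₀ hvw)
    have e1 := hF τ hτ.1
    have e2 := hF τ' hτ'.1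
    rw [← hττ'] at e2
    obtain ⟨κ, _, w, -, hw, hFw⟩ := h𝒮.frame _ e1.1
    obtain ⟨ι, _, u, -, hu, hut, rfl⟩ := h𝒯.frame τ hτ.1
    obtain ⟨ι', _, u', -, hu', hut', rfl⟩ := h𝒯.frame τ' hτ'.1
    rw [hFw] at e1 e2
    exact h𝒯.eq_of_parallel hu hu' hτ.1 hτ'.1 (h.pair.parallel_trans (h2 hu hut hw e1.2)
      (h2 hu' hut' hw e2.2).symm)

theorem isMinimalFamily_of_isTopFamily {C₀ : ℝ} (hC₀ : 0 ≤ C₀) (hc : IsConeComplete D P Q C₀ 𝒮)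
    (h𝒯 : IsTopFamily D P Q G 𝒯) : IsMinimalFamily f D P Q G 𝒯 := by
  refine ⟨h, h.isSimplexFamily_of_isTopFamily h𝒮 hc h𝒯, fun {ι} _ u hu hu𝒯 i => ?_,
    fun {ι} _ u h3 hu => ?_⟩
  · obtain ⟨κ, _, v, h3, hv, hvt, huv⟩ := h𝒯.frame _ hu𝒯
    obtain ⟨e, -⟩ := h.pair.exists_equiv_of_openCone_eq (hu.mono h.subset) (hv.mono h.subset) huv
    have hcard := Fintype.card_congr e
    exact h.isMin_of_isTop h𝒮 hC₀ hc (hcard ▸ h3) hu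
      (isTop_of_openCone_eq hvt huv.symm hcard.symm) i
  · obtain ⟨τ, hτ, C, -, hcτ⟩ := h.exists_coarse_mem h𝒯 h3 hu
    exact ⟨τ, hτ, C, hcτ⟩

/-- Every member of `𝒮` has a translate meeting `K`, and only finitely many members meet `K`, so the
maximum of their constants serves all members. -/
theorem isConeComplete_of_isTopFamily {C₀ : ℝ} (hc : IsConeComplete D P Q C₀ 𝒮)
    (h𝒯 : IsTopFamily D P Q G 𝒯) : ∃ C > 0, IsConeComplete D P Q C 𝒯 := by
  obtain ⟨K, hK, hKD, hcc⟩ := h.cocompact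
  have h1 : ∀ σ, ∃ C τ, σ ∈ 𝒮 → τ ∈ 𝒯 ∧ Coarse P C σ τ := fun σ => by
    by_cases hσ : σ ∈ 𝒮
    · obtain ⟨ι, _, u, h3, hu, rfl⟩ := h𝒮.frame σ hσ
      obtain ⟨τ, hτ, C, -, hC⟩ := h.exists_coarse_mem h𝒯 h3 hu
      exact ⟨C, τ, fun _ => ⟨hτ, hC⟩⟩
    · exact ⟨0, ∅, fun h => absurd h hσ⟩
  choose C τ hCτ using h1
  obtain ⟨M, hM⟩ := ((h𝒮.finite K hKD hK).image C).bddAbove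
  have hM1 : 0 < max M 1 := lt_max_of_lt_right one_pos
  refine ⟨max M 1 * max C₀ 1, mul_pos hM1 (lt_max_of_lt_right one_pos), fun ι _ u h3 hu => ?_⟩
  obtain ⟨σ, hσ, hcσ⟩ := hc ι u h3 hu
  obtain ⟨κ, _, w, -, hw, rfl⟩ := h𝒮.frame σ hσ
  obtain ⟨g, hg, hgK⟩ := hcc _ (h.sharp.sum_mem fun i _ => hw.mem i) hw.sum_mem
  have hgσ := h𝒮.invariant g hg _ hσ
  have h2 := hM (mem_image_of_mem C (⟨hgσ, _, mem_image_of_mem g (sum_mem_openCone w), hgK⟩ :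
    g '' openCone w ∈ {σ ∈ 𝒮 | (σ ∩ K).Nonempty}))
  obtain ⟨h4, h5⟩ := hCτ _ hgσ
  have hgP : g '' openCone w ⊆ P := by
    rw [image_openCone]
    exact h.pair.openCone_subset_closed ((h.isFrame_image hw hg).mono h.subset)
  have h6 := (h.pair.coarse_mono (h2.trans (le_max_left M 1)) hgP h5).image
    (h.map_closed _ (h.symm_apply_mem hg))
  rw [image_symm_image h] at h6
  exact ⟨_, h𝒯.invariant _ (h.symm_apply_mem hg) _ h4, h.pair.coarse_trans hM1.le
    (h.pair.coarse_mono (le_max_left C₀ 1)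
      (h.pair.openCone_subset_closed (hu.mono h.subset)) hcσ) h6⟩

end IsCocompactCone

end CoreFamily

/-! ### Charts and cones over subsets of projective space -/

section Charts

open Filter Topology

variable {d : ℕ} {f : Module.Dual ℝ (Fin d → ℝ)} {X Y : Set (RP d)}

theorem ne_zero_of_apply_ne_zero {v : Fin d → ℝ} (h : f v ≠ 0) : v ≠ 0 := by
  rintro rfl
  exact h (map_zero f)

theorem mk_smul_eq {v : Fin d → ℝ} (hv : v ≠ 0) {c : ℝ} (hc : c ≠ 0) :
    Projectivization.mk ℝ (c • v) (smul_ne_zero hc hv) = Projectivization.mk ℝ v hv :=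
  (Projectivization.mk_eq_mk_iff' ℝ _ _ _ _).2 ⟨c, rfl⟩

theorem mk_congr {v w : Fin d → ℝ} {hv : v ≠ 0} {hw : w ≠ 0} (h : v = w) :
    Projectivization.mk ℝ v hv = Projectivization.mk ℝ w hw := by
  subst h
  rfl

theorem exists_rep_mk {v : Fin d → ℝ} (hv : v ≠ 0) :
    ∃ a : ℝ, a ≠ 0 ∧ (Projectivization.mk ℝ v hv).rep = a • v := by
  obtain ⟨a, ha⟩ := Projectivization.exists_smul_eq_mk_rep ℝ v hv
  exact ⟨a, a.ne_zero, ha.symm⟩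

theorem apply_rep_mk_ne_zero_iff {v : Fin d → ℝ} (hv : v ≠ 0) :
    f (Projectivization.mk ℝ v hv).rep ≠ 0 ↔ f v ≠ 0 := by
  obtain ⟨a, ha, h⟩ := exists_rep_mk hv
  rw [h, map_smul, smul_eq_mul, mul_ne_zero_iff, and_iff_right ha]

theorem chart_mk {v : Fin d → ℝ} (hv : v ≠ 0) :
    chart f (Projectivization.mk ℝ v hv) = (f v)⁻¹ • v := by
  obtain ⟨a, ha, h⟩ := exists_rep_mk hv
  rw [chart, h, map_smul, smul_eq_mul, smul_smul, mul_inv, mul_comm a⁻¹, mul_assoc,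
    inv_mul_cancel₀ ha, mul_one]

theorem apply_chart {p : RP d} (hp : f p.rep ≠ 0) : f (chart f p) = 1 := by
  rw [chart, map_smul, smul_eq_mul, inv_mul_cancel₀ hp]

theorem chart_ne_zero {p : RP d} (hp : f p.rep ≠ 0) : chart f p ≠ 0 :=
  ne_zero_of_apply_ne_zero (f := f) (by rw [apply_chart hp]; exact one_ne_zero)

theorem mk_chart {p : RP d} (h : chart f p ≠ 0) :
    Projectivization.mk ℝ (chart f p) h = p := by
  exact ((Projectivization.mk_eq_mk_iff' ℝ _ _ h p.rep_nonzero).2 ⟨(f p.rep)⁻¹, rfl⟩).trans p.mk_rep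

theorem chart_injective {p q : RP d} (hp : f p.rep ≠ 0) (hq : f q.rep ≠ 0)
    (h : chart f p = chart f q) : p = q := by
  rw [← mk_chart (chart_ne_zero hp), ← mk_chart (chart_ne_zero hq)]
  exact mk_congr h

theorem eq_mk_of_submodule_eq {p : RP d} {v : Fin d → ℝ} (hv : v ≠ 0)
    (h : p.submodule = Submodule.span ℝ {v}) : p = Projectivization.mk ℝ v hv :=
  Projectivization.submodule_injective (by rw [h, Projectivization.submodule_mk])

theorem mk_submodule_le_iff {v : Fin d → ℝ} (hv : v ≠ 0) (W : Submodule ℝ (Fin d → ℝ)) :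
    (Projectivization.mk ℝ v hv).submodule ≤ W ↔ v ∈ W := by
  rw [Projectivization.submodule_mk, Submodule.span_singleton_le_iff_mem]

/-- The vectors of positive `f`-value that represent a point of `X`. -/
def coneOver (f : Module.Dual ℝ (Fin d → ℝ)) (X : Set (RP d)) : Set (Fin d → ℝ) :=
  {v | 0 < f v ∧ ∃ hv : v ≠ 0, Projectivization.mk ℝ v hv ∈ X}

theorem mem_coneOver_iff {v : Fin d → ℝ} (hv : v ≠ 0) (h : 0 < f v) :
    v ∈ coneOver f X ↔ Projectivization.mk ℝ v hv ∈ X :=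
  ⟨fun hx => hx.2.2, fun hx => ⟨h, hv, hx⟩⟩

theorem coneOver_mono (h : X ⊆ Y) : coneOver f X ⊆ coneOver f Y :=
  fun _ hv => ⟨hv.1, hv.2.1, h hv.2.2⟩

theorem chart_mem_coneOver_iff {p : RP d} (hp : f p.rep ≠ 0) :
    chart f p ∈ coneOver f X ↔ p ∈ X := by
  rw [mem_coneOver_iff (chart_ne_zero hp) (by rw [apply_chart hp]; exact one_pos), mk_chart]

theorem smul_mem_coneOver {v : Fin d → ℝ} (hv : v ∈ coneOver f X) {c : ℝ} (hc : 0 < c) :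
    c • v ∈ coneOver f X := by
  refine ⟨by rw [map_smul, smul_eq_mul]; exact mul_pos hc hv.1, smul_ne_zero hc.ne' hv.2.1, ?_⟩
  rw [mk_smul_eq hv.2.1 hc.ne']
  exact hv.2.2

theorem mem_of_mem_coneOver_smul {v : Fin d → ℝ} {c : ℝ} (hc : 0 < c)
    (hv : c • v ∈ coneOver f X) : v ∈ coneOver f X := by
  have := smul_mem_coneOver hv (inv_pos.2 hc)
  rwa [smul_smul, inv_mul_cancel₀ hc.ne', one_smul] at this

theorem exists_mem_coneOver_of_mem {p : RP d} (hp : p ∈ X) (hf : f p.rep ≠ 0) :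
    ∃ v ∈ coneOver f X, ∃ hv : v ≠ 0, p = Projectivization.mk ℝ v hv :=
  ⟨chart f p, (chart_mem_coneOver_iff hf).2 hp, chart_ne_zero hf, (mk_chart _).symm⟩

theorem image_chart_eq (hX : ∀ p ∈ X, f p.rep ≠ 0) :
    chart f '' X = coneOver f X ∩ {v | f v = 1} := by
  ext v
  constructor
  · rintro ⟨p, hp, rfl⟩
    exact ⟨(chart_mem_coneOver_iff (hX p hp)).2 hp, apply_chart (hX p hp)⟩
  · rintro ⟨⟨h1, hv, h2⟩, h3⟩
    refine ⟨_, h2, ?_⟩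
    rw [chart_mk, show f v = 1 from h3, inv_one, one_smul]

theorem inv_smul_mem_image_chart {v : Fin d → ℝ} (hv : v ≠ 0)
    (hX : Projectivization.mk ℝ v hv ∈ X) : (f v)⁻¹ • v ∈ chart f '' X :=
  ⟨_, hX, chart_mk hv⟩

/-- The cone over a convex set is convex, in every chart that contains the set. -/
theorem add_mem_coneOver (hX : ∀ p ∈ X, f p.rep ≠ 0) (hc : IsConvex X) {v w : Fin d → ℝ}
    (hv : v ∈ coneOver f X) (hw : w ∈ coneOver f X) : v + w ∈ coneOver f X := by
  obtain ⟨g, ⟨-, hg⟩, hconv⟩ := hc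
  obtain ⟨hfv, hv0, hvX⟩ := hv
  obtain ⟨hfw, hw0, hwX⟩ := hw
  have hgv : g v ≠ 0 := (apply_rep_mk_ne_zero_iff hv0).1 (hg _ hvX)
  have hgw : g w ≠ 0 := (apply_rep_mk_ne_zero_iff hw0).1 (hg _ hwX)
  -- A combination whose coefficients have the signs of `g v` and `g w` is a multiple of a point of
  -- the segment in the chart of `g`.
  have key : ∀ s t : ℝ, 0 < s * g v → 0 < t * g w → ∃ h : s • v + t • w ≠ 0,
      Projectivization.mk ℝ (s • v + t • w) h ∈ X := by
    intro s t hs ht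
    have hpos := add_pos hs ht
    have hm := hconv (inv_smul_mem_image_chart (f := g) hv0 hvX)
      (inv_smul_mem_image_chart (f := g) hw0 hwX) (div_nonneg hs.le hpos.le)
      (div_nonneg ht.le hpos.le) (by rw [← add_div, div_self hpos.ne'])
    obtain ⟨p, hp, hpe⟩ := hm
    have he : chart g p = (s * g v + t * g w)⁻¹ • (s • v + t • w) := by
      rw [hpe, smul_smul, smul_smul, smul_add, smul_smul, smul_smul, div_eq_inv_mul, div_eq_inv_mul,
        mul_assoc, mul_assoc, mul_assoc, mul_assoc, mul_inv_cancel₀ hgv, mul_inv_cancel₀ hgw,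
        mul_one, mul_one]
    have hgp := hg p hp
    have h0 : s • v + t • w ≠ 0 := fun h0 => chart_ne_zero hgp (by rw [he, h0, smul_zero])
    refine ⟨h0, ?_⟩
    rw [← mk_smul_eq h0 (inv_ne_zero hpos.ne'), mk_congr (hw := chart_ne_zero hgp) he.symm,
      mk_chart]
    exact hp
  -- With opposite signs of `g`, that segment would contain a combination of `v` and `w` on which
  -- `f` vanishes, against `hX`.
  have hsame : 0 < g v * g w := by
    by_contra hneg
    have hneg' : g v * g w < 0 := lt_of_le_of_ne (not_lt.1 hneg) (mul_ne_zero hgv hgw)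
    rcases lt_or_gt_of_ne hgv with hv1 | hv1
    · have hw1 : 0 < g w := pos_of_mul_neg_right hneg' hv1.le
      obtain ⟨h0, hm⟩ := key (-f w) (f v) (mul_pos_of_neg_of_neg (neg_neg_of_pos hfw) hv1)
        (mul_pos hfv hw1)
      exact (apply_rep_mk_ne_zero_iff h0).1 (hX _ hm) (by
        simp only [map_add, map_smul, smul_eq_mul]; ring)
    · have hw1 : g w < 0 := neg_of_mul_neg_right hneg' hv1.le
      obtain ⟨h0, hm⟩ := key (f w) (-f v) (mul_pos hfw hv1)
        (mul_pos_of_neg_of_neg (neg_neg_of_pos hfv) hw1)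
      exact (apply_rep_mk_ne_zero_iff h0).1 (hX _ hm) (by
        simp only [map_add, map_smul, smul_eq_mul]; ring)
  have hfvw : 0 < f (v + w) := by
    rw [map_add]
    exact add_pos hfv hfw
  have h0 : v + w ≠ 0 := ne_zero_of_apply_ne_zero hfvw.ne'
  refine ⟨hfvw, h0, ?_⟩
  rcases lt_or_gt_of_ne hgv with hv1 | hv1
  · have hw1 : g w < 0 := neg_of_mul_pos_right hsame hv1.le
    obtain ⟨h1, hm⟩ := key (-1) (-1) (by linarith) (by linarith)
    rw [← mk_smul_eq h0 (neg_ne_zero.2 one_ne_zero)]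
    rwa [mk_congr (w := (-1 : ℝ) • v + (-1 : ℝ) • w) (hw := h1) (smul_add _ _ _)]
  · have hw1 : 0 < g w := pos_of_mul_pos_right hsame hv1.le
    obtain ⟨h1, hm⟩ := key 1 1 (by linarith) (by linarith)
    rwa [mk_congr (w := (1 : ℝ) • v + (1 : ℝ) • w) (hw := h1) (by simp)]

theorem convex_coneOver (hX : ∀ p ∈ X, f p.rep ≠ 0) (hc : IsConvex X) : Convex ℝ (coneOver f X) :=
  (convex_iff_forall_pos).2 fun _ hx _ hy _ _ ha hb _ =>
    add_mem_coneOver hX hc (smul_mem_coneOver hx ha) (smul_mem_coneOver hy hb)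

theorem convex_image_chart (hX : ∀ p ∈ X, f p.rep ≠ 0) (hc : IsConvex X) :
    Convex ℝ (chart f '' X) := by
  rw [image_chart_eq hX]
  refine (convex_coneOver hX hc).inter fun x hx y hy a b _ _ hab => ?_
  have hx' : f x = 1 := hx
  have hy' : f y = 1 := hy
  simp [hx', hy', hab]

theorem IsProperChart.isConvex (h : IsProperChart f X) : IsConvex X := ⟨f, h.1, h.2.1⟩

theorem exists_bound_coneOver (hb : Bornology.IsBounded (chart f '' X)) : ∃ M > 0, ∀ x ∈ coneOver f X, ‖x‖ ≤ M * f x := by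
  obtain ⟨M, hM, h⟩ := hb.exists_pos_norm_le
  refine ⟨M, hM, fun x hx => ?_⟩
  have h1 := h _ (inv_smul_mem_image_chart (f := f) hx.2.1 hx.2.2)
  rw [norm_smul, norm_inv, Real.norm_of_nonneg hx.1.le, inv_mul_le_iff₀ hx.1] at h1
  linarith

theorem exists_bound_closure_coneOver (hb : Bornology.IsBounded (chart f '' X)) :
    ∃ M > 0, ∀ x ∈ closure (coneOver f X), ‖x‖ ≤ M * f x := by
  obtain ⟨M, hM, h⟩ := exists_bound_coneOver hb
  have hf : Continuous f := LinearMap.continuous_of_finiteDimensional _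
  exact ⟨M, hM, fun x hx => closure_minimal (t := {x | ‖x‖ ≤ M * f x}) h
    (isClosed_le continuous_norm (continuous_const.mul hf)) hx⟩

theorem isSharpCone_closure_coneOver (hX : ∀ p ∈ X, f p.rep ≠ 0) (hc : IsConvex X)
    (hb : Bornology.IsBounded (chart f '' X)) (hne : X.Nonempty) :
    IsSharpCone f (closure (coneOver f X)) := by
  refine ⟨isClosed_closure, ?_, fun {x y} hx hy => ?_, fun {c x} hc0 hx => ?_,
    exists_bound_closure_coneOver hb⟩
  · obtain ⟨p, hp⟩ := hne
    have h1 := (chart_mem_coneOver_iff (hX p hp)).2 hp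
    have h2 : Tendsto (fun c : ℝ => c • chart f p) (𝓝[>] 0) (𝓝 ((0 : ℝ) • chart f p)) :=
      (continuous_id.smul continuous_const).continuousAt.tendsto.mono_left nhdsWithin_le_nhds
    rw [zero_smul] at h2
    exact mem_closure_of_tendsto h2 (eventually_mem_nhdsWithin.mono fun c hc0 =>
      smul_mem_coneOver h1 hc0)
  · exact map_mem_closure₂ continuous_add hx hy fun a ha b hb => add_mem_coneOver hX hc ha hb
  · rcases hc0.eq_or_lt with rfl | hc0
    · rw [zero_smul]
      obtain ⟨p, hp⟩ := hne
      have h1 := (chart_mem_coneOver_iff (hX p hp)).2 hp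
      have h2 : Tendsto (fun c : ℝ => c • chart f p) (𝓝[>] 0) (𝓝 ((0 : ℝ) • chart f p)) :=
        (continuous_id.smul continuous_const).continuousAt.tendsto.mono_left nhdsWithin_le_nhds
      rw [zero_smul] at h2
      exact mem_closure_of_tendsto h2 (eventually_mem_nhdsWithin.mono fun c hc0 =>
        smul_mem_coneOver h1 hc0)
    · exact map_mem_closure (continuous_const_smul c) hx fun a ha => smul_mem_coneOver ha hc0

/-! ### The topology of projective space -/

theorem isOpenQuotientMap_mk' :
    IsOpenQuotientMap (Projectivization.mk' ℝ : {v : Fin d → ℝ // v ≠ 0} → RP d) := by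
  refine ⟨fun p => ⟨⟨p.rep, p.rep_nonzero⟩, p.mk_rep⟩, continuous_coinduced_rng, fun U hU => ?_⟩
  rw [isOpen_coinduced]
  have : Projectivization.mk' ℝ ⁻¹' (Projectivization.mk' ℝ '' U) =
      ⋃ a : ℝˣ, {v : {v : Fin d → ℝ // v ≠ 0} |
        (⟨(a : ℝ) • (v : Fin d → ℝ), smul_ne_zero a.ne_zero v.2⟩ : {v : Fin d → ℝ // v ≠ 0}) ∈
          U} := by
    ext v
    simp only [mem_preimage, mem_image, mem_iUnion, mem_ofPred_eq]
    constructor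
    · rintro ⟨w, hw, h⟩
      obtain ⟨a, ha⟩ := (Projectivization.mk_eq_mk_iff ℝ _ _ w.2 v.2).1 h
      exact ⟨a, by convert hw using 1; exact Subtype.ext ha⟩
    · rintro ⟨a, ha⟩
      exact ⟨_, ha, mk_smul_eq v.2 a.ne_zero⟩
  rw [this]
  exact isOpen_iUnion fun a => hU.preimage (by fun_prop)

theorem isOpen_coneOver (hX : IsOpen X) : IsOpen (coneOver f X) := by
  have hf : Continuous f := LinearMap.continuous_of_finiteDimensional _
  have h0 : IsOpen {v : Fin d → ℝ | v ≠ 0} := isOpen_ne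
  have h1 := h0.isOpenMap_subtype_val _ (hX.preimage isOpenQuotientMap_mk'.continuous)
  have h2 : coneOver f X = {v | 0 < f v} ∩
      Subtype.val '' (Projectivization.mk' ℝ ⁻¹' X : Set {v : Fin d → ℝ // v ≠ 0}) := by
    ext v
    constructor
    · rintro ⟨h1, hv, h2⟩
      exact ⟨h1, ⟨v, hv⟩, h2, rfl⟩
    · rintro ⟨h1, ⟨v, hv⟩, h2, rfl⟩
      exact ⟨h1, hv, h2⟩
  rw [h2]
  exact (isOpen_lt continuous_const hf).inter h1

theorem isOpen_image_mk {W : Set (Fin d → ℝ)} (hW : IsOpen W) :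
    IsOpen {p : RP d | ∃ (v : Fin d → ℝ) (hv : v ≠ 0), v ∈ W ∧ p = Projectivization.mk ℝ v hv} := by
  convert isOpenQuotientMap_mk'.isOpenMap _ (hW.preimage
    (continuous_subtype_val (p := fun v : Fin d → ℝ => v ≠ 0))) using 1
  ext p
  constructor
  · rintro ⟨v, hv, h1, rfl⟩
    exact ⟨⟨v, hv⟩, h1, rfl⟩
  · rintro ⟨v, h1, rfl⟩
    exact ⟨v, v.2, h1, rfl⟩

theorem continuousAt_chart {p : RP d} (hp : f p.rep ≠ 0) : ContinuousAt (chart f) p := by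
  have hf : Continuous f := LinearMap.continuous_of_finiteDimensional _
  obtain ⟨v, rfl⟩ := isOpenQuotientMap_mk'.surjective p
  rw [← isOpenQuotientMap_mk'.continuousAt_comp_iff]
  have hv : f v ≠ 0 := (apply_rep_mk_ne_zero_iff v.2).1 hp
  have h1 : chart f ∘ Projectivization.mk' ℝ =
      fun v : {v : Fin d → ℝ // v ≠ 0} => (f v)⁻¹ • (v : Fin d → ℝ) :=
    funext fun v => chart_mk v.2
  rw [h1]
  exact ((hf.comp continuous_subtype_val).continuousAt.inv₀ hv).smul
    continuous_subtype_val.continuousAt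

theorem tendsto_mk {α : Type*} {l : Filter α} {v : α → Fin d → ℝ} {w : Fin d → ℝ}
    (hv : ∀ n, v n ≠ 0) (hw : w ≠ 0) (h : Tendsto v l (𝓝 w)) :
    Tendsto (fun n => Projectivization.mk ℝ (v n) (hv n)) l (𝓝 (Projectivization.mk ℝ w hw)) := by
  have h1 : Tendsto (fun n => (⟨v n, hv n⟩ : {v : Fin d → ℝ // v ≠ 0})) l (𝓝 ⟨w, hw⟩) :=
    tendsto_subtype_rng.2 h
  exact (isOpenQuotientMap_mk'.continuous.tendsto (⟨w, hw⟩ : {v : Fin d → ℝ // v ≠ 0})).comp h1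

theorem isCompact_image_mk {W : Set (Fin d → ℝ)} (hW : IsCompact W) (h0 : ∀ v ∈ W, v ≠ 0) :
    IsCompact {p : RP d | ∃ (v : Fin d → ℝ) (hv : v ≠ 0), v ∈ W ∧
      p = Projectivization.mk ℝ v hv} := by
  have h1 : IsCompact ((Subtype.val : {v : Fin d → ℝ // v ≠ 0} → Fin d → ℝ) ⁻¹' W) := by
    rw [Subtype.isCompact_iff]
    convert hW using 1
    exact image_preimage_eq_of_subset fun v hv => ⟨⟨v, h0 v hv⟩, rfl⟩
  convert h1.image isOpenQuotientMap_mk'.continuous using 1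
  ext p
  constructor
  · rintro ⟨v, hv, h1, rfl⟩
    exact ⟨⟨v, hv⟩, h1, rfl⟩
  · rintro ⟨v, h1, rfl⟩
    exact ⟨v, v.2, h1, rfl⟩

theorem isCompact_image_chart (hX : ∀ p ∈ X, f p.rep ≠ 0) (hc : IsCompact X) :
    IsCompact (chart f '' X) :=
  hc.image_of_continuousOn fun p hp => (continuousAt_chart (hX p hp)).continuousWithinAt

theorem mk_mem_closure_iff {v : Fin d → ℝ} (hv : v ≠ 0) (hfv : 0 < f v) :
    Projectivization.mk ℝ v hv ∈ closure X ↔ v ∈ closure (coneOver f X) := by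
  have hf : Continuous f := LinearMap.continuous_of_finiteDimensional _
  constructor
  · intro h
    have h1 := (continuousAt_chart ((apply_rep_mk_ne_zero_iff (f := f) hv).2 hfv.ne')).tendsto
    have h2 : Tendsto (fun p => (f v) • chart f p) (𝓝 (Projectivization.mk ℝ v hv)) (𝓝 v) := by
      have := h1.const_smul (f v)
      rwa [chart_mk, smul_smul, mul_inv_cancel₀ hfv.ne', one_smul] at this
    refine mem_closure_iff_frequently.2 (h2.frequently ?_)
    have h3 : ∀ᶠ p in 𝓝 (Projectivization.mk ℝ v hv), f (f v • chart f p) ≠ 0 :=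
      ((hf.tendsto _).comp h2).eventually_ne hfv.ne'
    refine (mem_closure_iff_frequently.1 h).mp (h3.mono fun p hp hpX => ?_)
    refine smul_mem_coneOver ((chart_mem_coneOver_iff fun h0 => hp ?_).2 hpX) hfv
    rw [chart, h0]
    simp
  · intro h
    obtain ⟨w, hw, hwv⟩ := mem_closure_iff_seq_limit.1 h
    exact mem_closure_of_tendsto (tendsto_mk (fun n => (hw n).2.1) hv hwv)
      (Eventually.of_forall fun n => (hw n).2.2)

/-- Points of the closure of a set with bounded image in the chart of `f` lie in this chart. -/
theorem apply_rep_ne_zero_of_mem_closure (hX : ∀ p ∈ X, f p.rep ≠ 0)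
    (hb : Bornology.IsBounded (chart f '' X)) {p : RP d} (hp : p ∈ closure X) :
    f p.rep ≠ 0 := by
  intro h0
  obtain ⟨M, hM, hbd⟩ := exists_bound_coneOver hb
  have hf : Continuous f := LinearMap.continuous_of_finiteDimensional _
  -- This cone is an open neighbourhood of any point with `f = 0`, while the bound keeps `X` outside
  -- it.
  have hop : IsOpen {q : RP d | ∃ (v : Fin d → ℝ) (hv : v ≠ 0), v ∈ {v | M * |f v| < ‖v‖} ∧
      q = Projectivization.mk ℝ v hv} :=
    isOpen_image_mk (isOpen_lt (continuous_const.mul hf.abs) continuous_norm)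
  obtain ⟨q, ⟨v, hv, hv1, rfl⟩, hqX⟩ := mem_closure_iff.1 hp _ hop ⟨p.rep, p.rep_nonzero, by
    simp [h0, p.rep_nonzero], p.mk_rep.symm⟩
  have hfv : f v ≠ 0 := (apply_rep_mk_ne_zero_iff hv).1 (hX _ hqX)
  have h1 := hbd _ ((chart_mem_coneOver_iff (hX _ hqX)).2 hqX)
  rw [apply_chart (hX _ hqX), chart_mk, norm_smul, norm_inv, Real.norm_eq_abs, mul_one,
    inv_mul_le_iff₀ (abs_pos.2 hfv)] at h1
  have h2 : M * |f v| < ‖v‖ := hv1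
  linarith

/-- For `D + P ⊆ D`, approximate `y` by some `y'` in the open cone and write `x + y` as `x + (y -
y')` plus `y'`, where the first term is still in the open cone. -/
theorem isConePair_coneOver {Ω : Set (RP d)} (hΩ : IsOpen Ω) (hne : Ω.Nonempty)
    (hf : IsProperChart f Ω) : IsConePair f (coneOver f Ω) (closure (coneOver f Ω)) := by
  refine ⟨isSharpCone_closure_coneOver hf.1.2 hf.isConvex hf.2.2 hne, isOpen_coneOver hΩ,
    subset_closure, fun {x y} hx hy => ?_, fun {c x} hc hx => smul_mem_coneOver hx hc,
    fun h => h.2.1 rfl⟩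
  have h1 : ∀ᶠ y' in 𝓝 y, x + (y - y') ∈ coneOver f Ω := by
    have : Tendsto (fun y' => x + (y - y')) (𝓝 y) (𝓝 (x + (y - y))) :=
      Continuous.tendsto (by fun_prop) y
    rw [sub_self, add_zero] at this
    exact this.eventually ((isOpen_coneOver hΩ).mem_nhds hx)
  obtain ⟨y', hy', hy''⟩ := ((mem_closure_iff_frequently.1 hy).and_eventually h1).exists
  have := add_mem_coneOver hf.1.2 hf.isConvex hy'' hy'
  simpa [add_assoc] using this

end Charts

/-! ### Linear lifts of projective transformations -/

section Lifts

open Filter Topology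

variable {d : ℕ}

/-- The linear automorphism `T` induces the projective transformation `g`. -/
def IsLift (g : PGL(d, ℝ)) (T : (Fin d → ℝ) ≃ₗ[ℝ] (Fin d → ℝ)) : Prop :=
  ∀ (v : Fin d → ℝ) (hv : v ≠ 0),
    g • Projectivization.mk ℝ v hv = Projectivization.mk ℝ (T v) (T.map_ne_zero_iff.2 hv)

theorem exists_isLift (g : PGL(d, ℝ)) : ∃ T, IsLift g T := by
  obtain ⟨A, rfl⟩ := Matrix.ProjGenLinGroup.mk_surjective g
  exact ⟨DistribMulAction.toLinearEquiv ℝ (Fin d → ℝ) A, fun v hv => rfl⟩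

theorem IsLift.mul {g g' : PGL(d, ℝ)} {T T' : (Fin d → ℝ) ≃ₗ[ℝ] (Fin d → ℝ)} (h : IsLift g T)
    (h' : IsLift g' T') : IsLift (g * g') (T * T') := fun v hv => by
  rw [mul_smul, h' v hv, h]
  rfl

theorem isLift_one : IsLift (1 : PGL(d, ℝ)) 1 := fun v hv => by
  rw [one_smul]
  rfl

theorem IsLift.symm {g : PGL(d, ℝ)} {T : (Fin d → ℝ) ≃ₗ[ℝ] (Fin d → ℝ)} (h : IsLift g T) :
    IsLift g⁻¹ T.symm := fun v hv => by
  rw [inv_smul_eq_iff, h]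
  exact mk_congr (T.apply_symm_apply v).symm

theorem IsLift.smul {g : PGL(d, ℝ)} {T : (Fin d → ℝ) ≃ₗ[ℝ] (Fin d → ℝ)} (h : IsLift g T) {c : ℝ}
    (hc : c ≠ 0) : IsLift g (T.trans (LinearEquiv.smulOfNeZero ℝ (Fin d → ℝ) c hc)) := fun v hv => by
  rw [h v hv]
  exact (mk_smul_eq (T.map_ne_zero_iff.2 hv) hc).symm

theorem continuous_PGL_smul (g : PGL(d, ℝ)) : Continuous fun p : RP d => g • p := by
  obtain ⟨T, hT⟩ := exists_isLift g
  have hTc : Continuous T := LinearMap.continuous_of_finiteDimensional T.toLinearMap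
  refine isOpenQuotientMap_mk'.isQuotientMap.continuous_iff.2 ?_
  have : (fun p : RP d => g • p) ∘ Projectivization.mk' ℝ =
      Projectivization.mk' ℝ ∘ fun v : {v : Fin d → ℝ // v ≠ 0} =>
        (⟨T v, T.map_ne_zero_iff.2 v.2⟩ : {v : Fin d → ℝ // v ≠ 0}) := by
    ext1 v
    exact hT v v.2
  rw [this]
  exact isOpenQuotientMap_mk'.continuous.comp (by fun_prop)

instance : ContinuousConstSMul PGL(d, ℝ) (RP d) := ⟨continuous_PGL_smul⟩

/-- A projective transformation mapping a convex set `X` into `Y` has a linear lift that maps the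
cone over `X` into the cone over `Y`. -/
theorem exists_isLift_mapsTo {f f' : Module.Dual ℝ (Fin d → ℝ)} {X Y : Set (RP d)}
    (hX : ∀ p ∈ X, f p.rep ≠ 0) (hc : IsConvex X) (hY : ∀ p ∈ Y, f' p.rep ≠ 0) {g : PGL(d, ℝ)}
    (hg : ∀ p ∈ X, g • p ∈ Y) :
    ∃ T, IsLift g T ∧ ∀ v ∈ coneOver f X, T v ∈ coneOver f' Y := by
  obtain ⟨T, hT⟩ := exists_isLift g
  have hTY : ∀ v ∈ coneOver f X, f' (T v) ≠ 0 := fun v hv => by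
    have := hY _ (hg _ hv.2.2)
    rwa [hT, apply_rep_mk_ne_zero_iff] at this
  have hmem : ∀ {T' : (Fin d → ℝ) ≃ₗ[ℝ] (Fin d → ℝ)}, IsLift g T' → ∀ v ∈ coneOver f X,
      0 < f' (T' v) → T' v ∈ coneOver f' Y := fun {T'} hT' v hv h0 =>
    ⟨h0, T'.map_ne_zero_iff.2 hv.2.1, hT' v hv.2.1 ▸ hg _ hv.2.2⟩
  by_cases hpos : ∀ v ∈ coneOver f X, 0 < f' (T v)
  · exact ⟨T, hT, fun v hv => hmem hT v hv (hpos v hv)⟩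
  -- The sign of `f'` after `T` is constant, since a change of sign would give a zero on the convex
  -- cone; if it is negative, `-T` is the desired lift.
  · push Not at hpos
    obtain ⟨w, hw, hw0⟩ := hpos
    have hw1 : f' (T w) < 0 := lt_of_le_of_ne hw0 (hTY w hw)
    refine ⟨_, hT.smul (neg_ne_zero.2 one_ne_zero), fun v hv =>
      hmem (hT.smul (neg_ne_zero.2 one_ne_zero)) v hv ?_⟩
    have h1 : f' (T v) < 0 := by
      by_contra hv0
      have hv1 : 0 < f' (T v) := lt_of_le_of_ne (not_lt.1 hv0) (hTY v hv).symm
      refine hTY _ (add_mem_coneOver hX hc (smul_mem_coneOver hw hv1)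
        (smul_mem_coneOver hv (neg_pos.2 hw1))) ?_
      simp only [map_add, map_smul, smul_eq_mul]
      ring
    simpa using h1

/-- The linear automorphisms of the cone over `Ω` that induce elements of `Λ`. -/
def coneGroup (f : Module.Dual ℝ (Fin d → ℝ)) (Ω : Set (RP d)) (Λ : Subgroup PGL(d, ℝ)) :
    Subgroup ((Fin d → ℝ) ≃ₗ[ℝ] (Fin d → ℝ)) where
  carrier := {T | (∀ v ∈ coneOver f Ω, T v ∈ coneOver f Ω) ∧
    (∀ v ∈ coneOver f Ω, T.symm v ∈ coneOver f Ω) ∧ ∃ g ∈ Λ, IsLift g T}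
  mul_mem' := by
    rintro T T' ⟨h1, h2, g, hg, hT⟩ ⟨h1', h2', g', hg', hT'⟩
    exact ⟨fun v hv => h1 _ (h1' v hv), fun v hv => h2' _ (h2 v hv), g * g', Λ.mul_mem hg hg',
      hT.mul hT'⟩
  one_mem' := ⟨fun v hv => hv, fun v hv => hv, 1, Λ.one_mem, isLift_one⟩
  inv_mem' := by
    rintro T ⟨h1, h2, g, hg, hT⟩
    exact ⟨h2, h1, g⁻¹, Λ.inv_mem hg, hT.symm⟩

theorem smul_mem_of_mem_Aut {Ω : Set (RP d)} {g : PGL(d, ℝ)} (hg : g ∈ Aut Ω) {p : RP d}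
    (hp : p ∈ Ω) : g • p ∈ Ω := by
  have : g • Ω = Ω := hg
  rw [← this]
  exact smul_mem_smul_set hp

theorem exists_isLift_mem_coneGroup {f : Module.Dual ℝ (Fin d → ℝ)} {Ω : Set (RP d)}
    {Λ : Subgroup PGL(d, ℝ)} (hΩ : ∀ p ∈ Ω, f p.rep ≠ 0) (hc : IsConvex Ω) (hΛ : Λ ≤ Aut Ω)
    {g : PGL(d, ℝ)} (hg : g ∈ Λ) : ∃ T ∈ coneGroup f Ω Λ, IsLift g T := by
  obtain ⟨T, hT, hTm⟩ := exists_isLift_mapsTo hΩ hc hΩ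
    fun p hp => smul_mem_of_mem_Aut (hΛ hg) hp
  refine ⟨T, ⟨hTm, fun v hv => ?_, g, hg, hT⟩, hT⟩
  have h1 : Projectivization.mk ℝ (T.symm v) (T.symm.map_ne_zero_iff.2 hv.2.1) ∈ Ω := by
    rw [← hT.symm v hv.2.1]
    exact smul_mem_of_mem_Aut ((Aut Ω).inv_mem (hΛ hg)) hv.2.2
  have h2 := (apply_rep_mk_ne_zero_iff _).1 (hΩ _ h1)
  rcases lt_or_gt_of_ne h2 with h3 | h3
  · have h4 := hTm (-T.symm v) ⟨by rw [map_neg]; linarith, neg_ne_zero.2 (T.symm.map_ne_zero_iff.2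
      hv.2.1), by
        rw [mk_congr (w := (-1 : ℝ) • T.symm v) (hw := smul_ne_zero (neg_ne_zero.2 one_ne_zero)
            (T.symm.map_ne_zero_iff.2 hv.2.1)) (neg_one_smul ℝ _).symm,
          mk_smul_eq (T.symm.map_ne_zero_iff.2 hv.2.1) (neg_ne_zero.2 one_ne_zero)]
        exact h1⟩
    have h5 := h4.1
    have h6 := hv.1
    simp only [map_neg, LinearEquiv.apply_symm_apply] at h5
    linarith
  · exact ⟨h3, _, h1⟩

/-- Rescaling brings a translated vector exactly onto the compact slice `chart f '' K`, which makes
the linear action cocompact. -/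
theorem smul_mem_coneGroup {f : Module.Dual ℝ (Fin d → ℝ)} {Ω : Set (RP d)}
    {Λ : Subgroup PGL(d, ℝ)} {T : (Fin d → ℝ) ≃ₗ[ℝ] (Fin d → ℝ)} (hT : T ∈ coneGroup f Ω Λ) {c : ℝ}
    (hc : 0 < c) :
    T.trans (LinearEquiv.smulOfNeZero ℝ (Fin d → ℝ) c hc.ne') ∈ coneGroup f Ω Λ := by
  obtain ⟨h1, h2, g, hg, hT⟩ := hT
  refine ⟨fun v hv => smul_mem_coneOver (h1 v hv) hc, fun v hv => ?_, g, hg, hT.smul hc.ne'⟩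
  refine h2 _ (mem_of_mem_coneOver_smul hc ?_)
  have : c • (LinearEquiv.smulOfNeZero ℝ (Fin d → ℝ) c hc.ne').symm v = v :=
    (LinearEquiv.smulOfNeZero ℝ (Fin d → ℝ) c hc.ne').apply_symm_apply v
  exact this.symm ▸ hv

/-- A closed cone over a subset of projective space. -/
abbrev closedCone (f : Module.Dual ℝ (Fin d → ℝ)) (X : Set (RP d)) : Set (Fin d → ℝ) :=
  closure (coneOver f X)

namespace IsNaiveConvexCocompact

variable {Ω C : Set (RP d)} {Λ : Subgroup PGL(d, ℝ)} (h : IsNaiveConvexCocompact Ω C Λ)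
  {f : Module.Dual ℝ (Fin d → ℝ)} (hf : IsProperChart f Ω)
include h

theorem mem_coneOver_of_mem_closedCone {v : Fin d → ℝ} (hv : v ∈ closedCone f C)
    (hvΩ : v ∈ coneOver f Ω) : v ∈ coneOver f C :=
  ⟨hvΩ.1, hvΩ.2.1, h.closed ⟨(mk_mem_closure_iff hvΩ.2.1 hvΩ.1).2 hv, hvΩ.2.2⟩⟩

include hf

theorem isConePair : IsConePair f (coneOver f Ω) (closedCone f Ω) :=
  isConePair_coneOver h.domain.2.1 h.domain.1 hf

theorem isCocompactCone : IsCocompactCone f (coneOver f Ω) (closedCone f Ω) (closedCone f C)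
    (coneGroup f Ω Λ) := by
  have hC : ∀ p ∈ C, f p.rep ≠ 0 := fun p hp => hf.1.2 p (h.subset hp)
  refine ⟨h.isConePair hf, isSharpCone_closure_coneOver hC h.convex
    (hf.2.2.subset (image_mono h.subset)) h.nonempty, closure_mono (coneOver_mono h.subset),
    fun T hT v hv => hT.1 v hv, fun T hT v hv => ?_, fun T hT v hv => ?_, ?_⟩
  · exact map_mem_closure (LinearMap.continuous_of_finiteDimensional T.toLinearMap) hv hT.1
  · refine map_mem_closure (LinearMap.continuous_of_finiteDimensional T.toLinearMap) hv ?_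
    intro w hw
    obtain ⟨h1, -, g, hg, hTg⟩ := hT
    refine ⟨(h1 w (coneOver_mono h.subset hw)).1, T.map_ne_zero_iff.2 hw.2.1, ?_⟩
    rw [← hTg w hw.2.1]
    have h2 := smul_mem_smul_set (a := g) hw.2.2
    rwa [h.invariant g hg] at h2
  · obtain ⟨K, hKC, hK, hcov⟩ := h.cocompact
    refine ⟨chart f '' K, isCompact_image_chart (fun p hp => hC p (hKC hp)) hK, ?_,
      fun v hv hvΩ => ?_⟩
    · rintro _ ⟨p, hp, rfl⟩
      exact (chart_mem_coneOver_iff (hC p (hKC hp))).2 (h.subset (hKC hp))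
    · have hvC := h.mem_coneOver_of_mem_closedCone hv hvΩ
      obtain ⟨g, hg, hgK⟩ : ∃ g ∈ Λ, Projectivization.mk ℝ v hvC.2.1 ∈ g • K := by
        simpa using hcov hvC.2.2
      obtain ⟨T, hT, hTl⟩ := exists_isLift_mem_coneGroup hf.1.2 hf.isConvex h.le_aut
        (Λ.inv_mem hg)
      have h1 := hT.1 v hvΩ
      refine ⟨_, smul_mem_coneGroup hT (inv_pos.2 h1.1), ?_⟩
      have h2 : Projectivization.mk ℝ (T v) h1.2.1 ∈ K := by
        rw [← hTl v hvC.2.1]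
        exact mem_smul_set_iff_inv_smul_mem.1 hgK
      exact inv_smul_mem_image_chart _ h2

end IsNaiveConvexCocompact

end Lifts

/-! ### The Hilbert distance in terms of the order -/

section Hilbert

open Filter Topology

variable {d : ℕ} {f f' : Module.Dual ℝ (Fin d → ℝ)} {Ω : Set (RP d)}

namespace IsProperlyConvexDomain

variable (h : IsProperlyConvexDomain Ω) (hf : IsProperChart f Ω)
include h hf

theorem conePair : IsConePair f (coneOver f Ω) (closedCone f Ω) :=
  isConePair_coneOver h.2.1 h.1 hf

theorem apply_rep_ne_zero {p : RP d} (hp : p ∈ closure Ω) : f p.rep ≠ 0 :=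
  apply_rep_ne_zero_of_mem_closure hf.1.2 hf.2.2 hp

/-- The functional of any other proper chart has a constant sign on the cone. -/
theorem exists_sign (hf' : IsProperChart f' Ω) :
    ∃ ε : ℝ, ε ≠ 0 ∧ ∀ v ∈ closedCone f Ω, v ≠ 0 → 0 < ε * f' v := by
  have hne : ∀ v ∈ coneOver f Ω, f' v ≠ 0 := fun v hv =>
    (apply_rep_mk_ne_zero_iff hv.2.1).1 (hf'.1.2 _ hv.2.2)
  obtain ⟨ε, hε, hpos⟩ : ∃ ε : ℝ, ε ≠ 0 ∧ ∀ v ∈ coneOver f Ω, 0 < ε * f' v := by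
    by_cases hpos : ∀ v ∈ coneOver f Ω, 0 < f' v
    · exact ⟨1, one_ne_zero, fun v hv => by simpa using hpos v hv⟩
    · push Not at hpos
      obtain ⟨w, hw, hw0⟩ := hpos
      have hw1 : f' w < 0 := lt_of_le_of_ne hw0 (hne w hw)
      refine ⟨-1, neg_ne_zero.2 one_ne_zero, fun v hv => ?_⟩
      by_contra hv0
      have hv1 : 0 < f' v := lt_of_le_of_ne (by linarith) (hne v hv).symm
      refine hne _ (add_mem_coneOver hf.1.2 hf.isConvex (smul_mem_coneOver hw hv1)
        (smul_mem_coneOver hv (neg_pos.2 hw1))) ?_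
      simp only [map_add, map_smul, smul_eq_mul]
      ring
  obtain ⟨M, hM, hb⟩ := exists_bound_coneOver hf'.2.2
  have hc' : Continuous f' := LinearMap.continuous_of_finiteDimensional _
  have h1 : ∀ v ∈ coneOver f Ω, ‖ε • v‖ ≤ M * (ε * f' v) := fun v hv => by
    have := hb (ε • v) ⟨by simpa using hpos v hv, smul_ne_zero hε hv.2.1, by
      rw [mk_smul_eq hv.2.1 hε]
      exact hv.2.2⟩
    simpa using this
  refine ⟨ε, hε, fun v hv hv0 => ?_⟩
  have h2 : ‖ε • v‖ ≤ M * (ε * f' v) :=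
    closure_minimal (t := {v | ‖ε • v‖ ≤ M * (ε * f' v)}) h1
      (isClosed_le (by fun_prop) (by fun_prop)) hv
  have h3 : 0 < ‖ε • v‖ := norm_pos_iff.2 (smul_ne_zero hε hv0)
  exact pos_of_mul_pos_right (h3.trans_le h2) hM.le

theorem chart_mem_closedCone {p : RP d} (hp : p ∈ closure Ω) : chart f p ∈ closedCone f Ω := by
  have h1 := h.apply_rep_ne_zero hf hp
  rw [← mk_mem_closure_iff (chart_ne_zero h1) (by rw [apply_chart h1]; exact one_pos), mk_chart]
  exact hp

/-- Up to a common sign, the representatives of a point in two charts differ by a positive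
factor. -/
theorem exists_smul_chart {ε : ℝ} (hε : ∀ v ∈ closedCone f Ω, v ≠ 0 → 0 < ε * f' v)
    {p : RP d} (hp : p ∈ closure Ω) : ∃ c : ℝ, 0 < c ∧ chart f' p = ε • c • chart f p := by
  have h1 := h.apply_rep_ne_zero hf hp
  have h2 := hε _ (h.chart_mem_closedCone hf hp) (chart_ne_zero h1)
  refine ⟨(ε * f' (chart f p))⁻¹, inv_pos.2 h2, ?_⟩
  have h3 : ε ≠ 0 := left_ne_zero_of_mul h2.ne'
  conv_lhs => rw [← mk_chart (chart_ne_zero h1), chart_mk]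
  rw [smul_smul, mul_inv, ← mul_assoc, mul_inv_cancel₀ h3, one_mul]

omit h hf in
theorem exists_lt_of_sbtw {x y z : Fin d → ℝ} (hs : Sbtw ℝ x y z) :
    ∃ s : ℝ, 0 < s ∧ s < 1 ∧ y = (1 - s) • x + s • z := by
  obtain ⟨⟨s, ⟨hs0, hs1⟩, h1⟩, h2, h3⟩ := hs
  rw [AffineMap.lineMap_apply_module] at h1
  refine ⟨s, lt_of_le_of_ne hs0 ?_, lt_of_le_of_ne hs1 ?_, h1.symm⟩
  · rintro rfl
    simp at h1
    exact h2 h1.symm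
  · rintro rfl
    simp at h1
    exact h3 h1.symm

/-- The end points `a` and `b` are boundary vectors. That `x` lies between `a` and `y` says that a
certain `β • x - y` is a positive multiple of `a`, and being a boundary vector characterises the
exact constant; likewise for `α` and `b`. The common sign `ε` makes the computation valid in any
proper chart. -/
theorem log_crossRatio {x y : Fin d → ℝ} (hx : x ∈ coneOver f Ω) (hy : y ∈ coneOver f Ω) {α β : ℝ}
    (hα : α • y - x ∈ closedCone f Ω) (hα' : α • y - x ∉ coneOver f Ω)
    (hβ : β • x - y ∈ closedCone f Ω) (hβ' : β • x - y ∉ coneOver f Ω) (hf' : IsProperChart f' Ω)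
    {a b : RP d} (ha : a ∈ closure Ω \ Ω) (hb : b ∈ closure Ω \ Ω)
    (h1 : Sbtw ℝ (chart f' a) (chart f' (Projectivization.mk ℝ x hx.2.1))
      (chart f' (Projectivization.mk ℝ y hy.2.1)))
    (h2 : Sbtw ℝ (chart f' (Projectivization.mk ℝ x hx.2.1))
      (chart f' (Projectivization.mk ℝ y hy.2.1)) (chart f' b)) :
    crossRatio f' a (Projectivization.mk ℝ x hx.2.1) (Projectivization.mk ℝ y hy.2.1) b =
      α * β := by
  have hP := h.conePair hf
  obtain ⟨ε, hε, hsign⟩ := h.exists_sign hf hf'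
  have hex : ∀ {p : RP d}, p ∈ closure Ω \ Ω → ∃ v ∈ closedCone f Ω, v ∉ coneOver f Ω ∧
      chart f' p = ε • v := fun {p} hp => by
    obtain ⟨c, hc, hpc⟩ := h.exists_smul_chart hf hsign hp.1
    refine ⟨_, hP.smul_mem hc.le (h.chart_mem_closedCone hf hp.1), fun hm => hp.2 ?_, hpc⟩
    exact (chart_mem_coneOver_iff (h.apply_rep_ne_zero hf hp.1)).1 (mem_of_mem_coneOver_smul hc hm)
  have hin : ∀ {v : Fin d → ℝ} (hv : v ∈ coneOver f Ω), ∃ c : ℝ, 0 < c ∧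
      chart f' (Projectivization.mk ℝ v hv.2.1) = ε • c • v := fun {v} hv => by
    obtain ⟨c, hc, hpc⟩ := h.exists_smul_chart hf hsign (subset_closure hv.2.2)
    refine ⟨c * (f v)⁻¹, mul_pos hc (inv_pos.2 hv.1), ?_⟩
    rw [hpc, chart_mk, mul_smul]
  obtain ⟨a', haP, haD, hae⟩ := hex ha
  obtain ⟨b', hbP, hbD, hbe⟩ := hex hb
  obtain ⟨r, hr, hre⟩ := hin hx
  obtain ⟨q, hq, hqe⟩ := hin hy
  have hA := h1.left_ne_right
  have hB := h2.left_ne_right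
  obtain ⟨s, hs0, hs1, hs⟩ := exists_lt_of_sbtw h1
  obtain ⟨t, ht0, ht1, ht⟩ := exists_lt_of_sbtw h2
  rw [crossRatio]
  set X := chart f' (Projectivization.mk ℝ x hx.2.1)
  set Y := chart f' (Projectivization.mk ℝ y hy.2.1)
  have e1 : X - chart f' a = s • (Y - chart f' a) := by
    rw [hs]; module
  have e2 : Y - chart f' b = (1 - t) • (X - chart f' b) := by
    rw [ht]; module
  have ht1' : 0 < 1 - t := by linarith
  have hs1' : 0 < 1 - s := by linarith
  rw [e1, e2, norm_smul, norm_smul, Real.norm_of_nonneg hs0.le, Real.norm_of_nonneg ht1'.le]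
  have hβe : β = r / (s * q) := by
    have hx1 : (r / (s * q)) • x - y = ((1 - s) / (s * q)) • a' := by
      have : r • x = (1 - s) • a' + s • q • y := by
        apply smul_right_injective _ hε
        simp only
        rw [← hre, hs, hae, hqe]
        module
      have h3 : r • x - (s * q) • y = (1 - s) • a' := by
        rw [this]; module
      have h4 : (s * q) ≠ 0 := by positivity
      rw [div_eq_inv_mul, div_eq_inv_mul, mul_smul, mul_smul, ← h3, smul_sub, smul_smul _ _ y,
        inv_mul_cancel₀ h4, one_smul]
    have hpos : 0 < (1 - s) / (s * q) := by positivity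
    refine le_antisymm (hP.le_of_exact hx hβ' ?_) (hP.le_of_exact hx ?_ hβ)
    · rw [hx1]; exact hP.smul_mem hpos.le haP
    · rw [hx1]; exact fun hm => haD (mem_of_mem_coneOver_smul hpos hm)
  have hαe : α = q / ((1 - t) * r) := by
    have hx1 : (q / ((1 - t) * r)) • y - x = (t / ((1 - t) * r)) • b' := by
      have : q • y = (1 - t) • r • x + t • b' := by
        apply smul_right_injective _ hε
        simp only
        rw [← hqe, ht, hbe, hre]
        module
      have h3 : q • y - ((1 - t) * r) • x = t • b' := by
        rw [this]; module
      have h4 : ((1 - t) * r) ≠ 0 := by positivity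
      rw [div_eq_inv_mul, div_eq_inv_mul, mul_smul, mul_smul, ← h3, smul_sub, smul_smul _ _ x,
        inv_mul_cancel₀ h4, one_smul]
    have hpos : 0 < t / ((1 - t) * r) := by positivity
    refine le_antisymm (hP.le_of_exact hy hα' ?_) (hP.le_of_exact hy ?_ hα)
    · rw [hx1]; exact hP.smul_mem hpos.le hbP
    · rw [hx1]; exact fun hm => hbD (mem_of_mem_coneOver_smul hpos hm)
  have hn1 : ‖Y - chart f' a‖ ≠ 0 := norm_ne_zero_iff.2 (sub_ne_zero.2 hA.symm)
  have hn2 : ‖X - chart f' b‖ ≠ 0 := norm_ne_zero_iff.2 (sub_ne_zero.2 hB)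
  rw [hαe, hβe]
  field_simp

/-- The end point of the line through two distinct points beyond the first one. -/
theorem exists_endpoint {x y : Fin d → ℝ} (hx : x ∈ coneOver f Ω) (hy : y ∈ coneOver f Ω)
    (hxy : Projectivization.mk ℝ x hx.2.1 ≠ Projectivization.mk ℝ y hy.2.1) {β : ℝ}
    (hβ : β • x - y ∈ closedCone f Ω) (hβ' : β • x - y ∉ coneOver f Ω) :
    ∃ a ∈ closure Ω \ Ω, Sbtw ℝ (chart f a) (chart f (Projectivization.mk ℝ x hx.2.1))
      (chart f (Projectivization.mk ℝ y hy.2.1)) := by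
  have hP := h.conePair hf
  have hβ0 : 0 < β := by
    have h1 := hP.apply_nonneg hβ
    rw [map_sub, map_smul, smul_eq_mul, sub_nonneg] at h1
    exact pos_of_mul_pos_left (hy.1.trans_le h1) hx.1.le
  have hne : chart f (Projectivization.mk ℝ x hx.2.1) ≠ chart f (Projectivization.mk ℝ y hy.2.1) :=
    fun he => hxy (chart_injective (hf.1.2 _ hx.2.2) (hf.1.2 _ hy.2.2) he)
  rw [chart_mk, chart_mk] at hne ⊢
  -- This is the coefficient for which the normalised `x` minus `s` times the normalised `y` is
  -- proportional to `β • x - y`.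
  set s := f y / (β * f x) with hs
  have hs0 : 0 < s := div_pos hy.1 (mul_pos hβ0 hx.1)
  have hfx := hx.1
  have hfy := hy.1
  set z := (f x)⁻¹ • x - s • (f y)⁻¹ • y with hz
  have hze : z = (β * f x)⁻¹ • (β • x - y) := by
    rw [hz, smul_sub, smul_smul, smul_smul]
    congr 2
    · field_simp
    · rw [hs]; field_simp
  have hc : 0 < (β * f x)⁻¹ := by positivity
  have hzP : z ∈ closedCone f Ω := hze ▸ hP.smul_mem hc.le hβ
  have hzD : z ∉ coneOver f Ω := fun hm => hβ' (mem_of_mem_coneOver_smul hc (hze ▸ hm))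
  have hfz : f z = 1 - s := by
    simp only [hz, map_sub, map_smul, smul_eq_mul]
    field_simp
  have hs1 : s < 1 := by
    refine lt_of_le_of_ne (by linarith [hP.apply_nonneg hzP]) fun hs1 => hne ?_
    have := hP.eq_zero_of_apply_eq_zero hzP (by rw [hfz, hs1, sub_self])
    rwa [hz, hs1, one_smul, sub_eq_zero] at this
  have hs1' : 0 < 1 - s := by linarith
  have hfz0 : 0 < f z := hfz ▸ hs1'
  have hz0 : z ≠ 0 := ne_zero_of_apply_ne_zero (f := f) hfz0.ne'
  refine ⟨Projectivization.mk ℝ z hz0, ⟨(mk_mem_closure_iff hz0 hfz0).2 hzP,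
    fun hm => hzD ⟨hfz0, hz0, hm⟩⟩, ?_⟩
  rw [chart_mk, hfz]
  have hx1 : (f x)⁻¹ • x = AffineMap.lineMap ((1 - s)⁻¹ • z) ((f y)⁻¹ • y) s := by
    rw [AffineMap.lineMap_apply_module, smul_smul, mul_inv_cancel₀ hs1'.ne', one_smul, hz]
    module
  refine ⟨⟨s, ⟨hs0.le, hs1.le⟩, hx1.symm⟩, fun he => hne ?_, hne⟩
  have h2 : s • ((f x)⁻¹ • x - (f y)⁻¹ • y) = 0 := by
    have h3 : (1 - s) • (f x)⁻¹ • x = z := by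
      rw [he, smul_smul, mul_inv_cancel₀ hs1'.ne', one_smul]
    have h4 : s • ((f x)⁻¹ • x - (f y)⁻¹ • y) = z - (1 - s) • (f x)⁻¹ • x := by
      rw [hz]
      module
    rw [h4, h3, sub_self]
  exact sub_eq_zero.1 ((smul_eq_zero.1 h2).resolve_left hs0.ne')

/-- For distinct points the set in `hilbertDist` has the single element given by `log_crossRatio`.
For equal points it is empty, and the exact constants are inverse to each other. -/
theorem hilbertDist_mk {x y : Fin d → ℝ} (hx : x ∈ coneOver f Ω) (hy : y ∈ coneOver f Ω) {α β : ℝ}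
    (hα : α • y - x ∈ closedCone f Ω) (hα' : α • y - x ∉ coneOver f Ω)
    (hβ : β • x - y ∈ closedCone f Ω) (hβ' : β • x - y ∉ coneOver f Ω) :
    hilbertDist Ω (Projectivization.mk ℝ x hx.2.1) (Projectivization.mk ℝ y hy.2.1) =
      1 / 2 * Real.log (α * β) := by
  have hP := h.conePair hf
  by_cases hxy : Projectivization.mk ℝ x hx.2.1 = Projectivization.mk ℝ y hy.2.1
  · obtain ⟨c, hc⟩ := (Projectivization.mk_eq_mk_iff' ℝ _ _ _ _).1 hxy
    have hc0 : 0 < c := by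
      have := hx.1
      rw [← hc, map_smul, smul_eq_mul] at this
      exact pos_of_mul_pos_left this hy.1.le
    have hαc : α = c := le_antisymm
      (hP.le_of_exact hy hα' (by rw [hc, sub_self]; exact hP.zero_mem))
      (hP.le_of_exact hy (by rw [hc, sub_self]; exact hP.zero_notMem) hα)
    have hyx : c⁻¹ • x = y := by rw [← hc, smul_smul, inv_mul_cancel₀ hc0.ne', one_smul]
    have hβc : β = c⁻¹ := le_antisymm
      (hP.le_of_exact hx hβ' (by rw [hyx, sub_self]; exact hP.zero_mem))
      (hP.le_of_exact hx (by rw [hyx, sub_self]; exact hP.zero_notMem) hβ)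
    rw [hαc, hβc, mul_inv_cancel₀ hc0.ne', Real.log_one, mul_zero, hilbertDist]
    refine (congrArg sSup (eq_empty_iff_forall_notMem.2 ?_)).trans Real.sSup_empty
    rintro t ⟨f', a, b, -, -, -, h1, -⟩
    exact h1.ne_right (by rw [hxy])
  · rw [hilbertDist]
    refine (congrArg sSup (eq_singleton_iff_nonempty_unique_mem.2 ⟨?_, ?_⟩)).trans
      (csSup_singleton _)
    · obtain ⟨a, ha, h1⟩ := h.exists_endpoint hf hx hy hxy hβ hβ'
      obtain ⟨b, hb, h2⟩ := h.exists_endpoint hf hy hx (Ne.symm hxy) hα hα'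
      exact ⟨_, f, a, b, hf, ha, hb, h1, h2.symm, rfl⟩
    · rintro t ⟨f', a, b, hf', ha, hb, h1, h2, rfl⟩
      rw [h.log_crossRatio hf hx hy hα hα' hβ hβ' hf' ha hb h1 h2]

theorem one_le_mul {x y : Fin d → ℝ} (hx : x ∈ coneOver f Ω) (hy : y ∈ coneOver f Ω) {α β : ℝ}
    (hα : α • y - x ∈ closedCone f Ω) (hβ : β • x - y ∈ closedCone f Ω) :
    0 < α ∧ 0 < β ∧ 1 ≤ α * β := by
  have hP := h.conePair hf
  have h1 := hP.apply_nonneg hα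
  have h2 := hP.apply_nonneg hβ
  rw [map_sub, map_smul, smul_eq_mul, sub_nonneg] at h1 h2
  have hα0 : 0 < α := pos_of_mul_pos_left (hx.1.trans_le h1) hy.1.le
  have hβ0 : 0 < β := pos_of_mul_pos_left (hy.1.trans_le h2) hx.1.le
  refine ⟨hα0, hβ0, ?_⟩
  have h3 : 1 * f x ≤ α * β * f x := by
    calc 1 * f x ≤ α * f y := by linarith
      _ ≤ α * (β * f x) := mul_le_mul_of_nonneg_left h2 hα0.le
      _ = α * β * f x := by ring
  exact le_of_mul_le_mul_right h3 hx.1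

/-- The exact constants are the least admissible ones, so any admissible pair with small product
bounds the distance. -/
theorem hilbertDist_le_iff {x y : Fin d → ℝ} (hx : x ∈ coneOver f Ω) (hy : y ∈ coneOver f Ω)
    {r : ℝ} : hilbertDist Ω (Projectivization.mk ℝ x hx.2.1) (Projectivization.mk ℝ y hy.2.1) ≤ r ↔
      ∃ α β : ℝ, α • y - x ∈ closedCone f Ω ∧ β • x - y ∈ closedCone f Ω ∧
        α * β ≤ Real.exp (2 * r) := by
  have hP := h.conePair hf
  obtain ⟨α, -, hα, hα'⟩ := hP.exists_exact hx hy
  obtain ⟨β, -, hβ, hβ'⟩ := hP.exists_exact hy hx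
  have hm := h.one_le_mul hf hx hy hα hβ
  rw [h.hilbertDist_mk hf hx hy hα hα' hβ hβ']
  have key : 1 / 2 * Real.log (α * β) ≤ r ↔ α * β ≤ Real.exp (2 * r) := by
    rw [← Real.log_le_iff_le_exp (mul_pos hm.1 hm.2.1)]
    constructor <;> intro <;> linarith
  rw [key]
  constructor
  · exact fun h1 => ⟨α, β, hα, hβ, h1⟩
  · rintro ⟨α₁, β₁, h1, h2, h3⟩
    exact (mul_le_mul (hP.le_of_exact hy hα' h1) (hP.le_of_exact hx hβ' h2) hm.2.1.le
      (hm.1.le.trans (hP.le_of_exact hy hα' h1))).trans h3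

theorem hilbertDist_lt_iff {x y : Fin d → ℝ} (hx : x ∈ coneOver f Ω) (hy : y ∈ coneOver f Ω)
    {r : ℝ} : hilbertDist Ω (Projectivization.mk ℝ x hx.2.1) (Projectivization.mk ℝ y hy.2.1) < r ↔
      ∃ α β : ℝ, α • y - x ∈ closedCone f Ω ∧ β • x - y ∈ closedCone f Ω ∧
        α * β < Real.exp (2 * r) := by
  have hP := h.conePair hf
  obtain ⟨α, -, hα, hα'⟩ := hP.exists_exact hx hy
  obtain ⟨β, -, hβ, hβ'⟩ := hP.exists_exact hy hx
  have hm := h.one_le_mul hf hx hy hα hβ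
  rw [h.hilbertDist_mk hf hx hy hα hα' hβ hβ']
  have key : 1 / 2 * Real.log (α * β) < r ↔ α * β < Real.exp (2 * r) := by
    rw [← Real.log_lt_iff_lt_exp (mul_pos hm.1 hm.2.1)]
    constructor <;> intro <;> linarith
  rw [key]
  constructor
  · exact fun h1 => ⟨α, β, hα, hβ, h1⟩
  · rintro ⟨α₁, β₁, h1, h2, h3⟩
    exact (mul_le_mul (hP.le_of_exact hy hα' h1) (hP.le_of_exact hx hβ' h2) hm.2.1.le
      (hm.1.le.trans (hP.le_of_exact hy hα' h1))).trans_lt h3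

end IsProperlyConvexDomain

end Hilbert

/-! ### Simplices and frames -/

section Simplices

open Filter Topology

variable {d : ℕ} {f : Module.Dual ℝ (Fin d → ℝ)} {Ω C X Y : Set (RP d)}

theorem coneOver_subset_iff (hX : ∀ p ∈ X, f p.rep ≠ 0) :
    coneOver f X ⊆ coneOver f Y ↔ X ⊆ Y :=
  ⟨fun h p hp => (chart_mem_coneOver_iff (hX p hp)).1 (h ((chart_mem_coneOver_iff (hX p hp)).2 hp)),
    coneOver_mono⟩

theorem coneOver_inj (hX : ∀ p ∈ X, f p.rep ≠ 0) (hY : ∀ p ∈ Y, f p.rep ≠ 0) :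
    coneOver f X = coneOver f Y ↔ X = Y := by
  rw [Subset.antisymm_iff, coneOver_subset_iff hX, coneOver_subset_iff hY, Subset.antisymm_iff]

/-- An inclusion of subspaces is proper exactly when its image is closed in the larger set. -/
theorem isProperlyEmbedded_iff : IsProperlyEmbedded X Y ↔ X ⊆ Y ∧ closure X ∩ Y ⊆ X := by
  constructor
  · rintro ⟨h, hp⟩
    refine ⟨h, fun p hp' => ?_⟩
    have h1 := hp.isClosedMap.isClosed_range
    rw [range_inclusion] at h1
    have h2 := isClosed_preimage_val.1 h1
    rw [inter_eq_right.2 h] at h2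
    exact h2 ⟨hp'.2, hp'.1⟩
  · rintro ⟨h, hc⟩
    refine ⟨h, Topology.IsClosedEmbedding.isProperMap ⟨Topology.IsEmbedding.inclusion h, ?_⟩⟩
    rw [range_inclusion]
    refine isClosed_preimage_val.2 ?_
    rw [inter_eq_right.2 h, inter_comm]
    exact hc

theorem openSimplex_smul {k : ℕ} (v : Fin (k + 1) → Fin d → ℝ) {c : ℝ} (hc : c ≠ 0) :
    openSimplex (fun i => c • v i) = openSimplex v := by
  ext p
  have h1 : ∀ x : Fin (k + 1) → ℝ, Submodule.span ℝ {∑ i, x i • c • v i} =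
      Submodule.span ℝ {∑ i, x i • v i} := fun x => by
    have : ∑ i, x i • c • v i = c • ∑ i, x i • v i := by
      rw [Finset.smul_sum]
      exact Finset.sum_congr rfl fun i _ => smul_comm _ _ _
    rw [this, Submodule.span_singleton_smul_eq (IsUnit.mk0 c hc)]
  simp only [openSimplex, mem_ofPred_eq, h1]

theorem mk_mem_openSimplex {k : ℕ} {v : Fin (k + 1) → Fin d → ℝ} {w : Fin d → ℝ} (hw : w ≠ 0)
    (h : w ∈ openCone v) : Projectivization.mk ℝ w hw ∈ openSimplex v := by
  obtain ⟨x, hx, rfl⟩ := h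
  exact ⟨x, hx, Projectivization.submodule_mk _ _⟩

theorem exists_smul_eq_of_mk_mem_openSimplex {k : ℕ} {v : Fin (k + 1) → Fin d → ℝ} {w : Fin d → ℝ}
    (hw : w ≠ 0) (h : Projectivization.mk ℝ w hw ∈ openSimplex v) :
    ∃ c : ℝ, c ≠ 0 ∧ ∃ x ∈ openCone v, w = c • x := by
  obtain ⟨x, hx, h⟩ := h
  rw [Projectivization.submodule_mk] at h
  obtain ⟨c, hc⟩ := Submodule.mem_span_singleton.1 (h ▸ Submodule.mem_span_singleton_self w)
  refine ⟨c, ?_, _, ⟨x, hx, rfl⟩, hc.symm⟩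
  rintro rfl
  exact hw (by rw [← hc, zero_smul])

theorem coneOver_openSimplex (hP : IsConePair f (coneOver f Ω) (closedCone f Ω)) {k : ℕ}
    {u : Fin (k + 1) → Fin d → ℝ} (hu : IsFrame (coneOver f Ω) (closedCone f Ω) u) :
    coneOver f (openSimplex u) = openCone u := by
  ext w
  constructor
  · rintro ⟨h1, hw, h2⟩
    obtain ⟨c, -, x, hx, rfl⟩ := exists_smul_eq_of_mk_mem_openSimplex hw h2
    rw [map_smul, smul_eq_mul] at h1
    exact smul_mem_openCone (pos_of_mul_pos_left h1 (hP.openCone_subset_interior hu hx).1.le) hx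
  · intro hw
    have h1 := hP.openCone_subset_interior hu hw
    exact ⟨h1.1, h1.2.1, mk_mem_openSimplex h1.2.1 hw⟩

theorem openSimplex_subset (hP : IsConePair f (coneOver f Ω) (closedCone f Ω)) {k : ℕ}
    {u : Fin (k + 1) → Fin d → ℝ} (hu : IsFrame (coneOver f Ω) (closedCone f Ω) u) :
    openSimplex u ⊆ Ω := by
  rintro p ⟨x, hx, h⟩
  have h1 := hP.openCone_subset_interior hu ⟨x, hx, rfl⟩
  rw [eq_mk_of_submodule_eq h1.2.1 h]
  exact h1.2.2

theorem openSimplex_eq_iff (hP : IsConePair f (coneOver f Ω) (closedCone f Ω))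
    (hf : ∀ p ∈ Ω, f p.rep ≠ 0) {k l : ℕ}
    {u : Fin (k + 1) → Fin d → ℝ} {v : Fin (l + 1) → Fin d → ℝ}
    (hu : IsFrame (coneOver f Ω) (closedCone f Ω) u)
    (hv : IsFrame (coneOver f Ω) (closedCone f Ω) v) :
    openSimplex u = openSimplex v ↔ openCone u = openCone v := by
  rw [← coneOver_openSimplex hP hu, ← coneOver_openSimplex hP hv, coneOver_inj]
  · exact fun p hp => hf p (openSimplex_subset hP hu hp)
  · exact fun p hp => hf p (openSimplex_subset hP hv hp)

theorem openSimplex_subset_iff (hP : IsConePair f (coneOver f Ω) (closedCone f Ω))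
    (hf : ∀ p ∈ Ω, f p.rep ≠ 0) {k l : ℕ}
    {u : Fin (k + 1) → Fin d → ℝ} {v : Fin (l + 1) → Fin d → ℝ}
    (hu : IsFrame (coneOver f Ω) (closedCone f Ω) u)
    (hv : IsFrame (coneOver f Ω) (closedCone f Ω) v) :
    openSimplex u ⊆ openSimplex v ↔ openCone u ⊆ openCone v := by
  rw [← coneOver_openSimplex hP hu, ← coneOver_openSimplex hP hv, coneOver_subset_iff]
  exact fun p hp => hf p (openSimplex_subset hP hu hp)

theorem closure_openSimplex_inter_subset (hP : IsConePair f (coneOver f Ω) (closedCone f Ω))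
    (hf : ∀ p ∈ Ω, f p.rep ≠ 0) {k : ℕ}
    {u : Fin (k + 1) → Fin d → ℝ} (hu : IsFrame (coneOver f Ω) (closedCone f Ω) u) :
    closure (openSimplex u) ∩ Ω ⊆ openSimplex u := by
  rintro p ⟨hp, hpΩ⟩
  obtain ⟨v, hv, hv0, rfl⟩ := exists_mem_coneOver_of_mem hpΩ (hf p hpΩ)
  rw [mk_mem_closure_iff hv0 hv.1, coneOver_openSimplex hP hu] at hp
  obtain ⟨U, hU, hUv⟩ := mem_closure_iff_ultrafilter.1 hp
  exact mk_mem_openSimplex hv0 (hP.mem_openCone_of_tendsto (U := U) (x := id) hu hU hUv hv)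

theorem IsConePair.openCone_eq_of_subset {V : Type*} [NormedAddCommGroup V] [NormedSpace ℝ V]
    [FiniteDimensional ℝ V] {f : V →ₗ[ℝ] ℝ} {D P : Set V} (hP : IsConePair f D P) {ι κ : Type*}
    [Fintype ι] [Fintype κ] {u : ι → V} {v : κ → V} (hu : IsFrame D P u) (hv : IsFrame D P v)
    (h : openCone u ⊆ openCone v) (hcard : Fintype.card κ ≤ Fintype.card ι) :
    openCone u = openCone v := by
  refine h.antisymm fun p hp => ?_
  have h1 : Submodule.span ℝ (range u) ≤ Submodule.span ℝ (range v) := by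
    rw [← span_openCone, ← span_openCone]
    exact Submodule.span_mono h
  have h2 := Submodule.eq_of_le_of_finrank_le h1 (by
    rwa [finrank_span_eq_card (hP.linearIndependent_frame hu),
      finrank_span_eq_card (hP.linearIndependent_frame hv)])
  refine hP.mem_openCone_of_mem_span hu (hP.openCone_subset_interior hv hp) ?_
  rw [h2]
  exact openCone_subset_span v hp

theorem IsFrame.exists_fin {V : Type*} [NormedAddCommGroup V] [NormedSpace ℝ V] {D Q : Set V}
    {ι : Type*} [Fintype ι] {u : ι → V} (hu : IsFrame D Q u) (h3 : 3 ≤ Fintype.card ι) :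
    ∃ k, 2 ≤ k ∧ ∃ e : Fin (k + 1) ≃ ι, IsFrame D Q (u ∘ e) := by
  refine ⟨Fintype.card ι - 1, by omega, (Fintype.equivFinOfCardEq (by omega)).symm, ?_⟩
  exact hu.comp_equiv _

/-! ### Properly embedded and top-dimensional simplices of a convex co-compact triple -/

namespace IsNaiveConvexCocompact

variable {Λ : Subgroup PGL(d, ℝ)} (h : IsNaiveConvexCocompact Ω C Λ) (hf : IsProperChart f Ω)
include h hf

theorem openSimplex_subset_core {k : ℕ} {u : Fin (k + 1) → Fin d → ℝ}
    (hu : IsFrame (coneOver f Ω) (closedCone f C) u) : openSimplex u ⊆ C := by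
  have hcc := h.isCocompactCone hf
  rintro p ⟨x, hx, hp⟩
  have h1 := hcc.pair.openCone_subset_interior (hu.mono hcc.subset) ⟨x, hx, rfl⟩
  have h2 := h.mem_coneOver_of_mem_closedCone (hcc.sharp.sum_mem fun i _ =>
    hcc.sharp.smul_mem (hx i).le (hu.mem i)) h1
  rw [eq_mk_of_submodule_eq h1.2.1 hp]
  exact h2.2.2

theorem isProperlyEmbedded_openSimplex {k : ℕ} {u : Fin (k + 1) → Fin d → ℝ}
    (hu : IsFrame (coneOver f Ω) (closedCone f C) u) : IsProperlyEmbedded (openSimplex u) C := by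
  have hcc := h.isCocompactCone hf
  exact isProperlyEmbedded_iff.2 ⟨h.openSimplex_subset_core hf hu, fun p hp =>
    closure_openSimplex_inter_subset hcc.pair hf.1.2 (hu.mono hcc.subset) ⟨hp.1, h.subset hp.2⟩⟩

/-- The vertices of a properly embedded simplex form a frame, up to a common factor. -/
theorem exists_isFrame_smul {k : ℕ} {v : Fin (k + 1) → Fin d → ℝ} (hv : LinearIndependent ℝ v)
    (hS : IsProperlyEmbedded (openSimplex v) C) :
    ∃ c : ℝ, c ≠ 0 ∧ IsFrame (coneOver f Ω) (closedCone f C) fun i => c • v i := by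
  have hcc := h.isCocompactCone hf
  obtain ⟨hSC, hSc⟩ := isProperlyEmbedded_iff.1 hS
  have hne : ∀ w ∈ openCone v, w ≠ 0 := by
    rintro w ⟨x, hx, rfl⟩ h0
    exact (hx 0).ne' (Fintype.linearIndependent_iff.1 hv x h0 0)
  have hfw : ∀ w ∈ openCone v, f w ≠ 0 := fun w hw =>
    (apply_rep_mk_ne_zero_iff (hne w hw)).1 (hf.1.2 _ (h.subset (hSC (mk_mem_openSimplex _ hw))))
  set s := ∑ i, v i with hs
  have hsv : s ∈ openCone v := sum_mem_openCone v
  have hadd : ∀ {a b : ℝ} {x y : Fin d → ℝ}, 0 < a → 0 < b → x ∈ openCone v → y ∈ openCone v →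
      a • x + b • y ∈ openCone v := by
    rintro a b _ _ ha hb ⟨x, hx, rfl⟩ ⟨y, hy, rfl⟩
    refine ⟨fun i => a * x i + b * y i, fun i => add_pos (mul_pos ha (hx i)) (mul_pos hb (hy i)), ?_⟩
    simp only [Finset.smul_sum, smul_smul, add_smul, Finset.sum_add_distrib]
  have hc : (f s)⁻¹ ≠ 0 := inv_ne_zero (hfw s hsv)
  -- The convex cone `openCone v` contains no zero of `f`, so `f` has constant sign on it; the
  -- factor `(f s)⁻¹` makes the sign positive.
  have hsign : ∀ w ∈ openCone v, 0 < (f s)⁻¹ * f w := fun w hw => by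
    have h1 : 0 < f s * f w := by
      rcases lt_or_gt_of_ne (hfw s hsv) with h1 | h1 <;>
        rcases lt_or_gt_of_ne (hfw w hw) with h2 | h2
      · exact mul_pos_of_neg_of_neg h1 h2
      · exact absurd (by simp only [map_add, map_smul, smul_eq_mul]; ring)
          (hfw _ (hadd h2 (neg_pos.2 h1) hsv hw))
      · exact absurd (by simp only [map_add, map_smul, smul_eq_mul]; ring)
          (hfw _ (hadd (neg_pos.2 h2) h1 hsv hw))
      · exact mul_pos h1 h2
    have h2 : (f s)⁻¹ * f w = (f s * f w) / (f s) ^ 2 := by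
      have := hfw s hsv
      field_simp
    rw [h2]
    have := hfw s hsv
    positivity
  set u : Fin (k + 1) → Fin d → ℝ := fun i => (f s)⁻¹ • v i with hu
  have huC : ∀ w ∈ openCone u, w ∈ coneOver f (openSimplex v) := by
    rintro w ⟨x, hx, rfl⟩
    have hw : ∑ i, x i • v i ∈ openCone v := ⟨x, hx, rfl⟩
    have he : ∑ i, x i • u i = (f s)⁻¹ • ∑ i, x i • v i := by
      rw [Finset.smul_sum]
      exact Finset.sum_congr rfl fun i _ => smul_comm _ _ _
    rw [he]
    refine ⟨by simpa using hsign _ hw, smul_ne_zero hc (hne _ hw), ?_⟩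
    rw [mk_smul_eq (hne _ hw) hc]
    exact mk_mem_openSimplex _ hw
  have hlim : ∀ A : Finset (Fin (k + 1)), ∑ i ∈ A, u i ∈ closure (coneOver f (openSimplex v)) := by
    intro A
    refine mem_closure_of_tendsto (tendsto_add_inv_smul (∑ i ∈ A, u i) (∑ i, u i))
      (Eventually.of_forall fun n => huC _ ?_)
    classical
    refine ⟨fun i => (if i ∈ A then 1 else 0) + ((n : ℝ) + 1)⁻¹, fun i => ?_, ?_⟩
    · have : (0 : ℝ) < ((n : ℝ) + 1)⁻¹ := by positivity
      dsimp only
      split_ifs <;> linarith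
    · simp [add_smul, Finset.sum_add_distrib, Finset.smul_sum]
  have hCl : closure (coneOver f (openSimplex v)) ⊆ closedCone f C :=
    closure_mono (coneOver_mono hSC)
  refine ⟨_, hc, fun i => hCl (by simpa using hlim {i}),
    coneOver_mono (hSC.trans h.subset) (huC _ (sum_mem_openCone u)), fun A hA hAD => ?_⟩
  -- A facet sum in the open cone would represent a point of `C` in the closure of the simplex,
  -- hence, by properness, a point of the simplex. Its nonzero coordinate at `j` contradicts linear
  -- independence.
  have hpC := h.mem_coneOver_of_mem_closedCone (hCl (hlim A)) hAD
  have hpS := hSc ⟨(mk_mem_closure_iff hpC.2.1 hpC.1).2 (hlim A), hpC.2.2⟩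
  obtain ⟨c, hc0, _, ⟨x, hx, rfl⟩, he⟩ := exists_smul_eq_of_mk_mem_openSimplex hpC.2.1 hpS
  obtain ⟨j, hj⟩ : ∃ j, j ∉ A := by
    by_contra hall
    push Not at hall
    exact hA (Finset.eq_univ_iff_forall.2 hall)
  classical
  have h1 : ∑ i, (c * x i - if i ∈ A then (f s)⁻¹ else 0) • v i = 0 := by
    have h2 : ∑ i, (if i ∈ A then (f s)⁻¹ else 0) • v i = ∑ i ∈ A, u i := by
      simp [hu, ite_smul]
    simp only [sub_smul, Finset.sum_sub_distrib, h2, he, mul_smul, Finset.smul_sum, sub_self]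
  have h3 := Fintype.linearIndependent_iff.1 hv _ h1 j
  rw [if_neg hj, sub_zero] at h3
  exact mul_ne_zero hc0 (hx j).ne' h3

theorem isPES_iff {S : Set (RP d)} : IsPES C S ↔ ∃ k, 2 ≤ k ∧ ∃ u : Fin (k + 1) → Fin d → ℝ,
    IsFrame (coneOver f Ω) (closedCone f C) u ∧ S = openSimplex u := by
  have hcc := h.isCocompactCone hf
  constructor
  · rintro ⟨⟨k, hk, v, hv, rfl⟩, hS⟩
    obtain ⟨c, hc, hu⟩ := h.exists_isFrame_smul hf hv hS
    exact ⟨k, hk, _, hu, (openSimplex_smul v hc).symm⟩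
  · rintro ⟨k, hk, u, hu, rfl⟩
    exact ⟨⟨k, hk, u, hcc.pair.linearIndependent_frame (hu.mono hcc.subset), rfl⟩,
      h.isProperlyEmbedded_openSimplex hf hu⟩

theorem exists_equiv_of_openSimplex_eq {k l : ℕ} {u : Fin (k + 1) → Fin d → ℝ}
    (hu : IsFrame (coneOver f Ω) (closedCone f C) u) {v : Fin (l + 1) → Fin d → ℝ}
    (hv : LinearIndependent ℝ v) (huv : openSimplex u = openSimplex v) :
    ∃ (e : Fin (k + 1) ≃ Fin (l + 1)) (c : Fin (k + 1) → ℝ), (∀ i, c i ≠ 0) ∧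
      ∀ i, u i = c i • v (e i) := by
  have hcc := h.isCocompactCone hf
  have hS := h.isProperlyEmbedded_openSimplex hf hu
  rw [huv] at hS
  obtain ⟨c, hc, hcv⟩ := h.exists_isFrame_smul hf hv hS
  obtain ⟨e, a, ha, he⟩ := hcc.pair.exists_equiv_of_openCone_eq (hu.mono hcc.subset)
    (hcv.mono hcc.subset) ((openSimplex_eq_iff hcc.pair hf.1.2 (hu.mono hcc.subset)
      (hcv.mono hcc.subset)).1 (huv.trans (openSimplex_smul v hc).symm))
  exact ⟨e, fun i => a i * c, fun i => mul_ne_zero (ha i).ne' hc, fun i => by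
    rw [he i, mul_smul]⟩

theorem vertices_openSimplex {k : ℕ} {u : Fin (k + 1) → Fin d → ℝ}
    (hu : IsFrame (coneOver f Ω) (closedCone f C) u) (hu0 : ∀ i, u i ≠ 0) :
    vertices (openSimplex u) = range fun i => Projectivization.mk ℝ (u i) (hu0 i) := by
  have hcc := h.isCocompactCone hf
  ext p
  constructor
  · rintro ⟨l, v, hv, huv, j, hp⟩
    obtain ⟨e, c, hc, he⟩ := h.exists_equiv_of_openSimplex_eq hf hu hv huv
    refine ⟨e.symm j, Projectivization.submodule_injective ?_⟩
    rw [Projectivization.submodule_mk, he, e.apply_symm_apply, hp,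
      Submodule.span_singleton_smul_eq (IsUnit.mk0 _ (hc _))]
  · rintro ⟨i, rfl⟩
    exact ⟨k, u, hcc.pair.linearIndependent_frame (hu.mono hcc.subset), rfl, i,
      Projectivization.submodule_mk _ _⟩

theorem eq_of_isSimplexOfDim {k l : ℕ} {u : Fin (k + 1) → Fin d → ℝ}
    (hu : IsFrame (coneOver f Ω) (closedCone f C) u) (hl : IsSimplexOfDim l (openSimplex u)) :
    l = k := by
  obtain ⟨-, v, hv, huv⟩ := hl
  obtain ⟨e, -⟩ := h.exists_equiv_of_openSimplex_eq hf hu hv huv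
  have := Fintype.card_congr e
  simp only [Fintype.card_fin] at this
  omega

theorem isMaximalPES_of_card_le {k : ℕ} (hk : 2 ≤ k) {u : Fin (k + 1) → Fin d → ℝ}
    (hu : IsFrame (coneOver f Ω) (closedCone f C) u)
    (hmax : ∀ (l : ℕ) (w : Fin (l + 1) → Fin d → ℝ), 2 ≤ l →
      IsFrame (coneOver f Ω) (closedCone f C) w → openCone u ⊆ openCone w → l ≤ k) :
    IsMaximalPES C (openSimplex u) := by
  have hcc := h.isCocompactCone hf
  refine ⟨(h.isPES_iff hf).2 ⟨k, hk, u, hu, rfl⟩, fun T hT huT => ?_⟩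
  obtain ⟨l, hl, w, hw, rfl⟩ := (h.isPES_iff hf).1 hT
  have h1 := (openSimplex_subset_iff hcc.pair hf.1.2 (hu.mono hcc.subset) (hw.mono hcc.subset)).1 huT
  refine ((openSimplex_eq_iff hcc.pair hf.1.2 (hu.mono hcc.subset) (hw.mono hcc.subset)).2 ?_).symm
  exact hcc.pair.openCone_eq_of_subset (hu.mono hcc.subset) (hw.mono hcc.subset) h1
    (by simpa using hmax l w hl hw h1)

/-- Needed because `topSimplices` compares a simplex only with maximal ones; enlarging stops since
dimensions are bounded by `d`. -/
theorem exists_isMaximalPES (N : ℕ) : ∀ {k : ℕ}, 2 ≤ k → ∀ {u : Fin (k + 1) → Fin d → ℝ},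
    IsFrame (coneOver f Ω) (closedCone f C) u → d - k ≤ N →
    ∃ l, k ≤ l ∧ ∃ w : Fin (l + 1) → Fin d → ℝ, IsFrame (coneOver f Ω) (closedCone f C) w ∧
      openCone u ⊆ openCone w ∧ IsMaximalPES C (openSimplex w) := by
  have hcc := h.isCocompactCone hf
  have hbd : ∀ {k : ℕ} {u : Fin (k + 1) → Fin d → ℝ},
      IsFrame (coneOver f Ω) (closedCone f C) u → k + 1 ≤ d := fun {k u} hu => by
    simpa using hcc.pair.card_le_finrank (hu.mono hcc.subset)
  induction N with
  | zero =>
    intro k hk u hu hN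
    have := hbd hu
    omega
  | succ N ih =>
    intro k hk u hu hN
    by_cases hmax : ∀ (l : ℕ) (w : Fin (l + 1) → Fin d → ℝ), 2 ≤ l →
      IsFrame (coneOver f Ω) (closedCone f C) w → openCone u ⊆ openCone w → l ≤ k
    · exact ⟨k, le_rfl, u, hu, Subset.rfl, h.isMaximalPES_of_card_le hf hk hu hmax⟩
    · push Not at hmax
      obtain ⟨l, w, hl, hw, huw, hkl⟩ := hmax
      have := hbd hw
      obtain ⟨m, hm, z, hz, hwz, hzm⟩ := ih hl hw (by omega)
      exact ⟨m, by omega, z, hz, huw.trans hwz, hzm⟩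

omit h in
-- The representative of the nearby point may be rescaled by the constant `β`, which turns the bound
-- on a product of two constants into the one-sided normalisation of `Coarse`.
theorem _root_.ConvexProj.IsProperlyConvexDomain.coarse_of_subset_nbhd
    (hd : IsProperlyConvexDomain Ω) {S T : Set (RP d)} (hT : T ⊆ Ω) {r : ℝ}
    (hST : S ⊆ nbhd Ω T r) :
    Coarse (closedCone f Ω) (Real.exp (2 * r)) (coneOver f S) (coneOver f T) := by
  have hP := hd.conePair hf
  intro p hp
  obtain ⟨hpΩ, x, hxT, hlt⟩ := hST hp.2.2
  obtain ⟨x, hx, hx0, rfl⟩ := exists_mem_coneOver_of_mem hxT (hf.1.2 x (hT hxT))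
  have hpD : p ∈ coneOver f Ω := ⟨hp.1, hp.2.1, hpΩ⟩
  have hxD := coneOver_mono hT hx
  obtain ⟨α, β, h1, h2, h3⟩ := (hd.hilbertDist_lt_iff hf hxD hpD).1 hlt
  obtain ⟨hα, hβ, -⟩ := hd.one_le_mul hf hxD hpD h1 h2
  refine ⟨β • x, smul_mem_coneOver hx hβ, h2, ?_⟩
  have : Real.exp (2 * r) • p - β • x = (Real.exp (2 * r) - α * β) • p + β • (α • p - x) := by
    module
  rw [this]
  exact hP.add_mem (hP.smul_mem (by linarith) (hP.subset hpD)) (hP.smul_mem hβ.le h1)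

omit h in
theorem _root_.ConvexProj.IsProperlyConvexDomain.subset_nbhd_of_coarse
    (hd : IsProperlyConvexDomain Ω) {S T : Set (RP d)} (hS : S ⊆ Ω) (hT : T ⊆ Ω) {c r : ℝ}
    (hc : Coarse (closedCone f Ω) c (coneOver f S) (coneOver f T)) (hcr : c < Real.exp (2 * r)) :
    S ⊆ nbhd Ω T r := by
  intro p hp
  obtain ⟨p, hpS, hp0, rfl⟩ := exists_mem_coneOver_of_mem hp (hf.1.2 p (hS hp))
  obtain ⟨q, hq, h1, h2⟩ := hc p hpS
  exact ⟨hS hp, _, hq.2.2, (hd.hilbertDist_lt_iff hf (coneOver_mono hT hq)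
    (coneOver_mono hS hpS)).2 ⟨c, 1, h2, by rwa [one_smul], by rwa [mul_one]⟩⟩

omit h in
theorem _root_.ConvexProj.IsProperlyConvexDomain.iSup_hilbertDist_lt_top_iff
    (hd : IsProperlyConvexDomain Ω) {S T : Set (RP d)} (hS : S ⊆ Ω) (hT : T ⊆ Ω) :
    (⨆ p ∈ S, ⨅ q ∈ T, ENNReal.ofReal (hilbertDist Ω p q)) < ⊤ ↔
      ∃ c, Coarse (closedCone f Ω) c (coneOver f S) (coneOver f T) := by
  have hP := hd.conePair hf
  constructor
  · intro hlt
    set B := ⨆ p ∈ S, ⨅ q ∈ T, ENNReal.ofReal (hilbertDist Ω p q) with hB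
    refine ⟨Real.exp (2 * (B.toReal + 1)), fun p hp => ?_⟩
    have hpD := coneOver_mono hS hp
    have h1 : (⨅ q ∈ T, ENNReal.ofReal (hilbertDist Ω (Projectivization.mk ℝ p hp.2.1) q)) ≤ B :=
      le_iSup₂ (f := fun p (_ : p ∈ S) => ⨅ q ∈ T, ENNReal.ofReal (hilbertDist Ω p q)) _ hp.2.2
    have h2 : B < ENNReal.ofReal (B.toReal + 1) := by
      rw [ENNReal.lt_ofReal_iff_toReal_lt hlt.ne]
      linarith
    obtain ⟨q, hq⟩ := iInf_lt_iff.1 (h1.trans_lt h2)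
    obtain ⟨hqT, hq⟩ := iInf_lt_iff.1 hq
    have h3 := (ENNReal.ofReal_lt_ofReal_iff (by positivity)).1 hq
    obtain ⟨q, hq', hq0, rfl⟩ := exists_mem_coneOver_of_mem hqT (hf.1.2 q (hT hqT))
    have hqD := coneOver_mono hT hq'
    obtain ⟨α, β, h4, h5, h6⟩ := (hd.hilbertDist_lt_iff hf hpD hqD).1 h3
    obtain ⟨hα, hβ, -⟩ := hd.one_le_mul hf hpD hqD h4 h5
    refine ⟨α • q, smul_mem_coneOver hq' hα, h4, ?_⟩
    set E := Real.exp (2 * (B.toReal + 1))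
    have : E • p - α • q = (E - α * β) • p + α • (β • p - q) := by
      module
    rw [this]
    exact hP.add_mem (hP.smul_mem (by linarith) (hP.subset hpD)) (hP.smul_mem hα.le h5)
  · rintro ⟨c, hc⟩
    refine lt_of_le_of_lt (iSup₂_le fun p hp => ?_)
      (ENNReal.ofReal_lt_top (r := 1 / 2 * Real.log (max c 1)))
    obtain ⟨p, hpS, hp0, rfl⟩ := exists_mem_coneOver_of_mem hp (hf.1.2 p (hS hp))
    obtain ⟨q, hq, h1, h2⟩ := hc p hpS
    refine (iInf₂_le _ hq.2.2).trans (ENNReal.ofReal_le_ofReal ?_)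
    refine (hd.hilbertDist_le_iff hf (coneOver_mono hS hpS) (coneOver_mono hT hq)).2
      ⟨1, c, by rwa [one_smul], h2, ?_⟩
    have : (0 : ℝ) < max c 1 := lt_max_of_lt_right one_pos
    rw [one_mul, ← mul_assoc, show (2 : ℝ) * (1 / 2) = 1 by norm_num, one_mul, Real.exp_log this]
    exact le_max_left _ _

/-- A frame violating `IsTop` extends to a maximal simplex of at least its dimension. Conversely, a
simplex contained in a larger one is coarsely contained in it with constant 1, so `IsTop` implies
maximality. -/
theorem mem_topSimplices_iff {S : Set (RP d)} : S ∈ topSimplices Ω C ↔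
    ∃ k, 2 ≤ k ∧ ∃ u : Fin (k + 1) → Fin d → ℝ, IsFrame (coneOver f Ω) (closedCone f C) u ∧
      IsTop (coneOver f Ω) (closedCone f Ω) (closedCone f C) u ∧ S = openSimplex u := by
  have hcc := h.isCocompactCone hf
  have hiff : ∀ {k l : ℕ} {u : Fin (k + 1) → Fin d → ℝ} {w : Fin (l + 1) → Fin d → ℝ},
      IsFrame (coneOver f Ω) (closedCone f C) u → IsFrame (coneOver f Ω) (closedCone f C) w →
      ((⨆ p ∈ openSimplex u, ⨅ q ∈ openSimplex w, ENNReal.ofReal (hilbertDist Ω p q)) < ⊤ ↔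
        ∃ c, Coarse (closedCone f Ω) c (openCone u) (openCone w)) := fun {k l u w} hu hw => by
    rw [h.domain.iSup_hilbertDist_lt_top_iff hf (openSimplex_subset hcc.pair (hu.mono hcc.subset))
      (openSimplex_subset hcc.pair (hw.mono hcc.subset)),
      coneOver_openSimplex hcc.pair (hu.mono hcc.subset),
      coneOver_openSimplex hcc.pair (hw.mono hcc.subset)]
  constructor
  · rintro ⟨hS, hno⟩
    obtain ⟨k, hk, u, hu, rfl⟩ := (h.isPES_iff hf).1 hS.1
    refine ⟨k, hk, u, hu, fun κ _ w hw c hc => ?_, rfl⟩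
    by_contra hlt
    push Not at hlt
    rw [Fintype.card_fin] at hlt
    obtain ⟨l, hl, e, hwe⟩ := hw.exists_fin (by omega)
    have hcard := Fintype.card_congr e
    rw [Fintype.card_fin] at hcard
    obtain ⟨m, hlm, z, hz, hwz, hzm⟩ := h.exists_isMaximalPES hf _ hl hwe le_rfl
    rw [openCone_comp_equiv] at hwz
    exact hno ⟨_, k, m, hzm, ⟨hk, u, hcc.pair.linearIndependent_frame (hu.mono hcc.subset), rfl⟩,
      ⟨by omega, z, hcc.pair.linearIndependent_frame (hz.mono hcc.subset), rfl⟩, by omega,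
      (hiff hu hz).2 ⟨c, hc.mono_right hwz⟩⟩
  · rintro ⟨k, hk, u, hu, htop, rfl⟩
    refine ⟨h.isMaximalPES_of_card_le hf hk hu fun l w hl hw huw => ?_, ?_⟩
    · have := htop _ w hw 1 fun p hp => ⟨p, huw hp, by simpa using hcc.pair.zero_mem,
        by simpa using hcc.pair.zero_mem⟩
      simpa using this
    · rintro ⟨T, k', l, hT, hk', hl, hlt, hsup⟩
      obtain ⟨m, hm, w, hw, rfl⟩ := (h.isPES_iff hf).1 hT.1
      obtain rfl := h.eq_of_isSimplexOfDim hf hu hk'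
      obtain rfl := h.eq_of_isSimplexOfDim hf hw hl
      obtain ⟨c, hc⟩ := (hiff hu hw).1 hsup
      have := htop _ w hw c hc
      simp only [Fintype.card_fin] at this
      omega

end IsNaiveConvexCocompact

end Simplices

/-! ### Open faces -/

section Faces

open Filter Topology

variable {d : ℕ} {f : Module.Dual ℝ (Fin d → ℝ)} {Ω C : Set (RP d)}

theorem IsSharpCone.dom_smul_add_smul {V : Type*} [NormedAddCommGroup V] [NormedSpace ℝ V]
    {f : V →ₗ[ℝ] ℝ} {P : Set V} (h : IsSharpCone f P) {a b : V} (ha : a ∈ P) (hb : b ∈ P)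
    {s t s' t' : ℝ} (hs : 0 < s) (ht : 0 < t) (hs' : 0 < s') (ht' : 0 < t') :
    DomEquiv P (s • a + t • b) (s' • a + t' • b) := by
  have h1 : ∀ {s t s' t' : ℝ}, 0 < s → 0 < t → 0 < s' → 0 < t' →
      Dom P (s • a + t • b) (s' • a + t' • b) := fun {s t s' t'} hs ht hs' ht' =>
    h.dom_add_add (h.smul_dom hs (h.dom_smul hs' (h.dom_refl a)))
      (h.smul_dom ht (h.dom_smul ht' (h.dom_refl b))) (h.smul_mem hs'.le ha) (h.smul_mem ht'.le hb)
  exact ⟨h1 hs ht hs' ht', h1 hs' ht' hs ht⟩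

theorem isProperChart_of_add_mem (hf : f ≠ 0) {X : Set (RP d)} (hX : ∀ p ∈ X, f p.rep ≠ 0)
    (hadd : ∀ {v w}, v ∈ coneOver f X → w ∈ coneOver f X → v + w ∈ coneOver f X)
    (hb : ∃ M, ∀ v ∈ coneOver f X, ‖v‖ ≤ M * f v) : IsProperChart f X := by
  refine ⟨⟨hf, hX⟩, ?_, ?_⟩
  · rw [image_chart_eq hX]
    refine convex_iff_forall_pos.2 fun x hx y hy a b ha hb hab =>
      ⟨hadd (smul_mem_coneOver hx.1 ha) (smul_mem_coneOver hy.1 hb), ?_⟩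
    have hx' : f x = 1 := hx.2
    have hy' : f y = 1 := hy.2
    simp [hx', hy', hab]
  · obtain ⟨M, hM⟩ := hb
    rw [image_chart_eq hX]
    refine isBounded_iff_forall_norm_le.2 ⟨M, fun v hv => ?_⟩
    have := hM v hv.1
    rwa [show f v = 1 from hv.2, mul_one] at this

namespace IsProperlyConvexDomain

variable (h : IsProperlyConvexDomain Ω) (hf : IsProperChart f Ω)
include h hf

theorem mk_mem_closure_iff' {x : Fin d → ℝ} (hx0 : x ≠ 0) (hfx : 0 < f x) :
    Projectivization.mk ℝ x hx0 ∈ closure Ω ↔ x ∈ closedCone f Ω :=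
  mk_mem_closure_iff hx0 hfx

theorem exists_pos_smul_of_mk_eq {x y : Fin d → ℝ} (hfx : 0 < f x) (hfy : 0 < f y) {hx0 : x ≠ 0}
    {hy0 : y ≠ 0} (he : Projectivization.mk ℝ x hx0 = Projectivization.mk ℝ y hy0) :
    ∃ c : ℝ, 0 < c ∧ x = c • y := by
  obtain ⟨c, rfl⟩ := (Projectivization.mk_eq_mk_iff' ℝ _ _ _ _).1 he
  rw [map_smul, smul_eq_mul] at hfx
  exact ⟨c, pos_of_mul_pos_left hfx hfy.le, rfl⟩

/-- Interior points of one segment are positive combinations of the same two vectors and so dominate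
each other. Conversely, mutual domination allows the segment through both points to be prolonged at
both ends. -/
theorem mem_face_iff {x y : Fin d → ℝ} (hx : x ∈ closedCone f Ω) (hx0 : x ≠ 0)
    (hy : y ∈ closedCone f Ω) (hy0 : y ≠ 0) :
    Projectivization.mk ℝ y hy0 ∈ face Ω (Projectivization.mk ℝ x hx0) ↔
      DomEquiv (closedCone f Ω) x y := by
  have hP := h.conePair hf
  have hfx := hP.apply_pos hx hx0
  have hfy := hP.apply_pos hy hy0
  have hxc := (h.mk_mem_closure_iff' hf hx0 hfx).2 hx
  have hyc := (h.mk_mem_closure_iff' hf hy0 hfy).2 hy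
  constructor
  · rintro (he | ⟨-, f', a, b, hf', ha, hb, -, hsx, hsy⟩)
    · obtain ⟨c, hc, rfl⟩ := h.exists_pos_smul_of_mk_eq hf hfy hfx he
      exact hP.domEquiv_smul hc x
    · obtain ⟨ε, hε, hsign⟩ := h.exists_sign hf hf'
      obtain ⟨ca, hca, hae⟩ := h.exists_smul_chart hf hsign ha
      obtain ⟨cb, hcb, hbe⟩ := h.exists_smul_chart hf hsign hb
      obtain ⟨cx, hcx, hxe⟩ := h.exists_smul_chart hf hsign hxc
      obtain ⟨cy, hcy, hye⟩ := h.exists_smul_chart hf hsign hyc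
      have key : ∀ {z : Fin d → ℝ} (hz0 : z ≠ 0) (hfz : 0 < f z) {c : ℝ}, 0 < c →
          chart f' (Projectivization.mk ℝ z hz0) = ε • c • chart f (Projectivization.mk ℝ z hz0) →
          chart f' (Projectivization.mk ℝ z hz0) ∈ openSegment ℝ (chart f' a) (chart f' b) →
          ∃ s t r : ℝ, 0 < s ∧ 0 < t ∧ 0 < r ∧ r • z = s • chart f a + t • chart f b := by
        rintro z hz0 hfz c hc he ⟨s, t, hs, ht, -, hst⟩
        refine ⟨s * ca, t * cb, c * (f z)⁻¹, mul_pos hs hca, mul_pos ht hcb,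
          mul_pos hc (inv_pos.2 hfz), ?_⟩
        rw [he, hae, hbe, chart_mk] at hst
        apply smul_right_injective _ hε
        simp only
        rw [mul_smul, ← hst]
        module
      obtain ⟨s, t, r, hs, ht, hr, h1⟩ := key hx0 hfx hcx hxe hsx
      obtain ⟨s', t', r', hs', ht', hr', h2⟩ := key hy0 hfy hcy hye hsy
      have h3 := hP.dom_smul_add_smul (h.chart_mem_closedCone hf ha) (h.chart_mem_closedCone hf hb)
        hs ht hs' ht'
      rw [← h1, ← h2] at h3
      exact hP.domEquiv_trans (hP.domEquiv_trans (hP.domEquiv_smul hr x) h3)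
        (hP.domEquiv_smul hr' y).symm
  · intro hxy
    by_cases he : Projectivization.mk ℝ y hy0 = Projectivization.mk ℝ x hx0
    · exact Or.inl he
    refine Or.inr ⟨hyc, f, ?_⟩
    set X := chart f (Projectivization.mk ℝ x hx0) with hX
    set Y := chart f (Projectivization.mk ℝ y hy0) with hY
    have hXr := h.apply_rep_ne_zero hf hxc
    have hYr := h.apply_rep_ne_zero hf hyc
    have hXY : X ≠ Y := fun e => he (chart_injective hYr hXr e.symm)
    have hfX : f X = 1 := apply_chart hXr
    have hfY : f Y = 1 := apply_chart hYr
    have hXP : X ∈ closedCone f Ω := h.chart_mem_closedCone hf hxc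
    have hYP : Y ∈ closedCone f Ω := h.chart_mem_closedCone hf hyc
    have hdom : DomEquiv (closedCone f Ω) X Y := by
      rw [hX, hY, chart_mk, chart_mk]
      exact hP.domEquiv_trans (hP.domEquiv_smul (inv_pos.2 hfx) x).symm
        (hP.domEquiv_trans hxy (hP.domEquiv_smul (inv_pos.2 hfy) y))
    obtain ⟨⟨c, hc, h1⟩, ⟨c', hc', h2⟩⟩ := hdom
    -- The vectors `K • X - Y` and `K • Y - X` of the closed cone are the ends of a segment with `X`
    -- and `Y` in its interior. Both have `f`-value `K - 1`, which is positive as `X ≠ Y`.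
    set K := max c c'
    replace h1 := hP.smul_sub_mem_of_le (le_max_left c c') hYP h1
    replace h2 := hP.smul_sub_mem_of_le (le_max_right c c') hXP h2
    change K • Y - X ∈ _ at h1
    change K • X - Y ∈ _ at h2
    have hf1 : f (K • Y - X) = K - 1 := by simp [hfX, hfY]
    have hf2 : f (K • X - Y) = K - 1 := by simp [hfX, hfY]
    have hK1 : 1 < K := by
      have h3 := hP.apply_nonneg h1
      rw [hf1] at h3
      refine lt_of_le_of_ne (by linarith) fun h4 => hXY ?_
      have h5 := hP.eq_zero_of_apply_eq_zero h1 (by rw [hf1]; linarith)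
      rw [← h4, one_smul, sub_eq_zero] at h5
      exact h5.symm
    have hK0 : 0 < K - 1 := by linarith
    have hmk : ∀ {z : Fin d → ℝ}, z ∈ closedCone f Ω → f z = K - 1 → ∃ p ∈ closure Ω,
        chart f p = (K - 1)⁻¹ • z := fun {z} hz hfz => by
      have hfz0 : 0 < f z := hfz ▸ hK0
      have hz0 := ne_zero_of_apply_ne_zero (f := f) hfz0.ne'
      exact ⟨Projectivization.mk ℝ z hz0, (h.mk_mem_closure_iff' hf hz0 hfz0).2 hz, by
        rw [chart_mk, hfz]⟩
    obtain ⟨a, ha, hae⟩ := hmk h2 hf2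
    obtain ⟨b, hb, hbe⟩ := hmk h1 hf1
    have hK2 : 0 < K + 1 := by linarith
    have hw : K / (K + 1) + 1 / (K + 1) = 1 := by field_simp
    refine ⟨a, b, hf, ha, hb, ?_, ?_, ?_⟩
    · rintro rfl
      have h3 : (K - 1)⁻¹ • (K • Y - X) = (K - 1)⁻¹ • (K • X - Y) := hbe.symm.trans hae
      have h4 := smul_right_injective _ (inv_ne_zero hK0.ne') h3
      have h5 : (K + 1) • (X - Y) = 0 := by
        have : (K + 1) • (X - Y) = (K • X - Y) - (K • Y - X) := by module
        rw [this, h4, sub_self]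
      exact hXY (sub_eq_zero.1 ((smul_eq_zero.1 h5).resolve_left hK2.ne'))
    · refine ⟨K / (K + 1), 1 / (K + 1), by positivity, by positivity, hw, ?_⟩
      rw [hae, hbe]
      match_scalars <;> field_simp <;> ring
    · refine ⟨1 / (K + 1), K / (K + 1), by positivity, by positivity, by rwa [add_comm], ?_⟩
      rw [hae, hbe]
      match_scalars <;> field_simp <;> ring

theorem face_subset_closure {p : RP d} (hp : p ∈ closure Ω) : face Ω p ⊆ closure Ω := by
  rintro q (rfl | hq)
  · exact hp
  · exact hq.1

theorem coneOver_face {x : Fin d → ℝ} (hx : x ∈ closedCone f Ω) (hx0 : x ≠ 0) :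
    coneOver f (face Ω (Projectivization.mk ℝ x hx0)) =
      {w | w ∈ closedCone f Ω ∧ DomEquiv (closedCone f Ω) x w} := by
  have hP := h.conePair hf
  have hxc := (h.mk_mem_closure_iff' hf hx0 (hP.apply_pos hx hx0)).2 hx
  ext w
  constructor
  · rintro ⟨h1, hw0, h2⟩
    have hw := (h.mk_mem_closure_iff' hf hw0 h1).1 (h.face_subset_closure hf hxc h2)
    exact ⟨hw, (h.mem_face_iff hf hx hx0 hw hw0).1 h2⟩
  · rintro ⟨hw, h1⟩
    have hw0 := hP.ne_zero_of_dom hx hx0 h1.1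
    exact ⟨hP.apply_pos hw hw0, hw0, (h.mem_face_iff hf hx hx0 hw hw0).2 h1⟩

theorem isProperChart_face {x : Fin d → ℝ} (hx : x ∈ closedCone f Ω) (hx0 : x ≠ 0) :
    IsProperChart f (face Ω (Projectivization.mk ℝ x hx0)) := by
  have hP := h.conePair hf
  have hxc := (h.mk_mem_closure_iff' hf hx0 (hP.apply_pos hx hx0)).2 hx
  refine isProperChart_of_add_mem hf.1.1
    (fun p hp => h.apply_rep_ne_zero hf (h.face_subset_closure hf hxc hp)) ?_ ?_
  · rw [h.coneOver_face hf hx hx0]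
    rintro v w ⟨hv, hxv⟩ ⟨hw, hxw⟩
    exact ⟨hP.add_mem hv hw, hP.dom_add_right hxv.1 hw, hP.dom_add hxv.2 hxw.2⟩
  · obtain ⟨M, -, hM⟩ := hP.bound
    rw [h.coneOver_face hf hx hx0]
    exact ⟨M, fun v hv => hM v hv.1⟩

/-- Each vector of the face is interior to the cone relative to its order span, and the projective
span of the face lies in this order span. -/
theorem isOpenInSpan_face {x : Fin d → ℝ} (hx : x ∈ closedCone f Ω) (hx0 : x ≠ 0) :
    IsOpenInSpan (face Ω (Projectivization.mk ℝ x hx0)) := by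
  have hP := h.conePair hf
  have hxc := (h.mk_mem_closure_iff' hf hx0 (hP.apply_pos hx hx0)).2 hx
  set F := face Ω (Projectivization.mk ℝ x hx0) with hF
  have hFc := h.coneOver_face hf hx hx0
  rw [← hF] at hFc
  set W := hP.domSpan x
  have hrep : ∀ p ∈ F, ∃ v ∈ coneOver f F, ∃ hv : v ≠ 0, p = Projectivization.mk ℝ v hv :=
    fun p hp => exists_mem_coneOver_of_mem hp
      (h.apply_rep_ne_zero hf (h.face_subset_closure hf hxc hp))
  have hFW : ∀ w ∈ coneOver f F, w ∈ W := fun w hw => by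
    rw [hFc] at hw
    exact (hP.mem_domSpan_of_mem hw.1 hx).2 hw.2.2
  have hspan : linSpan F ≤ W := iSup₂_le fun p hp => by
    obtain ⟨v, hv, hv0, rfl⟩ := hrep p hp
    exact (mk_submodule_le_iff hv0 W).2 (hFW v hv)
  have hopen : ∀ e ∈ coneOver f F, ∀ᶠ w in 𝓝 e, w ∈ W → w ∈ coneOver f F := by
    intro e he
    have heW := hFW e he
    rw [hFc] at he
    have h1 := hP.eventually_smul_sub_mem he.1 (ε := 1 / 2) (by norm_num)
    have h2 : Tendsto (fun w => e - w) (𝓝 e) (𝓝 0) := by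
      have : Continuous fun w => e - w := by fun_prop
      simpa using this.tendsto e
    filter_upwards [h2.eventually h1] with w hw hwW
    have h3 := hw (hP.domSpan_mono hx he.1 he.2.1 (W.sub_mem heW hwW))
    have h4 : w - (1 / 2 : ℝ) • e ∈ closedCone f Ω := by
      convert h3 using 1
      module
    have h5 : w ∈ closedCone f Ω := by
      have := hP.add_mem h4 (hP.smul_mem (by norm_num : (0 : ℝ) ≤ 1 / 2) he.1)
      simpa using this
    rw [hFc]
    refine ⟨h5, hP.dom_trans (hP.dom_smul (by norm_num : (0 : ℝ) < 1 / 2) he.2.1) ?_,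
      (hP.mem_domSpan_of_mem h5 hx).1 hwW⟩
    exact hP.dom_of_mem h4
  refine ⟨_, isOpen_image_mk (W := {w | ∀ᶠ w' in 𝓝 w, w' ∈ W → w' ∈ coneOver f F})
    isOpen_setOfPred_eventually_nhds, Subset.antisymm (fun p hp => ?_) ?_⟩
  · obtain ⟨v, hv, hv0, rfl⟩ := hrep p hp
    exact ⟨⟨v, hv0, hopen v hv, rfl⟩, le_iSup₂ (f := fun p (_ : p ∈ F) => p.submodule) _ hp⟩
  · rintro p ⟨⟨v, hv0, hv, rfl⟩, hpF⟩
    exact (hv.self_of_nhds (hspan ((mk_submodule_le_iff hv0 _).1 hpF))).2.2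

theorem face_eq_of_domEquiv {x y : Fin d → ℝ} (hx : x ∈ closedCone f Ω) (hx0 : x ≠ 0)
    (hy : y ∈ closedCone f Ω) (hy0 : y ≠ 0) (hxy : DomEquiv (closedCone f Ω) x y) :
    face Ω (Projectivization.mk ℝ x hx0) = face Ω (Projectivization.mk ℝ y hy0) := by
  have hP := h.conePair hf
  rw [← coneOver_inj (h.isProperChart_face hf hx hx0).1.2 (h.isProperChart_face hf hy hy0).1.2,
    h.coneOver_face hf hx hx0, h.coneOver_face hf hy hy0]
  ext w
  exact ⟨fun hw => ⟨hw.1, hP.domEquiv_trans hxy.symm hw.2⟩,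
    fun hw => ⟨hw.1, hP.domEquiv_trans hxy hw.2⟩⟩

end IsProperlyConvexDomain

namespace IsNaiveConvexCocompact

variable {Λ : Subgroup PGL(d, ℝ)} (h : IsNaiveConvexCocompact Ω C Λ) (hf : IsProperChart f Ω)
include h hf

theorem coneOver_closure_inter_face {x : Fin d → ℝ} (hx : x ∈ closedCone f Ω) (hx0 : x ≠ 0) :
    coneOver f (closure C ∩ face Ω (Projectivization.mk ℝ x hx0)) =
      {w | w ∈ closedCone f C ∧ DomEquiv (closedCone f Ω) x w} := by
  have hcc := h.isCocompactCone hf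
  have hF := h.domain.coneOver_face hf hx hx0
  ext w
  constructor
  · rintro ⟨h1, hw0, h2, h3⟩
    have h4 : w ∈ coneOver f (face Ω (Projectivization.mk ℝ x hx0)) := ⟨h1, hw0, h3⟩
    rw [hF] at h4
    exact ⟨(mk_mem_closure_iff hw0 h1).1 h2, h4.2⟩
  · rintro ⟨hw, h1⟩
    have h2 : w ∈ coneOver f (face Ω (Projectivization.mk ℝ x hx0)) := by
      rw [hF]
      exact ⟨hcc.subset hw, h1⟩
    exact ⟨h2.1, h2.2.1, (mk_mem_closure_iff h2.2.1 h2.1).2 hw, h2.2.2⟩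

theorem isProperChart_closure_inter_face {x : Fin d → ℝ} (hx : x ∈ closedCone f Ω) (hx0 : x ≠ 0) :
    IsProperChart f (closure C ∩ face Ω (Projectivization.mk ℝ x hx0)) := by
  have hcc := h.isCocompactCone hf
  refine isProperChart_of_add_mem hf.1.1
    (fun p hp => (h.domain.isProperChart_face hf hx hx0).1.2 p hp.2) ?_ ?_
  · rw [h.coneOver_closure_inter_face hf hx hx0]
    rintro v w ⟨hv, hxv⟩ ⟨hw, hxw⟩
    exact ⟨hcc.sharp.add_mem hv hw, hcc.pair.dom_add_right hxv.1 (hcc.subset hw),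
      hcc.pair.dom_add hxv.2 hxw.2⟩
  · obtain ⟨M, -, hM⟩ := hcc.sharp.bound
    rw [h.coneOver_closure_inter_face hf hx hx0]
    exact ⟨M, fun v hv => hM v hv.1⟩

/-- In a minimal face the trace of the closure of `C` is compact. -/
theorem isCompact_closure_inter_face {x : Fin d → ℝ}
    (hx : IsMin (closedCone f Ω) (closedCone f C) x) :
    IsCompact (closure C ∩ face Ω (Projectivization.mk ℝ x hx.2.1)) := by
  have hcc := h.isCocompactCone hf
  have hfc : Continuous f := LinearMap.continuous_of_finiteDimensional _
  have hxP := hcc.subset hx.1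
  have hK := h.isProperChart_closure_inter_face hf hxP hx.2.1
  have hcone := h.coneOver_closure_inter_face hf hxP hx.2.1
  obtain ⟨M, hM, hb⟩ := hcc.sharp.bound
  -- This slice of the closed face is compact in general; minimality of `x` says that it contains no
  -- point outside the open face.
  set W : Set (Fin d → ℝ) := {w | w ∈ closedCone f C ∧ f w = 1 ∧ w ∈ hcc.pair.domSpan x} with hW
  have hWc : IsCompact W := by
    refine Metric.isCompact_of_isClosed_isBounded ?_ ?_
    · exact isClosed_closure.inter ((isClosed_eq hfc continuous_const).inter
        (Submodule.closed_of_finiteDimensional _))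
    · refine isBounded_iff_forall_norm_le.2 ⟨M, fun w hw => ?_⟩
      have := hb w hw.1
      rwa [hw.2.1, mul_one] at this
  have hW0 : ∀ w ∈ W, w ≠ 0 := fun w hw =>
    ne_zero_of_apply_ne_zero (f := f) (by rw [hw.2.1]; exact one_ne_zero)
  convert isCompact_image_mk hWc hW0 using 1
  ext p
  constructor
  · intro hp
    have hpr := hK.1.2 p hp
    have hpc := (chart_mem_coneOver_iff hpr).2 hp
    rw [hcone] at hpc
    exact ⟨chart f p, chart_ne_zero hpr, ⟨hpc.1, apply_chart hpr,
      (hcc.pair.mem_domSpan_of_mem (hcc.subset hpc.1) hxP).2 hpc.2.2⟩, (mk_chart _).symm⟩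
  · rintro ⟨w, hw0, hw, rfl⟩
    have h1 := (hcc.pair.mem_domSpan_of_mem (hcc.subset hw.1) hxP).1 hw.2.2
    have h2 : w ∈ coneOver f (closure C ∩ face Ω (Projectivization.mk ℝ x hx.2.1)) := by
      rw [hcone]
      exact ⟨hw.1, hx.2.2 w hw.1 hw0 h1, h1⟩
    exact h2.2.2

theorem mk_mem_closure_inter_face {x : Fin d → ℝ} (hx : x ∈ closedCone f C) (hx0 : x ≠ 0) :
    Projectivization.mk ℝ x hx0 ∈ closure C ∩ face Ω (Projectivization.mk ℝ x hx0) := by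
  have hcc := h.isCocompactCone hf
  have h1 : x ∈ coneOver f (closure C ∩ face Ω (Projectivization.mk ℝ x hx0)) := by
    rw [h.coneOver_closure_inter_face hf (hcc.subset hx) hx0]
    exact ⟨hx, hcc.pair.domEquiv_refl x⟩
  exact h1.2.2

/-- The center of mass of the trace of the closure of `C` in a minimal face lies in this trace. -/
theorem centerOfMass_mem {CoM : Set (RP d) → Set (RP d) → RP d} (hCoM : IsCenterOfMass CoM)
    {x : Fin d → ℝ} (hx : IsMin (closedCone f Ω) (closedCone f C) x) :
    CoM (face Ω (Projectivization.mk ℝ x hx.2.1))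
      (closure C ∩ face Ω (Projectivization.mk ℝ x hx.2.1)) ∈
      closure C ∩ face Ω (Projectivization.mk ℝ x hx.2.1) := by
  have hxP := (h.isCocompactCone hf).subset hx.1
  -- The trace is convex itself, so it is one of the sets intersected in its convex hull.
  refine hCoM.mem_hull _ _ ⟨f, h.domain.isProperChart_face hf hxP hx.2.1⟩
    (h.domain.isOpenInSpan_face hf hxP hx.2.1) inter_subset_right
    ⟨_, h.mk_mem_closure_inter_face hf hx.1 hx.2.1⟩ (h.isCompact_closure_inter_face hf hx) _
    ⟨Subset.rfl, inter_subset_right.trans subset_closure,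
      (h.isProperChart_closure_inter_face hf hxP hx.2.1).isConvex⟩

/-- Elements of `Λ` map the trace of the closure of `C` in a face to such a trace. -/
theorem smul_face {g : PGL(d, ℝ)} {T : (Fin d → ℝ) ≃ₗ[ℝ] (Fin d → ℝ)}
    (hT : T ∈ coneGroup f Ω Λ) (hgT : IsLift g T) {x : Fin d → ℝ} (hx : x ∈ closedCone f Ω)
    (hx0 : x ≠ 0) :
    g • face Ω (Projectivization.mk ℝ x hx0) =
      face Ω (Projectivization.mk ℝ (T x) (T.map_ne_zero_iff.2 hx0)) := by
  have hcc := h.isCocompactCone hf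
  have key : ∀ {g : PGL(d, ℝ)} {T : (Fin d → ℝ) ≃ₗ[ℝ] (Fin d → ℝ)}, T ∈ coneGroup f Ω Λ →
      IsLift g T → ∀ {x : Fin d → ℝ}, x ∈ closedCone f Ω → ∀ hx0 : x ≠ 0,
      g • face Ω (Projectivization.mk ℝ x hx0) ⊆
        face Ω (Projectivization.mk ℝ (T x) (T.map_ne_zero_iff.2 hx0)) := by
    rintro g T hT hgT x hx hx0 _ ⟨p, hp, rfl⟩
    obtain ⟨w, hw, hw0, rfl⟩ := exists_mem_coneOver_of_mem hp
      ((h.domain.isProperChart_face hf hx hx0).1.2 p hp)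
    rw [h.domain.coneOver_face hf hx hx0] at hw
    simp only
    rw [hgT w hw0, h.domain.mem_face_iff hf (hcc.map_closed T hT x hx) _
      (hcc.map_closed T hT w hw.1)]
    exact hw.2.image (hcc.map_closed T hT)
  refine (key hT hgT hx hx0).antisymm fun p hp => ?_
  rw [mem_smul_set_iff_inv_smul_mem]
  have h1 := key (hcc.symm_apply_mem hT) hgT.symm (hcc.map_closed T hT x hx)
    (T.map_ne_zero_iff.2 hx0) (smul_mem_smul_set hp)
  convert h1 using 2
  exact mk_congr (T.symm_apply_apply x).symm

end IsNaiveConvexCocompact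

end Faces

/-! ### The core family -/

section Core

open Filter Topology

variable {d : ℕ} {f : Module.Dual ℝ (Fin d → ℝ)} {Ω C : Set (RP d)}
  {CoM : Set (RP d) → Set (RP d) → RP d}

/-- The representative in the chart of `f` of the center of mass of the trace of the closure of `C`
in the open face of `p`. -/
def faceCenter (CoM : Set (RP d) → Set (RP d) → RP d) (f : Module.Dual ℝ (Fin d → ℝ))
    (Ω C : Set (RP d)) (p : RP d) : Fin d → ℝ :=
  chart f (CoM (face Ω p) (closure C ∩ face Ω p))

theorem isTop_of_parallel {V : Type*} [NormedAddCommGroup V] [NormedSpace ℝ V]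
    {f : V →ₗ[ℝ] ℝ} {D P Q : Set V} (hP : IsConePair f D P) {ι κ : Type} [Fintype ι] [Fintype κ]
    {u : ι → V} {v : κ → V} (hu : IsFrame D P u) (hv : IsFrame D P v) (huv : Parallel P u v)
    (htop : IsTop D P Q u) : IsTop D P Q v := by
  intro μ _ w hw C hc
  rw [← huv.card_eq]
  obtain ⟨C', hC', h1⟩ := hP.coarse_of_parallel hu hv huv
  refine htop μ w hw _ (hP.coarse_trans (le_max_right C 0) h1
    (hP.coarse_mono (le_max_left C 0) (hP.openCone_subset_closed hv) hc))

theorem linSpan_range_mk {ι : Type*} {w : ι → Fin d → ℝ} (hw : ∀ i, w i ≠ 0) :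
    linSpan (range fun i => Projectivization.mk ℝ (w i) (hw i)) = Submodule.span ℝ (range w) := by
  rw [linSpan, iSup_range, Submodule.span_range_eq_iSup]
  exact iSup_congr fun i => Projectivization.submodule_mk _ _

namespace IsNaiveConvexCocompact

variable {Λ : Subgroup PGL(d, ℝ)} (h : IsNaiveConvexCocompact Ω C Λ) (hf : IsProperChart f Ω)
include h hf

theorem faceCenter_spec (hCoM : IsCenterOfMass CoM) {x : Fin d → ℝ}
    (hx : IsMin (closedCone f Ω) (closedCone f C) x) :
    f (faceCenter CoM f Ω C (Projectivization.mk ℝ x hx.2.1)) = 1 ∧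
    faceCenter CoM f Ω C (Projectivization.mk ℝ x hx.2.1) ∈ closedCone f C ∧
    DomEquiv (closedCone f Ω) x (faceCenter CoM f Ω C (Projectivization.mk ℝ x hx.2.1)) ∧
    ∀ h0 : faceCenter CoM f Ω C (Projectivization.mk ℝ x hx.2.1) ≠ 0,
      Projectivization.mk ℝ _ h0 = CoM (face Ω (Projectivization.mk ℝ x hx.2.1))
        (closure C ∩ face Ω (Projectivization.mk ℝ x hx.2.1)) := by
  have hcc := h.isCocompactCone hf
  have hmem := h.centerOfMass_mem hf hCoM hx
  have hr := (h.isProperChart_closure_inter_face hf (hcc.subset hx.1) hx.2.1).1.2 _ hmem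
  have h1 := (chart_mem_coneOver_iff hr).2 hmem
  rw [h.coneOver_closure_inter_face hf (hcc.subset hx.1)] at h1
  exact ⟨apply_chart hr, h1.1, h1.2, fun h0 => mk_chart h0⟩

/-- The simplex of the core family associated with a top-dimensional simplex. -/
theorem coreSimplex_openSimplex (hCoM : IsCenterOfMass CoM) {k : ℕ} {u : Fin (k + 1) → Fin d → ℝ}
    (hu : IsFrame (coneOver f Ω) (closedCone f C) u)
    (hmin : ∀ i, IsMin (closedCone f Ω) (closedCone f C) (u i)) {w : Fin (k + 1) → Fin d → ℝ}
    (hw : ∀ i, w i = faceCenter CoM f Ω C (Projectivization.mk ℝ (u i) (hmin i).2.1)) :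
    IsFrame (coneOver f Ω) (closedCone f C) w ∧ Parallel (closedCone f Ω) u w ∧
      coreSimplex CoM Ω C (openSimplex u) = openSimplex w := by
  have hcc := h.isCocompactCone hf
  have hspec := fun i => h.faceCenter_spec hf hCoM (hmin i)
  simp only [← hw] at hspec
  have hw0 : ∀ i, w i ≠ 0 := fun i =>
    ne_zero_of_apply_ne_zero (f := f) (by rw [(hspec i).1]; exact one_ne_zero)
  have hwf : IsFrame (coneOver f Ω) (closedCone f C) w :=
    hcc.pair.isFrame_of_domEquiv (hu.mono hcc.subset) (fun i => (hspec i).2.1) hcc.subset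
      fun i => (hspec i).2.2.1
  refine ⟨hwf, ⟨Equiv.refl _, fun i => (hspec i).2.2.1⟩, ?_⟩
  have himage : (fun v => CoM (face Ω v) (closure C ∩ face Ω v)) '' vertices (openSimplex u) =
      range fun i => Projectivization.mk ℝ (w i) (hw0 i) := by
    rw [h.vertices_openSimplex hf hu fun i => (hmin i).2.1, ← range_comp]
    congr 1
    ext1 i
    exact ((hspec i).2.2.2 (hw0 i)).symm
  rw [coreSimplex, himage, linSpan_range_mk hw0]
  refine Subset.antisymm ?_ ?_
  · rintro p ⟨hpΩ, hp⟩
    obtain ⟨v, hv, hv0, rfl⟩ := exists_mem_coneOver_of_mem hpΩ (hf.1.2 p hpΩ)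
    exact mk_mem_openSimplex hv0 (hcc.pair.mem_openCone_of_mem_span (hwf.mono hcc.subset) hv
      ((mk_submodule_le_iff hv0 _).1 hp))
  · intro p hp
    refine ⟨openSimplex_subset hcc.pair (hwf.mono hcc.subset) hp, ?_⟩
    obtain ⟨x, hx, hp⟩ := hp
    change p.submodule ≤ _
    rw [hp, Submodule.span_singleton_le_iff_mem]
    exact openCone_subset_span w ⟨x, hx, rfl⟩

variable (hmin : ∀ {k : ℕ}, 2 ≤ k → ∀ {u : Fin (k + 1) → Fin d → ℝ},
  IsFrame (coneOver f Ω) (closedCone f C) u →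
  IsTop (coneOver f Ω) (closedCone f Ω) (closedCone f C) u →
  ∀ i, IsMin (closedCone f Ω) (closedCone f C) (u i))
include hmin

theorem exists_of_mem_coreFamily (hCoM : IsCenterOfMass CoM) {S : Set (RP d)}
    (hS : S ∈ coreFamily CoM Ω C) : ∃ k, 2 ≤ k ∧ ∃ u w : Fin (k + 1) → Fin d → ℝ,
      IsFrame (coneOver f Ω) (closedCone f C) u ∧
      IsTop (coneOver f Ω) (closedCone f Ω) (closedCone f C) u ∧
      IsFrame (coneOver f Ω) (closedCone f C) w ∧
      IsTop (coneOver f Ω) (closedCone f Ω) (closedCone f C) w ∧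
      Parallel (closedCone f Ω) u w ∧
      (∀ i h0, w i = faceCenter CoM f Ω C (Projectivization.mk ℝ (u i) h0)) ∧
      S = openSimplex w := by
  have hcc := h.isCocompactCone hf
  obtain ⟨S, hS, rfl⟩ := hS
  obtain ⟨k, hk, u, hu, htop, rfl⟩ := (h.mem_topSimplices_iff hf).1 hS
  have hmu := hmin hk hu htop
  obtain ⟨h1, h2, h3⟩ := h.coreSimplex_openSimplex hf hCoM hu hmu fun _ => rfl
  exact ⟨k, hk, u, _, hu, htop, h1,
    isTop_of_parallel hcc.pair (hu.mono hcc.subset) (h1.mono hcc.subset) h2 htop, h2,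
    fun i h0 => rfl, h3⟩

theorem coreFamily_subset_topSimplices (hCoM : IsCenterOfMass CoM) :
    coreFamily CoM Ω C ⊆ topSimplices Ω C := by
  intro S hS
  obtain ⟨k, hk, u, w, -, -, hw, htop, -, -, rfl⟩ :=
    h.exists_of_mem_coreFamily hf hmin hCoM hS
  exact (h.mem_topSimplices_iff hf).2 ⟨k, hk, w, hw, htop, rfl⟩

/-- The new vertices lie in the open faces of the old ones, so each core simplex is parallel to the
simplex it comes from. They depend on these faces only, so parallel simplices yield the same core
simplex. -/
theorem isTopFamily_coreFamily (hCoM : IsCenterOfMass CoM) :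
    IsTopFamily (coneOver f Ω) (closedCone f Ω) (closedCone f C) (coneGroup f Ω Λ)
      (coneOver f '' coreFamily CoM Ω C) := by
  have hcc := h.isCocompactCone hf
  have hmem : ∀ {k : ℕ}, 2 ≤ k → ∀ {u w : Fin (k + 1) → Fin d → ℝ},
      IsFrame (coneOver f Ω) (closedCone f C) u →
      IsTop (coneOver f Ω) (closedCone f Ω) (closedCone f C) u →
      (∀ i h0, w i = faceCenter CoM f Ω C (Projectivization.mk ℝ (u i) h0)) →
      IsFrame (coneOver f Ω) (closedCone f C) w ∧ Parallel (closedCone f Ω) u w ∧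
        openCone w ∈ coneOver f '' coreFamily CoM Ω C := fun {k} hk {u w} hu htop hw => by
    have hmu := hmin hk hu htop
    obtain ⟨h1, h2, h3⟩ := h.coreSimplex_openSimplex hf hCoM hu hmu fun i => hw i (hmu i).2.1
    refine ⟨h1, h2, _, ⟨_, (h.mem_topSimplices_iff hf).2 ⟨k, hk, u, hu, htop, rfl⟩, rfl⟩, ?_⟩
    rw [h3, coneOver_openSimplex hcc.pair (h1.mono hcc.subset)]
  have hcases : ∀ σ ∈ coneOver f '' coreFamily CoM Ω C, ∃ k, 2 ≤ k ∧
      ∃ u w : Fin (k + 1) → Fin d → ℝ,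
      IsFrame (coneOver f Ω) (closedCone f C) u ∧
      IsTop (coneOver f Ω) (closedCone f Ω) (closedCone f C) u ∧
      IsFrame (coneOver f Ω) (closedCone f C) w ∧
      IsTop (coneOver f Ω) (closedCone f Ω) (closedCone f C) w ∧
      (∀ i h0, w i = faceCenter CoM f Ω C (Projectivization.mk ℝ (u i) h0)) ∧
      σ = openCone w := by
    rintro _ ⟨S, hS, rfl⟩
    obtain ⟨k, hk, u, w, hu, hut, hw, hwt, -, huw, rfl⟩ :=
      h.exists_of_mem_coreFamily hf hmin hCoM hS
    exact ⟨k, hk, u, w, hu, hut, hw, hwt, huw, coneOver_openSimplex hcc.pair (hw.mono hcc.subset)⟩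
  refine ⟨fun σ hσ => ?_, fun T hT σ hσ => ?_, fun {ι κ} _ _ {v v'} hv hv' hvm hvm' hpar => ?_,
    fun {ι} _ {u} h3 hu htop => ?_⟩
  · obtain ⟨k, hk, u, w, -, -, hw, hwt, -, rfl⟩ := hcases σ hσ
    exact ⟨Fin (k + 1), inferInstance, w, by simpa using hk, hw, hwt, rfl⟩
  · obtain ⟨k, hk, u, w, hu, hut, hw, hwt, huw, rfl⟩ := hcases σ hσ
    obtain ⟨g, hg, hgT⟩ := hT.2.2
    have hTu := hcc.isFrame_image hu hT
    have hTt := hcc.isTop_image hut hT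
    have hmu := hmin hk hu hut
    have hmTu := hmin hk hTu hTt
    obtain ⟨h1, -, h2⟩ := hmem hk hTu hTt (w := fun i =>
      faceCenter CoM f Ω C (Projectivization.mk ℝ (T (u i)) (hmTu i).2.1)) fun i h0 => rfl
    rw [image_openCone]
    have hfT : ∀ i, 0 < f (T (w i)) := fun i => hcc.sharp.apply_pos
      (hcc.map_mem T hT _ (hw.mem i))
      (T.map_ne_zero_iff.2 (hcc.pair.frame_ne_zero (hw.mono hcc.subset) i))
    convert h2 using 1
    -- The image of a center and the center of the image face represent the same point, but only the
    -- latter is normalised by `f = 1`.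
    rw [← openCone_smul (T ∘ w) fun i => inv_pos.2 (hfT i)]
    congr 1
    ext1 i
    have hxP := hcc.subset (hmu i).1
    have hx0 := (hmu i).2.1
    have hw0 := hcc.pair.frame_ne_zero (hw.mono hcc.subset) i
    have hspec := (h.faceCenter_spec hf hCoM (hmu i)).2.2.2
    rw [← huw i] at hspec
    have hCl : g • (closure C ∩ face Ω (Projectivization.mk ℝ (u i) hx0)) =
        closure C ∩ face Ω (Projectivization.mk ℝ (T (u i)) (T.map_ne_zero_iff.2 hx0)) := by
      rw [smul_set_inter, ← closure_smul, h.invariant g hg, h.smul_face hf hT hgT hxP hx0]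
    have heq := hCoM.equivariant _ _ ⟨f, h.domain.isProperChart_face hf hxP hx0⟩
      (h.domain.isOpenInSpan_face hf hxP hx0) inter_subset_right
      ⟨_, h.mk_mem_closure_inter_face hf (hmu i).1 hx0⟩ (h.isCompact_closure_inter_face hf (hmu i)) g
    rw [hCl, h.smul_face hf hT hgT hxP hx0, ← hspec hw0, hgT] at heq
    rw [faceCenter, ← heq, chart_mk]
    rfl
  · obtain ⟨k, hk, u, w, hu, hut, hw, hwt, huw, hvw⟩ := hcases _ hvm
    obtain ⟨k', hk', u', w', hu', hut', hw', hwt', huw', hvw'⟩ := hcases _ hvm'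
    have hpe : ∀ {α β : Type} [Fintype α] [Fintype β] {a : α → Fin d → ℝ} {b : β → Fin d → ℝ},
        IsFrame (coneOver f Ω) (closedCone f C) a → IsFrame (coneOver f Ω) (closedCone f C) b →
        openCone a = openCone b → Parallel (closedCone f Ω) a b :=
      fun {α β} _ _ {a b} ha hb hab => by
      obtain ⟨e, c, hc, he⟩ := hcc.pair.exists_equiv_of_openCone_eq (ha.mono hcc.subset)
        (hb.mono hcc.subset) hab
      exact ⟨e, fun i => by rw [he i]; exact (hcc.pair.domEquiv_smul (hc i) _).symm⟩
    have hmu := hmin hk hu hut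
    have hmu' := hmin hk' hu' hut'
    obtain ⟨e, he⟩ := hcc.pair.parallel_trans (hpe hw hv hvw.symm)
      (hcc.pair.parallel_trans hpar (hpe hv' hw' hvw'))
    rw [hvw, hvw', ← openCone_comp_equiv w' e]
    congr 1
    ext1 i
    have h1 := (h.faceCenter_spec hf hCoM (hmu i)).2.2.1
    have h2 := (h.faceCenter_spec hf hCoM (hmu' (e i))).2.2.1
    rw [← huw i] at h1
    rw [← huw' (e i)] at h2
    have h3 := h.domain.face_eq_of_domEquiv hf (hcc.subset (hmu i).1) (hmu i).2.1
      (hcc.subset (hmu' (e i)).1) (hmu' (e i)).2.1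
      (hcc.pair.domEquiv_trans h1 (hcc.pair.domEquiv_trans (he i) h2.symm))
    rw [huw i (hmu i).2.1, Function.comp_apply, huw' (e i) (hmu' (e i)).2.1, faceCenter, faceCenter,
      h3]
  · obtain ⟨k, hk, e, hue⟩ := hu.exists_fin h3
    have hte : IsTop (coneOver f Ω) (closedCone f Ω) (closedCone f C) (u ∘ e) :=
      isTop_of_openCone_eq htop (openCone_comp_equiv u e).symm (Fintype.card_congr e).symm
    obtain ⟨h1, h2, h4⟩ := hmem hk hue hte (w := fun i => faceCenter CoM f Ω C
      (Projectivization.mk ℝ ((u ∘ e) i) (hmin hk hue hte i).2.1)) fun i h0 => rfl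
    refine ⟨_, _, _, h1, h4, hcc.pair.parallel_trans ⟨e.symm, fun i => ?_⟩ h2⟩
    rw [Function.comp_apply, e.apply_symm_apply]
    exact hcc.pair.domEquiv_refl _

end IsNaiveConvexCocompact

end Core

/-! ### Convergence in the local Hausdorff topology -/

section LocalHausdorff

open Filter Topology

variable {d : ℕ} {f : Module.Dual ℝ (Fin d → ℝ)} {Ω C : Set (RP d)}

namespace IsProperlyConvexDomain

variable (h : IsProperlyConvexDomain Ω) (hf : IsProperChart f Ω)
include h hf

theorem chart_mem {p : RP d} (hp : p ∈ Ω) : chart f p ∈ coneOver f Ω :=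
  (chart_mem_coneOver_iff (hf.1.2 p hp)).2 hp

theorem hilbertDist_lt_iff_chart {p q : RP d} (hp : p ∈ Ω) (hq : q ∈ Ω) {r : ℝ} :
    hilbertDist Ω p q < r ↔ ∃ α β : ℝ, α • chart f q - chart f p ∈ closedCone f Ω ∧
      β • chart f p - chart f q ∈ closedCone f Ω ∧ α * β < Real.exp (2 * r) := by
  rw [← h.hilbertDist_lt_iff hf (h.chart_mem hf hp) (h.chart_mem hf hq), mk_chart, mk_chart]

theorem hilbertDist_le_iff_chart {p q : RP d} (hp : p ∈ Ω) (hq : q ∈ Ω) {r : ℝ} :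
    hilbertDist Ω p q ≤ r ↔ ∃ α β : ℝ, α • chart f q - chart f p ∈ closedCone f Ω ∧
      β • chart f p - chart f q ∈ closedCone f Ω ∧ α * β ≤ Real.exp (2 * r) := by
  rw [← h.hilbertDist_le_iff hf (h.chart_mem hf hp) (h.chart_mem hf hq), mk_chart, mk_chart]

/-- Closed Hilbert balls are compact as seen in the chart: the two constants range over a compact
square, and domination of `chart f x₀` keeps the limit in the open cone. -/
theorem exists_tendsto_chart {α : Type*} {U : Ultrafilter α} {p : α → RP d} {x₀ : RP d}
    (hx₀ : x₀ ∈ Ω) {r : ℝ} (hp : ∀ᶠ n in U, p n ∈ Ω ∧ hilbertDist Ω x₀ (p n) ≤ r) :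
    ∃ q ∈ Ω, Tendsto (fun n => chart f (p n)) U (𝓝 (chart f q)) ∧ hilbertDist Ω x₀ q ≤ r := by
  have hP := h.conePair hf
  have hfc : Continuous f := LinearMap.continuous_of_finiteDimensional _
  have hx1 := apply_chart (hf.1.2 x₀ hx₀)
  set X := chart f x₀ with hX
  set E := Real.exp (2 * r) with hE
  -- Both constants are at least 1 since `f = 1` on both representatives, hence at most `E` because
  -- their product is.
  have h1 : ∀ n, ∃ αβ : ℝ × ℝ, (p n ∈ Ω ∧ hilbertDist Ω x₀ (p n) ≤ r) →
      αβ ∈ Icc (1 : ℝ) E ×ˢ Icc (1 : ℝ) E ∧ αβ.1 • chart f (p n) - X ∈ closedCone f Ω ∧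
      αβ.2 • X - chart f (p n) ∈ closedCone f Ω ∧ αβ.1 * αβ.2 ≤ E := by
    intro n
    by_cases hn : p n ∈ Ω ∧ hilbertDist Ω x₀ (p n) ≤ r
    · obtain ⟨α, β, h1, h2, h3⟩ := (h.hilbertDist_le_iff_chart hf hx₀ hn.1).1 hn.2
      have hpn := apply_chart (hf.1.2 (p n) hn.1)
      have h4 := hP.apply_nonneg h1
      have h5 := hP.apply_nonneg h2
      rw [map_sub, map_smul, smul_eq_mul, hx1, hpn] at h4 h5
      refine ⟨(α, β), fun _ => ⟨⟨⟨by linarith, ?_⟩, ⟨by linarith, ?_⟩⟩, h1, h2, h3⟩⟩ <;> nlinarith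
    · exact ⟨(0, 0), fun h => absurd h hn⟩
  choose αβ hαβ using h1
  obtain ⟨⟨α, β⟩, hmem, hlim⟩ := (isCompact_Icc.prod isCompact_Icc).ultrafilter_le_nhds
    (U.map αβ) (le_principal_iff.2 (mem_map.2 (hp.mono fun n hn => (hαβ n hn).1)))
  have hlim' : Tendsto αβ U (𝓝 (α, β)) := hlim
  have hα : Tendsto (fun n => (αβ n).1) U (𝓝 α) := (continuous_fst.tendsto _).comp hlim'
  have hβ : Tendsto (fun n => (αβ n).2) U (𝓝 β) := (continuous_snd.tendsto _).comp hlim'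
  obtain ⟨y, hy⟩ := hP.exists_tendsto (U := U) (x := fun n => chart f (p n))
    (hp.mono fun n hn => hP.subset (h.chart_mem hf hn.1))
    (hp.mono fun n hn => (hαβ n hn).2.2.1) (hβ.smul_const X)
  have hy1 : α • y - X ∈ closedCone f Ω := isClosed_closure.mem_of_tendsto
    ((hα.smul hy).sub_const X) (hp.mono fun n hn => (hαβ n hn).2.1)
  have hy2 : β • X - y ∈ closedCone f Ω := isClosed_closure.mem_of_tendsto
    ((hβ.smul_const X).sub hy) (hp.mono fun n hn => (hαβ n hn).2.2.1)
  have hyf : f y = 1 := tendsto_nhds_unique ((hfc.tendsto y).comp hy)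
    (tendsto_const_nhds.congr' (hp.mono fun n hn => (apply_chart (hf.1.2 (p n) hn.1)).symm))
  have hα0 : 0 < α := one_pos.trans_le hmem.1.1
  have hyD : y ∈ coneOver f Ω := hP.mem_of_dom (h.chart_mem hf hx₀) ⟨α, hα0, hy1⟩
  have hye : chart f (Projectivization.mk ℝ y hyD.2.1) = y := by
    rw [chart_mk, hyf, inv_one, one_smul]
  refine ⟨_, hyD.2.2, by rwa [hye], (h.hilbertDist_le_iff_chart hf hx₀ hyD.2.2).2
    ⟨α, β, by rwa [hye], by rwa [hye], ?_⟩⟩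
  exact le_of_tendsto (hα.mul hβ) (hp.mono fun n hn => (hαβ n hn).2.2.2)

/-- Increasing both constants by a small `δ` moves the two differences into the open cone, where the
bounds persist for nearby points. -/
theorem eventually_hilbertDist_lt {α : Type*} {l : Filter α} {p p' : α → RP d} {q q' : RP d}
    (hp : ∀ᶠ n in l, p n ∈ Ω) (hp' : ∀ᶠ n in l, p' n ∈ Ω) (hq : q ∈ Ω) (hq' : q' ∈ Ω)
    (hpq : Tendsto (fun n => chart f (p n)) l (𝓝 (chart f q)))
    (hpq' : Tendsto (fun n => chart f (p' n)) l (𝓝 (chart f q'))) {ε : ℝ}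
    (hε : hilbertDist Ω q q' < ε) : ∀ᶠ n in l, hilbertDist Ω (p n) (p' n) < ε := by
  have hP := h.conePair hf
  obtain ⟨a, b, h1, h2, h3⟩ := (h.hilbertDist_lt_iff_chart hf hq hq').1 hε
  obtain ⟨δ, hδ0, hδ⟩ : ∃ δ : ℝ, 0 < δ ∧ (a + δ) * (b + δ) < Real.exp (2 * ε) := by
    have hc : Tendsto (fun δ : ℝ => (a + δ) * (b + δ)) (𝓝[>] 0) (𝓝 ((a + 0) * (b + 0))) :=
      (Continuous.tendsto (by fun_prop) 0).mono_left nhdsWithin_le_nhds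
    rw [add_zero, add_zero] at hc
    obtain ⟨δ, h4, h5⟩ := ((hc.eventually (gt_mem_nhds h3)).and self_mem_nhdsWithin).exists
    exact ⟨δ, h5, h4⟩
  have key : ∀ {x y : α → Fin d → ℝ} {x₀ y₀ : Fin d → ℝ} {c : ℝ}, Tendsto x l (𝓝 x₀) →
      Tendsto y l (𝓝 y₀) → y₀ ∈ coneOver f Ω → c • y₀ - x₀ ∈ closedCone f Ω →
      ∀ᶠ n in l, (c + δ) • y n - x n ∈ closedCone f Ω := by
    intro x y x₀ y₀ c hx hy hy₀ hc
    have h4 : (c + δ) • y₀ - x₀ ∈ coneOver f Ω := by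
      have := hP.interior_add_mem (hP.interior_smul_mem hδ0 hy₀) hc
      convert this using 1
      module
    exact (((hy.const_smul (c + δ)).sub hx).eventually (hP.isOpen.mem_nhds h4)).mono
      fun n hn => hP.subset hn
  filter_upwards [hp, hp', key hpq hpq' (h.chart_mem hf hq') h1,
    key hpq' hpq (h.chart_mem hf hq) h2] with n n1 n2 n3 n4
  exact (h.hilbertDist_lt_iff_chart hf n1 n2).2 ⟨_, _, n3, n4, hδ⟩

/-- Simplices converge in the local Hausdorff topology if their vertices converge. -/
theorem tendsto_closedSubset {α : Type*} {U : Ultrafilter α} {A : α → ClosedSubset Ω}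
    {B : ClosedSubset Ω} {k : ℕ} {v : α → Fin (k + 1) → Fin d → ℝ} {x : Fin (k + 1) → Fin d → ℝ}
    (hv : ∀ᶠ n in U, IsFrame (coneOver f Ω) (closedCone f Ω) (v n) ∧
      (A n).carrier = openSimplex (v n))
    (hx : IsFrame (coneOver f Ω) (closedCone f Ω) x) (hB : B.carrier = openSimplex x)
    (hlim : ∀ i, Tendsto (fun n => v n i) U (𝓝 (x i))) : Tendsto A U (𝓝 B) := by
  have hP := h.conePair hf
  have hfc : Continuous f := LinearMap.continuous_of_finiteDimensional _
  rw [TopologicalSpace.tendsto_nhds_generateFrom_iff]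
  rintro _ ⟨C₀, x₀, r, ε, hx₀, hr, hε, rfl⟩ ⟨hB1, hB2⟩
  -- Points violating this stay in a Hilbert ball and converge to a point of `B`, which is strictly
  -- closer than `ε` to some point of `C₀`; so are the nearby violating points.
  have h1 : ∀ᶠ n in U, ∀ p ∈ (A n).carrier, hilbertDist Ω x₀ p ≤ r →
      ∃ q ∈ C₀.carrier, hilbertDist Ω p q < ε := by
    by_contra hno
    rw [← Ultrafilter.eventually_not] at hno
    have h2 : ∀ n, ∃ p, (¬ ∀ p ∈ (A n).carrier, hilbertDist Ω x₀ p ≤ r →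
        ∃ q ∈ C₀.carrier, hilbertDist Ω p q < ε) → p ∈ (A n).carrier ∧
        hilbertDist Ω x₀ p ≤ r ∧ ∀ q ∈ C₀.carrier, ¬ hilbertDist Ω p q < ε := by
      intro n
      by_cases hn : ∀ p ∈ (A n).carrier, hilbertDist Ω x₀ p ≤ r →
        ∃ q ∈ C₀.carrier, hilbertDist Ω p q < ε
      · exact ⟨x₀, fun h => absurd hn h⟩
      · push Not at hn
        obtain ⟨p, h3, h4, h5⟩ := hn
        exact ⟨p, fun _ => ⟨h3, h4, fun q hq => not_lt.2 (h5 q hq)⟩⟩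
    choose p hp using h2
    have hp' := hno.mono fun n hn => hp n hn
    obtain ⟨q, hq, hpq, hqr⟩ := h.exists_tendsto_chart hf (p := p) hx₀
      (hp'.mono fun n hn => ⟨(A n).subset hn.1, hn.2.1⟩)
    have hcone : ∀ᶠ n in U, ∃ t : Fin (k + 1) → ℝ, (∀ i, 0 < t i) ∧
        chart f (p n) = ∑ i, t i • v n i := by
      filter_upwards [hp', hv] with n n1 n2
      have h3 := (chart_mem_coneOver_iff (hf.1.2 _ ((A n).subset n1.1))).2 n1.1
      rwa [n2.2, coneOver_openSimplex hP n2.1] at h3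
    have h3 : ∀ n, ∃ t : Fin (k + 1) → ℝ, (∃ t : Fin (k + 1) → ℝ, (∀ i, 0 < t i) ∧
        chart f (p n) = ∑ i, t i • v n i) → (∀ i, 0 < t i) ∧ chart f (p n) = ∑ i, t i • v n i :=
      fun n => by
      by_cases hn : ∃ t : Fin (k + 1) → ℝ, (∀ i, 0 < t i) ∧ chart f (p n) = ∑ i, t i • v n i
      · obtain ⟨t, ht⟩ := hn
        exact ⟨t, fun _ => ht⟩
      · exact ⟨0, fun h => absurd h hn⟩
    choose t ht using h3
    obtain ⟨s, -, hs0, hse⟩ := hP.exists_tendsto_coeff (U := U) (u := v) (v := x) (t := t)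
      (hv.mono fun n hn i => hn.1.mem i) (hP.frame_ne_zero hx) hlim
      (hcone.mono fun n hn i => ((ht n hn).1 i).le)
      (hpq.congr' (hcone.mono fun n hn => (ht n hn).2))
    have hqD := h.chart_mem hf hq
    have hqB : q ∈ B.carrier := by
      rw [hB, ← mk_chart hqD.2.1]
      exact mk_mem_openSimplex _ ⟨s, fun i => hP.coeff_pos hx hs0 (hse ▸ hqD) i, hse⟩
    obtain ⟨q', hq', hlt⟩ := hB1 q hqB hqr
    have h4 := h.eventually_hilbertDist_lt hf (hp'.mono fun n hn => (A n).subset hn.1)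
      (Eventually.of_forall fun _ => C₀.subset hq') hq (C₀.subset hq') hpq tendsto_const_nhds hlt
    obtain ⟨n, n1, n2⟩ := (h4.and hp').exists
    exact n2.2.2 q' hq' n1
  -- Violating points of `C₀` converge in the closed set `C₀`. A point of `B` close to the limit is
  -- approximated by the points of `A n` with the same coefficients.
  have h2 : ∀ᶠ n in U, ∀ p ∈ C₀.carrier, hilbertDist Ω x₀ p ≤ r →
      ∃ q ∈ (A n).carrier, hilbertDist Ω p q < ε := by
    by_contra hno
    rw [← Ultrafilter.eventually_not] at hno
    have h2 : ∀ n, ∃ p, (¬ ∀ p ∈ C₀.carrier, hilbertDist Ω x₀ p ≤ r →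
        ∃ q ∈ (A n).carrier, hilbertDist Ω p q < ε) → p ∈ C₀.carrier ∧
        hilbertDist Ω x₀ p ≤ r ∧ ∀ q ∈ (A n).carrier, ¬ hilbertDist Ω p q < ε := by
      intro n
      by_cases hn : ∀ p ∈ C₀.carrier, hilbertDist Ω x₀ p ≤ r →
        ∃ q ∈ (A n).carrier, hilbertDist Ω p q < ε
      · exact ⟨x₀, fun h => absurd hn h⟩
      · push Not at hn
        obtain ⟨p, h3, h4, h5⟩ := hn
        exact ⟨p, fun _ => ⟨h3, h4, fun q hq => not_lt.2 (h5 q hq)⟩⟩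
    choose p hp using h2
    have hp' := hno.mono fun n hn => hp n hn
    obtain ⟨q, hq, hpq, hqr⟩ := h.exists_tendsto_chart hf (p := p) hx₀
      (hp'.mono fun n hn => ⟨C₀.subset hn.1, hn.2.1⟩)
    have hqD := h.chart_mem hf hq
    have hqC : q ∈ C₀.carrier := by
      refine C₀.closed ⟨?_, hq⟩
      rw [← mk_chart hqD.2.1, mk_mem_closure_iff hqD.2.1 hqD.1]
      exact mem_closure_of_tendsto hpq (hp'.mono fun n hn =>
        (chart_mem_coneOver_iff (hf.1.2 _ (C₀.subset hn.1))).2 hn.1)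
    obtain ⟨q', hq', hlt⟩ := hB2 q hqC hqr
    have hq'Ω := B.subset hq'
    have hq'D := h.chart_mem hf hq'Ω
    obtain ⟨t, ht, hte⟩ : chart f q' ∈ openCone x := by
      rw [← coneOver_openSimplex hP hx, ← hB]
      exact (chart_mem_coneOver_iff (hf.1.2 _ hq'Ω)).2 hq'
    have hfr : ∀ᶠ n in U, ∑ i, t i • v n i ∈ coneOver f Ω ∧
        ∀ h0, Projectivization.mk ℝ (∑ i, t i • v n i) h0 ∈ (A n).carrier := by
      filter_upwards [hv] with n hn
      refine ⟨hP.openCone_subset_interior hn.1 ⟨t, ht, rfl⟩, fun h0 => ?_⟩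
      rw [hn.2]
      exact mk_mem_openSimplex h0 ⟨t, ht, rfl⟩
    have h3 : ∀ n, ∃ p' : RP d, (∑ i, t i • v n i ∈ coneOver f Ω ∧
        ∀ h0, Projectivization.mk ℝ (∑ i, t i • v n i) h0 ∈ (A n).carrier) →
        p' ∈ (A n).carrier ∧ chart f p' = (f (∑ i, t i • v n i))⁻¹ • ∑ i, t i • v n i := fun n => by
      by_cases hn : ∑ i, t i • v n i ∈ coneOver f Ω ∧
        ∀ h0, Projectivization.mk ℝ (∑ i, t i • v n i) h0 ∈ (A n).carrier
      · exact ⟨_, fun _ => ⟨hn.2 hn.1.2.1, chart_mk _⟩⟩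
      · exact ⟨x₀, fun h => absurd h hn⟩
    choose p' hp'' using h3
    have hvl : Tendsto (fun n => ∑ i, t i • v n i) U (𝓝 (chart f q')) := by
      rw [hte]
      exact tendsto_finsetSum _ fun i _ => (hlim i).const_smul (t i)
    have hpl : Tendsto (fun n => chart f (p' n)) U (𝓝 (chart f q')) := by
      have h5 := (((hfc.tendsto _).comp hvl).inv₀ hq'D.1.ne').smul hvl
      rw [apply_chart (hf.1.2 _ hq'Ω), inv_one, one_smul] at h5
      exact h5.congr' (hfr.mono fun n hn => (hp'' n hn).2.symm)
    have h4 := h.eventually_hilbertDist_lt hf (hp'.mono fun n hn => C₀.subset hn.1)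
      (hfr.mono fun n hn => (A n).subset (hp'' n hn).1) hq hq'Ω hpq hpl hlt
    obtain ⟨n, n1, n2, n3⟩ := (h4.and (hp'.and hfr)).exists
    exact n2.2.2 _ (hp'' n n3).1 n1
  filter_upwards [h1, h2] with n n1 n2 using ⟨n1, n2⟩

end IsProperlyConvexDomain

end LocalHausdorff

/-! ### Isolated families and the core family -/

section Families

open Filter Topology

variable {d : ℕ} {f : Module.Dual ℝ (Fin d → ℝ)} {Ω C : Set (RP d)} {𝒮 : Set (Set (RP d))}

namespace IsNaiveConvexCocompact

variable {Λ : Subgroup PGL(d, ℝ)} (h : IsNaiveConvexCocompact Ω C Λ) (hf : IsProperChart f Ω)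
include h hf

theorem image_coneOver {g : PGL(d, ℝ)} {T : (Fin d → ℝ) ≃ₗ[ℝ] (Fin d → ℝ)}
    (hT : T ∈ coneGroup f Ω Λ) (hgT : IsLift g T) {S : Set (RP d)} (hS : S ⊆ Ω) :
    T '' coneOver f S = coneOver f (g • S) := by
  have key : ∀ {g : PGL(d, ℝ)} {T : (Fin d → ℝ) ≃ₗ[ℝ] (Fin d → ℝ)}, T ∈ coneGroup f Ω Λ →
      IsLift g T → ∀ {S : Set (RP d)}, S ⊆ Ω → T '' coneOver f S ⊆ coneOver f (g • S) := by
    rintro g T hT hgT S hS _ ⟨v, hv, rfl⟩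
    have h1 := hT.1 v (coneOver_mono hS hv)
    refine ⟨h1.1, h1.2.1, ?_⟩
    rw [← hgT v hv.2.1]
    exact smul_mem_smul_set hv.2.2
  refine (key hT hgT hS).antisymm fun v hv => ?_
  have hgS : g • S ⊆ Ω := by
    rintro _ ⟨p, hp, rfl⟩
    obtain ⟨v, hv, hv0, rfl⟩ := exists_mem_coneOver_of_mem (hS hp) (hf.1.2 p (hS hp))
    simp only
    rw [hgT v hv0]
    exact (hT.1 v hv).2.2
  have h1 := key ((coneGroup f Ω Λ).inv_mem hT) hgT.symm hgS (mem_image_of_mem _ hv)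
  rw [inv_smul_smul] at h1
  exact ⟨_, h1, T.apply_symm_apply v⟩

theorem image_coneOver_mem (hPES : ∀ S ∈ 𝒮, IsPES C S) (hinv : IsInvariantFamily Λ 𝒮) :
    ∀ T ∈ coneGroup f Ω Λ, ∀ σ ∈ coneOver f '' 𝒮, T '' σ ∈ coneOver f '' 𝒮 := by
  rintro T hT _ ⟨S, hS, rfl⟩
  obtain ⟨g, hg, hgT⟩ := hT.2.2
  refine ⟨g • S, hinv g hg S hS, (h.image_coneOver hf hT hgT ?_).symm⟩
  exact (hPES S hS).2.choose.trans h.subset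

theorem isInvariantFamily_of_image_mem (hPES : ∀ S ∈ 𝒮, IsPES C S)
    (hinv : ∀ T ∈ coneGroup f Ω Λ, ∀ σ ∈ coneOver f '' 𝒮, T '' σ ∈ coneOver f '' 𝒮) :
    IsInvariantFamily Λ 𝒮 := by
  intro g hg S hS
  obtain ⟨T, hT, hgT⟩ := exists_isLift_mem_coneGroup hf.1.2 hf.isConvex h.le_aut hg
  have hSΩ := (hPES S hS).2.choose.trans h.subset
  obtain ⟨S', hS', he⟩ := hinv T hT _ ⟨S, hS, rfl⟩
  rw [h.image_coneOver hf hT hgT hSΩ] at he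
  have hgS : g • S ⊆ Ω := by
    rintro _ ⟨p, hp, rfl⟩
    exact smul_mem_of_mem_Aut (h.le_aut hg) (hSΩ hp)
  rw [coneOver_inj (fun p hp => hf.1.2 p (h.subset ((hPES S' hS').2.choose hp)))
    (fun p hp => hf.1.2 p (hgS hp))] at he
  exact he ▸ hS'

/-- Infinitely many distinct simplices meeting `K` would subconverge, vertex by vertex, to a limit
simplex. It belongs to the family because the family is closed, and it is not isolated in it. -/
theorem finite_of_isIsolated (hPES : ∀ S ∈ 𝒮, IsPES C S) (hiso : IsIsolated Ω 𝒮)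
    {K : Set (Fin d → ℝ)} (hKD : K ⊆ coneOver f Ω) (hK : IsCompact K) :
    {σ ∈ coneOver f '' 𝒮 | (σ ∩ K).Nonempty}.Finite := by
  have hcc := h.isCocompactCone hf
  have hP := hcc.pair
  by_contra hinf
  let e := Set.Infinite.natEmbedding _ hinf
  have hS : ∀ n, ∃ S ∈ 𝒮, coneOver f S = (e n).1 := fun n => (e n).2.1
  choose S hS hSe using hS
  have hSinj : Function.Injective S := fun m n hmn => e.injective (Subtype.ext (by
    rw [← hSe, ← hSe, hmn]))
  -- The frame is rescaled so that its sum is a point of `K`; this bounds the vertices and keeps the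
  -- limit sum in the open cone.
  have hframe : ∀ n, ∃ k ∈ Iic d, ∃ v : Fin (k + 1) → Fin d → ℝ,
      IsFrame (coneOver f Ω) (closedCone f C) v ∧ S n = openSimplex v ∧ ∑ i, v i ∈ K := by
    intro n
    obtain ⟨k, -, u, hu, huS⟩ := (h.isPES_iff hf).1 (hPES _ (hS n))
    obtain ⟨s, hs, hsK⟩ := (e n).2.2
    rw [← hSe, huS, coneOver_openSimplex hP (hu.mono hcc.subset)] at hs
    obtain ⟨t, ht, rfl⟩ := hs
    have hv := hP.isFrame_smul hcc.sharp hcc.subset hu ht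
    have hkd := hP.card_le_finrank (hu.mono hcc.subset)
    simp only [Fintype.card_fin, Module.finrank_fin_fun] at hkd
    refine ⟨k, mem_Iic.2 (by omega), _, hv, ?_, hsK⟩
    rw [huS, openSimplex_eq_iff hP hf.1.2 (hu.mono hcc.subset) (hv.mono hcc.subset),
      openCone_smul u ht]
  obtain ⟨k, -, hk⟩ := (Ultrafilter.eventually_exists_mem_iff (f := hyperfilter ℕ)
    (finite_Iic d)).1 (Eventually.of_forall hframe)
  have h1 : ∀ n, ∃ v : Fin (k + 1) → Fin d → ℝ, (∃ v : Fin (k + 1) → Fin d → ℝ,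
      IsFrame (coneOver f Ω) (closedCone f C) v ∧ S n = openSimplex v ∧ ∑ i, v i ∈ K) →
      IsFrame (coneOver f Ω) (closedCone f C) v ∧ S n = openSimplex v ∧ ∑ i, v i ∈ K := fun n => by
    by_cases hn : ∃ v : Fin (k + 1) → Fin d → ℝ,
      IsFrame (coneOver f Ω) (closedCone f C) v ∧ S n = openSimplex v ∧ ∑ i, v i ∈ K
    · obtain ⟨v, hv⟩ := hn
      exact ⟨v, fun _ => hv⟩
    · exact ⟨0, fun h => absurd h hn⟩
  choose v hv using h1
  replace hv := hk.mono fun n hn => hv n hn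
  obtain ⟨a, haK, ha⟩ := hK.ultrafilter_le_nhds ((hyperfilter ℕ).map fun n => ∑ i, v n i)
    (le_principal_iff.2 (mem_map.2 (hv.mono fun n hn => hn.2.2)))
  replace ha : Tendsto (fun n => ∑ i, v n i) (hyperfilter ℕ) (𝓝 a) := ha
  have hvx : ∀ i, ∃ x, Tendsto (fun n => v n i) (hyperfilter ℕ) (𝓝 x) := fun i => by
    refine hcc.sharp.exists_tendsto (hv.mono fun n hn => hn.1.mem i)
      (hv.mono fun n hn => ?_) ha
    rw [← Finset.sum_erase_eq_sub (Finset.mem_univ i)]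
    exact hcc.sharp.sum_mem fun j _ => hn.1.mem j
  choose x hx using hvx
  have hxs : ∑ i, x i = a := tendsto_nhds_unique (tendsto_finsetSum _ fun i _ => hx i) ha
  have hxf : IsFrame (coneOver f Ω) (closedCone f C) x :=
    hP.isFrame_of_tendsto hcc.sharp (hv.mono fun n hn => hn.1) hx (hxs ▸ hKD haK)
  have hclosed : ∀ {k : ℕ} {u : Fin (k + 1) → Fin d → ℝ},
      IsFrame (coneOver f Ω) (closedCone f C) u → (openSimplex u).Nonempty ∧
      openSimplex u ⊆ Ω ∧ closure (openSimplex u) ∩ Ω ⊆ openSimplex u := fun {k u} hu => by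
    have h2 := hP.openCone_subset_interior (hu.mono hcc.subset) (sum_mem_openCone u)
    exact ⟨⟨_, mk_mem_openSimplex h2.2.1 (sum_mem_openCone u)⟩,
      openSimplex_subset hP (hu.mono hcc.subset),
      closure_openSimplex_inter_subset hP hf.1.2 (hu.mono hcc.subset)⟩
  have hclS : ∀ n, (S n).Nonempty ∧ S n ⊆ Ω ∧ closure (S n) ∩ Ω ⊆ S n := fun n => by
    obtain ⟨k, -, u, hu, huS, -⟩ := hframe n
    rw [huS]
    exact hclosed hu
  let A : ℕ → ClosedSubset Ω := fun n => ⟨S n, (hclS n).1, (hclS n).2.1, (hclS n).2.2⟩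
  let B : ClosedSubset Ω := ⟨openSimplex x, (hclosed hxf).1, (hclosed hxf).2.1, (hclosed hxf).2.2⟩
  have hAB : Tendsto A (hyperfilter ℕ) (𝓝 B) :=
    h.domain.tendsto_closedSubset hf (v := v) (hv.mono fun n hn => ⟨hn.1.mono hcc.subset, hn.2.1⟩)
      (hxf.mono hcc.subset) rfl hx
  have hB : B ∈ {A : ClosedSubset Ω | A.carrier ∈ 𝒮} :=
    hiso.1.mem_of_tendsto hAB (Eventually.of_forall hS)
  have hdisc := discreteTopology_subtype_iff.1 hiso.2 B hB
  -- The `S n` are distinct, so at most one of them equals the limit.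
  have hne : ∀ᶠ n in (hyperfilter ℕ : Filter ℕ), A n ≠ B := by
    have hfin : {n | A n = B}.Finite := Set.Subsingleton.finite fun m hm n hn =>
      hSinj (congrArg ClosedSubset.carrier ((show A m = B from hm).trans (show A n = B from hn).symm))
    exact hyperfilter_le_cofinite hfin.compl_mem_cofinite
  have hle : Tendsto A (hyperfilter ℕ) (𝓝[≠] B ⊓ 𝓟 {A : ClosedSubset Ω | A.carrier ∈ 𝒮}) :=
    tendsto_inf.2 ⟨tendsto_nhdsWithin_iff.2 ⟨hAB, hne⟩,
      tendsto_principal.2 (Eventually.of_forall hS)⟩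
  rw [hdisc] at hle
  exact (hyperfilter ℕ).neBot.ne (map_eq_bot_iff.1 (le_bot_iff.1 hle))

theorem isSimplexFamily_of_isIsolated (hPES : ∀ S ∈ 𝒮, IsPES C S) (hiso : IsIsolated Ω 𝒮)
    (hinv : IsInvariantFamily Λ 𝒮) :
    IsSimplexFamily (coneOver f Ω) (closedCone f C) (coneGroup f Ω Λ) (coneOver f '' 𝒮) := by
  have hcc := h.isCocompactCone hf
  refine ⟨?_, h.image_coneOver_mem hf hPES hinv, fun K hKD hK => h.finite_of_isIsolated hf hPES hiso
    hKD hK⟩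
  rintro _ ⟨S, hS, rfl⟩
  obtain ⟨k, hk, u, hu, rfl⟩ := (h.isPES_iff hf).1 (hPES _ hS)
  exact ⟨Fin (k + 1), inferInstance, u, by simpa using hk, hu,
    coneOver_openSimplex hcc.pair (hu.mono hcc.subset)⟩

theorem exists_isConeComplete (hPES : ∀ S ∈ 𝒮, IsPES C S) (hcomp : IsCoarselyComplete Ω C 𝒮) :
    ∃ c > 0, IsConeComplete (coneOver f Ω) (closedCone f Ω) (closedCone f C) c
      (coneOver f '' 𝒮) := by
  have hcc := h.isCocompactCone hf
  obtain ⟨D, -, hD⟩ := hcomp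
  refine ⟨_, Real.exp_pos (2 * D), fun ι _ u h3 hu => ?_⟩
  obtain ⟨k, hk, e, hue⟩ := hu.exists_fin h3
  obtain ⟨T, hT, hsub⟩ := hD _ ((h.isPES_iff hf).2 ⟨k, hk, _, hue, rfl⟩)
  refine ⟨_, ⟨T, hT, rfl⟩, ?_⟩
  have := h.domain.coarse_of_subset_nbhd hf ((hPES T hT).2.choose.trans h.subset) hsub
  rwa [coneOver_openSimplex hcc.pair (hue.mono hcc.subset), openCone_comp_equiv] at this

theorem isCoarselyComplete_of_isConeComplete (hPES : ∀ S ∈ 𝒮, IsPES C S) {c : ℝ} (hc0 : 0 < c)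
    (hc : IsConeComplete (coneOver f Ω) (closedCone f Ω) (closedCone f C) c (coneOver f '' 𝒮)) :
    IsCoarselyComplete Ω C 𝒮 := by
  have hcc := h.isCocompactCone hf
  -- The radius `c` is large enough because `c < exp (2 * c)`.
  refine ⟨c, hc0, fun S hS => ?_⟩
  obtain ⟨k, hk, u, hu, rfl⟩ := (h.isPES_iff hf).1 hS
  obtain ⟨_, ⟨T, hT, rfl⟩, hcT⟩ := hc _ u (by simpa using hk) hu
  rw [← coneOver_openSimplex hcc.pair (hu.mono hcc.subset)] at hcT
  refine ⟨T, hT, h.domain.subset_nbhd_of_coarse hf (openSimplex_subset hcc.pair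
    (hu.mono hcc.subset)) ((hPES T hT).2.choose.trans h.subset) hcT ?_⟩
  have := Real.add_one_le_exp (2 * c)
  linarith

/-- The order estimate for pairs of close points implies strong isolation. -/
theorem isStronglyIsolated_of_bound (hPES : ∀ S ∈ 𝒮, IsPES C S)
    (hbd : ∀ c : ℝ, ∃ M : ℝ, ∀ σ ∈ coneOver f '' 𝒮, ∀ τ ∈ coneOver f '' 𝒮, σ ≠ τ →
      ∀ x ∈ σ, ∀ y ∈ σ, ∀ x' ∈ τ, ∀ y' ∈ τ, x' - x ∈ closedCone f Ω →
      c • x - x' ∈ closedCone f Ω → y' - y ∈ closedCone f Ω → c • y - y' ∈ closedCone f Ω →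
      ∃ α β : ℝ, 0 < α ∧ 0 < β ∧ α • y - x ∈ closedCone f Ω ∧ β • x - y ∈ closedCone f Ω ∧
        α * β ≤ M) : IsStronglyIsolated Ω 𝒮 := by
  have hcc := h.isCocompactCone hf
  have hP := hcc.pair
  intro r hr
  set E := Real.exp (2 * r) with hE
  have hE0 : 0 < E := Real.exp_pos _
  obtain ⟨M, hM⟩ := hbd (E * E)
  -- The maximum with 1 keeps the argument of the logarithm positive.
  set N := max (E * E * M) 1
  have hN : 0 < N := lt_max_of_lt_right one_pos
  refine ⟨max (1 / 2 * Real.log N) 1, lt_max_of_lt_right one_pos, fun S₁ h₁ S₂ h₂ hne => ?_⟩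
  have hS₁ := (hPES S₁ h₁).2.choose.trans h.subset
  have hS₂ := (hPES S₂ h₂).2.choose.trans h.subset
  -- A point of both neighbourhoods lies between `x` and `E • x` for a vector `x` over `S₁`, and a
  -- vector over `S₂` lies between `x` and `E * E` times `x`.
  have hclose : ∀ {p : RP d}, p ∈ nbhd Ω S₁ r ∩ nbhd Ω S₂ r → p ∈ Ω ∧ ∃ x ∈ coneOver f S₁,
      ∃ x' ∈ coneOver f S₂, chart f p - x ∈ closedCone f Ω ∧ E • x - chart f p ∈ closedCone f Ω ∧
      x' - x ∈ closedCone f Ω ∧ (E * E) • x - x' ∈ closedCone f Ω := by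
    rintro p ⟨⟨hpΩ, x, hx, hxp⟩, ⟨-, x', hx', hxp'⟩⟩
    refine ⟨hpΩ, ?_⟩
    have key : ∀ {S : Set (RP d)} (hS : S ⊆ Ω) {x : RP d}, x ∈ S → hilbertDist Ω x p < r →
        ∃ α β : ℝ, 0 < α ∧ 0 < β ∧ α • chart f p - chart f x ∈ closedCone f Ω ∧
          β • chart f x - chart f p ∈ closedCone f Ω ∧ α * β < E := by
      intro S hS x hx hxp
      obtain ⟨α, β, a1, a2, a3⟩ := (h.domain.hilbertDist_lt_iff_chart hf (hS hx) hpΩ).1 hxp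
      obtain ⟨hα, hβ, -⟩ := h.domain.one_le_mul hf (h.domain.chart_mem hf (hS hx))
        (h.domain.chart_mem hf hpΩ) a1 a2
      exact ⟨α, β, hα, hβ, a1, a2, a3⟩
    obtain ⟨α, β, hα, hβ, a1, a2, a3⟩ := key hS₁ hx hxp
    obtain ⟨α', β', hα', hβ', b1, b2, b3⟩ := key hS₂ hx' hxp'
    have hxC := (chart_mem_coneOver_iff (hf.1.2 x (hS₁ hx))).2 hx
    have hxC' := (chart_mem_coneOver_iff (hf.1.2 x' (hS₂ hx'))).2 hx'
    have hxP := hP.subset (coneOver_mono hS₁ hxC)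
    have hpP := hP.subset (h.domain.chart_mem hf hpΩ)
    have c1 : chart f p - α⁻¹ • chart f x ∈ closedCone f Ω := by
      convert hP.smul_mem (inv_pos.2 hα).le a1 using 1
      rw [smul_sub, smul_smul, inv_mul_cancel₀ hα.ne', one_smul]
    have c2 : E • α⁻¹ • chart f x - chart f p ∈ closedCone f Ω := by
      have : β ≤ E * α⁻¹ := by
        rw [← div_eq_mul_inv, le_div_iff₀ hα]
        linarith
      rw [smul_smul]
      exact hP.smul_sub_mem_of_le this hxP a2
    have c3 : E • chart f p - β' • chart f x' ∈ closedCone f Ω := by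
      have h3 := hP.smul_mem hβ'.le b1
      rw [smul_sub, smul_smul] at h3
      exact hP.smul_sub_mem_of_le (by linarith) hpP h3
    refine ⟨_, smul_mem_coneOver hxC (inv_pos.2 hα), _, smul_mem_coneOver hxC' hβ', c1, c2, ?_, ?_⟩
    · convert hP.add_mem b2 c1 using 1
      module
    · convert hP.add_mem c3 (hP.smul_mem hE0.le c2) using 1
      module
  refine iSup₂_le fun p hp => iSup₂_le fun q hq => ENNReal.ofReal_le_ofReal
    (le_max_of_le_left ?_)
  obtain ⟨hpΩ, x, hx, x', hx', p1, p2, p3, p4⟩ := hclose hp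
  obtain ⟨hqΩ, y, hy, y', hy', q1, q2, q3, q4⟩ := hclose hq
  have hne' : coneOver f S₁ ≠ coneOver f S₂ := fun he => hne ((coneOver_inj
    (fun p hp => hf.1.2 p (hS₁ hp)) (fun p hp => hf.1.2 p (hS₂ hp))).1 he)
  obtain ⟨α, β, hα, hβ, h1, h2, h3⟩ := hM _ ⟨S₁, h₁, rfl⟩ _ ⟨S₂, h₂, rfl⟩ hne' x hx y hy x' hx'
    y' hy' p3 p4 q3 q4
  refine (h.domain.hilbertDist_le_iff_chart hf hpΩ hqΩ).2 ⟨E * α, E * β, ?_, ?_, ?_⟩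
  · convert hP.add_mem p2 (hP.smul_mem hE0.le (hP.add_mem h1 (hP.smul_mem hα.le q1))) using 1
    module
  · convert hP.add_mem q2 (hP.smul_mem hE0.le (hP.add_mem h2 (hP.smul_mem hβ.le p1))) using 1
    module
  · rw [show 2 * (1 / 2 * Real.log N) = Real.log N by ring, Real.exp_log hN]
    refine le_max_of_le_left ?_
    calc E * α * (E * β) = E * E * (α * β) := by ring
      _ ≤ E * E * M := mul_le_mul_of_nonneg_left h3 (by positivity)

end IsNaiveConvexCocompact

/-- The properties of the core family for a given center of mass. -/
theorem IsNaiveConvexCocompact.coreFamily_properties {Λ : Subgroup PGL(d, ℝ)}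
    (h : IsNaiveConvexCocompact Ω C Λ) (hiso : HasCoarselyIsolatedSimplices Ω C Λ)
    {CoM : Set (RP d) → Set (RP d) → RP d} (hCoM : IsCenterOfMass CoM) :
    (∀ S ∈ topSimplices Ω C, ∀ v ∈ vertices S, IsCompact (closure C ∩ face Ω v)) ∧
      IsMaximalFamily C (coreFamily CoM Ω C) ∧ IsStronglyIsolated Ω (coreFamily CoM Ω C) ∧
      IsCoarselyComplete Ω C (coreFamily CoM Ω C) ∧ IsInvariantFamily Λ (coreFamily CoM Ω C) := by
  obtain ⟨f, hf⟩ := h.domain.2.2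
  obtain ⟨𝒮, hmax, hisol, hcomp, hinv⟩ := hiso
  have hcc := h.isCocompactCone hf
  have hPES : ∀ S ∈ 𝒮, IsPES C S := fun S hS => (hmax S hS).1
  have h𝒮 := h.isSimplexFamily_of_isIsolated hf hPES hisol hinv
  obtain ⟨c, hc0, hc⟩ := h.exists_isConeComplete hf hPES hcomp
  have hmin : ∀ {k : ℕ}, 2 ≤ k → ∀ {u : Fin (k + 1) → Fin d → ℝ},
      IsFrame (coneOver f Ω) (closedCone f C) u →
      IsTop (coneOver f Ω) (closedCone f Ω) (closedCone f C) u →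
      ∀ i, IsMin (closedCone f Ω) (closedCone f C) (u i) := fun {k} hk {u} hu htop i =>
    hcc.isMin_of_isTop h𝒮 hc0.le hc (by simpa using hk) hu htop i
  have htop := h.isTopFamily_coreFamily hf hmin hCoM
  have hcore := h.coreFamily_subset_topSimplices hf hmin hCoM
  have hcPES : ∀ S ∈ coreFamily CoM Ω C, IsPES C S := fun S hS => (hcore hS).1.1
  refine ⟨fun S hS v hv => ?_, fun S hS => (hcore hS).1, ?_, ?_, ?_⟩
  · obtain ⟨k, hk, u, hu, hut, rfl⟩ := (h.mem_topSimplices_iff hf).1 hS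
    rw [h.vertices_openSimplex hf hu fun i => (hmin hk hu hut i).2.1] at hv
    obtain ⟨i, rfl⟩ := hv
    exact h.isCompact_closure_inter_face hf (hmin hk hu hut i)
  · exact h.isStronglyIsolated_of_bound hf hcPES fun c' =>
      (hcc.isMinimalFamily_of_isTopFamily h𝒮 hc0.le hc htop).exists_bound_of_close
        htop.eq_of_parallel c'
  · obtain ⟨c', hc0', hc'⟩ := hcc.isConeComplete_of_isTopFamily h𝒮 hc htop
    exact h.isCoarselyComplete_of_isConeComplete hf hcPES hc0' hc'
  · exact h.isInvariantFamily_of_image_mem hf hcPES htop.invariant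

end Families

/-! ### Fixed points in compact subsets of open cones -/

section FixedPoint

open Filter Topology

variable {V : Type*} [NormedAddCommGroup V] [NormedSpace ℝ V] [FiniteDimensional ℝ V]

/-- Carathéodory: the hull is the image of a compact set of weights and points, with the number of
points bounded by the dimension plus one. Shorter combinations are padded with zero weights at `k₀`.
-/
theorem isCompact_convexHull_of_isCompact {K : Set V} (hK : IsCompact K) :
    IsCompact (convexHull ℝ K) := by
  rcases K.eq_empty_or_nonempty with rfl | ⟨k₀, hk₀⟩
  · simp
  set N := Module.finrank ℝ V + 1
  have h1 : IsCompact (stdSimplex ℝ (Fin N) ×ˢ Set.pi univ fun _ : Fin N => K) :=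
    (isCompact_stdSimplex ℝ (Fin N)).prod (isCompact_univ_pi fun _ => hK)
  have h2 : Continuous fun p : (Fin N → ℝ) × (Fin N → V) => ∑ i, p.1 i • p.2 i := by fun_prop
  convert h1.image h2 using 1
  ext x
  constructor
  · intro hx
    obtain ⟨ι, _, z, w, hz, hind, hw, hw1, rfl⟩ := eq_pos_convex_span_of_mem_convexHull hx
    have hcard : Fintype.card ι ≤ Fintype.card (Fin N) := by
      rw [Fintype.card_fin]
      exact hind.card_le_finrank_succ.trans (Nat.succ_le_succ (Submodule.finrank_le _))
    obtain ⟨e⟩ := Function.Embedding.nonempty_of_card_le hcard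
    have hw0 : ∀ j ∉ range e, Function.extend e w 0 j = 0 := fun j hj =>
      Function.extend_apply' _ _ _ hj
    refine ⟨(Function.extend e w 0, Function.extend e z fun _ => k₀), ⟨⟨fun j => ?_, ?_⟩,
      fun j _ => ?_⟩, ?_⟩
    · by_cases hj : j ∈ range e
      · obtain ⟨i, rfl⟩ := hj
        simp only
        rw [e.injective.extend_apply]
        exact (hw i).le
      · simp only
        rw [hw0 j hj]
    · rw [← hw1]
      exact (Fintype.sum_of_injective e e.injective _ _ hw0 fun i =>
        (e.injective.extend_apply w 0 i).symm).symm
    · by_cases hj : j ∈ range e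
      · obtain ⟨i, rfl⟩ := hj
        simp only
        rw [e.injective.extend_apply]
        exact hz (mem_range_self i)
      · simp only
        rw [Function.extend_apply' _ _ _ hj]
        exact hk₀
    · refine (Fintype.sum_of_injective e e.injective _ _ (fun j hj => ?_) fun i => ?_).symm
      · simp only
        rw [hw0 j hj, zero_smul]
      · simp only
        rw [e.injective.extend_apply, e.injective.extend_apply]
  · rintro ⟨⟨w, z⟩, ⟨⟨hw, hw1⟩, hz⟩, rfl⟩
    exact (convex_convexHull ℝ K).sum_mem (fun i _ => hw i) hw1 fun i _ =>
      subset_convexHull ℝ K (hz i (mem_univ i))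

/-- The points of the cone `M` that are at multiplicative distance at most `ρ` from every nonzero
point of `M`, in the order of `P`. -/
def centralCone (P M : Set V) (ρ : ℝ) : Set V :=
  {x ∈ M | ∀ y ∈ M, y ≠ 0 → ∃ s : ℝ, 0 ≤ s ∧ x - s • y ∈ P ∧ (ρ * s) • y - x ∈ P}

/-! ### Contraction of invariant cones -/

namespace IsSharpCone

variable {f : V →ₗ[ℝ] ℝ} {P M : Set V} (hP : IsSharpCone f P) (hM : IsSharpCone f M) (hMP : M ⊆ P)
include hP hM hMP

theorem centralCone_mem_of_normalized {ρ : ℝ} {x : V} (hx : x ∈ M)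
    (h : ∀ y ∈ M, f y = 1 → ∃ s : ℝ, 0 ≤ s ∧ x - s • y ∈ P ∧ (ρ * s) • y - x ∈ P) :
    x ∈ centralCone P M ρ := by
  refine ⟨hx, fun y hy hy0 => ?_⟩
  have hfy := hM.apply_pos hy hy0
  obtain ⟨s, hs, h1, h2⟩ := h ((f y)⁻¹ • y) (hM.smul_mem (inv_pos.2 hfy).le hy) (by
    rw [map_smul, smul_eq_mul, inv_mul_cancel₀ hfy.ne'])
  refine ⟨s * (f y)⁻¹, mul_nonneg hs (inv_pos.2 hfy).le, by rwa [mul_smul], ?_⟩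
  rwa [← mul_assoc, mul_smul]

theorem isSharpCone_centralCone (ρ : ℝ) : IsSharpCone f (centralCone P M ρ) := by
  have hfc : Continuous f := LinearMap.continuous_of_finiteDimensional _
  refine ⟨isClosed_iff_ultrafilter.2 fun x U hU hxU => ?_, ⟨hM.zero_mem, fun y hy _ =>
    ⟨0, le_rfl, by simpa using hP.zero_mem, by simpa using hP.zero_mem⟩⟩, ?_, ?_, ?_⟩
  · have hxM : ∀ᶠ z in U, z ∈ centralCone P M ρ := hxU
    refine ⟨hM.isClosed.mem_of_tendsto hU (hxM.mono fun z hz => hz.1), fun y hy hy0 => ?_⟩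
    have hfy := hM.apply_pos hy hy0
    have h1 : ∀ z, ∃ s : ℝ, z ∈ centralCone P M ρ →
        0 ≤ s ∧ z - s • y ∈ P ∧ (ρ * s) • y - z ∈ P := fun z => by
      by_cases hz : z ∈ centralCone P M ρ
      · obtain ⟨s, hs⟩ := hz.2 y hy hy0
        exact ⟨s, fun _ => hs⟩
      · exact ⟨0, fun h => absurd h hz⟩
    choose s hs using h1
    have hfx : ∀ᶠ z in U, f z < f x + 1 :=
      ((hfc.tendsto x).mono_left hU).eventually (gt_mem_nhds (lt_add_one _))
    have hbd : ∀ᶠ z in U, s z ∈ Icc 0 ((f x + 1) / f y) := by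
      filter_upwards [hxM, hfx] with z n1 n2
      obtain ⟨a1, a2, -⟩ := hs z n1
      refine ⟨a1, ?_⟩
      have a3 := hP.apply_nonneg a2
      rw [map_sub, map_smul, smul_eq_mul] at a3
      rw [le_div_iff₀ hfy]
      linarith
    obtain ⟨t, ht, hlim⟩ := isCompact_Icc.ultrafilter_le_nhds (U.map s)
      (le_principal_iff.2 (mem_map.2 hbd))
    have hst : Tendsto s U (𝓝 t) := hlim
    have hid : Tendsto (fun z : V => z) U (𝓝 x) := hU
    exact ⟨t, ht.1, hP.isClosed.mem_of_tendsto (hid.sub (hst.smul_const y))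
      (hxM.mono fun z hz => (hs z hz).2.1), hP.isClosed.mem_of_tendsto
      (((hst.const_mul ρ).smul_const y).sub hid) (hxM.mono fun z hz => (hs z hz).2.2)⟩
  · rintro x x' ⟨hx, h1⟩ ⟨hx', h2⟩
    refine ⟨hM.add_mem hx hx', fun y hy hy0 => ?_⟩
    obtain ⟨s, hs, a1, a2⟩ := h1 y hy hy0
    obtain ⟨s', hs', b1, b2⟩ := h2 y hy hy0
    refine ⟨s + s', add_nonneg hs hs', ?_, ?_⟩
    · convert hP.add_mem a1 b1 using 1
      module
    · convert hP.add_mem a2 b2 using 1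
      module
  · rintro c x hc ⟨hx, h1⟩
    refine ⟨hM.smul_mem hc hx, fun y hy hy0 => ?_⟩
    obtain ⟨s, hs, a1, a2⟩ := h1 y hy hy0
    refine ⟨c * s, mul_nonneg hc hs, ?_, ?_⟩
    · convert hP.smul_mem hc a1 using 1
      module
    · convert hP.smul_mem hc a2 using 1
      module
  · obtain ⟨b, hb, h1⟩ := hM.bound
    exact ⟨b, hb, fun x hx => h1 x hx.1⟩

omit hP hMP in
/-- A closed cone contains a vector dominating all its vectors. -/
theorem exists_dom_all : ∃ c ∈ M, ∀ y ∈ M, Dom M y c := by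
  -- Take `c` with order span of the largest possible dimension; adding another vector of `M` cannot
  -- enlarge it.
  have h1 : ∃ n, ∃ c ∈ M, Module.finrank ℝ V - Module.finrank ℝ (hM.domSpan c) = n :=
    ⟨_, 0, hM.zero_mem, rfl⟩
  classical
  obtain ⟨c, hc, hcn⟩ := Nat.find_spec h1
  refine ⟨c, hc, fun y hy => ?_⟩
  have hcy := hM.add_mem hc hy
  have h2 : hM.domSpan c ≤ hM.domSpan (c + y) := hM.domSpan_mono hc hcy
    (hM.dom_add_right (hM.dom_refl c) hy)
  have h3 := Nat.find_min' h1 ⟨c + y, hcy, rfl⟩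
  have h4 := Submodule.finrank_le (hM.domSpan (c + y))
  have h5 := Submodule.finrank_le (hM.domSpan c)
  have h6 := Submodule.eq_of_le_of_finrank_le h2 (by omega)
  rw [← hM.mem_domSpan_of_mem hy hc, h6, hM.mem_domSpan_of_mem hy hcy]
  exact hM.dom_add_left (hM.dom_refl y) hc

omit hP hMP in
-- A vector dominating all of `M` is interior to `M` in its order span, and the slice `f = 1` is
-- bounded, so one `ε` serves every `y`.
theorem exists_uniform_center (hne : ∃ x ∈ M, x ≠ 0) : ∃ c ∈ M, f c = 1 ∧ ∃ ε : ℝ, 0 < ε ∧ ε < 1 ∧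
    ∀ y ∈ M, f y = 1 → c - ε • y ∈ M := by
  obtain ⟨c, hc, hdom⟩ := hM.exists_dom_all
  obtain ⟨x, hx, hx0⟩ := hne
  have hc0 := hM.ne_zero_of_dom hx hx0 (hdom x hx)
  have hfc := hM.apply_pos hc hc0
  set c' := (f c)⁻¹ • c with hc'
  have hcM : c' ∈ M := hM.smul_mem (inv_pos.2 hfc).le hc
  have hdom' : ∀ y ∈ M, Dom M y c' := fun y hy => hM.dom_smul (inv_pos.2 hfc) (hdom y hy)
  obtain ⟨δ, hδ, hball⟩ := Metric.eventually_nhds_iff.1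
    (hM.eventually_smul_sub_mem hcM (ε := 1) one_pos)
  obtain ⟨b, hb, hbd⟩ := hM.bound
  refine ⟨c', hcM, by rw [hc', map_smul, smul_eq_mul, inv_mul_cancel₀ hfc.ne'],
    min (1 / 2) (δ / (2 * b)), by positivity, (min_le_left _ _).trans_lt (by norm_num),
    fun y hy hfy => ?_⟩
  set ε := min (1 / 2) (δ / (2 * b))
  have hε : 0 < ε := by positivity
  have h1 : ‖ε • y‖ < δ := by
    rw [norm_smul, Real.norm_of_nonneg hε.le]
    have h2 := hbd y hy
    rw [hfy, mul_one] at h2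
    calc ε * ‖y‖ ≤ δ / (2 * b) * b :=
          mul_le_mul (min_le_right _ _) h2 (norm_nonneg _) (by positivity)
      _ = δ / 2 := by field_simp
      _ < δ := half_lt_self hδ
  have h3 := hball (y := ε • y) (by simpa using h1) ((hM.domSpan c').smul_mem ε
    ((hM.mem_domSpan_of_mem hy hcM).2 (hdom' y hy)))
  rwa [one_smul] at h3

omit hP in
theorem isCompact_slice : IsCompact (M ∩ {x | f x = 1}) := by
  have hfc : Continuous f := LinearMap.continuous_of_finiteDimensional _
  have : ProperSpace V := FiniteDimensional.proper ℝ V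
  obtain ⟨b, hb, hbd⟩ := hM.bound
  refine Metric.isCompact_of_isClosed_isBounded
    (hM.isClosed.inter (isClosed_eq hfc continuous_const)) ?_
  refine isBounded_iff_forall_norm_le.2 ⟨b, fun y hy => ?_⟩
  have := hbd y hy.1
  rwa [show f y = 1 from hy.2, mul_one] at this

/-- Near a point `y₀` of the compact slice, `y` is at least half of `y₀`, which bounds a fixed
multiple of `c`; finitely many such neighbourhoods cover the slice. -/
theorem exists_uniform_lower (heq : ∀ x ∈ M, ∀ y ∈ M, y ≠ 0 → Dom P x y) {c : V} (hc : c ∈ M) :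
    ∃ κ : ℝ, 0 < κ ∧ ∀ y ∈ M, f y = 1 → y - κ • c ∈ P := by
  have hcP := hMP hc
  have hmono : ∀ {κ κ' : ℝ} {y : V}, κ' ≤ κ → y - κ • c ∈ P → y - κ' • c ∈ P :=
    fun {κ κ' y} hκ h1 => by
    convert hP.add_mem h1 (hP.smul_mem (sub_nonneg.2 hκ) hcP) using 1
    module
  have key := IsCompact.induction_on (p := fun s : Set V => ∃ κ : ℝ, 0 < κ ∧
    ∀ y ∈ s, y ∈ M → y - κ • c ∈ P) (hM.isCompact_slice hMP) ⟨1, one_pos, by simp⟩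
    (fun s t hst ⟨κ, hκ, h1⟩ => ⟨κ, hκ, fun y hy => h1 y (hst hy)⟩)
    (fun s t ⟨κ, hκ, h1⟩ ⟨κ', hκ', h2⟩ => ⟨min κ κ', lt_min hκ hκ', fun y hy hyM => by
      rcases hy with hy | hy
      · exact hmono (min_le_left _ _) (h1 y hy hyM)
      · exact hmono (min_le_right _ _) (h2 y hy hyM)⟩) ?_
  · obtain ⟨κ, hκ, h1⟩ := key
    exact ⟨κ, hκ, fun y hy hfy => h1 y ⟨hy, hfy⟩ hy⟩
  · rintro y₀ ⟨hy₀, hfy₀⟩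
    have hy₀0 : y₀ ≠ 0 := by
      rintro rfl
      simp at hfy₀
    have hyP := hMP hy₀
    obtain ⟨k, hk, h1⟩ := heq c hc y₀ hy₀ hy₀0
    have h2 : Tendsto (fun y => y₀ - y) (𝓝 y₀) (𝓝 0) := by
      have : Continuous fun y => y₀ - y := by fun_prop
      simpa using this.tendsto y₀
    have h3 := h2.eventually (hP.eventually_smul_sub_mem hyP (ε := 1 / 2) (by norm_num))
    refine ⟨_, mem_nhdsWithin_of_mem_nhds h3, (2 * k)⁻¹, by positivity, fun y hy hyM => ?_⟩
    have h4 := hy ((hP.domSpan y₀).sub_mem ((hP.mem_domSpan_of_mem hyP hyP).2 (hP.dom_refl _))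
      ((hP.mem_domSpan_of_mem (hMP hyM) hyP).2 (heq y hyM y₀ hy₀ hy₀0)))
    have h5 := hP.add_mem h4 (hP.smul_mem (by positivity : 0 ≤ (2 * k)⁻¹) h1)
    convert h5 using 1
    match_scalars <;> field_simp <;> norm_num

/-- The uniform center bounds all normalised vectors from above and the uniform lower bound holds
from below, so `M` has finite multiplicative diameter. -/
theorem exists_centralCone_eq (heq : ∀ x ∈ M, ∀ y ∈ M, y ≠ 0 → Dom P x y)
    (hne : ∃ x ∈ M, x ≠ 0) : ∃ ρ : ℝ, 1 ≤ ρ ∧ M ⊆ centralCone P M ρ := by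
  obtain ⟨c, hc, -, ε, hε, -, hcε⟩ := hM.exists_uniform_center hne
  obtain ⟨κ, hκ, hcκ⟩ := hP.exists_uniform_lower hM hMP heq hc
  set t := κ * ε with ht
  have ht0 : 0 < t := mul_pos hκ hε
  have hxy : ∀ x ∈ M, ∀ y ∈ M, f x = 1 → f y = 1 → x - t • y ∈ P := fun x hx y hy hfx hfy => by
    convert hP.add_mem (hcκ x hx hfx) (hP.smul_mem hκ.le (hMP (hcε y hy hfy))) using 1
    rw [ht]
    module
  refine ⟨max (t⁻¹ * t⁻¹) 1, le_max_right _ _, fun x hx =>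
    hP.centralCone_mem_of_normalized hM hMP hx fun y hy hfy => ?_⟩
  by_cases hx0 : x = 0
  · subst hx0
    exact ⟨0, le_rfl, by simpa using hP.zero_mem, by simpa using hP.zero_mem⟩
  have hfx := hM.apply_pos hx hx0
  have hx1M : (f x)⁻¹ • x ∈ M := hM.smul_mem (inv_pos.2 hfx).le hx
  have hx1 : f ((f x)⁻¹ • x) = 1 := by rw [map_smul, smul_eq_mul, inv_mul_cancel₀ hfx.ne']
  refine ⟨f x * t, by positivity, ?_, ?_⟩
  · convert hP.smul_mem hfx.le (hxy _ hx1M y hy hx1 hfy) using 1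
    rw [smul_sub, smul_smul, smul_smul, mul_inv_cancel₀ hfx.ne', one_smul]
  · refine hP.smul_sub_mem_of_le (c := f x * t⁻¹) ?_ (hMP hy) ?_
    · calc f x * t⁻¹ = t⁻¹ * t⁻¹ * (f x * t) := by field_simp
        _ ≤ max (t⁻¹ * t⁻¹) 1 * (f x * t) :=
          mul_le_mul_of_nonneg_right (le_max_left _ _) (by positivity)
    · convert hP.smul_mem (by positivity : 0 ≤ f x * t⁻¹) (hxy y hy _ hx1M hfy hx1) using 1
      match_scalars <;> field_simp

/-- A group of linear maps that preserves a closed cone with relatively open nonzero part fixes a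
ray in every invariant closed subcone of this part. -/
theorem exists_common_ray (hne : ∃ x ∈ M, x ≠ 0)
    (heq : ∀ x ∈ M, ∀ y ∈ M, y ≠ 0 → Dom P x y) {H : Set (V ≃ₗ[ℝ] V)}
    (hHP : ∀ T ∈ H, ∀ x ∈ P, T x ∈ P) (hHM : ∀ T ∈ H, ∀ x ∈ M, T x ∈ M)
    (hsymm : ∀ T ∈ H, T.symm ∈ H) :
    ∃ x ∈ M, x ≠ 0 ∧ ∀ T ∈ H, ∃ c : ℝ, 0 < c ∧ T x = c • x := by
  set S : Set (Set V) := {N | N ⊆ M ∧ IsSharpCone f N ∧ (∃ x ∈ N, x ≠ 0) ∧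
    ∀ T ∈ H, ∀ x ∈ N, T x ∈ N} with hS
  -- Take a minimal invariant closed cone; compactness of the slices keeps intersections of chains
  -- nonzero. The rest of the proof shows that it is a ray.
  obtain ⟨N, -, hN⟩ := zorn_superset_nonempty S (fun 𝒞 h𝒞 hchain hne𝒞 => by
    refine ⟨⋂₀ 𝒞, ⟨?_, ?_, ?_, ?_⟩, fun s hs => sInter_subset_of_mem hs⟩
    · obtain ⟨N, hN⟩ := hne𝒞
      exact (sInter_subset_of_mem hN).trans (h𝒞 hN).1
    · refine ⟨isClosed_sInter fun N hN => (h𝒞 hN).2.1.isClosed,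
        fun N hN => (h𝒞 hN).2.1.zero_mem,
        fun hx hy N hN => (h𝒞 hN).2.1.add_mem (hx N hN) (hy N hN),
        fun hc hx N hN => (h𝒞 hN).2.1.smul_mem hc (hx N hN), ?_⟩
      obtain ⟨N, hN⟩ := hne𝒞
      obtain ⟨b, hb, hbd⟩ := (h𝒞 hN).2.1.bound
      exact ⟨b, hb, fun x hx => hbd x (hx N hN)⟩
    · have : Nonempty 𝒞 := hne𝒞.to_subtype
      obtain ⟨x, hx⟩ := IsCompact.nonempty_iInter_of_directed_nonempty_isCompact_isClosed
        (fun N : 𝒞 => (N : Set V) ∩ {x | f x = 1}) (fun N N' => by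
          rcases hchain.total N.2 N'.2 with hle | hle
          · exact ⟨N, Subset.rfl, inter_subset_inter_left _ hle⟩
          · exact ⟨N', inter_subset_inter_left _ hle, Subset.rfl⟩)
        (fun N => by
          obtain ⟨x, hx, hx0⟩ := (h𝒞 N.2).2.2.1
          have hfx := (h𝒞 N.2).2.1.apply_pos hx hx0
          exact ⟨(f x)⁻¹ • x, (h𝒞 N.2).2.1.smul_mem (inv_pos.2 hfx).le hx, by
            simp [hfx.ne']⟩)
        (fun N => (h𝒞 N.2).2.1.isCompact_slice (h𝒞 N.2).1)
        (fun N => ((h𝒞 N.2).2.1.isCompact_slice (h𝒞 N.2).1).isClosed)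
      rw [mem_iInter] at hx
      refine ⟨x, fun N hN => (hx ⟨N, hN⟩).1, ?_⟩
      rintro rfl
      obtain ⟨N, hN⟩ := hne𝒞
      simpa using (hx ⟨N, hN⟩).2
    · exact fun T hT x hx N hN => (h𝒞 hN).2.2.2 T hT x (hx N hN)) M
    ⟨Subset.rfl, hM, hne, hHM⟩
  obtain ⟨hNM, hNc, hNne, hNH⟩ := hN.prop
  have hNP := hNM.trans hMP
  obtain ⟨c, hc, hfc1, ε, hε, hε1, hcε⟩ := hNc.exists_uniform_center hNne
  -- The vectors of `N` at distance at most the smaller constant from all of `N` form an invariant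
  -- closed cone, equal to `N` by minimality once it contains `c`. If `s • y ≤ c - ε • y ≤ (ρ * s) •
  -- y`, then `c` lies between `ε + s` and `ε + ρ * s` times `y`, with `ε + s ≤ 1`; this yields the
  -- smaller ratio.
  have hstep : ∀ {ρ : ℝ}, 1 ≤ ρ → N ⊆ centralCone P N ρ →
      N ⊆ centralCone P N (1 + (1 - ε) * (ρ - 1)) := by
    intro ρ hρ hNρ
    refine hN.le_of_le ⟨?_, hP.isSharpCone_centralCone hNc hNP _, ⟨c, ?_, ?_⟩, ?_⟩
      fun x hx => hx.1
    · exact fun x hx => hNM hx.1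
    · refine hP.centralCone_mem_of_normalized hNc hNP hc fun y hy hfy => ?_
      have hz := hcε y hy hfy
      have hy0 : y ≠ 0 := by
        rintro rfl
        simp at hfy
      obtain ⟨s, hs, h1, h2⟩ := (hNρ hz).2 y hy hy0
      refine ⟨ε + s, by positivity, ?_, ?_⟩
      · convert h1 using 1
        module
      · have h3 : (ε + ρ * s) • y - c ∈ P := by
          convert h2 using 1
          module
        refine hP.smul_sub_mem_of_le ?_ (hNP hy) h3
        have h4 := hP.apply_nonneg h1
        simp only [map_sub, map_smul, smul_eq_mul, hfc1, hfy, mul_one] at h4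
        have h5 : 0 ≤ ε * (ρ - 1) * (1 - (ε + s)) :=
          mul_nonneg (mul_nonneg hε.le (by linarith)) (by linarith)
        nlinarith
    · rintro rfl
      simp at hfc1
    · rintro T hT x ⟨hx, h1⟩
      refine ⟨hNH T hT x hx, fun y hy hy0 => ?_⟩
      obtain ⟨s, hs, h2, h3⟩ := h1 (T.symm y) (hNH _ (hsymm T hT) y hy)
        (T.symm.map_ne_zero_iff.2 hy0)
      refine ⟨s, hs, ?_, ?_⟩
      · simpa using hHP T hT _ h2
      · simpa using hHP T hT _ h3
  obtain ⟨ρ, hρ, hNρ⟩ := hP.exists_centralCone_eq hNc hNP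
    (fun x hx y hy hy0 => heq x (hNM hx) y (hNM hy) hy0) hNne
  have hiter : ∀ n : ℕ, N ⊆ centralCone P N (1 + (1 - ε) ^ n * (ρ - 1)) := by
    intro n
    induction n with
    | zero => simpa using hNρ
    | succ n ih =>
      have := hstep (le_add_of_nonneg_right (mul_nonneg (pow_nonneg (by linarith) n)
        (by linarith))) ih
      convert this using 2
      ring
  -- The iterated constants tend to 1, so any two normalised vectors of `N` are comparable with
  -- constant 1 and coincide.
  have huniq : ∀ x ∈ N, ∀ y ∈ N, f x = 1 → f y = 1 → x = y := by
    intro x hx y hy hfx hfy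
    have hy0 : y ≠ 0 := by
      rintro rfl
      simp at hfy
    have h1 : ∀ n : ℕ, x - (1 + (1 - ε) ^ n * (ρ - 1))⁻¹ • y ∈ P := by
      intro n
      obtain ⟨s, hs, h1, h2⟩ := (hiter n hx).2 y hy hy0
      set r := 1 + (1 - ε) ^ n * (ρ - 1) with hr
      have hr0 : 0 < r := by
        have : 0 ≤ (1 - ε) ^ n * (ρ - 1) :=
          mul_nonneg (pow_nonneg (by linarith) n) (by linarith)
        linarith
      have h3 := hP.apply_nonneg h2
      rw [map_sub, map_smul, smul_eq_mul, hfx, hfy, mul_one, sub_nonneg] at h3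
      have h4 : r⁻¹ ≤ s := by
        rw [inv_eq_one_div, div_le_iff₀ hr0]
        linarith
      convert hP.add_mem h1 (hP.smul_mem (sub_nonneg.2 h4) (hNP hy)) using 1
      module
    have h2 : Tendsto (fun n : ℕ => x - (1 + (1 - ε) ^ n * (ρ - 1))⁻¹ • y) atTop
        (𝓝 (x - (1 + 0 * (ρ - 1))⁻¹ • y)) := by
      refine tendsto_const_nhds.sub (Tendsto.smul_const (Tendsto.inv₀ ?_ (by simp)) y)
      exact ((tendsto_pow_atTop_nhds_zero_of_lt_one (by linarith) (by linarith)).mul_const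
        _).const_add _
    have h3 := hP.isClosed.mem_of_tendsto h2 (Eventually.of_forall h1)
    rw [zero_mul, add_zero, inv_one, one_smul] at h3
    exact sub_eq_zero.1 (hP.eq_zero_of_apply_eq_zero h3 (by rw [map_sub, hfx, hfy, sub_self]))
  have hc0 : c ≠ 0 := by
    rintro rfl
    simp at hfc1
  refine ⟨c, hNM hc, hc0, fun T hT => ?_⟩
  have hTc := hNH T hT c hc
  have hfT := hNc.apply_pos hTc (T.map_ne_zero_iff.2 hc0)
  refine ⟨f (T c), hfT, ?_⟩
  have h3 := huniq _ (hNc.smul_mem (inv_pos.2 hfT).le hTc) c hc (by simp [hfT.ne']) hfc1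
  rw [inv_smul_eq_iff₀ hfT.ne'] at h3
  exact h3

end IsSharpCone

end FixedPoint

/-! ### Existence of centers of mass -/

/-- A choice of points that is possible on every orbit, given the stabilizers, can be made
equivariantly. -/
theorem exists_equivariant {G X Y : Type*} [Group G] [MulAction G X] [MulAction G Y] [Nonempty Y]
    (P : X → Y → Prop) (hP : ∀ (g : G) (x y), P x y → P (g • x) (g • y)) :
    ∃ φ : X → Y, ∀ x, (∃ y, P x y ∧ ∀ g : G, g • x = x → g • y = y) →
      P x (φ x) ∧ ∀ g : G, φ (g • x) = g • φ x := by
  classical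
  let s : Setoid X := MulAction.orbitRel G X
  -- Fix a representative of each orbit and a suitable value there, fixed by its stabiliser;
  -- transporting the value along the orbit is then independent of the chosen group elements.
  let r : X → X := fun x => (Quotient.mk s x).out
  have hr : ∀ x, ∃ h : G, h • r x = x := fun x => by
    have h1 : r x ≈ x := Quotient.mk_out x
    obtain ⟨h, h2⟩ := MulAction.orbitRel_apply.1 h1
    exact ⟨h⁻¹, by rw [← h2]; exact inv_smul_smul h x⟩
  have hrg : ∀ (g : G) x, r (g • x) = r x := fun g x => by
    have h1 : Quotient.mk s (g • x) = Quotient.mk s x :=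
      Quotient.sound (MulAction.orbitRel_apply.2 ⟨g, rfl⟩)
    simp only [r, h1]
  choose h hh using hr
  have hy : ∀ x, ∃ y : Y, (∃ y, P x y ∧ ∀ g : G, g • x = x → g • y = y) →
      P x y ∧ ∀ g : G, g • x = x → g • y = y := fun x => by
    by_cases hx : ∃ y, P x y ∧ ∀ g : G, g • x = x → g • y = y
    · obtain ⟨y, hy⟩ := hx
      exact ⟨y, fun _ => hy⟩
    · exact ⟨Classical.arbitrary Y, fun h => absurd h hx⟩
  choose y hy using hy
  refine ⟨fun x => h x • y (r x), fun x ⟨z, hz, hzx⟩ => ?_⟩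
  have hrx : (h x)⁻¹ • x = r x := by rw [inv_smul_eq_iff, hh]
  obtain ⟨h1, h2⟩ := hy (r x) ⟨(h x)⁻¹ • z, by
    rw [← hrx]
    exact hP _ _ _ hz, fun g hg => by
    have h3 : (h x * g * (h x)⁻¹) • x = x := by
      rw [mul_smul, mul_smul, hrx, hg, hh]
    have h4 := hzx _ h3
    rw [mul_smul, mul_smul] at h4
    rw [eq_inv_smul_iff, h4]⟩
  refine ⟨?_, fun g => ?_⟩
  · have := hP (h x) _ _ h1
    rwa [hh] at this
  · have h3 : ((g * h x)⁻¹ * h (g • x)) • r x = r x := by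
      have h4 := hh (g • x)
      rw [hrg] at h4
      rw [mul_smul, h4, inv_smul_eq_iff, mul_smul, hh]
    have h4 := h2 _ h3
    rw [mul_smul, inv_smul_eq_iff, mul_smul] at h4
    simp only [hrg, h4]

section CenterOfMass

open Filter Topology

variable {d : ℕ} {f : Module.Dual ℝ (Fin d → ℝ)} {F K L : Set (RP d)}

/-! ### Projective convex hulls and fixed points of stabilisers -/

theorem IsConvex.smul (hL : IsConvex L) (g : PGL(d, ℝ)) : IsConvex (g • L) := by
  obtain ⟨f, ⟨hf0, hf⟩, hc⟩ := hL
  obtain ⟨T, hT⟩ := exists_isLift g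
  have h1 : ∀ v, (f.comp T.symm.toLinearMap) (T v) = f v := fun v => by simp
  have h2 : ∀ p : RP d, chart (f.comp T.symm.toLinearMap) (g • p) = T (chart f p) := fun p => by
    induction p using Projectivization.ind with
    | h v hv => rw [hT v hv, chart_mk, chart_mk, h1, map_smul]
  refine ⟨f.comp T.symm.toLinearMap, ⟨fun h0 => hf0 ?_, ?_⟩, ?_⟩
  · refine LinearMap.ext fun v => ?_
    rw [← h1, h0, LinearMap.zero_apply, LinearMap.zero_apply]
  · rintro _ ⟨p, hp, rfl⟩
    have h3 := hf p hp
    induction p using Projectivization.ind with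
    | h v hv =>
      rw [apply_rep_mk_ne_zero_iff] at h3
      show (f.comp T.symm.toLinearMap) (g • Projectivization.mk ℝ v hv).rep ≠ 0
      rwa [hT v hv, apply_rep_mk_ne_zero_iff, h1]
  · have h3 : chart (f.comp T.symm.toLinearMap) '' (g • L) = T.toLinearMap '' (chart f '' L) := by
      rw [← image_smul, image_image, image_image]
      simp only [h2]
      rfl
    rw [h3]
    exact hc.linear_image _

theorem convHull_smul_subset (g : PGL(d, ℝ)) (F K : Set (RP d)) :
    convHull (g • F) (g • K) ⊆ g • convHull F K := by
  intro p hp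
  rw [mem_smul_set_iff_inv_smul_mem]
  rintro Y ⟨h1, h2, h3⟩
  rw [← mem_smul_set_iff_inv_smul_mem]
  refine hp _ ⟨smul_set_mono h1, ?_, h3.smul g⟩
  rw [closure_smul]
  exact smul_set_mono h2

theorem smul_convHull (g : PGL(d, ℝ)) (F K : Set (RP d)) :
    g • convHull F K = convHull (g • F) (g • K) := by
  refine Subset.antisymm ?_ (convHull_smul_subset g F K)
  have h1 := convHull_smul_subset g⁻¹ (g • F) (g • K)
  rw [inv_smul_smul, inv_smul_smul] at h1
  have h2 := smul_set_mono (a := g) h1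
  rwa [smul_inv_smul] at h2

/-- The hull can be computed in one chart although competitors may be convex in other charts: each
lies in the closure of `F`, hence in the chart of `f`, where it is convex as well. -/
theorem convHull_eq (hF : IsProperChart f F) (hK : K ⊆ F) :
    convHull F K = {p | f p.rep ≠ 0 ∧ chart f p ∈ convexHull ℝ (chart f '' K)} := by
  have h1 : convexHull ℝ (chart f '' K) ⊆ chart f '' F :=
    convexHull_min (image_mono hK) hF.2.1
  refine Subset.antisymm (sInter_subset_of_mem (mem_ofPred.2 ⟨fun p hp => ⟨hF.1.2 p (hK hp),
    subset_convexHull ℝ _ (mem_image_of_mem _ hp)⟩, ?_, f, ⟨hF.1.1, fun p hp => hp.1⟩, ?_⟩)) ?_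
  · rintro p ⟨hp, hpK⟩
    obtain ⟨q, hq, hqp⟩ := h1 hpK
    rw [← chart_injective (hF.1.2 q hq) hp hqp]
    exact subset_closure hq
  · have h2 : chart f '' {p | f p.rep ≠ 0 ∧ chart f p ∈ convexHull ℝ (chart f '' K)} =
        convexHull ℝ (chart f '' K) := by
      refine Subset.antisymm ?_ fun v hv => ?_
      · rintro _ ⟨p, hp, rfl⟩
        exact hp.2
      · obtain ⟨q, hq, rfl⟩ := h1 hv
        exact ⟨q, ⟨hF.1.2 q hq, hv⟩, rfl⟩
    rw [h2]
    exact convex_convexHull ℝ _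
  · rintro p ⟨hp, hpK⟩ Y ⟨hKY, hYF, hY⟩
    have hYf : ∀ q ∈ Y, f q.rep ≠ 0 := fun q hq =>
      apply_rep_ne_zero_of_mem_closure hF.1.2 hF.2.2 (hYF hq)
    obtain ⟨q, hq, hqp⟩ := convexHull_min (image_mono hKY) (convex_image_chart hYf hY) hpK
    rwa [← chart_injective (hYf q hq) hp hqp]

theorem image_chart_convHull (hF : IsProperChart f F) (hK : K ⊆ F) :
    chart f '' convHull F K = convexHull ℝ (chart f '' K) := by
  rw [convHull_eq hF hK]
  refine Subset.antisymm (fun v ⟨p, hp, hpv⟩ => hpv ▸ hp.2) fun v hv => ?_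
  obtain ⟨q, hq, rfl⟩ := convexHull_min (image_mono hK) hF.2.1 hv
  exact ⟨q, ⟨hF.1.2 q hq, hv⟩, rfl⟩

theorem subset_convHull (F K : Set (RP d)) : K ⊆ convHull F K :=
  subset_sInter fun _ hY => hY.1

theorem convHull_subset (hF : IsProperChart f F) (hK : K ⊆ F) : convHull F K ⊆ F := by
  rw [convHull_eq hF hK]
  rintro p ⟨hp, hpK⟩
  obtain ⟨q, hq, hqp⟩ := convexHull_min (image_mono hK) hF.2.1 hpK
  rwa [← chart_injective (hF.1.2 q hq) hp hqp]

theorem isConvex_convHull (hF : IsProperChart f F) (hK : K ⊆ F) : IsConvex (convHull F K) := by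
  refine ⟨f, ⟨hF.1.1, fun p hp => hF.1.2 p (convHull_subset hF hK hp)⟩, ?_⟩
  rw [image_chart_convHull hF hK]
  exact convex_convexHull ℝ _

theorem convHull_convHull (hF : IsProperChart f F) (hK : K ⊆ F) :
    convHull F (convHull F K) = convHull F K :=
  Subset.antisymm (sInter_subset_of_mem ⟨Subset.rfl, (convHull_subset hF hK).trans subset_closure,
    isConvex_convHull hF hK⟩) (subset_convHull F _)

theorem isCompact_convHull (hF : IsProperChart f F) (hK : K ⊆ F) (hKc : IsCompact K) :
    IsCompact (convHull F K) := by
  have h1 := isCompact_convexHull_of_isCompact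
    (isCompact_image_chart (fun p hp => hF.1.2 p (hK hp)) hKc)
  have h0 : ∀ v ∈ convexHull ℝ (chart f '' K), v ≠ 0 := by
    rw [← image_chart_convHull hF hK]
    rintro _ ⟨p, hp, rfl⟩
    exact chart_ne_zero (hF.1.2 p (convHull_subset hF hK hp))
  convert isCompact_image_mk h1 h0 using 1
  rw [convHull_eq hF hK]
  ext p
  constructor
  · rintro ⟨hp, hpK⟩
    exact ⟨_, chart_ne_zero hp, hpK, (mk_chart _).symm⟩
  · rintro ⟨v, hv, hvK, rfl⟩
    have hvK' := hvK
    rw [← image_chart_convHull hF hK] at hvK'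
    obtain ⟨q, hq, rfl⟩ := hvK'
    rw [mk_chart]
    exact ⟨hF.1.2 q (convHull_subset hF hK hq), hvK⟩

theorem mem_coneOver_of_mem_closure (hL : ∀ p ∈ L, f p.rep ≠ 0) (hLc : IsCompact L)
    {v : Fin d → ℝ} (hv : v ∈ closure (coneOver f L)) (hfv : 0 < f v) : v ∈ coneOver f L := by
  have hfc : Continuous f := LinearMap.continuous_of_finiteDimensional _
  have h1 : ContinuousAt (fun w => (f w)⁻¹ • w) v :=
    (hfc.continuousAt.inv₀ hfv.ne').smul continuousAt_id
  have h2 := h1.continuousWithinAt.mem_closure hv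
    fun w (hw : w ∈ coneOver f L) => inv_smul_mem_image_chart hw.2.1 hw.2.2
  rw [(isCompact_image_chart hL hLc).isClosed.closure_eq] at h2
  obtain ⟨p, hp, hpv⟩ := h2
  have h3 := (chart_mem_coneOver_iff (hL p hp)).2 hp
  rw [hpv] at h3
  exact mem_of_mem_coneOver_smul (inv_pos.2 hfv) h3

theorem mem_linSpan_of_mem_coneOver {v : Fin d → ℝ} (hv : v ∈ coneOver f F) : v ∈ linSpan F := by
  obtain ⟨-, hv0, hvF⟩ := hv
  rw [← mk_submodule_le_iff hv0]
  exact le_biSup (fun p : RP d => p.submodule) hvF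

theorem exists_sub_smul_mem_coneOver (hF : IsOpenInSpan F) {x y : Fin d → ℝ}
    (hx : x ∈ coneOver f F) (hy : y ∈ coneOver f F) :
    ∃ δ : ℝ, 0 < δ ∧ y - δ • x ∈ coneOver f F := by
  obtain ⟨U, hU, hFU⟩ := hF
  have hyU : y ∈ coneOver f U := coneOver_mono (hFU.trans_subset inter_subset_left) hy
  have h1 : Tendsto (fun δ : ℝ => y - δ • x) (𝓝[>] 0) (𝓝 y) := by
    have : Continuous fun δ : ℝ => y - δ • x := by fun_prop
    simpa using (this.tendsto 0).mono_left nhdsWithin_le_nhds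
  obtain ⟨δ, hδU, hδ⟩ := ((h1.eventually ((isOpen_coneOver hU).mem_nhds hyU)).and
    self_mem_nhdsWithin).exists
  obtain ⟨a1, a2, a3⟩ := hδU
  refine ⟨δ, hδ, a1, a2, ?_⟩
  rw [hFU]
  exact ⟨a3, (mk_submodule_le_iff a2 _).2 ((linSpan F).sub_mem (mem_linSpan_of_mem_coneOver hy)
    ((linSpan F).smul_mem δ (mem_linSpan_of_mem_coneOver hx)))⟩

/-- The automorphisms of `F` that preserve a compact convex subset have a common fixed point
in it. -/
theorem exists_fixed_point (hF : IsProperChart f F) (hFo : IsOpenInSpan F) (hLF : L ⊆ F)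
    (hLne : L.Nonempty) (hLc : IsCompact L) (hL : IsConvex L) :
    ∃ p ∈ L, ∀ g : PGL(d, ℝ), g • F = F → g • L = L → g • p = p := by
  have hLf : ∀ p ∈ L, f p.rep ≠ 0 := fun p hp => hF.1.2 p (hLF hp)
  have hP := isSharpCone_closure_coneOver hF.1.2 hF.isConvex hF.2.2 (hLne.mono hLF)
  have hM := isSharpCone_closure_coneOver hLf hL (hF.2.2.subset (image_mono hLF)) hLne
  have hsub : coneOver f L ⊆ coneOver f F := coneOver_mono hLF
  have hmem : ∀ {v}, v ∈ closure (coneOver f L) → v ≠ 0 → v ∈ coneOver f L := fun hv hv0 =>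
    mem_coneOver_of_mem_closure hLf hLc hv (hM.apply_pos hv hv0)
  have hcl : ∀ (T : (Fin d → ℝ) ≃ₗ[ℝ] (Fin d → ℝ)) (D : Set (Fin d → ℝ)),
      (∀ v ∈ D, T v ∈ D) → ∀ v ∈ closure D, T v ∈ closure D := fun T D hT v hv =>
    map_mem_closure (LinearMap.continuous_of_finiteDimensional T.toLinearMap) hv hT
  -- Nonzero vectors over the compact set `L` lie in the cone over `F`, which is open in its span,
  -- so they dominate each other. The group acting is formed by the lifts that preserve both cones.
  obtain ⟨x, hx, hx0, hfix⟩ := hP.exists_common_ray hM (closure_mono hsub) (by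
      obtain ⟨p, hp⟩ := hLne
      obtain ⟨v, hv, hv0, -⟩ := exists_mem_coneOver_of_mem hp (hLf p hp)
      exact ⟨v, subset_closure hv, hv0⟩) (fun x hx y hy hy0 => by
      by_cases hx0 : x = 0
      · subst hx0
        exact ⟨1, one_pos, by simpa using closure_mono hsub hy⟩
      obtain ⟨δ, hδ, h1⟩ := exists_sub_smul_mem_coneOver hFo (hsub (hmem hx hx0))
        (hsub (hmem hy hy0))
      refine ⟨δ⁻¹, inv_pos.2 hδ, ?_⟩
      have h2 := hP.smul_mem (inv_pos.2 hδ).le (subset_closure h1)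
      rwa [smul_sub, inv_smul_smul₀ hδ.ne'] at h2)
    (H := {T | T ∈ coneGroup f F (Aut F) ∧ (∀ v ∈ coneOver f L, T v ∈ coneOver f L) ∧
      ∀ v ∈ coneOver f L, T.symm v ∈ coneOver f L})
    (fun T hT => hcl T _ hT.1.1) (fun T hT => hcl T _ hT.2.1)
    fun T hT => ⟨inv_mem hT.1, hT.2.2, hT.2.1⟩
  obtain ⟨-, hx0', hxL⟩ := hmem hx hx0
  refine ⟨_, hxL, fun g hgF hgL => ?_⟩
  obtain ⟨T, hT, hgT⟩ := exists_isLift_mem_coneGroup (Λ := Aut F) hF.1.2 hF.isConvex le_rfl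
    (g := g) hgF
  have hTH : (∀ v ∈ coneOver f L, T v ∈ coneOver f L) ∧
      ∀ v ∈ coneOver f L, T.symm v ∈ coneOver f L := by
    refine ⟨fun v hv => ?_, fun v hv => ?_⟩
    · refine ⟨(hT.1 v (hsub hv)).1, T.map_ne_zero_iff.2 hv.2.1, ?_⟩
      rw [← hgT v hv.2.1]
      exact hgL.subset (smul_mem_smul_set hv.2.2)
    · refine ⟨(hT.2.1 v (hsub hv)).1, T.symm.map_ne_zero_iff.2 hv.2.1, ?_⟩
      rw [← hgT.symm v hv.2.1, ← mem_smul_set_iff_inv_smul_mem, hgL]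
      exact hv.2.2
  obtain ⟨c, hc, hTx⟩ := hfix T ⟨hT, hTH⟩
  rw [hgT, mk_congr (hw := smul_ne_zero hc.ne' hx0) hTx, mk_smul_eq hx0 hc.ne']

/-- The equivariant choice is made for the pair of `F` and the hull of `K`, so dependence on the
hull alone is automatic; stabilisers of such pairs have fixed points in the hull. -/
theorem exists_isCenterOfMass [Nonempty (RP d)] :
    ∃ CoM : Set (RP d) → Set (RP d) → RP d, IsCenterOfMass CoM := by
  obtain ⟨φ, hφ⟩ := exists_equivariant (G := PGL(d, ℝ)) (X := Set (RP d) × Set (RP d))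
    (Y := RP d) (fun x p => p ∈ x.2) fun g x p hp => smul_mem_smul_set hp
  have key : ∀ F K, IsProperlyConvex F → IsOpenInSpan F → K ⊆ F → K.Nonempty → IsCompact K →
      φ (F, convHull F K) ∈ convHull F K ∧
      ∀ g : PGL(d, ℝ), φ (g • (F, convHull F K)) = g • φ (F, convHull F K) := by
    rintro F K ⟨f, hF⟩ hFo hKF hKne hKc
    obtain ⟨p, hp, hfix⟩ := exists_fixed_point hF hFo (convHull_subset hF hKF)
      (hKne.mono (subset_convHull F K)) (isCompact_convHull hF hKF hKc) (isConvex_convHull hF hKF)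
    exact hφ (F, convHull F K) ⟨p, hp, fun g hg => hfix g (congrArg Prod.fst hg) (congrArg Prod.snd hg)⟩
  refine ⟨fun F K => φ (F, convHull F K), fun F K h1 h2 h3 h4 h5 => (key F K h1 h2 h3 h4 h5).1,
    ?_, fun F K h1 h2 h3 h4 h5 g => ?_⟩
  · rintro F K ⟨f, hF⟩ - hKF - -
    simp only [convHull_convHull hF hKF]
  · rw [← (key F K h1 h2 h3 h4 h5).2 g, ← smul_convHull]
    rfl

end CenterOfMass

end ConvexProj

end

theorem theorem1p17 {d : ℕ} (Ω C : Set (ConvexProj.RP d)) (Λ : Subgroup PGL(d, ℝ))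
    (hncc : ConvexProj.IsNaiveConvexCocompact Ω C Λ)
    (hiso : ConvexProj.HasCoarselyIsolatedSimplices Ω C Λ) :
    (∃ 𝒮 : Set (Set (ConvexProj.RP d)),
      ConvexProj.IsMaximalFamily C 𝒮 ∧ ConvexProj.IsStronglyIsolated Ω 𝒮 ∧
      ConvexProj.IsCoarselyComplete Ω C 𝒮 ∧ ConvexProj.IsInvariantFamily Λ 𝒮) ∧
    (∃ CoM : Set (ConvexProj.RP d) → Set (ConvexProj.RP d) → ConvexProj.RP d,
      ConvexProj.IsCenterOfMass CoM) ∧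
    (∀ CoM : Set (ConvexProj.RP d) → Set (ConvexProj.RP d) → ConvexProj.RP d,
      ConvexProj.IsCenterOfMass CoM →
      (∀ S ∈ ConvexProj.topSimplices Ω C, ∀ v ∈ ConvexProj.vertices S,
        IsCompact (closure C ∩ ConvexProj.face Ω v)) ∧
      ConvexProj.IsMaximalFamily C (ConvexProj.coreFamily CoM Ω C) ∧
      ConvexProj.IsStronglyIsolated Ω (ConvexProj.coreFamily CoM Ω C) ∧
      ConvexProj.IsCoarselyComplete Ω C (ConvexProj.coreFamily CoM Ω C) ∧
      ConvexProj.IsInvariantFamily Λ (ConvexProj.coreFamily CoM Ω C)) := by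
  have : Nonempty (ConvexProj.RP d) := hncc.domain.1.to_type
  obtain ⟨CoM, hCoM⟩ := ConvexProj.exists_isCenterOfMass (d := d)
  exact ⟨⟨_, (hncc.coreFamily_properties hiso hCoM).2⟩, ⟨CoM, hCoM⟩,
    fun _ h => hncc.coreFamily_properties hiso h⟩
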